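/- Let $k$ be a field of characteristic $0$, $G$ a finite group and $\alpha\colon G^3\to k^*$ a normalized 3-cocycle, $\alpha(g,h,l)\,\alpha(f,gh,l)\,\alpha(f,g,h)=\alpha(fg,h,l)\,\alpha(f,g,hl)$. Put $$\alpha(f,g|h)=\frac{\alpha(f,ghg^{-1},g)}{\alpha(f,g,h)\,\alpha(fgh(fg)^{-1},f,g)},\qquad \alpha(f|g,h)=\frac{\alpha(f,g,h)\,\alpha(fgf^{-1},fhf^{-1},f)}{\alpha(fgf^{-1},f,h)} .$$ **The category $\mathcal Z(G,\alpha)$.** Its objects are finite-dimensional $G$-graded $k$-vector spaces $X=\bigoplus_g X_g$ with linear automorphisms $f\colon X\to X$ ($f\in G$) such that $f.X_g=X_{fgf^{-1}}$ and $(fg).x=\alpha(f,g|h)\,f.(g.x)$ for $x\in X_h$; its morphisms are the linear maps preserving grading and action. The tensor product is that of graded spaces, with $f.(x\otimes y)=\alpha(f|g,h)\,(f.x\otimes f.y)$ for $x\in X_g$, $y\in Y_h$, associativity constraint $x\otimes(y\otimes z)\mapsto\alpha(f,g,h)\,(x\otimes y)\otimes z$ for $x\in X_f$, $y\in Y_g$,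 $z\in Z_h$, unit object $k$ in degree $1$ with trivial action, braiding $x\otimes y\mapsto f.y\otimes x$ for $x\in X_f$, and twist $\theta_X(x)=f.x$ for $x\in X_f$. **The algebra $A(H,F,\gamma,\varepsilon)$.** Let $H\subset G$ be a subgroup and $F\trianglelefteq H$ a normal subgroup of $H$. Let $\gamma\colon F\times F\to k^*$ be normalized with $\gamma(g,h)\,\gamma(f,gh)=\alpha(f,g,h)\,\gamma(f,g)\,\gamma(fg,h)$ for $f,g,h\in F$, and let $\varepsilon\colon H\times F\to k^*$ satisfy $$\varepsilon_{gh}(f)=\varepsilon_g(hfh^{-1})\,\varepsilon_h(f)\,\alpha(g,h|f)\quad(g,h\in H,\ f\in F),$$ $$\gamma(f,g)\,\varepsilon_h(fg)=\alpha(h|f,g)\,\varepsilon_h(f)\,\varepsilon_h(g)\,\gamma(hfh^{-1},hgh^{-1})\quad(h\in H,\ f,g\in F),$$ $$\gamma(f,g)=\varepsilon_f(g)\,\gamma(fgf^{-1},f)\quad(f,g\in F).$$ Let $k[F,\gamma,\varepsilon]$ be the commutative algebra in $\mathcal Z(H,\alpha|_H)$ with basis $e_f$ ($f\in F$) in degree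 $f$, product $e_fe_g=\gamma(f,g)e_{fg}$, unit $e_1$ and action $h.e_f=\varepsilon_h(f)\,e_{hfh^{-1}}$. For a commutative algebra $B$ in $\mathcal Z(H,\alpha|_H)$, the transfer $E(B)$ is the following commutative algebra in $\mathcal Z(G,\alpha)$. A map $a\colon G\to B$ has degree $f\in G$ if $a(x)\in B_{x^{-1}fx}$ for all $x\in G$ (with $B_g=0$ for $g\notin H$), and $E(B)_f$ is the space of maps $a$ of degree $f$ with $a(xh)=\alpha(h^{-1},x^{-1}|f)\,h^{-1}.a(x)$ for all $x\in G$, $h\in H$. The action is $(g.a)(x)=\alpha(x^{-1},g|f)^{-1}a(g^{-1}x)$ for $a\in E(B)_f$, the product is $(ab)(x)=\alpha(x^{-1}|f,g)\,a(x)b(x)$ for $a\in E(B)_f$, $b\in E(B)_g$, and the unit is the constant map $1_B$. Put $A=A(H,F,\gamma,\varepsilon)=E(k[F,\gamma,\varepsilon])$. **Local modules.** A right $A$-module $M$ in $\mathcal Z(G,\alpha)$, with action $\nu\colon M\otimes A\to M$, is local if $\nu\circ c_{A,M}\circ c_{M,A}=\nu$, where $c$ is the braiding. Local right $A$-modules form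 a braided monoidal category $\mathcal Z(G,\alpha)^{\mathrm{loc}}_A$: the tensor product $M\otimes_AN$ is the coequalizer of the two maps $(M\otimes A)\otimes N\to M\otimes N$ given by $\nu_M\otimes 1$ and by the left action $\nu_N\circ c_{A,N}$ of $A$ on $N$, the unit object is $A$, and the braiding is induced by that of $\mathcal Z(G,\alpha)$. **The cocycle $\overline\alpha$.** Let $s\colon H/F\to H$ be a section of the quotient map with $s(1)=1$. For $x,y,z\in H/F$ put $\tau(x,y)=s(y)^{-1}s(x)^{-1}s(xy)\in F$, $h=s(xy)^{-1}s(xyz)$ and $t'=h^{-1}\tau(x,y)h\in F$, and $$\begin{aligned}\overline\alpha(x,y,z)={}&\alpha\big(s(x),s(y),s(y)^{-1}s(x)^{-1}s(xyz)\big)\;\gamma\big(\tau(y,z),\tau(x,yz)\big)\;\gamma\big(\tau(xy,z),t'\big)^{-1}\;\varepsilon_h(t')\\ &\times\alpha\big(s(y),s(y)^{-1}s(yz),\tau(x,yz)\big)^{-1}\,\alpha\big(s(z),\tau(y,z),\tau(x,yz)\big)^{-1}\\ &\times\alpha\big(s(x),s(y),\tau(x,y)\big)^{-1}\,\alpha\big(s(x)s(y),\tau(x,y),h\big)\,\alpha\big(s(z),\tau(xy,z),t'\big).\end{aligned}$$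 **Theorem.** The function $\overline\alpha$ is a normalized 3-cocycle on $H/F$. The twist of $\mathcal Z(H/F,\overline\alpha)$ makes it a ribbon category. For every local right $A$-module $M$ the twist of $\mathcal Z(G,\alpha)$ on $M$ is a morphism of modules, and these morphisms make $\mathcal Z(G,\alpha)^{\mathrm{loc}}_A$ a ribbon category. There is a $k$-linear braided monoidal equivalence $$\mathcal Z(G,\alpha)^{\mathrm{loc}}_{A(H,F,\gamma,\varepsilon)}\;\simeq\;\mathcal Z(H/F,\overline\alpha)$$ that carries twists to twists, that is, an equivalence of ribbon categories. -/

import Mathlib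

universe v w u

set_option linter.unusedSectionVars false
set_option linter.unusedSimpArgs false

/-! ## Local modules over a commutative algebra in a braided category -/

section
open CategoryTheory MonoidalCategory Limits MonObj

section LocMod
variable {C : Type w} [Category.{v} C] [MonoidalCategory C] [BraidedCategory C]

/-- Local right modules over an algebra `A`: right modules whose action is unchanged by the double
braiding. -/
structure LocMod (A : Mon C) where
  X : C
  act : X ⊗ A.X ⟶ X
  act_one : X ◁ η ≫ act = (ρ_ X).hom
  act_assoc : X ◁ μ ≫ act = (α_ X A.X A.X).inv ≫ act ▷ A.X ≫ act
  isLocal : (β_ X A.X).hom ≫ (β_ A.X X).hom ≫ act = act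

namespace LocMod
variable {A : Mon C}

/-- Morphisms of modules. -/
@[ext]
structure Hom (M N : LocMod A) where
  hom : M.X ⟶ N.X
  act_hom : M.act ≫ hom = hom ▷ A.X ≫ N.act

instance : Category (LocMod A) where
  Hom M N := Hom M N
  id M := { hom := 𝟙 M.X, act_hom := by simp }
  comp f g := { hom := f.hom ≫ g.hom
                act_hom := by
                  rw [← Category.assoc, f.act_hom, Category.assoc, g.act_hom,
                    comp_whiskerRight, Category.assoc] }

@[ext]
theorem hom_ext {M N : LocMod A} (f g : M ⟶ N) (h : f.hom = g.hom) : f = g := Hom.ext h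

@[simp]
theorem id_hom (M : LocMod A) : Hom.hom (𝟙 M) = 𝟙 M.X := rfl

@[simp]
theorem comp_hom {M N P : LocMod A} (f : M ⟶ N) (g : N ⟶ P) :
    Hom.hom (f ≫ g) = f.hom ≫ g.hom := rfl

variable [IsCommMonObj A.X]

theorem comm_act (M : LocMod A) :
    M.X ◁ (β_ A.X A.X).hom ≫ (α_ M.X A.X A.X).inv ≫ M.act ▷ A.X ≫ M.act =
      (α_ M.X A.X A.X).inv ≫ M.act ▷ A.X ≫ M.act := by
  rw [← M.act_assoc, ← MonoidalCategory.whiskerLeft_comp_assoc, IsCommMonObj.mul_comm]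

/-- A local module as a bimodule, the left action being the right action precomposed with the
braiding. -/
@[simps]
def toBimod (M : LocMod A) : Bimod A A where
  X := M.X
  actLeft := (β_ A.X M.X).hom ≫ M.act
  one_actLeft := by
    rw [BraidedCategory.braiding_naturality_left_assoc, M.act_one, braiding_rightUnitor]
  left_assoc := by
    rw [BraidedCategory.braiding_naturality_left_assoc, M.act_assoc,
      BraidedCategory.braiding_tensor_left_hom, MonoidalCategory.whiskerLeft_comp]
    simp only [Category.assoc]
    rw [BraidedCategory.braiding_naturality_right_assoc,
      BraidedCategory.braiding_tensor_right_hom]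
    simp only [Category.assoc, Iso.hom_inv_id_assoc, comm_act]
  actRight := M.act
  actRight_one := M.act_one
  right_assoc := M.act_assoc
  middle_assoc := by
    rw [BraidedCategory.braiding_naturality_right_assoc,
      BraidedCategory.braiding_tensor_right_hom]
    simp only [Category.assoc, Iso.hom_inv_id_assoc, comm_act, comp_whiskerRight]

theorem inv_act (M : LocMod A) : (β_ M.X A.X).inv ≫ M.act = (β_ A.X M.X).hom ≫ M.act := by
  rw [Iso.inv_comp_eq, M.isLocal]

variable [HasCoequalizers C]

/-- The underlying object of `M ⊗_A N`. -/
noncomputable def tensorX (M N : LocMod A) : C :=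
  coequalizer (M.act ▷ N.X) ((α_ _ _ _).hom ≫ (M.X ◁ ((β_ A.X N.X).hom ≫ N.act)))

/-- `M ⊗ N ⟶ M ⊗_A N`. -/
noncomputable def proj (M N : LocMod A) : M.X ⊗ N.X ⟶ tensorX M N :=
  coequalizer.π (M.act ▷ N.X) ((α_ _ _ _).hom ≫ (M.X ◁ ((β_ A.X N.X).hom ≫ N.act)))

theorem proj_condition (M N : LocMod A) :
    M.act ▷ N.X ≫ proj M N =
      (α_ _ _ _).hom ≫ M.X ◁ ((β_ A.X N.X).hom ≫ N.act) ≫ proj M N := by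
  have := coequalizer.condition (M.act ▷ N.X) ((α_ _ _ _).hom ≫ (M.X ◁ ((β_ A.X N.X).hom ≫ N.act)))
  rw [Category.assoc] at this
  exact this

instance (M N : LocMod A) : Epi (proj M N) :=
  inferInstanceAs (Epi (coequalizer.π _ _))

variable [∀ X : C, PreservesColimitsOfSize.{0, 0} (tensorLeft X)]
  [∀ X : C, PreservesColimitsOfSize.{0, 0} (tensorRight X)]

instance (X : C) (M N : LocMod A) : Epi (X ◁ proj M N) :=
  inferInstanceAs (Epi ((tensorLeft X).map (coequalizer.π _ _)))

instance (X : C) (M N : LocMod A) : Epi (proj M N ▷ X) :=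
  inferInstanceAs (Epi ((tensorRight X).map (coequalizer.π _ _)))

/-- The action on `M ⊗_A N`, induced by the action on `N`. -/
noncomputable def tensorAct (M N : LocMod A) : tensorX M N ⊗ A.X ⟶ tensorX M N :=
  (Bimod.tensorBimod M.toBimod N.toBimod).actRight

noncomputable def tensorActLeft (M N : LocMod A) : A.X ⊗ tensorX M N ⟶ tensorX M N :=
  (Bimod.tensorBimod M.toBimod N.toBimod).actLeft

theorem proj_act (M N : LocMod A) :
    proj M N ▷ A.X ≫ tensorAct M N = (α_ _ _ _).hom ≫ M.X ◁ N.act ≫ proj M N :=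
  Bimod.TensorBimod.π_tensor_id_actRight M.toBimod N.toBimod

theorem proj_actLeft (M N : LocMod A) :
    A.X ◁ proj M N ≫ tensorActLeft M N =
      (α_ _ _ _).inv ≫ ((β_ A.X M.X).hom ≫ M.act) ▷ N.X ≫ proj M N :=
  Bimod.TensorBimod.whiskerLeft_π_actLeft M.toBimod N.toBimod

theorem tensorActLeft_eq (M N : LocMod A) :
    tensorActLeft M N = (β_ A.X _).hom ≫ tensorAct M N := by
  rw [← cancel_epi (A.X ◁ proj M N), proj_actLeft,
    BraidedCategory.braiding_naturality_right_assoc, proj_act,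
    BraidedCategory.braiding_tensor_right_hom, comp_whiskerRight, Category.assoc, proj_condition]
  simp

theorem tensorActLeft_eq' (M N : LocMod A) :
    tensorActLeft M N = (β_ _ A.X).inv ≫ tensorAct M N := by
  rw [← cancel_epi (A.X ◁ proj M N), proj_actLeft,
    BraidedCategory.braiding_inv_naturality_right_assoc, proj_act,
    BraidedCategory.braiding_tensor_left_inv, ← inv_act, comp_whiskerRight, Category.assoc,
    proj_condition, ← inv_act]
  simp

/-- The local module `M ⊗_A N`. -/
@[simps]
noncomputable def tensor (M N : LocMod A) : LocMod A where
  X := tensorX M N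
  act := tensorAct M N
  act_one := (Bimod.tensorBimod M.toBimod N.toBimod).actRight_one
  act_assoc := (Bimod.tensorBimod M.toBimod N.toBimod).right_assoc
  isLocal := by
    rw [← tensorActLeft_eq, tensorActLeft_eq', Iso.hom_inv_id_assoc]

variable (A) in
/-- The unit object: `A` as a module over itself. -/
@[simps]
def unit : LocMod A where
  X := A.X
  act := μ
  act_one := MonObj.mul_one A.X
  act_assoc := MonObj.mul_assoc_flip A.X
  isLocal := by rw [IsCommMonObj.mul_comm, IsCommMonObj.mul_comm]

@[simps]
def bimodHom {M N : LocMod A} (f : M ⟶ N) : M.toBimod ⟶ N.toBimod where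
  hom := f.hom
  left_act_hom := by
    change ((β_ A.X M.X).hom ≫ M.act) ≫ f.hom = A.X ◁ f.hom ≫ (β_ A.X N.X).hom ≫ N.act
    rw [Category.assoc, f.act_hom, BraidedCategory.braiding_naturality_right_assoc]
  right_act_hom := f.act_hom

@[simps obj map]
def bimodFunctor : LocMod A ⥤ Bimod A A where
  obj := toBimod
  map := bimodHom

instance : (bimodFunctor (A := A)).Faithful where
  map_injective h := hom_ext _ _ (congrArg Bimod.Hom.hom h)

noncomputable def tensorIso (M N : LocMod A) :
    Bimod.tensorBimod M.toBimod N.toBimod ≅ (tensor M N).toBimod :=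
  Bimod.isoOfIso (Iso.refl (tensorX M N))
    (by
      have : tensorActLeft M N ≫ 𝟙 _ = A.X ◁ 𝟙 _ ≫ (β_ A.X _).hom ≫ tensorAct M N := by
        rw [tensorActLeft_eq]; simp
      exact this)
    (by
      have : tensorAct M N ≫ 𝟙 _ = 𝟙 _ ▷ A.X ≫ tensorAct M N := by simp
      exact this)

noncomputable def unitIso : Bimod.regular A ≅ (unit A).toBimod :=
  Bimod.isoOfIso (Iso.refl A.X)
    (by
      have : (μ : A.X ⊗ A.X ⟶ A.X) ≫ 𝟙 _ = A.X ◁ 𝟙 _ ≫ (β_ A.X A.X).hom ≫ μ := by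
        rw [IsCommMonObj.mul_comm]; simp
      exact this)
    (by
      have : (μ : A.X ⊗ A.X ⟶ A.X) ≫ 𝟙 _ = 𝟙 _ ▷ A.X ≫ μ := by simp
      exact this)

/-- The tensor product over `A` makes bimodules a monoidal category. -/
noncomputable instance bimodMonoidal : MonoidalCategory (Bimod A A) where
  tensorObj M N := M.tensorBimod N
  tensorUnit := Bimod.regular A
  whiskerLeft M _ _ f := Bimod.whiskerLeft M f
  whiskerRight f N := Bimod.whiskerRight f N
  associator := Bimod.associatorBimod
  leftUnitor := Bimod.leftUnitorBimod
  rightUnitor := Bimod.rightUnitorBimod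
  tensorHom_comp_tensorHom f g h i := by
    dsimp only
    rw [Bimod.whiskerLeft_comp_bimod, Bimod.comp_whiskerRight_bimod, Category.assoc,
      Category.assoc, ← Category.assoc (Bimod.whiskerLeft _ _) (Bimod.whiskerRight _ _),
      Bimod.whisker_exchange_bimod, Category.assoc]
  id_tensorHom_id _ _ := by simp [Bimod.id_whiskerRight_bimod, Bimod.whiskerLeft_id_bimod]
  whiskerLeft_id _ _ := Bimod.whiskerLeft_id_bimod
  id_whiskerRight _ _ := Bimod.id_whiskerRight_bimod
  associator_naturality f g h := by
    simp only [Bimod.comp_whiskerLeft_bimod, Bimod.whiskerRight_comp_bimod,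
      Bimod.whiskerLeft_comp_bimod, Bimod.comp_whiskerRight_bimod,
      Bimod.whisker_assoc_bimod, Category.assoc, Iso.inv_hom_id, Iso.hom_inv_id_assoc,
      Iso.inv_hom_id_assoc, Category.comp_id]
  leftUnitor_naturality f := by
    rw [Bimod.id_whiskerLeft_bimod]; simp
  rightUnitor_naturality f := by
    rw [Bimod.whiskerRight_id_bimod]; simp
  pentagon M N P Q := Bimod.pentagon_bimod M N P Q
  triangle M N := Bimod.triangle_bimod M N


@[simps]
def homOfBimod {M N : LocMod A} (f : M.toBimod ⟶ N.toBimod) : M ⟶ N where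
  hom := f.hom
  act_hom := f.right_act_hom

@[simps]
def isoOfBimod {M N : LocMod A} (e : M.toBimod ≅ N.toBimod) : M ≅ N where
  hom := homOfBimod e.hom
  inv := homOfBimod e.inv
  hom_inv_id := hom_ext _ _ (congrArg Bimod.Hom.hom e.hom_inv_id)
  inv_hom_id := hom_ext _ _ (congrArg Bimod.Hom.hom e.inv_hom_id)

/-- Local modules are closed under the tensor product over `A`. -/
noncomputable instance : MonoidalCategoryStruct (LocMod A) where
  tensorObj := tensor
  tensorUnit := unit A
  whiskerLeft M _ _ f :=
    homOfBimod ((tensorIso _ _).inv ≫ M.toBimod ◁ bimodHom f ≫ (tensorIso _ _).hom)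
  whiskerRight f N :=
    homOfBimod ((tensorIso _ _).inv ≫ bimodHom f ▷ N.toBimod ≫ (tensorIso _ _).hom)
  tensorHom f g :=
    homOfBimod ((tensorIso _ _).inv ≫ (bimodHom f ⊗ₘ bimodHom g) ≫ (tensorIso _ _).hom)
  associator M N P := isoOfBimod
    (((tensorIso _ _).symm ≪≫ ((tensorIso _ _).symm ⊗ᵢ .refl _))
        ≪≫ α_ M.toBimod N.toBimod P.toBimod
        ≪≫ ((.refl _ ⊗ᵢ tensorIso _ _) ≪≫ tensorIso _ _))
  leftUnitor M := isoOfBimod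
    (((tensorIso _ _).symm ≪≫ (unitIso.symm ⊗ᵢ .refl _)) ≪≫ λ_ M.toBimod)
  rightUnitor M := isoOfBimod
    (((tensorIso _ _).symm ≪≫ (.refl _ ⊗ᵢ unitIso.symm)) ≪≫ ρ_ M.toBimod)

noncomputable instance : MonoidalCategory (LocMod A) :=
  Monoidal.induced bimodFunctor
    { μIso := tensorIso
      εIso := unitIso
      whiskerLeft_eq := fun _ _ _ _ => rfl
      whiskerRight_eq := fun _ _ => rfl
      tensorHom_eq := fun _ _ => rfl
      associator_eq := fun _ _ _ => rfl
      leftUnitor_eq := fun _ => rfl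
      rightUnitor_eq := fun _ => rfl }


/-- The canonical projection `M ⊗ N ⟶ M ⊗_A N`. -/
noncomputable def pr (M N : LocMod A) : M.X ⊗ N.X ⟶ (M ⊗ N).X := proj M N

theorem pr_condition (M N : LocMod A) :
    M.act ▷ N.X ≫ pr M N =
      (α_ _ _ _).hom ≫ M.X ◁ (β_ A.X N.X).hom ≫ M.X ◁ N.act ≫ pr M N := by
  have := proj_condition M N
  rw [MonoidalCategory.whiskerLeft_comp, Category.assoc] at this
  exact this

theorem pr_act (M N : LocMod A) :
    pr M N ▷ A.X ≫ (M ⊗ N).act = (α_ _ _ _).hom ≫ M.X ◁ N.act ≫ pr M N :=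
  proj_act M N

instance (M N : LocMod A) : Epi (pr M N) := inferInstanceAs (Epi (proj M N))

instance (X : C) (M N : LocMod A) : Epi (X ◁ pr M N) := inferInstanceAs (Epi (X ◁ proj M N))

instance (X : C) (M N : LocMod A) : Epi (pr M N ▷ X) := inferInstanceAs (Epi (proj M N ▷ X))

theorem pr_whiskerLeft (M : LocMod A) {N N' : LocMod A} (f : N ⟶ N') :
    pr M N ≫ (M ◁ f).hom = M.X ◁ f.hom ≫ pr M N' := by
  have h : (M ◁ f).hom = (Bimod.whiskerLeft M.toBimod (bimodHom f)).hom :=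
    (Category.id_comp _).trans (Category.comp_id _)
  exact (congrArg (fun t => pr M N ≫ t) h).trans (ι_colimMap _ _)

theorem pr_whiskerRight {M M' : LocMod A} (f : M ⟶ M') (N : LocMod A) :
    pr M N ≫ (f ▷ N).hom = f.hom ▷ N.X ≫ pr M' N := by
  have h : (f ▷ N).hom = (Bimod.whiskerRight (bimodHom f) N.toBimod).hom :=
    (Category.id_comp _).trans (Category.comp_id _)
  exact (congrArg (fun t => pr M N ≫ t) h).trans (ι_colimMap _ _)

noncomputable def bproj (P Q : Bimod A A) : P.X ⊗ Q.X ⟶ (P.tensorBimod Q).X :=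
  coequalizer.π (P.actRight ▷ Q.X) ((α_ _ _ _).hom ≫ (P.X ◁ Q.actLeft))

theorem bproj_assoc (P Q L : Bimod A A) :
    bproj P Q ▷ L.X ≫ bproj (P.tensorBimod Q) L ≫ (Bimod.associatorBimod P Q L).hom.hom =
      (α_ _ _ _).hom ≫ P.X ◁ bproj Q L ≫ bproj P (Q.tensorBimod L) := by
  have h1 : bproj (P.tensorBimod Q) L ≫ (Bimod.associatorBimod P Q L).hom.hom =
      Bimod.AssociatorBimod.homAux P Q L := coequalizer.π_desc _ _
  rw [h1]
  exact π_tensor_id_preserves_coequalizer_inv_desc _ _ _ _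

theorem bproj_whiskerRight {P P' : Bimod A A} (f : P ⟶ P') (Q : Bimod A A) :
    bproj P Q ≫ (f ▷ Q).hom = f.hom ▷ Q.X ≫ bproj P' Q := ι_colimMap _ _

theorem bproj_whiskerLeft (P : Bimod A A) {Q Q' : Bimod A A} (f : Q ⟶ Q') :
    bproj P Q ≫ (P ◁ f).hom = P.X ◁ f.hom ≫ bproj P Q' := ι_colimMap _ _


theorem pr_assoc (M N P : LocMod A) :
    pr M N ▷ P.X ≫ pr (M ⊗ N) P ≫ (α_ M N P).hom.hom =
      (α_ _ _ _).hom ≫ M.X ◁ pr N P ≫ pr M (N ⊗ P) := by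
  have h1 : pr (M ⊗ N) P ≫ ((tensorIso M N).inv ▷ P.toBimod).hom =
      bproj (M.toBimod.tensorBimod N.toBimod) P.toBimod := by
    refine (bproj_whiskerRight (tensorIso M N).inv P.toBimod).trans ?_
    refine Eq.trans ?_ (Category.id_comp _)
    congr 1
    exact id_whiskerRight _ _
  have h2 : bproj M.toBimod (N.toBimod.tensorBimod P.toBimod) ≫
      (M.toBimod ◁ (tensorIso N P).hom).hom = pr M (N ⊗ P) := by
    refine (bproj_whiskerLeft M.toBimod (tensorIso N P).hom).trans ?_
    refine Eq.trans ?_ (Category.id_comp _)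
    congr 1
    exact MonoidalCategory.whiskerLeft_id _ _
  have h3 := bproj_assoc M.toBimod N.toBimod P.toBimod
  have h0 : (α_ M N P).hom.hom = (𝟙 _ ≫ ((tensorIso M N).inv ⊗ₘ 𝟙 P.toBimod).hom) ≫
      (Bimod.associatorBimod M.toBimod N.toBimod P.toBimod).hom.hom ≫
        ((𝟙 M.toBimod ⊗ₘ (tensorIso N P).hom).hom ≫ 𝟙 _) := rfl
  rw [tensorHom_id, id_tensorHom, Category.id_comp, Category.comp_id] at h0
  have h4 := congrArg (fun t => t ≫ (M.toBimod ◁ (tensorIso N P).hom).hom) h3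
  simp only [Category.assoc] at h4
  refine (congrArg (fun t => pr M N ▷ P.X ≫ pr (M ⊗ N) P ≫ t) h0).trans ?_
  refine (congrArg (fun t => pr M N ▷ P.X ≫ t) ((Category.assoc _ _ _).symm.trans
    (congrArg (fun t => t ≫ _) h1))).trans ?_
  exact h4.trans (congrArg (fun t => (α_ M.X N.X P.X).hom ≫ M.X ◁ pr N P ≫ t) h2)

theorem braid_wd (M N : LocMod A) :
    M.act ▷ N.X ≫ (β_ M.X N.X).hom ≫ pr N M = (α_ _ _ _).hom ≫
      M.X ◁ (β_ A.X N.X).hom ≫ M.X ◁ N.act ≫ (β_ M.X N.X).hom ≫ pr N M := by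
  have e : M.act = (β_ M.X A.X).hom ≫ (β_ A.X M.X).hom ≫ M.act := M.isLocal.symm
  rw [BraidedCategory.braiding_naturality_left_assoc,
    BraidedCategory.braiding_naturality_right_assoc, pr_condition]
  conv_lhs => rw [e]
  simp

theorem braid_inv_wd (M N : LocMod A) :
    M.act ▷ N.X ≫ (β_ N.X M.X).inv ≫ pr N M = (α_ _ _ _).hom ≫
      M.X ◁ (β_ A.X N.X).hom ≫ M.X ◁ N.act ≫ (β_ N.X M.X).inv ≫ pr N M := by
  rw [← MonoidalCategory.whiskerLeft_comp_assoc, ← inv_act,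
    MonoidalCategory.whiskerLeft_comp_assoc, BraidedCategory.braiding_inv_naturality_left_assoc,
    BraidedCategory.braiding_inv_naturality_right_assoc, pr_condition]
  simp

noncomputable def prDesc {M N : LocMod A} {Z : C} (f : M.X ⊗ N.X ⟶ Z)
    (h : M.act ▷ N.X ≫ f = (α_ _ _ _).hom ≫ M.X ◁ (β_ A.X N.X).hom ≫ M.X ◁ N.act ≫ f) :
    (M ⊗ N).X ⟶ Z :=
  coequalizer.desc f (by simpa using h)

theorem pr_desc {M N : LocMod A} {Z : C} (f : M.X ⊗ N.X ⟶ Z)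
    (h : M.act ▷ N.X ≫ f = (α_ _ _ _).hom ≫ M.X ◁ (β_ A.X N.X).hom ≫ M.X ◁ N.act ≫ f) :
    pr M N ≫ prDesc f h = f :=
  coequalizer.π_desc _ _

/-- The braiding `M ⊗_A N ≅ N ⊗_A M`, induced by the braiding `M ⊗ N ≅ N ⊗ M`. -/
noncomputable def braid (M N : LocMod A) : M ⊗ N ≅ N ⊗ M where
  hom :=
    { hom := prDesc ((β_ M.X N.X).hom ≫ pr N M) (braid_wd M N)
      act_hom := by
        rw [← cancel_epi (pr M N ▷ A.X), ← Category.assoc, pr_act, ← comp_whiskerRight_assoc,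
          pr_desc, Category.assoc, Category.assoc, pr_desc, comp_whiskerRight, Category.assoc,
          pr_act, BraidedCategory.braiding_naturality_right_assoc, pr_condition]
        simp only [BraidedCategory.braiding_tensor_right_hom, Category.assoc,
          Iso.hom_inv_id_assoc, Iso.inv_hom_id_assoc]
        rw [← MonoidalCategory.whiskerLeft_comp_assoc N.X (β_ A.X M.X).hom,
          ← MonoidalCategory.whiskerLeft_comp_assoc, M.isLocal] }
  inv :=
    { hom := prDesc ((β_ M.X N.X).inv ≫ pr M N) (braid_inv_wd N M)
      act_hom := by
        rw [← cancel_epi (pr N M ▷ A.X), ← Category.assoc, pr_act, ← comp_whiskerRight_assoc,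
          pr_desc, Category.assoc, Category.assoc, pr_desc, comp_whiskerRight, Category.assoc,
          pr_act, BraidedCategory.braiding_inv_naturality_right_assoc, pr_condition]
        simp }
  hom_inv_id := by
    ext
    rw [← cancel_epi (pr M N), comp_hom, ← Category.assoc, pr_desc, Category.assoc, pr_desc]
    simp
  inv_hom_id := by
    ext
    rw [← cancel_epi (pr N M), comp_hom, ← Category.assoc, pr_desc, Category.assoc, pr_desc]
    simp

theorem pr_braid (M N : LocMod A) :
    pr M N ≫ (braid M N).hom.hom = (β_ M.X N.X).hom ≫ pr N M := pr_desc _ (braid_wd M N)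

theorem pr_assoc_inv (M N P : LocMod A) :
    M.X ◁ pr N P ≫ pr M (N ⊗ P) ≫ (α_ M N P).inv.hom =
      (α_ _ _ _).inv ≫ pr M N ▷ P.X ≫ pr (M ⊗ N) P := by
  rw [Iso.eq_inv_comp, ← Category.assoc, ← Category.assoc, Category.assoc (α_ _ _ _).hom,
    ← pr_assoc, Category.assoc, Category.assoc, ← comp_hom, Iso.hom_inv_id, id_hom,
    Category.comp_id]

noncomputable instance : BraidedCategory (LocMod A) where
  braiding := braid
  braiding_naturality_left f N := by
    ext
    rw [← cancel_epi (pr _ _), comp_hom, comp_hom, ← Category.assoc, pr_whiskerRight,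
      ← Category.assoc, pr_braid, Category.assoc, Category.assoc, pr_braid, pr_whiskerLeft]
    simp
  braiding_naturality_right M _ _ f := by
    ext
    rw [← cancel_epi (pr _ _), comp_hom, comp_hom, ← Category.assoc, pr_whiskerLeft,
      ← Category.assoc, pr_braid, Category.assoc, Category.assoc, pr_braid, pr_whiskerRight]
    simp
  hexagon_forward M N P := by
    ext
    rw [← cancel_epi (pr M N ▷ P.X ≫ pr (M ⊗ N) P)]
    simp only [comp_hom]
    calc _ = (pr M N ▷ P.X ≫ pr (M ⊗ N) P ≫ (α_ M N P).hom.hom) ≫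
            (braid M (N ⊗ P)).hom.hom ≫ (α_ N P M).hom.hom := by simp only [Category.assoc]
      _ = (α_ M.X N.X P.X).hom ≫ M.X ◁ pr N P ≫ (β_ _ _).hom ≫
            pr (N ⊗ P) M ≫ (α_ N P M).hom.hom := by
          rw [pr_assoc, Category.assoc, Category.assoc, ← Category.assoc (pr M (N ⊗ P)), pr_braid,
            Category.assoc]
      _ = (α_ M.X N.X P.X).hom ≫ (β_ _ _).hom ≫ (α_ N.X P.X M.X).hom ≫ N.X ◁ pr P M ≫
            pr N (P ⊗ M) := by
          rw [BraidedCategory.braiding_naturality_right_assoc, pr_assoc]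
      _ = (β_ M.X N.X).hom ▷ P.X ≫ (α_ _ _ _).hom ≫ N.X ◁ (β_ M.X P.X).hom ≫ N.X ◁ pr P M ≫
            pr N (P ⊗ M) := by
          simp
      _ = (β_ M.X N.X).hom ▷ P.X ≫ (pr N M ▷ P.X ≫ pr (N ⊗ M) P ≫ (α_ N M P).hom.hom) ≫
            (N ◁ (braid M P).hom).hom := by
          rw [pr_assoc, Category.assoc, Category.assoc, pr_whiskerLeft,
            ← MonoidalCategory.whiskerLeft_comp_assoc, ← pr_braid,
            MonoidalCategory.whiskerLeft_comp_assoc]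
      _ = _ := by
          simp only [Category.assoc]
          rw [← Category.assoc (pr (M ⊗ N) P), pr_whiskerRight, Category.assoc,
            ← comp_whiskerRight_assoc, ← comp_whiskerRight_assoc, pr_braid]
  hexagon_reverse M N P := by
    ext
    rw [← cancel_epi (M.X ◁ pr N P ≫ pr M (N ⊗ P))]
    simp only [comp_hom]
    calc _ = (M.X ◁ pr N P ≫ pr M (N ⊗ P) ≫ (α_ M N P).inv.hom) ≫
            (braid (M ⊗ N) P).hom.hom ≫ (α_ P M N).inv.hom := by simp only [Category.assoc]
      _ = (α_ M.X N.X P.X).inv ≫ pr M N ▷ P.X ≫ (β_ _ _).hom ≫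
            pr P (M ⊗ N) ≫ (α_ P M N).inv.hom := by
          rw [pr_assoc_inv, Category.assoc, Category.assoc, ← Category.assoc (pr (M ⊗ N) P),
            pr_braid, Category.assoc]
      _ = (α_ M.X N.X P.X).inv ≫ (β_ _ _).hom ≫ (α_ P.X M.X N.X).inv ≫ pr P M ▷ N.X ≫
            pr (P ⊗ M) N := by
          rw [BraidedCategory.braiding_naturality_left_assoc, pr_assoc_inv]
      _ = M.X ◁ (β_ N.X P.X).hom ≫ (α_ _ _ _).inv ≫ (β_ M.X P.X).hom ▷ N.X ≫ pr P M ▷ N.X ≫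
            pr (P ⊗ M) N := by
          simp
      _ = M.X ◁ (β_ N.X P.X).hom ≫ (M.X ◁ pr P N ≫ pr M (P ⊗ N) ≫ (α_ M P N).inv.hom) ≫
            ((braid M P).hom ▷ N).hom := by
          rw [pr_assoc_inv, Category.assoc, Category.assoc, pr_whiskerRight,
            ← comp_whiskerRight_assoc, ← pr_braid, comp_whiskerRight_assoc]
      _ = _ := by
          simp only [Category.assoc]
          rw [← Category.assoc (pr M (N ⊗ P)), pr_whiskerLeft, Category.assoc,
            ← MonoidalCategory.whiskerLeft_comp_assoc, ← MonoidalCategory.whiskerLeft_comp_assoc,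
            pr_braid]

end LocMod
end LocMod

end

/-! ## The category `Z(G,α)` -/

section
/-- Normalized 3-cocycles of a group with values in `kˣ`. -/
structure IsCocycle3 {G k : Type u} [Group G] [Field k] (a : G → G → G → kˣ) : Prop where
  cocycle : ∀ f g h l, a g h l * a f (g * h) l * a f g h = a (f * g) h l * a f g (h * l)
  one_left : ∀ g h, a 1 g h = 1
  one_mid : ∀ g h, a g 1 h = 1
  one_right : ∀ g h, a g h 1 = 1

/-- The type of normalized 3-cocycles. -/
structure Cocycle3 (G k : Type u) [Group G] [Field k] where
  toFun : G → G → G → kˣ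
  isCocycle : IsCocycle3 toFun

namespace Cocycle3
variable {G k : Type u} [Group G] [Field k]

/-- `α(f,g|h) = α(f,g,h)⁻¹ α(f,ghg⁻¹,g) α((fg)h(fg)⁻¹,f,g)⁻¹`. -/
def act (α : Cocycle3 G k) (f g h : G) : kˣ :=
  (α.toFun f g h)⁻¹ * α.toFun f (g * h * g⁻¹) g * (α.toFun (f * g * h * (f * g)⁻¹) f g)⁻¹

/-- `α(f|g,h) = α(f,g,h) α(fgf⁻¹,f,h)⁻¹ α(fgf⁻¹,fhf⁻¹,f)`. -/
def ten (α : Cocycle3 G k) (f g h : G) : kˣ :=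
  α.toFun f g h * (α.toFun (f * g * f⁻¹) f h)⁻¹ *
    α.toFun (f * g * f⁻¹) (f * h * f⁻¹) f

theorem act_cocycle (α : Cocycle3 G k) (f g h u : G) :
    α.act f (g * h) u * α.act g h u = α.act (f * g) h u * α.act f g (h * u * h⁻¹) := by
  have h1 := α.isCocycle.cocycle f g h u
  have h2 := α.isCocycle.cocycle f g (h * u * h⁻¹) h
  have h3 := α.isCocycle.cocycle f (g * h * u * h⁻¹ * g⁻¹) g h
  have h4 := α.isCocycle.cocycle (f * g * h * u * h⁻¹ * g⁻¹ * f⁻¹) f g h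
  simp only [act]
  simp only [mul_assoc, mul_inv_rev, inv_mul_cancel_left, inv_mul_cancel, mul_one, inv_inv] at *
  apply_fun Additive.ofMul at h1 h2 h3 h4 ⊢
  simp only [ofMul_mul, ofMul_inv] at *
  linear_combination (norm := abel1) (-1:ℤ) • h1 + h2 - h3 + h4
  
theorem ten_act (α : Cocycle3 G k) (f g u v : G) :
    α.ten (f * g) u v * α.act f g u * α.act f g v =
      α.act f g (u * v) * α.ten g u v * α.ten f (g * u * g⁻¹) (g * v * g⁻¹) := by
  have h1 := α.isCocycle.cocycle f g u v
  have h2 := α.isCocycle.cocycle f (g * u * g⁻¹) g v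
  have h3 := α.isCocycle.cocycle f (g * u * g⁻¹) (g * v * g⁻¹) g
  have h4 := α.isCocycle.cocycle (f * g * u * g⁻¹ * f⁻¹) f g v
  have h5 := α.isCocycle.cocycle (f * g * u * g⁻¹ * f⁻¹) f (g * v * g⁻¹) g
  have h6 := α.isCocycle.cocycle (f * g * u * g⁻¹ * f⁻¹) (f * g * v * g⁻¹ * f⁻¹) f g
  simp only [act, ten]
  simp only [mul_assoc, mul_inv_rev, inv_mul_cancel_left, inv_mul_cancel, mul_one, inv_inv] at *
  apply_fun Additive.ofMul at h1 h2 h3 h4 h5 h6 ⊢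
  simp only [ofMul_mul, ofMul_inv] at *
  linear_combination (norm := abel1) (-1:ℤ) • h1 + h2 - h3 - h4 + h5 - h6

theorem ten_assoc (α : Cocycle3 G k) (f g h u : G) :
    α.toFun g h u * α.ten f (g * h) u * α.ten f g h =
      α.ten f g (h * u) * α.ten f h u *
        α.toFun (f * g * f⁻¹) (f * h * f⁻¹) (f * u * f⁻¹) := by
  have h1 := α.isCocycle.cocycle f g h u
  have h2 := α.isCocycle.cocycle (f * g * f⁻¹) f h u
  have h3 := α.isCocycle.cocycle (f * g * f⁻¹) (f * h * f⁻¹) f u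
  have h4 := α.isCocycle.cocycle (f * g * f⁻¹) (f * h * f⁻¹) (f * u * f⁻¹) f
  simp only [ten]
  simp only [mul_assoc, mul_inv_rev, inv_mul_cancel_left, inv_mul_cancel, mul_one, inv_inv] at *
  apply_fun Additive.ofMul at h1 h2 h3 h4 ⊢
  simp only [ofMul_mul, ofMul_inv] at *
  linear_combination (norm := abel1) h1 - h2 + h3 - h4

theorem ten_act_swap (α : Cocycle3 G k) (f a b : G) :
    α.ten f a b * α.act f a b = α.ten f (a * b * a⁻¹) a * α.act (f * a * f⁻¹) f b := by
  simp only [act, ten]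
  simp only [mul_assoc, mul_inv_rev, inv_mul_cancel_left, inv_mul_cancel, mul_one, inv_inv]
  apply_fun Additive.ofMul
  simp only [ofMul_mul, ofMul_inv]
  abel

theorem ten_hexagon (α : Cocycle3 G k) (a b c : G) :
    (α.toFun a b c)⁻¹ * (α.ten a b c * (α.toFun (a * b * a⁻¹) (a * c * a⁻¹) a)⁻¹) =
      (α.toFun (a * b * a⁻¹) a c)⁻¹ := by
  simp only [ten]
  apply_fun Additive.ofMul
  simp only [ofMul_mul, ofMul_inv]
  abel

theorem act_hexagon (α : Cocycle3 G k) (a b c : G) :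
    α.toFun a b c * (α.act a b c * α.toFun (a * (b * c * b⁻¹) * a⁻¹) a b) =
      α.toFun a (b * c * b⁻¹) b := by
  simp only [act]
  simp only [mul_assoc, mul_inv_rev, inv_mul_cancel_left, inv_mul_cancel, mul_one, inv_inv]
  apply_fun Additive.ofMul
  simp only [ofMul_mul, ofMul_inv]
  abel

theorem act_one_left (α : Cocycle3 G k) (g h : G) : α.act 1 g h = 1 := by
  simp [act, α.isCocycle.one_left, α.isCocycle.one_mid]

theorem act_one_mid (α : Cocycle3 G k) (g h : G) : α.act g 1 h = 1 := by
  simp [act, α.isCocycle.one_right, α.isCocycle.one_mid]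

theorem act_one_right (α : Cocycle3 G k) (g h : G) : α.act g h 1 = 1 := by
  simp [act, α.isCocycle.one_right, α.isCocycle.one_mid, α.isCocycle.one_left]

theorem ten_one_left (α : Cocycle3 G k) (g h : G) : α.ten 1 g h = 1 := by
  simp [ten, α.isCocycle.one_left, α.isCocycle.one_mid, α.isCocycle.one_right]

theorem ten_one_mid (α : Cocycle3 G k) (g h : G) : α.ten g 1 h = 1 := by
  simp [ten, α.isCocycle.one_left, α.isCocycle.one_mid, α.isCocycle.one_right]

theorem ten_one_right (α : Cocycle3 G k) (g h : G) : α.ten g h 1 = 1 := by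
  simp [ten, α.isCocycle.one_left, α.isCocycle.one_mid, α.isCocycle.one_right]

end Cocycle3

attribute [local instance] Fintype.ofFinite
open scoped TensorProduct Classical

/-- Objects of `Z(G,α)`: finite-dimensional `G`-graded vector spaces, the grading being given by the
projections `p g` onto the components, with an `α`-projective `G`-action: `f.V_g ⊆ V_{fgf⁻¹}` and
`(fg).v = α(f,g|h) f.(g.v)` for `v ∈ V_h`. With `ρ 1 = id` the maps `ρ f` are automatically
invertible. -/
structure ZObj {G k : Type u} [Group G] [Finite G] [Field k] (α : Cocycle3 G k) where
  V : Type u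
  [addCommGroup : AddCommGroup V]
  [module : Module k V]
  [finite : Module.Finite k V]
  p : G → V →ₗ[k] V
  p_same : ∀ g v, p g (p g v) = p g v
  p_ne : ∀ g h v, g ≠ h → p g (p h v) = 0
  p_sum : ∀ v, ∑ g, p g v = v
  ρ : G → V →ₗ[k] V
  ρ_one : ∀ v, ρ 1 v = v
  ρ_p : ∀ f g v, ρ f (p g v) = p (f * g * f⁻¹) (ρ f v)
  ρ_mul : ∀ f g h v, ρ (f * g) (p h v) = (α.act f g h : k) • ρ f (ρ g (p h v))

attribute [instance] ZObj.addCommGroup ZObj.module ZObj.finite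

namespace ZObj
variable {G k : Type u} [Group G] [Finite G] [Field k] {α : Cocycle3 G k}

/-- `v` is homogeneous of degree `g`. -/
def Deg (X : ZObj α) (g : G) (v : X.V) : Prop := X.p g v = v

theorem deg_p (X : ZObj α) (g : G) (v : X.V) : X.Deg g (X.p g v) := X.p_same g v

theorem Deg.p_eq {X : ZObj α} {a : G} {v : X.V} (h : X.Deg a v) (g : G) :
    X.p g v = if g = a then v else 0 := by
  split_ifs with hg
  · rw [hg]; exact h
  · rw [← h]; exact X.p_ne g a v hg

theorem Deg.ρ {X : ZObj α} {a : G} {v : X.V} (h : X.Deg a v) (f : G) :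
    X.Deg (f * a * f⁻¹) (X.ρ f v) := by
  unfold Deg; rw [← X.ρ_p, h]

theorem Deg.ρ_mul {X : ZObj α} {a : G} {v : X.V} (h : X.Deg a v) (f g : G) :
    X.ρ (f * g) v = (α.act f g a : k) • X.ρ f (X.ρ g v) := by
  have := X.ρ_mul f g a v
  rwa [h] at this

theorem lin_ext {X : ZObj α} {M : Type*} [AddCommMonoid M] [Module k M] {φ ψ : X.V →ₗ[k] M}
    (h : ∀ a v, X.Deg a v → φ v = ψ v) : φ = ψ := by
  ext v
  rw [← X.p_sum v, map_sum, map_sum]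
  exact Finset.sum_congr rfl fun g _ => h g _ (X.deg_p g v)

theorem lin_ext_apply {X : ZObj α} {M : Type*} [AddCommMonoid M] [Module k M]
    (φ ψ : X.V →ₗ[k] M) (h : ∀ a v, X.Deg a v → φ v = ψ v) (v : X.V) : φ v = ψ v := by
  rw [lin_ext h]

theorem ten_ext {X Y : ZObj α} {M : Type*} [AddCommMonoid M] [Module k M]
    {φ ψ : X.V ⊗[k] Y.V →ₗ[k] M}
    (h : ∀ a b x y, X.Deg a x → Y.Deg b y → φ (x ⊗ₜ y) = ψ (x ⊗ₜ y)) : φ = ψ := by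
  apply TensorProduct.ext
  refine lin_ext fun a x hx => ?_
  refine lin_ext fun b y hy => ?_
  exact h a b x y hx hy

theorem ten_ext_apply {X Y : ZObj α} {M : Type*} [AddCommMonoid M] [Module k M]
    (φ ψ : X.V ⊗[k] Y.V →ₗ[k] M)
    (h : ∀ a b x y, X.Deg a x → Y.Deg b y → φ (x ⊗ₜ y) = ψ (x ⊗ₜ y)) (v : X.V ⊗[k] Y.V) :
    φ v = ψ v := by
  rw [ten_ext h]

theorem ten3_ext {X Y Z : ZObj α} {M : Type*} [AddCommMonoid M] [Module k M]
    {φ ψ : (X.V ⊗[k] Y.V) ⊗[k] Z.V →ₗ[k] M}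
    (h : ∀ a b c x y z, X.Deg a x → Y.Deg b y → Z.Deg c z →
      φ ((x ⊗ₜ y) ⊗ₜ z) = ψ ((x ⊗ₜ y) ⊗ₜ z)) : φ = ψ := by
  apply TensorProduct.ext
  refine ten_ext fun a b x y hx hy => ?_
  refine lin_ext fun c z hz => ?_
  exact h a b c x y z hx hy hz

theorem ten3_ext' {X Y Z : ZObj α} {M : Type*} [AddCommMonoid M] [Module k M]
    {φ ψ : X.V ⊗[k] (Y.V ⊗[k] Z.V) →ₗ[k] M}
    (h : ∀ a b c x y z, X.Deg a x → Y.Deg b y → Z.Deg c z →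
      φ (x ⊗ₜ (y ⊗ₜ z)) = ψ (x ⊗ₜ (y ⊗ₜ z))) : φ = ψ := by
  apply TensorProduct.ext
  refine lin_ext fun a x hx => ?_
  refine ten_ext fun b c y z hy hz => ?_
  exact h a b c x y z hx hy hz

/-- Morphisms: linear maps that preserve the grading and the action. -/
@[ext]
structure Hom (X Y : ZObj α) where
  lin : X.V →ₗ[k] Y.V
  p_comm : ∀ g v, lin (X.p g v) = Y.p g (lin v)
  ρ_comm : ∀ g v, lin (X.ρ g v) = Y.ρ g (lin v)

theorem Hom.deg {X Y : ZObj α} (f : Hom X Y) {a : G} {v : X.V} (h : X.Deg a v) :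
    Y.Deg a (f.lin v) := by
  unfold Deg; rw [← f.p_comm, h]

instance : CategoryTheory.Category (ZObj α) where
  Hom X Y := Hom X Y
  id X := { lin := LinearMap.id, p_comm := fun _ _ => rfl, ρ_comm := fun _ _ => rfl }
  comp f g := { lin := g.lin ∘ₗ f.lin
                p_comm := fun a v => by simp [f.p_comm, g.p_comm]
                ρ_comm := fun a v => by simp [f.ρ_comm, g.ρ_comm] }

open CategoryTheory

@[ext]
theorem hom_ext {X Y : ZObj α} (f g : X ⟶ Y) (h : f.lin = g.lin) : f = g := Hom.ext h

@[simp]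
theorem id_lin (X : ZObj α) : Hom.lin (𝟙 X) = LinearMap.id := rfl

@[simp]
theorem comp_lin {X Y Z : ZObj α} (f : X ⟶ Y) (g : Y ⟶ Z) :
    Hom.lin (f ≫ g) = g.lin ∘ₗ f.lin := rfl

/-- Isomorphisms from inverse linear maps -/
@[simps]
def isoMk {X Y : ZObj α} (f : X ⟶ Y) (g : Y.V →ₗ[k] X.V) (h₁ : g ∘ₗ f.lin = LinearMap.id)
    (h₂ : f.lin ∘ₗ g = LinearMap.id) : X ≅ Y where
  hom := f
  inv :=
    { lin := g
      p_comm := fun a v => by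
        have h₁' := LinearMap.congr_fun h₁
        have h₂' := LinearMap.congr_fun h₂
        simp only [LinearMap.comp_apply, LinearMap.id_apply] at h₁' h₂'
        conv_lhs => rw [← h₂' v, ← f.p_comm, h₁']
      ρ_comm := fun a v => by
        have h₁' := LinearMap.congr_fun h₁
        have h₂' := LinearMap.congr_fun h₂
        simp only [LinearMap.comp_apply, LinearMap.id_apply] at h₁' h₂'
        conv_lhs => rw [← h₂' v, ← f.ρ_comm, h₁'] }
  hom_inv_id := hom_ext _ _ h₁
  inv_hom_id := hom_ext _ _ h₂

/-- multiplication by `c a b` on `X_a ⊗ Y_b` -/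
noncomputable def sc (X Y : ZObj α) (c : G → G → k) : X.V ⊗[k] Y.V →ₗ[k] X.V ⊗[k] Y.V :=
  ∑ a, ∑ b, c a b • TensorProduct.map (X.p a) (Y.p b)

theorem sc_tmul {X Y : ZObj α} (c : G → G → k) {a b : G} {x : X.V} {y : Y.V}
    (hx : X.Deg a x) (hy : Y.Deg b y) : sc X Y c (x ⊗ₜ y) = c a b • (x ⊗ₜ y) := by
  simp only [sc, LinearMap.sum_apply, LinearMap.smul_apply, TensorProduct.map_tmul, hx.p_eq,
    hy.p_eq]
  rw [Finset.sum_eq_single a, Finset.sum_eq_single b] <;> simp +contextual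

/-- The projection of `X ⊗ Y` onto `⊕_{ab = g} X_a ⊗ Y_b`. -/
noncomputable def tensorP (X Y : ZObj α) (g : G) : X.V ⊗[k] Y.V →ₗ[k] X.V ⊗[k] Y.V :=
  sc X Y fun a b => if a * b = g then 1 else 0

/-- `f.(x ⊗ y) = α(f|a,b) (f.x ⊗ f.y)` for `x ∈ X_a`, `y ∈ Y_b`. -/
noncomputable def tensorρ (X Y : ZObj α) (f : G) : X.V ⊗[k] Y.V →ₗ[k] X.V ⊗[k] Y.V :=
  TensorProduct.map (X.ρ f) (Y.ρ f) ∘ₗ sc X Y fun a b => α.ten f a b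

theorem tensorP_tmul {X Y : ZObj α} {a b : G} {x : X.V} {y : Y.V}
    (hx : X.Deg a x) (hy : Y.Deg b y) (g : G) :
    tensorP X Y g (x ⊗ₜ y) = if a * b = g then x ⊗ₜ y else 0 := by
  rw [tensorP, sc_tmul _ hx hy, ite_smul, one_smul, zero_smul]

theorem tensorρ_tmul {X Y : ZObj α} {a b : G} {x : X.V} {y : Y.V}
    (hx : X.Deg a x) (hy : Y.Deg b y) (f : G) :
    tensorρ X Y f (x ⊗ₜ y) = (α.ten f a b : k) • (X.ρ f x ⊗ₜ Y.ρ f y) := by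
  rw [tensorρ, LinearMap.comp_apply, sc_tmul _ hx hy, map_smul, TensorProduct.map_tmul]

/-- The tensor product. -/
@[reducible] noncomputable def tensorObj (X Y : ZObj α) : ZObj α where
  V := X.V ⊗[k] Y.V
  p := tensorP X Y
  p_same g := ten_ext_apply (tensorP X Y g ∘ₗ tensorP X Y g) _ fun a b x y hx hy => by
    rw [LinearMap.comp_apply, tensorP_tmul hx hy]
    split_ifs with h
    · rw [tensorP_tmul hx hy, if_pos h]
    · simp
  p_ne g h v hgh := ten_ext_apply (tensorP X Y g ∘ₗ tensorP X Y h) 0 (fun a b x y hx hy => by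
    rw [LinearMap.comp_apply, tensorP_tmul hx hy]
    split_ifs with h'
    · rw [tensorP_tmul hx hy, if_neg (fun h'' => hgh (h''.symm.trans h')), LinearMap.zero_apply]
    · simp) v
  p_sum v := by
    rw [← LinearMap.sum_apply]
    refine ten_ext_apply _ LinearMap.id (fun a b x y hx hy => ?_) v
    simp [LinearMap.sum_apply, tensorP_tmul hx hy]
  ρ := tensorρ X Y
  ρ_one := ten_ext_apply _ LinearMap.id fun a b x y hx hy => by
    simp [tensorρ_tmul hx hy, α.ten_one_left, X.ρ_one, Y.ρ_one]
  ρ_p f g := ten_ext_apply (tensorρ X Y f ∘ₗ tensorP X Y g)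
      (tensorP X Y _ ∘ₗ tensorρ X Y f) fun a b x y hx hy => by
    have : f * a * f⁻¹ * (f * b * f⁻¹) = f * g * f⁻¹ ↔ a * b = g := by
      rw [show f * a * f⁻¹ * (f * b * f⁻¹) = f * (a * b) * f⁻¹ by group, mul_left_inj,
        mul_right_inj]
    simp only [LinearMap.comp_apply, tensorP_tmul hx hy, tensorρ_tmul hx hy, map_smul,
      tensorP_tmul (hx.ρ f) (hy.ρ f), this]
    split_ifs
    · rw [tensorρ_tmul hx hy]
    · simp
  ρ_mul f g h := ten_ext_apply (tensorρ X Y (f * g) ∘ₗ tensorP X Y h)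
      ((α.act f g h : k) • (tensorρ X Y f ∘ₗ tensorρ X Y g ∘ₗ tensorP X Y h))
      fun a b x y hx hy => by
    simp only [LinearMap.comp_apply, LinearMap.smul_apply, tensorP_tmul hx hy]
    split_ifs with hab
    · subst hab
      rw [tensorρ_tmul hx hy, tensorρ_tmul hx hy, map_smul, tensorρ_tmul (hx.ρ g) (hy.ρ g),
        hx.ρ_mul, hy.ρ_mul, TensorProduct.smul_tmul_smul, smul_smul, smul_smul, smul_smul]
      congr 1
      have := congrArg (fun t : kˣ => (t : k)) (α.ten_act f g a b)
      push_cast at this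
      linear_combination this
    · simp

theorem Deg.tmul {X Y : ZObj α} {a b : G} {x : X.V} {y : Y.V} (hx : X.Deg a x) (hy : Y.Deg b y) :
    (tensorObj X Y).Deg (a * b) (x ⊗ₜ[k] y : X.V ⊗[k] Y.V) :=
  (tensorP_tmul hx hy _).trans (if_pos rfl)

variable (α) in
/-- The unit object: `k` in degree `1`, with the trivial action. -/
@[reducible] noncomputable def unit : ZObj α where
  V := k
  p g := if g = 1 then LinearMap.id else 0
  p_same g v := by split_ifs <;> simp
  p_ne g h v hgh := by split_ifs <;> simp_all
  p_sum v := by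
    rw [← LinearMap.sum_apply]; simp
  ρ _ := LinearMap.id
  ρ_one _ := rfl
  ρ_p f g v := by simp [conj_eq_one_iff]
  ρ_mul f g h v := by
    by_cases hh : h = 1
    · simp [hh, α.act_one_right]
    · simp [hh]

theorem deg_unit (c : k) : (unit α).Deg 1 c := by
  show (if (1 : G) = 1 then LinearMap.id else 0 : k →ₗ[k] k) c = c
  simp

end ZObj

namespace ZObj
variable {G k : Type u} [Group G] [Finite G] [Field k] {α : Cocycle3 G k}
open CategoryTheory MonoidalCategory

theorem Deg.smul {X : ZObj α} {a : G} {v : X.V} (h : X.Deg a v) (c : k) : X.Deg a (c • v) := by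
  unfold Deg at *; rw [map_smul, h]

theorem p_comm_of_deg {X : ZObj α}
    (Y : ZObj α) (φ : X.V →ₗ[k] Y.V) (h : ∀ a v, X.Deg a v → Y.Deg a (φ v)) (g : G) (v : X.V) :
    φ (X.p g v) = Y.p g (φ v) := by
  refine lin_ext_apply (φ ∘ₗ X.p g) (Y.p g ∘ₗ φ) (fun a v hv => ?_) v
  rw [LinearMap.comp_apply, LinearMap.comp_apply, hv.p_eq, (h a v hv).p_eq]
  split_ifs <;> simp

/-- A linear map out of `X ⊗ Y` that is graded and equivariant on homogeneous elements. -/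
@[simps]
def homMk₂ {X Y Z : ZObj α} (φ : X.V ⊗[k] Y.V →ₗ[k] Z.V)
    (hp : ∀ a b x y, X.Deg a x → Y.Deg b y → Z.Deg (a * b) (φ (x ⊗ₜ y)))
    (hρ : ∀ f a b x y, X.Deg a x → Y.Deg b y →
      (α.ten f a b : k) • φ (X.ρ f x ⊗ₜ Y.ρ f y) = Z.ρ f (φ (x ⊗ₜ y))) :
    tensorObj X Y ⟶ Z where
  lin := φ
  p_comm g := ten_ext_apply (φ ∘ₗ tensorP X Y g) (Z.p g ∘ₗ φ) fun a b x y hx hy => by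
    rw [LinearMap.comp_apply, LinearMap.comp_apply, tensorP_tmul hx hy, (hp a b x y hx hy).p_eq]
    by_cases h : a * b = g
    · rw [if_pos h, if_pos h.symm]
    · rw [if_neg h, if_neg (Ne.symm h), map_zero]
  ρ_comm f := ten_ext_apply (φ ∘ₗ tensorρ X Y f) (Z.ρ f ∘ₗ φ) fun a b x y hx hy => by
    rw [LinearMap.comp_apply, LinearMap.comp_apply, tensorρ_tmul hx hy, map_smul,
      hρ f a b x y hx hy]

/-- Multiplication by `c a b d` on `(X_a ⊗ Y_b) ⊗ Z_d`. -/
noncomputable def sc₃ (X Y Z : ZObj α) (c : G → G → G → k) :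
    (X.V ⊗[k] Y.V) ⊗[k] Z.V →ₗ[k] (X.V ⊗[k] Y.V) ⊗[k] Z.V :=
  ∑ a, ∑ b, ∑ d, c a b d • TensorProduct.map (TensorProduct.map (X.p a) (Y.p b)) (Z.p d)

theorem sc₃_tmul {X Y Z : ZObj α} (c : G → G → G → k) {a b d : G} {x : X.V} {y : Y.V} {z : Z.V}
    (hx : X.Deg a x) (hy : Y.Deg b y) (hz : Z.Deg d z) :
    sc₃ X Y Z c ((x ⊗ₜ y) ⊗ₜ z) = c a b d • ((x ⊗ₜ y) ⊗ₜ z) := by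
  simp only [sc₃, LinearMap.sum_apply, LinearMap.smul_apply, TensorProduct.map_tmul, hx.p_eq,
    hy.p_eq, hz.p_eq]
  rw [Finset.sum_eq_single a, Finset.sum_eq_single b, Finset.sum_eq_single d] <;>
    simp +contextual

/-- `(x ⊗ y) ⊗ z ↦ α(a,b,c)⁻¹ x ⊗ (y ⊗ z)`. -/
noncomputable def assocLin (X Y Z : ZObj α) :
    (X.V ⊗[k] Y.V) ⊗[k] Z.V →ₗ[k] X.V ⊗[k] (Y.V ⊗[k] Z.V) :=
  (TensorProduct.assoc k X.V Y.V Z.V).toLinearMap ∘ₗ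
    sc₃ X Y Z fun a b c => ((α.toFun a b c)⁻¹ : kˣ)

/-- `x ⊗ (y ⊗ z) ↦ α(a,b,c) (x ⊗ y) ⊗ z`. -/
noncomputable def assocInvLin (X Y Z : ZObj α) :
    X.V ⊗[k] (Y.V ⊗[k] Z.V) →ₗ[k] (X.V ⊗[k] Y.V) ⊗[k] Z.V :=
  sc₃ X Y Z (fun a b c => α.toFun a b c) ∘ₗ (TensorProduct.assoc k X.V Y.V Z.V).symm.toLinearMap

theorem assocLin_tmul {X Y Z : ZObj α} {a b c : G} {x : X.V} {y : Y.V} {z : Z.V}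
    (hx : X.Deg a x) (hy : Y.Deg b y) (hz : Z.Deg c z) :
    assocLin X Y Z ((x ⊗ₜ y) ⊗ₜ z) = (((α.toFun a b c)⁻¹ : kˣ) : k) • (x ⊗ₜ (y ⊗ₜ z)) := by
  simp [assocLin, sc₃_tmul _ hx hy hz]

theorem assocInvLin_tmul {X Y Z : ZObj α} {a b c : G} {x : X.V} {y : Y.V} {z : Z.V}
    (hx : X.Deg a x) (hy : Y.Deg b y) (hz : Z.Deg c z) :
    assocInvLin X Y Z (x ⊗ₜ (y ⊗ₜ z)) = (α.toFun a b c : k) • ((x ⊗ₜ y) ⊗ₜ z) := by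
  simp [assocInvLin, sc₃_tmul _ hx hy hz]

theorem tensorρ_tmul₃ {X Y Z : ZObj α} {a b c : G} {x : X.V} {y : Y.V} {z : Z.V}
    (hx : X.Deg a x) (hy : Y.Deg b y) (hz : Z.Deg c z) (f : G) :
    (tensorObj (tensorObj X Y) Z).ρ f ((x ⊗ₜ y) ⊗ₜ z : (X.V ⊗[k] Y.V) ⊗[k] Z.V) =
      ((α.ten f (a * b) c : k) * α.ten f a b) •
        ((X.ρ f x ⊗ₜ Y.ρ f y) ⊗ₜ Z.ρ f z : (X.V ⊗[k] Y.V) ⊗[k] Z.V) := by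
  refine (tensorρ_tmul (hx.tmul hy) hz f).trans ?_
  have h : (tensorObj X Y).ρ f (x ⊗ₜ[k] y : X.V ⊗[k] Y.V) =
    (α.ten f a b : k) • (X.ρ f x ⊗ₜ[k] Y.ρ f y : X.V ⊗[k] Y.V) := tensorρ_tmul hx hy f
  rw [h, mul_smul]
  rfl

theorem tensorρ_tmul₃' {X Y Z : ZObj α} {a b c : G} {x : X.V} {y : Y.V} {z : Z.V}
    (hx : X.Deg a x) (hy : Y.Deg b y) (hz : Z.Deg c z) (f : G) :
    (tensorObj X (tensorObj Y Z)).ρ f (x ⊗ₜ (y ⊗ₜ z) : X.V ⊗[k] (Y.V ⊗[k] Z.V)) =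
      ((α.ten f a (b * c) : k) * α.ten f b c) •
        (X.ρ f x ⊗ₜ (Y.ρ f y ⊗ₜ Z.ρ f z) : X.V ⊗[k] (Y.V ⊗[k] Z.V)) := by
  refine (tensorρ_tmul hx (hy.tmul hz) f).trans ?_
  have h : (tensorObj Y Z).ρ f (y ⊗ₜ[k] z : Y.V ⊗[k] Z.V) =
    (α.ten f b c : k) • (Y.ρ f y ⊗ₜ[k] Z.ρ f z : Y.V ⊗[k] Z.V) := tensorρ_tmul hy hz f
  rw [h, mul_smul]
  congr 1
  exact TensorProduct.tmul_smul _ _ _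

/-- The associator; its inverse is `x ⊗ (y ⊗ z) ↦ α(a,b,c) (x ⊗ y) ⊗ z` for `x`, `y`, `z` of degrees
`a`, `b`, `c`. -/
noncomputable def associator (X Y Z : ZObj α) :
    tensorObj (tensorObj X Y) Z ≅ tensorObj X (tensorObj Y Z) :=
  isoMk
    { lin := assocLin X Y Z
      p_comm := fun g v => by
        refine LinearMap.congr_fun (ten3_ext (φ := assocLin X Y Z ∘ₗ tensorP (tensorObj X Y) Z g)
          (ψ := tensorP X (tensorObj Y Z) g ∘ₗ assocLin X Y Z)
          fun a b c x y z hx hy hz => ?_) v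
        rw [LinearMap.comp_apply, LinearMap.comp_apply, assocLin_tmul hx hy hz, map_smul]
        refine (congrArg _ (tensorP_tmul (hx.tmul hy) hz g)).trans ?_
        refine Eq.trans ?_ (congrArg _ (tensorP_tmul hx (hy.tmul hz) g).symm)
        rw [mul_assoc]
        split_ifs
        · exact assocLin_tmul hx hy hz
        · rw [map_zero, smul_zero]
      ρ_comm := fun f v => by
        refine LinearMap.congr_fun (ten3_ext (φ := assocLin X Y Z ∘ₗ tensorρ (tensorObj X Y) Z f)
          (ψ := tensorρ X (tensorObj Y Z) f ∘ₗ assocLin X Y Z)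
          fun a b c x y z hx hy hz => ?_) v
        rw [LinearMap.comp_apply, LinearMap.comp_apply, assocLin_tmul hx hy hz, map_smul]
        refine (congrArg _ (tensorρ_tmul₃ hx hy hz f)).trans ?_
        refine Eq.trans ?_ (congrArg _ (tensorρ_tmul₃' hx hy hz f).symm)
        rw [map_smul, assocLin_tmul (hx.ρ f) (hy.ρ f) (hz.ρ f), smul_smul, smul_smul]
        congr 1
        have := congrArg (fun t : kˣ => (t : k)) (α.ten_assoc f a b c)
        push_cast at this ⊢
        field_simp
        linear_combination this }
    (assocInvLin X Y Z)
    (ten3_ext fun a b c x y z hx hy hz => by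
      rw [LinearMap.comp_apply]
      refine (congrArg _ (assocLin_tmul hx hy hz)).trans ?_
      rw [map_smul, assocInvLin_tmul hx hy hz, smul_smul]
      simp)
    (ten3_ext' fun a b c x y z hx hy hz => by
      rw [LinearMap.comp_apply]
      refine (congrArg _ (assocInvLin_tmul hx hy hz)).trans ?_
      rw [map_smul]
      refine (congrArg _ (assocLin_tmul hx hy hz)).trans ?_
      rw [smul_smul]
      simp)

theorem Deg.unit_eq {a : G} {c : k} (h : (unit α).Deg a c) (hc : c ≠ 0) : a = 1 := by
  by_contra ha
  have h' : (if a = 1 then LinearMap.id else 0 : k →ₗ[k] k) c = c := h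
  rw [if_neg ha] at h'
  exact hc h'.symm

noncomputable def leftUnitor (X : ZObj α) : tensorObj (unit α) X ≅ X :=
  isoMk
    (homMk₂ (TensorProduct.lid k X.V).toLinearMap
      (fun a b c x hc hx => by
        rw [LinearEquiv.coe_coe, TensorProduct.lid_tmul]
        by_cases h : c = 0
        · rw [h, zero_smul]; exact map_zero _
        · rw [hc.unit_eq h, one_mul]; exact hx.smul c)
      (fun f a b c x hc hx => by
        rw [LinearEquiv.coe_coe, TensorProduct.lid_tmul, TensorProduct.lid_tmul]
        by_cases h : c = 0
        · simp [h]
        · rw [hc.unit_eq h, α.ten_one_mid]; simp))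
    (TensorProduct.lid k X.V).symm.toLinearMap
    (LinearMap.ext fun v => (TensorProduct.lid k X.V).symm_apply_apply v)
    (LinearMap.ext fun v => (TensorProduct.lid k X.V).apply_symm_apply v)

noncomputable def rightUnitor (X : ZObj α) : tensorObj X (unit α) ≅ X :=
  isoMk
    (homMk₂ (TensorProduct.rid k X.V).toLinearMap
      (fun a b x c hx hc => by
        rw [LinearEquiv.coe_coe, TensorProduct.rid_tmul]
        by_cases h : c = 0
        · rw [h, zero_smul]; exact map_zero _
        · rw [hc.unit_eq h, mul_one]; exact hx.smul c)
      (fun f a b x c hx hc => by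
        rw [LinearEquiv.coe_coe, TensorProduct.rid_tmul, TensorProduct.rid_tmul]
        by_cases h : c = 0
        · simp [h]
        · rw [hc.unit_eq h, α.ten_one_right]; simp))
    (TensorProduct.rid k X.V).symm.toLinearMap
    (LinearMap.ext fun v => (TensorProduct.rid k X.V).symm_apply_apply v)
    (LinearMap.ext fun v => (TensorProduct.rid k X.V).apply_symm_apply v)

noncomputable def tensorMap {X X' Y Y' : ZObj α} (f : X ⟶ X') (g : Y ⟶ Y') :
    tensorObj X Y ⟶ tensorObj X' Y' :=
  homMk₂ (TensorProduct.map f.lin g.lin)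
    (fun a b x y hx hy => by
      rw [TensorProduct.map_tmul]; exact (f.deg hx).tmul (g.deg hy))
    (fun h a b x y hx hy => by
      rw [TensorProduct.map_tmul, TensorProduct.map_tmul, f.ρ_comm, g.ρ_comm]
      exact (tensorρ_tmul (f.deg hx) (g.deg hy) h).symm)

noncomputable instance : MonoidalCategoryStruct (ZObj α) where
  tensorObj := tensorObj
  tensorUnit := unit α
  tensorHom := tensorMap
  whiskerLeft X _ _ f := tensorMap (𝟙 X) f
  whiskerRight f Y := tensorMap f (𝟙 Y)
  associator := associator
  leftUnitor := leftUnitor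
  rightUnitor := rightUnitor

/-- The pure tensor `x ⊗ y` as an element of the tensor product object. -/
def tm {X Y : ZObj α} (x : X.V) (y : Y.V) : (X ⊗ Y).V := (x ⊗ₜ[k] y : X.V ⊗[k] Y.V)

theorem tm_smul {X Y : ZObj α} (c : k) (x : X.V) (y : Y.V) : tm x (c • y) = c • tm x y :=
  TensorProduct.tmul_smul _ _ _

theorem smul_tm {X Y : ZObj α} (c : k) (x : X.V) (y : Y.V) : tm (c • x) y = c • tm x y :=
  TensorProduct.smul_tmul' _ _ _

theorem tm_zero {X Y : ZObj α} (x : X.V) : tm x (0 : Y.V) = 0 := TensorProduct.tmul_zero _ _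

theorem zero_tm {X Y : ZObj α} (y : Y.V) : tm (0 : X.V) y = 0 := TensorProduct.zero_tmul _ _

theorem tm_add {X Y : ZObj α} (x : X.V) (y z : Y.V) : tm x (y + z) = tm x y + tm x z :=
  TensorProduct.tmul_add _ _ _

theorem add_tm {X Y : ZObj α} (x z : X.V) (y : Y.V) : tm (x + z) y = tm x y + tm z y :=
  TensorProduct.add_tmul _ _ _

theorem Deg.tm {X Y : ZObj α} {a b : G} {x : X.V} {y : Y.V} (hx : X.Deg a x) (hy : Y.Deg b y) :
    (X ⊗ Y).Deg (a * b) (tm x y) := hx.tmul hy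

theorem ρ_tm {X Y : ZObj α} {a b : G} {x : X.V} {y : Y.V} (hx : X.Deg a x) (hy : Y.Deg b y)
    (f : G) : (X ⊗ Y).ρ f (tm x y) = (α.ten f a b : k) • tm (X.ρ f x) (Y.ρ f y) :=
  tensorρ_tmul hx hy f

theorem tensorHom_tm {X X' Y Y' : ZObj α} (f : X ⟶ X') (g : Y ⟶ Y') (x : X.V) (y : Y.V) :
    Hom.lin (f ⊗ₘ g) (tm x y) = tm (f.lin x) (g.lin y) := rfl

theorem whiskerLeft_tm (X : ZObj α) {Y Y' : ZObj α} (g : Y ⟶ Y') (x : X.V) (y : Y.V) :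
    Hom.lin (X ◁ g) (tm x y) = tm x (g.lin y) := rfl

theorem whiskerRight_tm {X X' : ZObj α} (f : X ⟶ X') (Y : ZObj α) (x : X.V) (y : Y.V) :
    Hom.lin (f ▷ Y) (tm x y) = tm (f.lin x) y := rfl

theorem associator_hom_tm {X Y Z : ZObj α} {a b c : G} {x : X.V} {y : Y.V} {z : Z.V}
    (hx : X.Deg a x) (hy : Y.Deg b y) (hz : Z.Deg c z) :
    Hom.lin (α_ X Y Z).hom (tm (tm x y) z) =
      (((α.toFun a b c)⁻¹ : kˣ) : k) • tm x (tm y z) :=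
  assocLin_tmul hx hy hz

theorem associator_inv_tm {X Y Z : ZObj α} {a b c : G} {x : X.V} {y : Y.V} {z : Z.V}
    (hx : X.Deg a x) (hy : Y.Deg b y) (hz : Z.Deg c z) :
    Hom.lin (α_ X Y Z).inv (tm x (tm y z)) = (α.toFun a b c : k) • tm (tm x y) z :=
  assocInvLin_tmul hx hy hz

theorem leftUnitor_hom_tm (X : ZObj α) (c : k) (x : X.V) :
    Hom.lin (λ_ X).hom (tm (X := 𝟙_ (ZObj α)) c x) = c • x := TensorProduct.lid_tmul _ _

theorem rightUnitor_hom_tm (X : ZObj α) (c : k) (x : X.V) :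
    Hom.lin (ρ_ X).hom (tm (Y := 𝟙_ (ZObj α)) x c) = c • x := TensorProduct.rid_tmul _ _

/-- Linear maps out of `X ⊗ Y` agree if they agree on homogeneous pure tensors. -/
theorem lin_ext₂ {X Y : ZObj α} {M : Type*} [AddCommMonoid M] [Module k M]
    {φ ψ : (X ⊗ Y).V →ₗ[k] M}
    (h : ∀ a b x y, X.Deg a x → Y.Deg b y → φ (tm x y) = ψ (tm x y)) : φ = ψ :=
  ten_ext h

theorem lin_ext₃ {X Y Z : ZObj α} {M : Type*} [AddCommMonoid M] [Module k M]
    {φ ψ : ((X ⊗ Y) ⊗ Z).V →ₗ[k] M}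
    (h : ∀ a b c x y z, X.Deg a x → Y.Deg b y → Z.Deg c z →
      φ (tm (tm x y) z) = ψ (tm (tm x y) z)) : φ = ψ :=
  ten3_ext h

theorem lin_ext₃' {X Y Z : ZObj α} {M : Type*} [AddCommMonoid M] [Module k M]
    {φ ψ : (X ⊗ (Y ⊗ Z)).V →ₗ[k] M}
    (h : ∀ a b c x y z, X.Deg a x → Y.Deg b y → Z.Deg c z →
      φ (tm x (tm y z)) = ψ (tm x (tm y z))) : φ = ψ :=
  ten3_ext' h

/-- Morphisms out of `X ⊗ Y` agree if they agree on homogeneous pure tensors. -/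
theorem hom_ext₂ {X Y Z : ZObj α} {f g : X ⊗ Y ⟶ Z}
    (h : ∀ a b x y, X.Deg a x → Y.Deg b y → f.lin (tm x y) = g.lin (tm x y)) : f = g :=
  hom_ext _ _ (lin_ext₂ h)

theorem hom_ext₃ {X Y Z W : ZObj α} {f g : (X ⊗ Y) ⊗ Z ⟶ W}
    (h : ∀ a b c x y z, X.Deg a x → Y.Deg b y → Z.Deg c z →
      f.lin (tm (tm x y) z) = g.lin (tm (tm x y) z)) : f = g :=
  hom_ext _ _ (lin_ext₃ h)

theorem hom_ext₃' {X Y Z W : ZObj α} {f g : X ⊗ (Y ⊗ Z) ⟶ W}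
    (h : ∀ a b c x y z, X.Deg a x → Y.Deg b y → Z.Deg c z →
      f.lin (tm x (tm y z)) = g.lin (tm x (tm y z))) : f = g :=
  hom_ext _ _ (lin_ext₃' h)

theorem hom_ext₄ {X Y Z T W : ZObj α} {f g : ((X ⊗ Y) ⊗ Z) ⊗ T ⟶ W}
    (h : ∀ a b c d x y z t, X.Deg a x → Y.Deg b y → Z.Deg c z → T.Deg d t →
      f.lin (tm (tm (tm x y) z) t) = g.lin (tm (tm (tm x y) z) t)) : f = g := by
  refine hom_ext _ _ (TensorProduct.ext ?_)
  refine lin_ext₃ fun a b c x y z hx hy hz => ?_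
  refine lin_ext fun d t ht => ?_
  exact h a b c d x y z t hx hy hz ht

theorem comp_apply {X Y Z : ZObj α} (f : X ⟶ Y) (g : Y ⟶ Z) (v : X.V) :
    Hom.lin (f ≫ g) v = g.lin (f.lin v) := rfl

noncomputable instance : MonoidalCategory (ZObj α) where
  tensorHom_def f g := hom_ext₂ fun a b x y hx hy => rfl
  id_tensorHom_id X Y := hom_ext₂ fun a b x y hx hy => rfl
  tensorHom_comp_tensorHom f g h i := hom_ext₂ fun a b x y hx hy => rfl
  whiskerLeft_id X Y := hom_ext₂ fun a b x y hx hy => rfl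
  id_whiskerRight X Y := hom_ext₂ fun a b x y hx hy => rfl
  associator_naturality f g h := hom_ext₃ fun a b c x y z hx hy hz => by
    simp only [comp_apply, tensorHom_tm, associator_hom_tm hx hy hz,
      associator_hom_tm (f.deg hx) (g.deg hy) (h.deg hz), map_smul]
  leftUnitor_naturality {X Y} f := hom_ext₂ fun a b c x hc hx => by
    simp only [comp_apply, whiskerLeft_tm, leftUnitor_hom_tm, map_smul]
  rightUnitor_naturality {X Y} f := hom_ext₂ fun a b x c hx hc => by
    simp only [comp_apply, whiskerRight_tm, rightUnitor_hom_tm, map_smul]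
  pentagon W X Y Z := hom_ext₄ fun a b c d w x y z hw hx hy hz => by
    simp only [comp_apply, whiskerRight_tm, whiskerLeft_tm, map_smul, smul_tm, tm_smul, smul_smul,
      associator_hom_tm hw hx hy, associator_hom_tm hx hy hz, associator_hom_tm hw (hx.tm hy) hz,
      associator_hom_tm hw hx (hy.tm hz), associator_hom_tm (hw.tm hx) hy hz]
    congr 1
    have := congrArg (fun t : kˣ => ((t⁻¹ : kˣ) : k)) (α.isCocycle.cocycle a b c d)
    push_cast [mul_inv_rev] at this ⊢
    linear_combination this
  triangle X Y := hom_ext₃ fun a b c x y z hx hy hz => by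
    simp only [comp_apply]
    by_cases h : (show k from y) = 0
    · have h0 : y = 0 := h
      simp only [h0, tm_zero, zero_tm, map_zero]
    · obtain rfl := Deg.unit_eq (α := α) hy h
      rw [associator_hom_tm hx hy hz, α.isCocycle.one_mid, inv_one, Units.val_one, one_smul,
        whiskerLeft_tm, whiskerRight_tm]
      refine (congrArg (tm x) (leftUnitor_hom_tm Y y z)).trans ?_
      rw [tm_smul, ← smul_tm]
      exact congrArg (fun t => tm t z) (rightUnitor_hom_tm X y x).symm

/-! ### Braiding and twist -/

theorem ρ_inv_apply {X : ZObj α} {a : G} {v : X.V} (h : X.Deg a v) (f : G) :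
    X.ρ f⁻¹ (X.ρ f v) = (((α.act f⁻¹ f a)⁻¹ : kˣ) : k) • v := by
  have := h.ρ_mul f⁻¹ f
  rw [inv_mul_cancel, X.ρ_one] at this
  conv_rhs => rw [this, smul_smul]
  simp

theorem ρ_injective (X : ZObj α) (f : G) : Function.Injective (X.ρ f) := by
  rw [← LinearMap.ker_eq_bot, LinearMap.ker_eq_bot']
  intro v hv
  rw [← X.p_sum v]
  refine Finset.sum_eq_zero fun g _ => ?_
  have h := ρ_inv_apply (X.deg_p g v) f
  rw [X.ρ_p, hv, map_zero, map_zero] at h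
  simpa using h.symm

/-- The action of `f` as a linear automorphism. -/
noncomputable def ρE (X : ZObj α) (f : G) : X.V ≃ₗ[k] X.V :=
  LinearEquiv.ofInjectiveEndo (X.ρ f) (X.ρ_injective f)

theorem ρE_apply (X : ZObj α) (f : G) (v : X.V) : X.ρE f v = X.ρ f v := rfl

theorem ρ_ρE_symm (X : ZObj α) (f : G) (v : X.V) : X.ρ f ((X.ρE f).symm v) = v :=
  (X.ρE f).apply_symm_apply v

theorem ρE_symm_ρ (X : ZObj α) (f : G) (v : X.V) : (X.ρE f).symm (X.ρ f v) = v :=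
  (X.ρE f).symm_apply_apply v

theorem Deg.ρE_symm {X : ZObj α} {a : G} {v : X.V} (h : X.Deg a v) (f : G) :
    X.Deg (f⁻¹ * a * f) ((X.ρE f).symm v) := by
  apply X.ρ_injective f
  rw [X.ρ_p, ρ_ρE_symm]
  rw [show f * (f⁻¹ * a * f) * f⁻¹ = a by group]
  exact h

/-- `x ⊗ y ↦ a.y ⊗ x` for `x` of degree `a`. -/
noncomputable def braidLin (X Y : ZObj α) : X.V ⊗[k] Y.V →ₗ[k] Y.V ⊗[k] X.V :=
  ∑ a, TensorProduct.map (Y.ρ a) (X.p a) ∘ₗ (TensorProduct.comm k X.V Y.V).toLinearMap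

noncomputable def braidInvLin (X Y : ZObj α) : Y.V ⊗[k] X.V →ₗ[k] X.V ⊗[k] Y.V :=
  ∑ a, TensorProduct.map (X.p a) (Y.ρE a).symm.toLinearMap ∘ₗ
    (TensorProduct.comm k Y.V X.V).toLinearMap

theorem braidLin_tmul {X Y : ZObj α} {a : G} {x : X.V} (hx : X.Deg a x) (y : Y.V) :
    braidLin X Y (x ⊗ₜ y) = Y.ρ a y ⊗ₜ x := by
  simp only [braidLin, LinearMap.sum_apply, LinearMap.comp_apply, LinearEquiv.coe_coe,
    TensorProduct.comm_tmul, TensorProduct.map_tmul, hx.p_eq]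
  rw [Finset.sum_eq_single a] <;> simp +contextual

theorem braidInvLin_tmul {X Y : ZObj α} {a : G} {x : X.V} (hx : X.Deg a x) (y : Y.V) :
    braidInvLin X Y (y ⊗ₜ x) = x ⊗ₜ (Y.ρE a).symm y := by
  simp only [braidInvLin, LinearMap.sum_apply, LinearMap.comp_apply, LinearEquiv.coe_coe,
    TensorProduct.comm_tmul, TensorProduct.map_tmul, hx.p_eq]
  rw [Finset.sum_eq_single a] <;> simp +contextual

/-- The braiding `x ⊗ y ↦ a.y ⊗ x` for `x` of degree `a`. -/
noncomputable def braiding (X Y : ZObj α) : X ⊗ Y ≅ Y ⊗ X :=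
  isoMk
    (homMk₂ (Z := Y ⊗ X) (braidLin X Y)
      (fun a b x y hx hy => by
        rw [braidLin_tmul hx]
        have := (hy.ρ a).tm hx
        rwa [inv_mul_cancel_right] at this)
      (fun f a b x y hx hy => by
        rw [braidLin_tmul (hx.ρ f), braidLin_tmul hx]
        have h : (Y ⊗ X).ρ f (tm (Y.ρ a y) x) = _ := ρ_tm (hy.ρ a) hx f
        refine Eq.trans ?_ h.symm
        have h1 := hy.ρ_mul (f * a * f⁻¹) f
        have h2 := hy.ρ_mul f a
        rw [inv_mul_cancel_right, h2] at h1
        have h3 : Y.ρ (f * a * f⁻¹) (Y.ρ f y) =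
            ((((α.act (f * a * f⁻¹) f b)⁻¹ : kˣ) : k) * α.act f a b) • Y.ρ f (Y.ρ a y) := by
          rw [mul_smul, h1, smul_smul]
          simp
        rw [h3]
        refine (congrArg _ (smul_tm _ _ _)).trans ?_
        rw [smul_smul]
        congr 1
        have h4 := congrArg (fun t : kˣ => (t : k)) (α.ten_act_swap f a b)
        push_cast at h4 ⊢
        field_simp
        linear_combination h4))
    (braidInvLin X Y)
    (ten_ext fun a b x y hx hy => by
      refine (congrArg _ (braidLin_tmul hx y)).trans ?_
      refine (braidInvLin_tmul hx _).trans ?_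
      rw [ρE_symm_ρ]; rfl)
    (ten_ext fun b a y x hy hx => by
      refine (congrArg _ (braidInvLin_tmul hx y)).trans ?_
      refine (braidLin_tmul hx _).trans ?_
      rw [ρ_ρE_symm]; rfl)

theorem braiding_hom_tm {X Y : ZObj α} {a : G} {x : X.V} (hx : X.Deg a x) (y : Y.V) :
    Hom.lin (braiding X Y).hom (tm x y) = tm (Y.ρ a y) x := braidLin_tmul hx y

noncomputable instance : BraidedCategory (ZObj α) where
  braiding := braiding
  braiding_naturality_right X Y Z f := hom_ext₂ fun a b x y hx hy => by
    simp only [comp_apply, whiskerLeft_tm, whiskerRight_tm, braiding_hom_tm hx, f.ρ_comm]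
  braiding_naturality_left f Z := hom_ext₂ fun a b x y hx hy => by
    simp only [comp_apply, whiskerLeft_tm, whiskerRight_tm, braiding_hom_tm hx,
      braiding_hom_tm (f.deg hx)]
  hexagon_forward X Y Z := hom_ext₃ fun a b c x y z hx hy hz => by
    simp only [comp_apply, whiskerLeft_tm, whiskerRight_tm, braiding_hom_tm hx,
      associator_hom_tm hx hy hz, map_smul, ρ_tm hy hz, smul_tm, tm_smul,
      associator_hom_tm (hy.ρ a) (hz.ρ a) hx, associator_hom_tm (hy.ρ a) hx hz, smul_smul]
    congr 1
    have h4 := congrArg (fun t : kˣ => (t : k)) (α.ten_hexagon a b c)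
    push_cast at h4 ⊢
    linear_combination h4
  hexagon_reverse X Y Z := hom_ext₃' fun a b c x y z hx hy hz => by
    simp only [comp_apply, whiskerLeft_tm, whiskerRight_tm, braiding_hom_tm hx,
      braiding_hom_tm hy, braiding_hom_tm (hx.tm hy), hz.ρ_mul,
      associator_inv_tm hx hy hz, map_smul, smul_tm, tm_smul,
      associator_inv_tm hx (hz.ρ b) hy, associator_inv_tm ((hz.ρ b).ρ a) hx hy, smul_smul]
    congr 1
    have h4 := congrArg (fun t : kˣ => (t : k)) (α.act_hexagon a b c)
    push_cast at h4 ⊢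
    linear_combination h4
end ZObj

namespace ZObj
variable {G k : Type u} [Group G] [Finite G] [Field k] {α : Cocycle3 G k}
open CategoryTheory MonoidalCategory Limits

theorem braiding_tm {X Y : ZObj α} {a : G} {x : X.V} (hx : X.Deg a x) (y : Y.V) :
    Hom.lin (β_ X Y).hom (tm x y) = tm (Y.ρ a y) x := braiding_hom_tm hx y

/-- `v ↦ f.v` for `v` of degree `f`. -/
noncomputable def twistLin (X : ZObj α) : X.V →ₗ[k] X.V := ∑ a, X.ρ a ∘ₗ X.p a

theorem twistLin_apply {X : ZObj α} {a : G} {x : X.V} (hx : X.Deg a x) :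
    twistLin X x = X.ρ a x := by
  simp only [twistLin, LinearMap.sum_apply, LinearMap.comp_apply, hx.p_eq]
  rw [Finset.sum_eq_single a] <;> simp +contextual

noncomputable def twistInvLin (X : ZObj α) : X.V →ₗ[k] X.V :=
  ∑ a, (X.ρE a).symm.toLinearMap ∘ₗ X.p a

theorem twistInvLin_apply {X : ZObj α} {a : G} {x : X.V} (hx : X.Deg a x) :
    twistInvLin X x = (X.ρE a).symm x := by
  simp only [twistInvLin, LinearMap.sum_apply, LinearMap.comp_apply, hx.p_eq]
  rw [Finset.sum_eq_single a] <;> simp +contextual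

theorem Deg.ρ_self {X : ZObj α} {a : G} {x : X.V} (hx : X.Deg a x) : X.Deg a (X.ρ a x) := by
  have := hx.ρ a
  rwa [mul_inv_cancel_right] at this

theorem Deg.ρE_symm_self {X : ZObj α} {a : G} {x : X.V} (hx : X.Deg a x) :
    X.Deg a ((X.ρE a).symm x) := by
  have := hx.ρE_symm a
  rwa [inv_mul_cancel, one_mul] at this

theorem _root_.Cocycle3.act_twist (α : Cocycle3 G k) (f a : G) :
    α.act f a a = α.act (f * a * f⁻¹) f a := by
  simp only [Cocycle3.act]
  simp only [mul_assoc, mul_inv_rev, inv_mul_cancel_left, inv_mul_cancel, mul_one, inv_inv,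
    mul_inv_cancel, mul_inv_cancel_left]
  rw [one_mul]

/-- The twist of `Z(G,α)` on an object. -/
noncomputable def twistIso (X : ZObj α) : X ≅ X :=
  isoMk
    { lin := twistLin X
      p_comm := p_comm_of_deg X _ fun a v hv => by
        rw [twistLin_apply hv]; exact hv.ρ_self
      ρ_comm := fun f => lin_ext_apply (twistLin X ∘ₗ X.ρ f) (X.ρ f ∘ₗ twistLin X)
        fun a v hv => by
          rw [LinearMap.comp_apply, LinearMap.comp_apply, twistLin_apply hv,
            twistLin_apply (hv.ρ f)]
          have h1 := hv.ρ_mul (f * a * f⁻¹) f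
          have h2 := hv.ρ_mul f a
          rw [inv_mul_cancel_right, h2, α.act_twist] at h1
          exact (smul_right_injective _ (Units.ne_zero _) h1).symm }
    (twistInvLin X)
    (lin_ext fun a x hx => by
      rw [LinearMap.comp_apply, twistLin_apply hx, twistInvLin_apply hx.ρ_self, ρE_symm_ρ]
      rfl)
    (lin_ext fun a x hx => by
      rw [LinearMap.comp_apply, twistInvLin_apply hx, twistLin_apply hx.ρE_symm_self, ρ_ρE_symm]
      rfl)

variable (α) in
/-- The twist of `Z(G,α)`. -/
noncomputable def twist : 𝟭 (ZObj α) ≅ 𝟭 (ZObj α) :=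
  NatIso.ofComponents twistIso fun {X Y} f => hom_ext _ _ (lin_ext fun a x hx => by
    have hx : X.Deg a x := hx
    change twistLin Y (f.lin x) = f.lin (twistLin X x)
    rw [twistLin_apply hx, twistLin_apply (f.deg hx), f.ρ_comm])

theorem twist_apply {X : ZObj α} {a : G} {x : X.V} (hx : X.Deg a x) :
    Hom.lin ((twist α).hom.app X) x = X.ρ a x := twistLin_apply hx

/-! ### Coequalizers -/

section coeq
variable {X Y : ZObj α} (f g : X ⟶ Y)

theorem coeq_le (φ : X.V →ₗ[k] X.V) (ψ : Y.V →ₗ[k] Y.V) (hf : ∀ v, f.lin (φ v) = ψ (f.lin v))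
    (hg : ∀ v, g.lin (φ v) = ψ (g.lin v)) :
    LinearMap.range (f.lin - g.lin) ≤ (LinearMap.range (f.lin - g.lin)).comap ψ := by
  rintro _ ⟨v, rfl⟩
  exact ⟨φ v, by simp [hf, hg]⟩

/-- The cokernel of `f - g`. -/
noncomputable def coeqObj : ZObj α where
  V := Y.V ⧸ LinearMap.range (f.lin - g.lin)
  p a := Submodule.mapQ _ _ (Y.p a) (coeq_le f g (X.p a) (Y.p a) (f.p_comm a) (g.p_comm a))
  p_same a v := by
    induction v using Submodule.Quotient.induction_on with
    | H v => simp only [Submodule.mapQ_apply, Y.p_same]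
  p_ne a b v hab := by
    induction v using Submodule.Quotient.induction_on with
    | H v => simp only [Submodule.mapQ_apply, Y.p_ne a b v hab, Submodule.Quotient.mk_zero]
  p_sum v := by
    induction v using Submodule.Quotient.induction_on with
    | H v =>
      simp only [Submodule.mapQ_apply]
      conv_rhs => rw [← Y.p_sum v]
      exact (map_sum (Submodule.mkQ _) _ _).symm
  ρ a := Submodule.mapQ _ _ (Y.ρ a) (coeq_le f g (X.ρ a) (Y.ρ a) (f.ρ_comm a) (g.ρ_comm a))
  ρ_one v := by
    induction v using Submodule.Quotient.induction_on with
    | H v => simp only [Submodule.mapQ_apply, Y.ρ_one]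
  ρ_p a b v := by
    induction v using Submodule.Quotient.induction_on with
    | H v => simp only [Submodule.mapQ_apply, Y.ρ_p]
  ρ_mul a b c v := by
    induction v using Submodule.Quotient.induction_on with
    | H v => simp only [Submodule.mapQ_apply, Y.ρ_mul, Submodule.Quotient.mk_smul]

noncomputable def coeqπ : Y ⟶ coeqObj f g where
  lin := Submodule.mkQ _
  p_comm _ _ := rfl
  ρ_comm _ _ := rfl

theorem coeq_condition : f ≫ coeqπ f g = g ≫ coeqπ f g :=
  hom_ext _ _ (LinearMap.ext fun v => (Submodule.Quotient.eq _).2 ⟨v, rfl⟩)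

noncomputable def coeqDesc {Z : ZObj α} (h : Y ⟶ Z) (w : f ≫ h = g ≫ h) : coeqObj f g ⟶ Z where
  lin := Submodule.liftQ _ h.lin (by
    rintro _ ⟨v, rfl⟩
    have := LinearMap.congr_fun (congrArg Hom.lin w) v
    simp only [comp_lin, LinearMap.comp_apply] at this
    rw [LinearMap.mem_ker, LinearMap.sub_apply, map_sub, this, sub_self])
  p_comm a v := by
    induction v using Submodule.Quotient.induction_on with
    | H v => exact h.p_comm a v
  ρ_comm a v := by
    induction v using Submodule.Quotient.induction_on with
    | H v => exact h.ρ_comm a v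

noncomputable def coeqIsColimit : IsColimit (Cofork.ofπ (coeqπ f g) (coeq_condition f g)) :=
  Cofork.IsColimit.mk _ (fun s => coeqDesc f g s.π s.condition)
    (fun _ => hom_ext _ _ (Submodule.liftQ_mkQ _ _ _))
    (fun _ _ hm => hom_ext _ _ (Submodule.linearMap_qext _
      ((congrArg Hom.lin hm).trans (Submodule.liftQ_mkQ _ _ _).symm)))

end coeq

instance : HasCoequalizers (ZObj α) :=
  have {X Y : ZObj α} (f g : X ⟶ Y) : HasCoequalizer f g := ⟨⟨⟨_, coeqIsColimit f g⟩⟩⟩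
  hasCoequalizers_of_hasColimit_parallelPair _

end ZObj

namespace ZObj
variable {G k : Type u} [Group G] [Finite G] [Field k] {α : Cocycle3 G k}
open CategoryTheory MonoidalCategory Limits

/-! ### Duals -/

theorem p_ρE_symm (X : ZObj α) (f g : G) (v : X.V) :
    (X.ρE f).symm (X.p (f * g * f⁻¹) v) = X.p g ((X.ρE f).symm v) := by
  apply X.ρ_injective f
  rw [ρ_ρE_symm, X.ρ_p, ρ_ρE_symm]

/-- `(f.l)(x) = α(f|a,a⁻¹)⁻¹ l(f⁻¹.x)` for `l` of degree `a`, that is, supported on `X_{a⁻¹}`;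
here `f⁻¹.` is the inverse of the action of `f`. -/
noncomputable def dualρ (X : ZObj α) (f : G) : Module.Dual k X.V →ₗ[k] Module.Dual k X.V :=
  (X.ρE f).symm.toLinearMap.dualMap ∘ₗ
    ∑ a, (((α.ten f a a⁻¹)⁻¹ : kˣ) : k) • (X.p a⁻¹).dualMap

theorem dualρ_p (X : ZObj α) (f a : G) (l : Module.Dual k X.V) :
    dualρ X f ((X.p a⁻¹).dualMap l) = (((α.ten f a a⁻¹)⁻¹ : kˣ) : k) •
      (X.ρE f).symm.toLinearMap.dualMap ((X.p a⁻¹).dualMap l) := by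
  simp only [dualρ, LinearMap.comp_apply, LinearMap.sum_apply, LinearMap.smul_apply]
  rw [← map_smul]
  congr 1
  rw [Finset.sum_eq_single a]
  · congr 1
    ext v
    simp [X.p_same]
  · intro b _ hb
    convert smul_zero _
    ext v
    simp [X.p_ne _ _ v (fun h => hb (inv_injective h).symm)]
  · simp

/-- The dual object: `(X*)_g = (X_{g⁻¹})*`. -/
@[reducible] noncomputable def dual (X : ZObj α) : ZObj α where
  V := Module.Dual k X.V
  p g := (X.p g⁻¹).dualMap
  p_same g l := by ext v; simp [X.p_same]
  p_ne g h l hgh := by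
    ext v
    simp [X.p_ne h⁻¹ g⁻¹ v fun e => hgh (inv_injective e).symm]
  p_sum l := by
    ext v
    simp only [LinearMap.sum_apply, LinearMap.dualMap_apply]
    rw [← map_sum]
    congr 1
    rw [Fintype.sum_equiv (Equiv.inv G) (fun g => X.p g⁻¹ v) (fun g => X.p g v) (fun g => rfl)]
    exact X.p_sum v
  ρ := dualρ X
  ρ_one l := by
    ext v
    have h1 : ∀ w, (X.ρE 1).symm w = w := fun w => by
      apply X.ρ_injective 1
      rw [ρ_ρE_symm, X.ρ_one]
    simp only [dualρ, LinearMap.comp_apply, LinearMap.dualMap_apply, LinearEquiv.coe_coe, h1,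
      α.ten_one_left, inv_one, Units.val_one, one_smul, LinearMap.sum_apply]
    rw [← map_sum]
    congr 1
    rw [Fintype.sum_equiv (Equiv.inv G) (fun g => X.p g⁻¹ v) (fun g => X.p g v) (fun g => rfl)]
    exact X.p_sum v
  ρ_p f a l := by
    rw [dualρ_p]
    ext v
    simp only [dualρ, LinearMap.smul_apply, LinearMap.dualMap_apply, LinearEquiv.coe_coe,
      LinearMap.comp_apply, LinearMap.sum_apply]
    have h1 : (f * a * f⁻¹)⁻¹ = f * a⁻¹ * f⁻¹ := by group
    rw [h1, p_ρE_symm, Finset.sum_eq_single a]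
    · rw [X.p_same]
    · intro b _ hb
      rw [X.p_ne _ _ _ (fun h => hb (inv_injective h)), map_zero, smul_zero]
    · simp
  ρ_mul f g a l := by
    have h2 : (X.ρE g).symm.toLinearMap.dualMap ((X.p a⁻¹).dualMap l) =
        (X.p (g * a * g⁻¹)⁻¹).dualMap ((X.ρE g).symm.toLinearMap.dualMap l) := by
      ext v
      simp only [LinearMap.dualMap_apply, LinearEquiv.coe_coe]
      rw [show (g * a * g⁻¹)⁻¹ = g * a⁻¹ * g⁻¹ by group, p_ρE_symm]
    rw [dualρ_p, dualρ_p, map_smul, h2, dualρ_p, ← h2]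
    ext v
    simp only [LinearMap.smul_apply, LinearMap.dualMap_apply, LinearEquiv.coe_coe]
    obtain ⟨w, rfl⟩ : ∃ w, X.ρ f (X.ρ g w) = v := ⟨(X.ρE g).symm ((X.ρE f).symm v), by
      rw [ρ_ρE_symm, ρ_ρE_symm]⟩
    rw [ρE_symm_ρ, ρE_symm_ρ]
    have h3 : X.p a⁻¹ ((X.ρE (f * g)).symm (X.ρ f (X.ρ g w))) =
        (((α.act f g a⁻¹)⁻¹ : kˣ) : k) • X.p a⁻¹ w := by
      rw [← p_ρE_symm, LinearEquiv.symm_apply_eq, ρE_apply, map_smul, X.ρ_mul, smul_smul,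
        X.ρ_p, X.ρ_p]
      simp only [Units.inv_mul, one_smul]
      congr 2
      group
    rw [h3, map_smul, smul_smul, smul_smul]
    simp only [smul_eq_mul, ← mul_assoc]
    congr 1
    have h4 := congrArg (fun t : kˣ => (t : k)) (α.ten_act f g a a⁻¹)
    rw [mul_inv_cancel, α.act_one_right, show g * a⁻¹ * g⁻¹ = (g * a * g⁻¹)⁻¹ by group] at h4
    push_cast at h4 ⊢
    field_simp
    linear_combination -h4

end ZObj

namespace ZObj
variable {G k : Type u} [Group G] [Finite G] [Field k] {α : Cocycle3 G k}
open CategoryTheory MonoidalCategory Limits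

/-- `V ⊗ V* ≃ End V`. -/
noncomputable def endEquiv (X : ZObj α) :
    X.V ⊗[k] Module.Dual k X.V ≃ₗ[k] (X.V →ₗ[k] X.V) :=
  TensorProduct.comm k _ _ ≪≫ₗ dualTensorHomEquiv k X.V X.V

theorem endEquiv_tmul (X : ZObj α) (x : X.V) (l : Module.Dual k X.V) (w : X.V) :
    endEquiv X (x ⊗ₜ l) w = l w • x := by
  simp [endEquiv]

theorem endEquiv_map (X : ZObj α) (φ ψ : X.V →ₗ[k] X.V) (t : X.V ⊗[k] Module.Dual k X.V) :
    endEquiv X (TensorProduct.map φ ψ.dualMap t) = φ ∘ₗ endEquiv X t ∘ₗ ψ := by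
  induction t with
  | zero => simp
  | add s t hs ht => simp only [map_add, hs, ht, LinearMap.comp_add, LinearMap.add_comp]
  | tmul x l => ext w; simp [endEquiv_tmul]

theorem endEquiv_symm_comp (X : ZObj α) (φ θ ψ : X.V →ₗ[k] X.V) :
    (endEquiv X).symm (φ ∘ₗ θ ∘ₗ ψ) = TensorProduct.map φ ψ.dualMap ((endEquiv X).symm θ) := by
  rw [LinearEquiv.symm_apply_eq, endEquiv_map, LinearEquiv.apply_symm_apply]

/-- The canonical element of `X_g ⊗ (X_g)*`. -/
noncomputable def can (X : ZObj α) (g : G) : X.V ⊗[k] Module.Dual k X.V :=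
  (endEquiv X).symm (X.p g)

theorem can_eq (X : ZObj α) (g : G) :
    can X g = TensorProduct.map (X.p g) (X.p g).dualMap (can X g) := by
  rw [can, ← endEquiv_symm_comp]
  congr 1
  ext v
  simp [X.p_same]

theorem endEquiv_can (X : ZObj α) (g : G) : endEquiv X (can X g) = X.p g :=
  LinearEquiv.apply_symm_apply _ _

noncomputable def evLin (X : ZObj α) : Module.Dual k X.V ⊗[k] X.V →ₗ[k] k := contractLeft k X.V

theorem Deg.dual_apply {X : ZObj α} {a b : G} {l : Module.Dual k X.V} {x : X.V}
    (hl : (dual X).Deg a l) (hx : X.Deg b x) (hab : b ≠ a⁻¹) : l x = 0 := by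
  have h : (X.p a⁻¹).dualMap l = l := hl
  rw [← h, LinearMap.dualMap_apply, hx.p_eq, if_neg (Ne.symm hab), map_zero]

/-- The evaluation `l ⊗ x ↦ l x`. -/
noncomputable def ev (X : ZObj α) : dual X ⊗ X ⟶ 𝟙_ (ZObj α) :=
  homMk₂ (X := dual X) (Z := unit α) (evLin X)
    (fun a b l x hl hx => by
      rw [evLin]
      refine (congrArg (Deg _ _) (contractLeft_apply _ _)).mpr ?_
      by_cases h : b = a⁻¹
      · rw [h, mul_inv_cancel]; exact deg_unit _
      · rw [hl.dual_apply hx h]; exact map_zero _)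
    (fun f a b l x hl hx => by
      rw [evLin]
      refine (congrArg _ (contractLeft_apply _ _)).trans ?_
      refine Eq.trans ?_ (contractLeft_apply _ _).symm
      by_cases h : b = a⁻¹
      · have h1 := dualρ_p X f a l
        rw [show (X.p a⁻¹).dualMap l = l from hl] at h1
        refine (congrArg (fun t : Module.Dual k X.V => _ • t _) h1).trans ?_
        rw [LinearMap.smul_apply, LinearMap.dualMap_apply, LinearEquiv.coe_coe, ρE_symm_ρ,
          smul_smul, h]
        simp
      · rw [hl.dual_apply hx h]
        refine (congrArg _ (Deg.dual_apply (hl.ρ f) (hx.ρ f) fun e => h ?_)).trans (smul_zero _)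
        have : f * b * f⁻¹ = f * a⁻¹ * f⁻¹ := by rw [e]; group
        simpa using this)

theorem tensorP_map {X Y : ZObj α} (a b g : G) (t : X.V ⊗[k] Y.V) :
    tensorP X Y g (TensorProduct.map (X.p a) (Y.p b) t) =
      if a * b = g then TensorProduct.map (X.p a) (Y.p b) t else 0 := by
  induction t with
  | zero => simp
  | add s t hs ht => rw [map_add, map_add, hs, ht]; split_ifs <;> simp
  | tmul x y => rw [TensorProduct.map_tmul, tensorP_tmul (X.deg_p a x) (Y.deg_p b y)]

theorem tensorρ_map {X Y : ZObj α} (a b f : G) (t : X.V ⊗[k] Y.V) :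
    tensorρ X Y f (TensorProduct.map (X.p a) (Y.p b) t) =
      (α.ten f a b : k) • TensorProduct.map (X.ρ f ∘ₗ X.p a) (Y.ρ f ∘ₗ Y.p b) t := by
  induction t with
  | zero => simp
  | add s t hs ht => rw [map_add, map_add, hs, ht, map_add, smul_add]
  | tmul x y =>
    rw [TensorProduct.map_tmul, tensorρ_tmul (X.deg_p a x) (Y.deg_p b y), TensorProduct.map_tmul]
    rfl

theorem tensorP_can (X : ZObj α) (g a : G) :
    tensorP X (dual X) g (can X a) = if g = 1 then can X a else 0 := by
  have h : can X a = TensorProduct.map (X.p a) ((dual X).p a⁻¹) (can X a) := by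
    conv_lhs => rw [can_eq]
    simp only [inv_inv]
  rw [h, tensorP_map, mul_inv_cancel]
  by_cases hg : g = 1
  · rw [if_pos hg.symm, if_pos hg]
  · rw [if_neg (Ne.symm hg), if_neg hg]

theorem tensorρ_can (X : ZObj α) (f a : G) :
    tensorρ X (dual X) f (can X a) =
      ((α.ten f a a⁻¹ : k) * ((α.ten f a⁻¹ a)⁻¹ : kˣ)) • can X (f * a * f⁻¹) := by
  have h : can X a = TensorProduct.map (X.p a) ((dual X).p a⁻¹) (can X a) := by
    conv_lhs => rw [can_eq]
    simp only [inv_inv]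
  have h1 : (dual X).ρ f ∘ₗ (dual X).p a⁻¹ = (((α.ten f a⁻¹ a)⁻¹ : kˣ) : k) •
      (X.p a ∘ₗ (X.ρE f).symm.toLinearMap).dualMap := by
    refine LinearMap.ext fun l => LinearMap.ext fun v => ?_
    have := LinearMap.congr_fun (dualρ_p X f a⁻¹ l) v
    rw [inv_inv] at this
    refine Eq.trans ?_ this
    simp only [LinearMap.comp_apply, inv_inv]
  conv_lhs => rw [h, tensorρ_map, h1, TensorProduct.map_smul_right, LinearMap.smul_apply,
    smul_smul]
  congr 1
  refine (endEquiv_symm_comp X _ (X.p a) _).symm.trans ?_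
  rw [can]
  congr 1
  ext v
  simp only [LinearMap.comp_apply, LinearEquiv.coe_coe, X.p_same]
  rw [X.ρ_p, ρ_ρE_symm]

theorem _root_.Cocycle3.ten_dual (α : Cocycle3 G k) (f a : G) :
    α.toFun a a⁻¹ a * α.ten f a a⁻¹ * (α.ten f a⁻¹ a)⁻¹ =
      α.toFun (f * a * f⁻¹) (f * a * f⁻¹)⁻¹ (f * a * f⁻¹) := by
  have h := α.ten_assoc f a a⁻¹ a
  rw [mul_inv_cancel, inv_mul_cancel, α.ten_one_mid, α.ten_one_right, mul_one, one_mul,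
    show f * a⁻¹ * f⁻¹ = (f * a * f⁻¹)⁻¹ by group] at h
  rw [h, mul_inv_cancel_comm]

/-- `∑_a α(a,a⁻¹,a) can_a`. -/
noncomputable def coevElt (X : ZObj α) : X.V ⊗[k] Module.Dual k X.V :=
  ∑ a, (α.toFun a a⁻¹ a : k) • can X a

theorem tensorP_coevElt (X : ZObj α) (g : G) :
    tensorP X (dual X) g (coevElt X) = if g = 1 then coevElt X else 0 := by
  have h : tensorP X (dual X) g (coevElt X) =
      ∑ a, (α.toFun a a⁻¹ a : k) • (if g = 1 then can X a else 0) := by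
    rw [coevElt, map_sum]
    exact Finset.sum_congr rfl fun a _ => (map_smul _ _ _).trans (congrArg _ (tensorP_can X g a))
  rw [h]
  split_ifs
  · rfl
  · simp

theorem tensorρ_coevElt (X : ZObj α) (f : G) :
    tensorρ X (dual X) f (coevElt X) = coevElt X := by
  have h : tensorρ X (dual X) f (coevElt X) =
      ∑ a, (α.toFun a a⁻¹ a : k) • ((α.ten f a a⁻¹ : k) * ((α.ten f a⁻¹ a)⁻¹ : kˣ)) •
        can X (f * a * f⁻¹) := by
    rw [coevElt, map_sum]
    exact Finset.sum_congr rfl fun a _ => (map_smul _ _ _).trans (congrArg _ (tensorρ_can X f a))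
  rw [h]
  refine Fintype.sum_equiv (MulAut.conj f).toEquiv _ _ fun a => ?_
  simp only [MulEquiv.toEquiv_eq_coe, MulEquiv.coe_toEquiv, MulAut.conj_apply]
  rw [← α.ten_dual, smul_smul]
  push_cast
  rw [← mul_assoc]

/-- The coevaluation. -/
noncomputable def coev (X : ZObj α) : 𝟙_ (ZObj α) ⟶ X ⊗ dual X where
  lin := LinearMap.toSpanSingleton k _ (coevElt X)
  p_comm g c := by
    change (if g = 1 then LinearMap.id else 0 : k →ₗ[k] k) c • coevElt X =
      tensorP X (dual X) g (c • coevElt X)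
    rw [map_smul]
    refine Eq.trans ?_ (congrArg (c • ·) (tensorP_coevElt X g)).symm
    by_cases hg : g = 1
    · simp [hg]
    · simp [hg]
  ρ_comm f c := by
    change c • coevElt X = tensorρ X (dual X) f (c • coevElt X)
    rw [map_smul]
    exact (congrArg (c • ·) (tensorρ_coevElt X f)).symm

theorem ev_tm (X : ZObj α) (l : Module.Dual k X.V) (x : X.V) :
    Hom.lin (ev X) (tm (X := dual X) l x) = l x := contractLeft_apply _ _

theorem assoc_ev (X : ZObj α) (a b c : G) (t : X.V ⊗[k] Module.Dual k X.V) {x : X.V}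
    (hx : X.Deg c x) :
    Hom.lin ((α_ X (dual X) X).hom ≫ X ◁ ev X ≫ (ρ_ X).hom)
      (tm (X := X ⊗ dual X) (TensorProduct.map (X.p a) ((dual X).p b) t) x) =
        (((α.toFun a b c)⁻¹ : kˣ) : k) •
          endEquiv X (TensorProduct.map (X.p a) ((dual X).p b) t) x := by
  induction t with
  | zero =>
    simp only [map_zero, LinearMap.zero_apply, smul_zero]
    exact (congrArg _ (zero_tm (X := X ⊗ dual X) x)).trans (map_zero _)
  | add s t hs ht =>
    simp only [map_add, LinearMap.add_apply, smul_add]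
    rw [← hs, ← ht]
    refine Eq.trans (congrArg _ ?_) (map_add _ _ _)
    exact (add_tm (X := X ⊗ dual X) _ _ x)
  | tmul y l =>
    rw [TensorProduct.map_tmul]
    refine Eq.trans ?_ (congrArg _ (endEquiv_tmul X _ _ x).symm)
    rw [comp_apply, comp_apply]
    have := associator_hom_tm (X.deg_p a y) ((dual X).deg_p b l) hx
    refine (congrArg _ (congrArg _ this)).trans ?_
    rw [map_smul, map_smul, whiskerLeft_tm]
    exact congrArg _ (rightUnitor_hom_tm X _ _)

theorem assoc_ev' (X : ZObj α) (a b c : G) (t : X.V ⊗[k] Module.Dual k X.V)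
    {l : Module.Dual k X.V} (hl : (dual X).Deg c l) :
    Hom.lin ((α_ (dual X) X (dual X)).inv ≫ ev X ▷ dual X ≫ (λ_ (dual X)).hom)
      (tm (X := dual X) (Y := X ⊗ dual X) l (TensorProduct.map (X.p a) ((dual X).p b) t)) =
        ((α.toFun c a b : k) •
          (l ∘ₗ endEquiv X (TensorProduct.map (X.p a) ((dual X).p b) t)) :
          Module.Dual k X.V) := by
  induction t with
  | zero =>
    simp only [map_zero, LinearMap.comp_zero, smul_zero]
    exact (congrArg _ (tm_zero (X := dual X) (Y := X ⊗ dual X) l)).trans (map_zero _)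
  | add s t hs ht =>
    simp only [map_add, LinearMap.comp_add, smul_add]
    rw [← hs, ← ht]
    refine Eq.trans (congrArg _ ?_) (map_add _ _ _)
    exact (tm_add (X := dual X) (Y := X ⊗ dual X) l _ _)
  | tmul y m =>
    have h0 : l ∘ₗ endEquiv X (X.p a y ⊗ₜ (dual X).p b m) = l (X.p a y) • (dual X).p b m := by
      refine LinearMap.ext fun x => ?_
      refine (congrArg l (endEquiv_tmul X _ _ x)).trans ?_
      rw [map_smul, smul_eq_mul, mul_comm]
      rfl
    rw [TensorProduct.map_tmul]
    refine Eq.trans ?_ (congrArg _ h0.symm)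
    rw [comp_apply, comp_apply]
    have := associator_inv_tm hl (X.deg_p a y) ((dual X).deg_p b m)
    refine (congrArg _ (congrArg _ this)).trans ?_
    rw [map_smul, map_smul, whiskerRight_tm]
    exact congrArg _ (leftUnitor_hom_tm (dual X) _ _)

theorem can_eq' (X : ZObj α) (a : G) :
    TensorProduct.map (X.p a) ((dual X).p a⁻¹) (can X a) = can X a := by
  conv_rhs => rw [can_eq]
  simp only [inv_inv]

theorem zigzag (X : ZObj α) {c : G} {x : X.V} (hx : X.Deg c x) :
    Hom.lin ((α_ X (dual X) X).hom ≫ X ◁ ev X ≫ (ρ_ X).hom)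
      (tm (X := X ⊗ dual X) (coevElt X) x) = x := by
  have h1 : tm (X := X ⊗ dual X) (coevElt X) x =
      ∑ a, (α.toFun a a⁻¹ a : k) • tm (X := X ⊗ dual X) (can X a) x := by
    refine (TensorProduct.sum_tmul _ _ _).trans (Finset.sum_congr rfl fun a _ => ?_)
    exact smul_tm (X := X ⊗ dual X) _ _ _
  rw [h1, map_sum]
  simp only [map_smul]
  rw [Finset.sum_eq_single c]
  · have := assoc_ev X c c⁻¹ c (can X c) hx
    rw [can_eq', endEquiv_can] at this
    refine (congrArg _ this).trans ?_
    rw [smul_smul, hx]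
    simp
  · intro a _ hac
    have := assoc_ev X a a⁻¹ c (can X a) hx
    rw [can_eq', endEquiv_can] at this
    refine (congrArg _ this).trans ?_
    rw [hx.p_eq, if_neg hac, smul_zero, smul_zero]
  · simp

theorem _root_.Cocycle3.inv_self (α : Cocycle3 G k) (a : G) :
    α.toFun a⁻¹ a a⁻¹ * α.toFun a a⁻¹ a = 1 := by
  have := α.isCocycle.cocycle a a⁻¹ a a⁻¹
  simpa [α.isCocycle.one_left, α.isCocycle.one_mid, α.isCocycle.one_right] using this

theorem zigzag' (X : ZObj α) {c : G} {l : Module.Dual k X.V} (hl : (dual X).Deg c l) :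
    Hom.lin ((α_ (dual X) X (dual X)).inv ≫ ev X ▷ dual X ≫ (λ_ (dual X)).hom)
      (tm (X := dual X) (Y := X ⊗ dual X) l (coevElt X)) = l := by
  have h1 : tm (X := dual X) (Y := X ⊗ dual X) l (coevElt X) =
      ∑ a, (α.toFun a a⁻¹ a : k) • tm (X := dual X) (Y := X ⊗ dual X) l (can X a) := by
    refine (TensorProduct.tmul_sum _ _ _).trans (Finset.sum_congr rfl fun a _ => ?_)
    exact tm_smul (X := dual X) (Y := X ⊗ dual X) _ _ _
  rw [h1, map_sum]
  simp only [map_smul]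
  have hl' : (X.p c⁻¹).dualMap l = l := hl
  rw [Finset.sum_eq_single c⁻¹]
  · have := assoc_ev' X c⁻¹ c⁻¹⁻¹ c (can X c⁻¹) hl
    rw [can_eq', endEquiv_can] at this
    refine (congrArg _ this).trans ?_
    refine (smul_smul _ _ _).trans ?_
    have h2 := congrArg (fun t : kˣ => (t : k)) (α.inv_self c)
    push_cast at h2
    rw [inv_inv, h2, one_smul]
    exact hl'
  · intro a _ hac
    have := assoc_ev' X a a⁻¹ c (can X a) hl
    rw [can_eq', endEquiv_can] at this
    refine (congrArg _ this).trans ?_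
    have h0 : l ∘ₗ X.p a = 0 := by
      refine LinearMap.ext fun x => ?_
      exact hl.dual_apply (X.deg_p a x) hac
    refine (congrArg _ (congrArg _ h0)).trans ?_
    rw [smul_zero]
    exact smul_zero _
  · simp

noncomputable instance exactPairing (X : ZObj α) : ExactPairing X (dual X) where
  coevaluation' := coev X
  evaluation' := ev X
  evaluation_coevaluation' := by
    rw [← cancel_mono (ρ_ X).hom]
    refine hom_ext₂ fun a b c x hc hx => ?_
    have h1 : Hom.lin (coev X ▷ X) (tm (X := 𝟙_ (ZObj α)) c x) =
        (show k from c) • tm (X := X ⊗ dual X) (coevElt X) x := smul_tm (X := X ⊗ dual X) _ _ _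
    simp only [Category.assoc, Iso.inv_hom_id, Category.comp_id]
    rw [comp_apply, h1, map_smul, zigzag X hx]
    exact (leftUnitor_hom_tm X c x).symm
  coevaluation_evaluation' := by
    rw [← cancel_mono (λ_ (dual X)).hom]
    refine hom_ext₂ fun a b l c hl hc => ?_
    have h1 : Hom.lin (dual X ◁ coev X) (tm (Y := 𝟙_ (ZObj α)) l c) =
        (show k from c) • tm (X := dual X) (Y := X ⊗ dual X) l (coevElt X) :=
      tm_smul (X := dual X) (Y := X ⊗ dual X) _ _ _
    simp only [Category.assoc, Iso.inv_hom_id, Category.comp_id]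
    rw [comp_apply, h1, map_smul, zigzag' X hl]
    exact (rightUnitor_hom_tm (dual X) c l).symm

instance (X : ZObj α) : PreservesColimitsOfSize.{0, 0} (tensorRight X) :=
  (tensorRightAdjunction X (dual X)).leftAdjoint_preservesColimits

instance (X : ZObj α) : PreservesColimitsOfSize.{0, 0} (tensorLeft X) :=
  preservesColimits_of_natIso (BraidedCategory.tensorLeftIsoTensorRight X).symm

end ZObj

namespace ZObj
variable {G k : Type u} [Group G] [Finite G] [Field k] {α : Cocycle3 G k}
open CategoryTheory MonoidalCategory Limits

/-- The subobject carried by a graded invariant subspace. -/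
@[reducible] noncomputable def sub (X : ZObj α) (S : Submodule k X.V)
    (hp : ∀ g v, v ∈ S → X.p g v ∈ S) (hρ : ∀ g v, v ∈ S → X.ρ g v ∈ S) : ZObj α where
  V := S
  p g := (X.p g).restrict (hp g)
  p_same g v := Subtype.ext (X.p_same g v)
  p_ne g h v hgh := Subtype.ext (X.p_ne g h v hgh)
  p_sum v := Subtype.ext (by
    refine Eq.trans ?_ (X.p_sum v)
    rw [AddSubmonoidClass.coe_finsetSum]
    rfl)
  ρ g := (X.ρ g).restrict (hρ g)
  ρ_one v := Subtype.ext (X.ρ_one v)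
  ρ_p f g v := Subtype.ext (X.ρ_p f g v)
  ρ_mul f g h v := Subtype.ext (X.ρ_mul f g h v)

/-- A commutative algebra in `Z(G,α)`, in terms of homogeneous elements. -/
structure CommAlg (α : Cocycle3 G k) where
  X : ZObj α
  mul : X.V →ₗ[k] X.V →ₗ[k] X.V
  one : X.V
  deg_one : X.Deg 1 one
  ρ_one : ∀ f, X.ρ f one = one
  deg_mul : ∀ a b x y, X.Deg a x → X.Deg b y → X.Deg (a * b) (mul x y)
  ρ_mul : ∀ f a b x y, X.Deg a x → X.Deg b y →
    X.ρ f (mul x y) = (α.ten f a b : k) • mul (X.ρ f x) (X.ρ f y)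
  mul_assoc : ∀ a b c x y z, X.Deg a x → X.Deg b y → X.Deg c z →
    mul x (mul y z) = (α.toFun a b c : k) • mul (mul x y) z
  one_mul : ∀ x, mul one x = x
  mul_one : ∀ x, mul x one = x
  mul_comm : ∀ a x y, X.Deg a x → mul x y = mul (X.ρ a y) x

namespace CommAlg

noncomputable def mulHom (B : CommAlg α) : B.X ⊗ B.X ⟶ B.X :=
  homMk₂ (TensorProduct.lift B.mul) (fun a b x y hx hy => B.deg_mul a b x y hx hy)
    (fun f a b x y hx hy => (B.ρ_mul f a b x y hx hy).symm)

theorem mulHom_tm (B : CommAlg α) (x y : B.X.V) : B.mulHom.lin (tm x y) = B.mul x y :=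
  TensorProduct.lift.tmul _ _

noncomputable def oneHom (B : CommAlg α) : 𝟙_ (ZObj α) ⟶ B.X where
  lin := LinearMap.toSpanSingleton k _ B.one
  p_comm g c := by
    change (if g = 1 then LinearMap.id else 0 : k →ₗ[k] k) c • B.one = B.X.p g (c • B.one)
    rw [map_smul, B.deg_one.p_eq]
    split_ifs <;> simp
  ρ_comm f c := by
    change c • B.one = B.X.ρ f (c • B.one)
    rw [map_smul, B.ρ_one]

theorem oneHom_apply (B : CommAlg α) (c : k) : Hom.lin B.oneHom c = c • B.one := rfl

noncomputable instance (B : CommAlg α) : MonObj B.X where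
  one := B.oneHom
  mul := B.mulHom
  one_mul := hom_ext₂ fun a b c x hc hx => by
    refine (B.mulHom_tm _ _).trans ((congrArg (fun t => B.mul t x) (B.oneHom_apply c)).trans ?_)
    rw [map_smul, LinearMap.smul_apply, B.one_mul]
    exact (leftUnitor_hom_tm _ c x).symm
  mul_one := hom_ext₂ fun a b x c hx hc => by
    refine (B.mulHom_tm _ _).trans ((congrArg (B.mul x) (B.oneHom_apply c)).trans ?_)
    rw [map_smul, B.mul_one]
    exact (rightUnitor_hom_tm _ c x).symm
  mul_assoc := hom_ext₃ fun a b c x y z hx hy hz => by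
    simp only [comp_apply, whiskerRight_tm, whiskerLeft_tm, mulHom_tm, associator_hom_tm hx hy hz,
      map_smul, B.mul_assoc a b c x y z hx hy hz, smul_smul]
    simp

/-- The corresponding monoid object. -/
noncomputable def toMon (B : CommAlg α) : Mon (ZObj α) where
  X := B.X

instance (B : CommAlg α) : IsCommMonObj B.toMon.X where
  mul_comm := hom_ext₂ fun a b x y hx hy => by
    change Hom.lin ((β_ B.X B.X).hom ≫ B.mulHom) (tm x y) = B.mulHom.lin (tm x y)
    have hx : B.X.Deg a x := hx
    have h1 : Hom.lin (β_ B.X B.X).hom (tm x y) = tm (B.X.ρ a y) x := braiding_tm hx y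
    refine (congrArg B.mulHom.lin h1).trans ?_
    exact (B.mulHom_tm _ _).trans ((B.mul_comm a x y hx).symm.trans (B.mulHom_tm _ _).symm)

end CommAlg
end ZObj

namespace Cocycle3
variable {G k : Type u} [Group G] [Field k]

/-- The restriction of a cocycle to a subgroup. -/
def restrict (α : Cocycle3 G k) (H : Subgroup G) : Cocycle3 H k where
  toFun f g h := α.toFun f g h
  isCocycle :=
    { cocycle := fun f g h l => α.isCocycle.cocycle f g h l
      one_left := fun g h => α.isCocycle.one_left g h
      one_mid := fun g h => α.isCocycle.one_mid g h
      one_right := fun g h => α.isCocycle.one_right g h }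

end Cocycle3

/-- The cochains `γ` and `ε` that determine the algebra `k[F,γ,ε]` in `Z(H,α)`: `γ` is normalized with
coboundary `α|_F`, `ε_mul` says that `h.e_f = ε_h(f) e_{hfh⁻¹}` is an `α`-projective action, `γ_ε`
that this action is compatible with the product `e_f e_g = γ(f,g) e_{fg}`, and `γ_comm` that the
product is commutative in the braided sense. -/
structure EtaleData {H k : Type u} [Group H] [Field k] (α : Cocycle3 H k) (F : Subgroup H)
    [F.Normal] where
  γ : F → F → kˣ
  ε : H → F → kˣ
  γ_one_left : ∀ f, γ 1 f = 1
  γ_one_right : ∀ f, γ f 1 = 1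
  coboundary : ∀ f g h, γ g h * γ f (g * h) = α.toFun f g h * γ f g * γ (f * g) h
  ε_mul : ∀ g h f, ε (g * h) f = ε g (MulAut.conjNormal h f) * ε h f * α.act g h f
  γ_ε : ∀ h f g, γ f g * ε h (f * g) =
    α.ten h f g * ε h f * ε h g * γ (MulAut.conjNormal h f) (MulAut.conjNormal h g)
  γ_comm : ∀ f g : F, γ f g = ε f g * γ (MulAut.conjNormal (f : H) g) f

namespace EtaleData
variable {H k : Type u} [Group H] [Field k] {α : Cocycle3 H k} {F : Subgroup H} [F.Normal]

theorem ε_one_left (D : EtaleData α F) (f : F) : D.ε 1 f = 1 := by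
  have := D.ε_mul 1 1 f
  simpa [α.act_one_left] using this

theorem ε_one_right (D : EtaleData α F) (h : H) : D.ε h 1 = 1 := by
  have := D.γ_ε h 1 1
  simpa [D.γ_one_left, α.ten_one_mid] using this

variable [Finite H]
open ZObj

/-- The projection onto degree `h`, where `e_f` has degree `f`. -/
noncomputable def eP (F : Subgroup H) (h : H) : (F →₀ k) →ₗ[k] (F →₀ k) :=
  Finsupp.lsum k fun f => if (f : H) = h then Finsupp.lsingle f else 0

theorem eP_single (h : H) (f : F) (c : k) :
    eP F h (Finsupp.single f c) = if (f : H) = h then Finsupp.single f c else 0 := by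
  by_cases hf : (f : H) = h <;> simp [eP, hf]

/-- `h.e_f = ε_h(f) e_{hfh⁻¹}`. -/
noncomputable def eρ (D : EtaleData α F) (h : H) : (F →₀ k) →ₗ[k] (F →₀ k) :=
  Finsupp.lsum k fun f => (D.ε h f : k) • Finsupp.lsingle (MulAut.conjNormal h f)

theorem eρ_single (D : EtaleData α F) (h : H) (f : F) (c : k) :
    D.eρ h (Finsupp.single f c) =
      (D.ε h f : k) • Finsupp.single (MulAut.conjNormal h f) c := by
  simp [eρ]

/-- `e_f e_g = γ(f,g) e_{fg}`. -/
noncomputable def eMul (D : EtaleData α F) : (F →₀ k) →ₗ[k] (F →₀ k) →ₗ[k] (F →₀ k) :=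
  Finsupp.lsum k fun f => LinearMap.toSpanSingleton k _
    (Finsupp.lsum k fun g => (D.γ f g : k) • Finsupp.lsingle (f * g))

theorem eMul_single (D : EtaleData α F) (f g : F) (c d : k) :
    D.eMul (Finsupp.single f c) (Finsupp.single g d) =
      ((D.γ f g : k) * c) • Finsupp.single (f * g) d := by
  rw [eMul, Finsupp.lsum_single, LinearMap.toSpanSingleton_apply, LinearMap.smul_apply,
    Finsupp.lsum_single, LinearMap.smul_apply, smul_smul, Finsupp.lsingle_apply, mul_comm]

/-- The `H`-graded space with basis `e_f`, `f ∈ F`, and `h.e_f = ε_h(f) e_{hfh⁻¹}`. -/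
@[reducible] noncomputable def algObj (D : EtaleData α F) : ZObj α where
  V := F →₀ k
  p := eP F
  p_same h v := by
    rw [← LinearMap.comp_apply]
    congr 1
    refine Finsupp.lhom_ext fun f c => ?_
    by_cases hf : (f : H) = h <;> simp [eP_single, hf]
  p_ne g h v hgh := by
    rw [← LinearMap.comp_apply]
    refine (LinearMap.congr_fun ?_ v : _ = (0 : (F →₀ k) →ₗ[k] (F →₀ k)) v)
    refine Finsupp.lhom_ext fun f c => ?_
    by_cases hf : (f : H) = h
    · simp [eP_single, hf, Ne.symm hgh]
    · simp [eP_single, hf]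
  p_sum v := by
    rw [← LinearMap.sum_apply]
    refine (LinearMap.congr_fun ?_ v : _ = (LinearMap.id : (F →₀ k) →ₗ[k] (F →₀ k)) v)
    refine Finsupp.lhom_ext fun f c => ?_
    rw [LinearMap.sum_apply, Finset.sum_eq_single (f : H)]
    · simp [eP_single]
    · intro b _ hb
      simp [eP_single, Ne.symm hb]
    · simp
  ρ := D.eρ
  ρ_one v := by
    refine (LinearMap.congr_fun ?_ v : _ = (LinearMap.id : (F →₀ k) →ₗ[k] (F →₀ k)) v)
    refine Finsupp.lhom_ext fun f c => ?_
    simp [eρ_single, D.ε_one_left]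
  ρ_p g h v := by
    rw [← LinearMap.comp_apply, ← LinearMap.comp_apply]
    congr 1
    refine Finsupp.lhom_ext fun f c => ?_
    rw [LinearMap.comp_apply, LinearMap.comp_apply, eP_single, eρ_single, map_smul, eP_single]
    by_cases hf : (f : H) = h
    · rw [if_pos hf, if_pos (by rw [MulAut.conjNormal_apply, hf]), eρ_single]
    · rw [if_neg hf, if_neg (fun e => hf (by simpa [MulAut.conjNormal_apply] using e)), map_zero,
        smul_zero]
  ρ_mul g h l v := by
    rw [← LinearMap.comp_apply, ← LinearMap.comp_apply, ← LinearMap.comp_apply,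
      ← LinearMap.smul_apply]
    congr 1
    refine Finsupp.lhom_ext fun f c => ?_
    simp only [LinearMap.comp_apply, LinearMap.smul_apply, eP_single]
    by_cases hf : (f : H) = l
    · subst hf
      rw [if_pos rfl, eρ_single, eρ_single, map_smul, eρ_single, smul_smul, smul_smul, map_mul,
        MulAut.mul_apply, D.ε_mul]
      congr 1
      push_cast
      ring
    · simp [hf]

theorem deg_algObj (D : EtaleData α F) {a : H} {v : F →₀ k} (hv : D.algObj.Deg a v) :
    v = 0 ∨ ∃ (f : F) (c : k), (f : H) = a ∧ v = Finsupp.single f c := by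
  by_cases ha : a ∈ F
  · right
    refine ⟨⟨a, ha⟩, v ⟨a, ha⟩, rfl, ?_⟩
    have h1 : eP F a = Finsupp.lsingle ⟨a, ha⟩ ∘ₗ Finsupp.lapply (R := k) (⟨a, ha⟩ : F) := by
      refine Finsupp.lhom_ext fun f c => ?_
      rw [eP_single]
      by_cases hf : f = ⟨a, ha⟩
      · subst hf; simp
      · have : ¬ (f : H) = a := fun e => hf (Subtype.ext e)
        simp [this, hf]
    have h2 : eP F a v = v := hv
    rw [h1] at h2
    exact h2.symm
  · left
    have h1 : (eP F a : (F →₀ k) →ₗ[k] (F →₀ k)) = 0 := by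
      refine Finsupp.lhom_ext fun f c => ?_
      rw [eP_single, if_neg (fun e : (f : H) = a => ha (e ▸ f.2))]
      rfl
    have h2 : eP F a v = v := hv
    rw [h1] at h2
    exact h2.symm

theorem deg_single (D : EtaleData α F) (f : F) (c : k) :
    D.algObj.Deg (f : H) (Finsupp.single f c) := by
  refine (eP_single _ _ _).trans (if_pos rfl)

/-- The commutative algebra `k[F,γ,ε]` in `Z(H,α)`. -/
noncomputable def alg (D : EtaleData α F) : CommAlg α where
  X := D.algObj
  mul := D.eMul
  one := Finsupp.single 1 1
  deg_one := D.deg_single 1 1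
  ρ_one f := by
    refine (D.eρ_single f 1 1).trans ?_
    rw [D.ε_one_right, map_one, Units.val_one, one_smul]
  deg_mul a b x y hx hy := by
    obtain rfl | ⟨f, c, rfl, rfl⟩ := D.deg_algObj hx
    · rw [map_zero]; exact map_zero _
    obtain rfl | ⟨g, d, rfl, rfl⟩ := D.deg_algObj hy
    · rw [map_zero]; exact map_zero _
    rw [eMul_single]
    exact (D.deg_single (f * g) d).smul _
  ρ_mul h a b x y hx hy := by
    obtain rfl | ⟨f, c, rfl, rfl⟩ := D.deg_algObj hx
    · simp
    obtain rfl | ⟨g, d, rfl, rfl⟩ := D.deg_algObj hy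
    · simp
    rw [eMul_single, map_smul, eρ_single, eρ_single, eρ_single, map_smul, map_smul,
      LinearMap.smul_apply, eMul_single]
    simp only [smul_smul, map_mul]
    congr 1
    have := congrArg (fun t : kˣ => (t : k)) (D.γ_ε h f g)
    push_cast at this
    linear_combination c * this
  mul_assoc a b c x y z hx hy hz := by
    obtain rfl | ⟨f, r, rfl, rfl⟩ := D.deg_algObj hx
    · simp
    obtain rfl | ⟨g, s, rfl, rfl⟩ := D.deg_algObj hy
    · simp
    obtain rfl | ⟨h, t, rfl, rfl⟩ := D.deg_algObj hz
    · simp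
    rw [eMul_single, map_smul, eMul_single, eMul_single, map_smul, LinearMap.smul_apply,
      eMul_single]
    simp only [smul_smul, mul_assoc f g h]
    congr 1
    have := congrArg (fun t : kˣ => (t : k)) (D.coboundary f g h)
    push_cast at this
    linear_combination r * s * this
  one_mul x := by
    refine (LinearMap.congr_fun ?_ x : _ = (LinearMap.id : (F →₀ k) →ₗ[k] (F →₀ k)) x)
    refine Finsupp.lhom_ext fun f c => ?_
    simp [eMul_single, D.γ_one_left]
  mul_one x := by
    refine (LinearMap.congr_fun (f := D.eMul.flip (Finsupp.single 1 1)) ?_ x :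
      _ = (LinearMap.id : (F →₀ k) →ₗ[k] (F →₀ k)) x)
    refine Finsupp.lhom_ext fun f c => ?_
    simp [eMul_single, D.γ_one_right]
  mul_comm a x y hx := by
    obtain rfl | ⟨f, c, rfl, rfl⟩ := D.deg_algObj hx
    · simp
    refine (LinearMap.congr_fun (f := D.eMul (Finsupp.single f c))
      (g := D.eMul.flip (Finsupp.single f c) ∘ₗ D.eρ f) ?_ y)
    refine Finsupp.lhom_ext fun g d => ?_
    rw [LinearMap.comp_apply, LinearMap.flip_apply, eρ_single, eMul_single, map_smul,
      LinearMap.smul_apply, eMul_single, smul_smul,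
      show MulAut.conjNormal (f : H) g * f = f * g from
        Subtype.ext (by simp [MulAut.conjNormal_apply]), D.γ_comm f g]
    simp [mul_comm, mul_left_comm]

end EtaleData

namespace ZObj
variable {G k : Type u} [Group G] [Finite G] [Field k] {α : Cocycle3 G k} {H : Subgroup G}

section transfer
variable (V : ZObj (α.restrict H))

/-- The projection onto `V_g`, where `V_g = 0` for `g ∉ H`. -/
noncomputable def pG (g : G) : V.V →ₗ[k] V.V := if h : g ∈ H then V.p ⟨g, h⟩ else 0

theorem pG_same (g : G) (v : V.V) : V.pG g (V.pG g v) = V.pG g v := by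
  unfold pG
  split_ifs
  · exact V.p_same _ v
  · rfl

theorem pG_ne (f g : G) (v : V.V) (hfg : f ≠ g) : V.pG f (V.pG g v) = 0 := by
  unfold pG
  split_ifs
  · exact V.p_ne _ _ v fun e => hfg (congrArg Subtype.val e)
  · exact map_zero _
  · rfl
  · rfl

theorem pG_sum (v : V.V) : ∑ g, V.pG g v = v := by
  have h1 : ∑ g ∈ @Finset.univ H (Fintype.ofFinite H), V.pG (g : G) v = ∑ g, V.pG g v := by
    refine Finset.sum_bij_ne_zero (fun g _ _ => (g : G)) (fun _ _ _ => Finset.mem_univ _)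
      (fun _ _ _ _ _ _ e => Subtype.ext e) (fun g _ hg => ?_) (fun _ _ _ => rfl)
    by_cases h : g ∈ H
    · exact ⟨⟨g, h⟩, @Finset.mem_univ _ (Fintype.ofFinite H) _, hg, rfl⟩
    · exact absurd (by simp [pG, h]) hg
  rw [← h1]
  refine Eq.trans (Finset.sum_congr rfl fun g _ => ?_) (V.p_sum v)
  simp [pG]

theorem pG_coe (h : H) (v : V.V) : V.pG (h : G) v = V.p h v := by
  simp [pG]

/-- The component of degree `f` of a map `a : G → V`: the map `a` has degree `f` if
`a x` has degree `x⁻¹ f x` for all `x`. -/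
noncomputable def mapP (f : G) : (G → V.V) →ₗ[k] (G → V.V) :=
  LinearMap.pi fun x => V.pG (x⁻¹ * f * x) ∘ₗ LinearMap.proj x

theorem mapP_apply (f : G) (a : G → V.V) (x : G) :
    V.mapP f a x = V.pG (x⁻¹ * f * x) (a x) := rfl

/-- `(g.a)(x) = α(x⁻¹,g|f)⁻¹ a(g⁻¹x)` for `a` of degree `f`. -/
noncomputable def mapρ (g : G) : (G → V.V) →ₗ[k] (G → V.V) :=
  LinearMap.pi fun x => ∑ f, (((α.act x⁻¹ g f)⁻¹ : kˣ) : k) •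
    (LinearMap.proj (g⁻¹ * x) ∘ₗ V.mapP f)

theorem mapP_same (f : G) (a : G → V.V) : V.mapP f (V.mapP f a) = V.mapP f a :=
  funext fun _ => V.pG_same _ _

theorem mapP_ne (f g : G) (a : G → V.V) (h : f ≠ g) : V.mapP f (V.mapP g a) = 0 :=
  funext fun x => V.pG_ne _ _ _ fun e => h (by simpa using e)

theorem mapP_sum (a : G → V.V) : ∑ f, V.mapP f a = a := by
  funext x
  rw [Finset.sum_apply]
  refine Eq.trans ?_ (V.pG_sum (a x))
  refine Fintype.sum_equiv (MulAut.conj x⁻¹).toEquiv _ _ fun f => ?_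
  simp [mapP_apply]

theorem mapρ_apply (g f : G) (a : G → V.V) (ha : V.mapP f a = a) (x : G) :
    V.mapρ g a x = (((α.act x⁻¹ g f)⁻¹ : kˣ) : k) • a (g⁻¹ * x) := by
  simp only [mapρ, LinearMap.pi_apply, LinearMap.sum_apply, LinearMap.smul_apply,
    LinearMap.comp_apply, LinearMap.proj_apply]
  rw [Finset.sum_eq_single f, ha]
  · intro b _ hb
    rw [← ha, V.mapP_ne _ _ _ hb, Pi.zero_apply, smul_zero]
  · simp

theorem mapP_mapρ (g f : G) (a : G → V.V) (ha : V.mapP f a = a) :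
    V.mapP (g * f * g⁻¹) (V.mapρ g a) = V.mapρ g a := by
  funext x
  rw [mapP_apply, V.mapρ_apply g f a ha, map_smul]
  congr 1
  have := congrFun ha (g⁻¹ * x)
  rw [mapP_apply] at this
  conv_rhs => rw [← this]
  congr 2
  group

theorem map_ext {M : Type*} [AddCommMonoid M] [Module k M] (φ ψ : (G → V.V) →ₗ[k] M)
    (h : ∀ f a, V.mapP f a = a → φ a = ψ a) (a : G → V.V) : φ a = ψ a := by
  rw [← V.mapP_sum a, map_sum, map_sum]
  exact Finset.sum_congr rfl fun f _ => h f _ (V.mapP_same f a)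

/-- The object `Map(G,V)` of `Z(G,α)`. -/
@[reducible] noncomputable def mapObj : ZObj α where
  V := G → V.V
  p := V.mapP
  p_same := V.mapP_same
  p_ne := V.mapP_ne
  p_sum := V.mapP_sum
  ρ := V.mapρ
  ρ_one := V.map_ext _ LinearMap.id fun f a ha => by
    funext x
    rw [V.mapρ_apply 1 f a ha, α.act_one_mid]
    simp
  ρ_p f g := V.map_ext (V.mapρ f ∘ₗ V.mapP g) (V.mapP (f * g * f⁻¹) ∘ₗ V.mapρ f)
    fun h a ha => by
      rw [LinearMap.comp_apply, LinearMap.comp_apply]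
      by_cases hg : g = h
      · rw [hg, ha, V.mapP_mapρ f h a ha]
      · rw [← ha, V.mapP_ne g h a hg, map_zero, ha, ← V.mapP_mapρ f h a ha, V.mapP_ne]
        exact fun e => hg (by simpa using e)
  ρ_mul f g h a := by
    have hb := V.mapP_same h a
    generalize V.mapP h a = b at hb
    funext x
    rw [Pi.smul_apply, V.mapρ_apply _ _ _ (V.mapP_mapρ g h b hb), V.mapρ_apply _ _ _ hb,
      V.mapρ_apply _ _ _ hb, smul_smul, smul_smul]
    have h1 := congrArg (fun t : kˣ => (t : k)) (α.act_cocycle x⁻¹ f g h)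
    rw [show (f * g)⁻¹ * x = g⁻¹ * (f⁻¹ * x) by group]
    congr 1
    rw [show (f⁻¹ * x)⁻¹ = x⁻¹ * f by group]
    push_cast at h1 ⊢
    field_simp
    linear_combination -h1

/-- The defining condition of the transfer:
`a(xh) = α(h⁻¹,x⁻¹|f) h⁻¹.a(x)` on the component of degree `f`. -/
noncomputable def transferSub : Submodule k (G → V.V) where
  carrier := {a | ∀ (f x : G) (h : H),
    V.mapP f a (x * h) = (α.act (h : G)⁻¹ x⁻¹ f : k) • V.ρ h⁻¹ (V.mapP f a x)}
  add_mem' ha hb f x h := by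
    simp only [map_add, Pi.add_apply, ha f x h, hb f x h, smul_add]
  zero_mem' f x h := by simp
  smul_mem' c a ha f x h := by
    simp only [map_smul, Pi.smul_apply, ha f x h]
    rw [smul_comm]

theorem mem_transferSub {a : G → V.V} {f : G} (ha : V.mapP f a = a) :
    a ∈ V.transferSub ↔ ∀ (x : G) (h : H),
      a (x * h) = (α.act (h : G)⁻¹ x⁻¹ f : k) • V.ρ h⁻¹ (a x) := by
  constructor
  · intro h x y
    have := h f x y
    rwa [ha] at this
  · intro h g x y
    by_cases hg : g = f
    · rw [hg, ha]; exact h x y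
    · rw [← ha, V.mapP_ne g f a hg]; simp

theorem mapP_mem (f : G) {a : G → V.V} (ha : a ∈ V.transferSub) : V.mapP f a ∈ V.transferSub :=
  (V.mem_transferSub (V.mapP_same f a)).2 fun x h => ha f x h

theorem mapρ_mem (g : G) {a : G → V.V} (ha : a ∈ V.transferSub) : V.mapρ g a ∈ V.transferSub := by
  rw [← V.mapP_sum a, map_sum]
  refine Submodule.sum_mem _ fun f _ => ?_
  have hb := V.mapP_same f a
  have hm := V.mapP_mem f ha
  generalize V.mapP f a = b at hb hm
  rw [V.mem_transferSub (V.mapP_mapρ g f b hb)]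
  intro x h
  rw [V.mapρ_apply _ _ _ hb, V.mapρ_apply _ _ _ hb, ← mul_assoc,
    (V.mem_transferSub hb).1 hm, map_smul, smul_smul, smul_smul]
  congr 1
  have h1 := congrArg (fun t : kˣ => (t : k)) (α.act_cocycle (h : G)⁻¹ x⁻¹ g f)
  rw [show (g⁻¹ * x)⁻¹ = x⁻¹ * g by group, mul_inv_rev]
  push_cast at h1 ⊢
  field_simp
  linear_combination h1

/-- The transfer `E(V)`, an object of `Z(G,α)`. -/
@[reducible] noncomputable def transfer : ZObj α :=
  V.mapObj.sub V.transferSub (fun g _ h => V.mapP_mem g h) (fun g _ h => V.mapρ_mem g h)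

theorem deg_transfer {f : G} {a : V.transfer.V} (ha : V.transfer.Deg f a) :
    V.mapP f a.1 = a.1 := congrArg Subtype.val ha

theorem deg_map_apply {f : G} {a : G → V.V} (ha : V.mapP f a = a) (x : G) :
    a x = 0 ∨ ∃ h : x⁻¹ * f * x ∈ H, V.Deg ⟨_, h⟩ (a x) := by
  have := congrFun ha x
  rw [mapP_apply] at this
  by_cases h : x⁻¹ * f * x ∈ H
  · exact Or.inr ⟨h, (V.pG_coe ⟨_, h⟩ (a x)).symm.trans this⟩
  · left
    rw [← this]
    simp [pG, h]

end transfer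

namespace CommAlg
variable (B : CommAlg (α.restrict H))

/-- `(ab)(x) = α(x⁻¹|f,g) a(x) b(x)` for `a` of degree `f` and `b` of degree `g`. -/
noncomputable def mapMul : (G → B.X.V) →ₗ[k] (G → B.X.V) →ₗ[k] (G → B.X.V) :=
  ∑ f, ∑ g, LinearMap.mk₂ k
    (fun a b x => (α.ten x⁻¹ f g : k) • B.mul (B.X.mapP f a x) (B.X.mapP g b x))
    (fun a a' b => funext fun x => by simp)
    (fun c a b => funext fun x => by simp [smul_comm c])
    (fun a b b' => funext fun x => by simp)
    (fun c a b => funext fun x => by simp [smul_comm c])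

theorem mapMul_apply {f g : G} {a b : G → B.X.V} (ha : B.X.mapP f a = a) (hb : B.X.mapP g b = b)
    (x : G) : B.mapMul a b x = (α.ten x⁻¹ f g : k) • B.mul (a x) (b x) := by
  simp only [mapMul, LinearMap.sum_apply, Finset.sum_apply, LinearMap.mk₂_apply]
  rw [Finset.sum_eq_single f, Finset.sum_eq_single g, ha, hb]
  · intro c _ hc
    rw [← hb, B.X.mapP_ne _ _ _ hc]; simp
  · simp
  · intro c _ hc
    rw [← ha, B.X.mapP_ne _ _ _ hc]; simp
  · simp

theorem mapP_mapMul {f g : G} {a b : G → B.X.V} (ha : B.X.mapP f a = a) (hb : B.X.mapP g b = b) :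
    B.X.mapP (f * g) (B.mapMul a b) = B.mapMul a b := by
  funext x
  rw [mapP_apply, B.mapMul_apply ha hb, map_smul]
  congr 1
  obtain h0 | ⟨h, ha'⟩ := B.X.deg_map_apply ha x
  · rw [h0]; simp
  obtain h0 | ⟨h', hb'⟩ := B.X.deg_map_apply hb x
  · rw [h0]; simp
  have h1 := B.deg_mul _ _ _ _ ha' hb'
  refine Eq.trans ?_ h1
  rw [← pG_coe]
  congr 1
  simp only [Subgroup.coe_mul]
  congr 1
  group

theorem mapMul_mem {a b : G → B.X.V} (ha : a ∈ B.X.transferSub) (hb : b ∈ B.X.transferSub) :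
    B.mapMul a b ∈ B.X.transferSub := by
  rw [← B.X.mapP_sum a, ← B.X.mapP_sum b]
  simp only [map_sum, LinearMap.sum_apply]
  refine Submodule.sum_mem _ fun f _ => Submodule.sum_mem _ fun g _ => ?_
  have ha' := B.X.mapP_same g a
  have hma := B.X.mapP_mem g ha
  have hb' := B.X.mapP_same f b
  have hmb := B.X.mapP_mem f hb
  generalize B.X.mapP g a = a at ha' hma
  generalize B.X.mapP f b = b at hb' hmb
  rw [B.X.mem_transferSub (B.mapP_mapMul ha' hb')]
  intro x h
  rw [B.mapMul_apply ha' hb', B.mapMul_apply ha' hb', (B.X.mem_transferSub ha').1 hma,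
    (B.X.mem_transferSub hb').1 hmb]
  obtain h0 | ⟨h1, ha''⟩ := B.X.deg_map_apply ha' x
  · rw [h0]; simp
  obtain h0 | ⟨h2, hb''⟩ := B.X.deg_map_apply hb' x
  · rw [h0]; simp
  rw [map_smul (B.X.ρ h⁻¹), B.ρ_mul _ _ _ _ _ ha'' hb'']
  simp only [map_smul, LinearMap.smul_apply, smul_smul]
  congr 1
  have h3 := congrArg (fun t : kˣ => (t : k)) (α.ten_act (h : G)⁻¹ x⁻¹ g f)
  have h4 : ((α.restrict H).ten h⁻¹ ⟨_, h1⟩ ⟨_, h2⟩ : k) =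
      α.ten (h : G)⁻¹ (x⁻¹ * g * x⁻¹⁻¹) (x⁻¹ * f * x⁻¹⁻¹) := by
    rw [inv_inv]; rfl
  rw [h4, mul_inv_rev]
  push_cast at h3
  linear_combination h3

theorem mapP_one : B.X.mapP 1 (fun _ => B.one) = fun _ => B.one := by
  funext x
  rw [mapP_apply, _root_.mul_one, inv_mul_cancel]
  exact (B.X.pG_coe 1 B.one).trans B.deg_one

theorem one_mem : (fun _ => B.one) ∈ B.X.transferSub := by
  rw [B.X.mem_transferSub B.mapP_one]
  intro x h
  rw [B.ρ_one, α.act_one_right, Units.val_one, one_smul]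

theorem mapρ_mapMul (h : G) {f g : G} {a b : G → B.X.V} (ha : B.X.mapP f a = a)
    (hb : B.X.mapP g b = b) :
    B.X.mapρ h (B.mapMul a b) = (α.ten h f g : k) • B.mapMul (B.X.mapρ h a) (B.X.mapρ h b) := by
  funext x
  rw [B.X.mapρ_apply _ _ _ (B.mapP_mapMul ha hb), Pi.smul_apply,
    B.mapMul_apply (B.X.mapP_mapρ h f a ha) (B.X.mapP_mapρ h g b hb),
    B.mapMul_apply ha hb, B.X.mapρ_apply _ _ _ ha, B.X.mapρ_apply _ _ _ hb]
  simp only [map_smul, LinearMap.smul_apply, smul_smul]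
  congr 1
  have h1 := congrArg (fun t : kˣ => (t : k)) (α.ten_act x⁻¹ h f g)
  rw [show (h⁻¹ * x)⁻¹ = x⁻¹ * h by group]
  push_cast at h1 ⊢
  field_simp
  linear_combination h1

theorem mapMul_assoc {f g h : G} {a b c : G → B.X.V} (ha : B.X.mapP f a = a)
    (hb : B.X.mapP g b = b) (hc : B.X.mapP h c = c) :
    B.mapMul a (B.mapMul b c) = (α.toFun f g h : k) • B.mapMul (B.mapMul a b) c := by
  funext x
  rw [Pi.smul_apply, B.mapMul_apply ha (B.mapP_mapMul hb hc),
    B.mapMul_apply (B.mapP_mapMul ha hb) hc, B.mapMul_apply hb hc, B.mapMul_apply ha hb]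
  obtain h0 | ⟨h1, ha'⟩ := B.X.deg_map_apply ha x
  · rw [h0]; simp
  obtain h0 | ⟨h2, hb'⟩ := B.X.deg_map_apply hb x
  · rw [h0]; simp
  obtain h0 | ⟨h3, hc'⟩ := B.X.deg_map_apply hc x
  · rw [h0]; simp
  simp only [map_smul, LinearMap.smul_apply, smul_smul, B.mul_assoc _ _ _ _ _ _ ha' hb' hc']
  congr 1
  have h4 := congrArg (fun t : kˣ => (t : k)) (α.ten_assoc x⁻¹ f g h)
  have h5 : ((α.restrict H).toFun ⟨_, h1⟩ ⟨_, h2⟩ ⟨_, h3⟩ : k) =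
      α.toFun (x⁻¹ * f * x⁻¹⁻¹) (x⁻¹ * g * x⁻¹⁻¹) (x⁻¹ * h * x⁻¹⁻¹) := by
    rw [inv_inv]; rfl
  rw [h5]
  push_cast at h4
  linear_combination -h4

theorem mapMul_comm {f g : G} {a b : G → B.X.V} (ha : B.X.mapP f a = a)
    (hb : B.X.mapP g b = b) (hm : b ∈ B.X.transferSub) :
    B.mapMul a b = B.mapMul (B.X.mapρ f b) a := by
  funext x
  rw [B.mapMul_apply ha hb, B.mapMul_apply (B.X.mapP_mapρ f g b hb) ha]
  obtain h0 | ⟨h1, ha'⟩ := B.X.deg_map_apply ha x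
  · rw [h0]; simp
  have h2 := (B.X.mem_transferSub hb).1 hm x ⟨_, h1⟩⁻¹
  have h3 : x * ((⟨_, h1⟩⁻¹ : H) : G) = f⁻¹ * x := by
    rw [Subgroup.coe_inv]
    group
  have h4 : (((⟨_, h1⟩⁻¹ : H) : G))⁻¹ = x⁻¹ * f * x⁻¹⁻¹ := by
    rw [Subgroup.coe_inv, inv_inv, inv_inv]
  rw [h3, h4] at h2
  simp only [inv_inv] at h2
  rw [B.X.mapρ_apply _ _ _ hb, h2, B.mul_comm _ _ _ ha']
  simp only [map_smul, LinearMap.smul_apply, smul_smul]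
  congr 1
  have h5 := congrArg (fun t : kˣ => (t : k)) (α.ten_act_swap x⁻¹ f g)
  rw [inv_inv] at h5
  push_cast at h5 ⊢
  field_simp
  linear_combination h5

/-- The transfer of a commutative algebra in `Z(H,α|_H)`, a commutative algebra in `Z(G,α)`. -/
noncomputable def transfer : CommAlg α where
  X := B.X.transfer
  mul := LinearMap.mk₂ k (fun a b => ⟨B.mapMul a.1 b.1, B.mapMul_mem a.2 b.2⟩)
    (fun a a' b => Subtype.ext (by simp)) (fun c a b => Subtype.ext (by simp))
    (fun a b b' => Subtype.ext (by simp)) (fun c a b => Subtype.ext (by simp))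
  one := ⟨fun _ => B.one, B.one_mem⟩
  deg_one := Subtype.ext B.mapP_one
  ρ_one f := Subtype.ext (funext fun x => by
    refine (B.X.mapρ_apply f 1 _ B.mapP_one x).trans ?_
    rw [α.act_one_right]
    simp)
  deg_mul f g a b ha hb := Subtype.ext
    (B.mapP_mapMul (B.X.deg_transfer ha) (B.X.deg_transfer hb))
  ρ_mul h f g a b ha hb := Subtype.ext
    (B.mapρ_mapMul h (B.X.deg_transfer ha) (B.X.deg_transfer hb))
  mul_assoc f g h a b c ha hb hc := Subtype.ext
    (B.mapMul_assoc (B.X.deg_transfer ha) (B.X.deg_transfer hb) (B.X.deg_transfer hc))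
  one_mul a := Subtype.ext (B.X.map_ext (B.mapMul fun _ => B.one) LinearMap.id (fun f a ha => by
    funext x
    rw [B.mapMul_apply B.mapP_one ha, α.ten_one_mid, B.one_mul]
    simp) a.1)
  mul_one a := Subtype.ext (B.X.map_ext (B.mapMul.flip fun _ => B.one) LinearMap.id
    (fun f a ha => by
      funext x
      rw [LinearMap.flip_apply, B.mapMul_apply ha B.mapP_one, α.ten_one_right, B.mul_one]
      simp) a.1)
  mul_comm f a b ha := Subtype.ext (by
    have ha' := B.X.deg_transfer ha
    change B.mapMul a.1 b.1 = B.mapMul (B.X.mapρ f b.1) a.1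
    rw [← B.X.mapP_sum b.1]
    simp only [map_sum, LinearMap.sum_apply]
    exact Finset.sum_congr rfl fun g _ =>
      B.mapMul_comm ha' (B.X.mapP_same g b.1) (B.X.mapP_mem g b.2))

end CommAlg
end ZObj

namespace EtaleData
variable {H k : Type u} [Group H] [Field k] {α : Cocycle3 H k} {F : Subgroup H} [F.Normal]

/-- `τ(x,y) = s(y)⁻¹ s(x)⁻¹ s(xy) ∈ F` for a section `s` of `H → H/F`. -/
def tau (s : H ⧸ F → H) (hs : ∀ x, (s x : H ⧸ F) = x) (x y : H ⧸ F) : F :=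
  ⟨(s y)⁻¹ * (s x)⁻¹ * s (x * y), by
    rw [← QuotientGroup.eq_one_iff]
    change ((s y : H ⧸ F))⁻¹ * ((s x : H ⧸ F))⁻¹ * (s (x * y) : H ⧸ F) = 1
    rw [hs, hs, hs, ← mul_inv_rev, inv_mul_cancel]⟩

/-- The 3-cochain `ᾱ` on `H/F` obtained from `α`, `γ`, `ε` and a section `s` of `H → H/F`. -/
def reduced (D : EtaleData α F) (s : H ⧸ F → H) (hs : ∀ x, (s x : H ⧸ F) = x)
    (x y z : H ⧸ F) : kˣ :=
  let t : F := tau s hs x y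
  let h : H := (s (x * y))⁻¹ * s (x * y * z)
  let t' : F := MulAut.conjNormal h⁻¹ t
  let r : F := tau s hs (x * y) z
  let p : F := tau s hs y z
  let q : F := tau s hs x (y * z)
  α.toFun (s x) (s y) ((s y)⁻¹ * (s x)⁻¹ * s (x * y * z)) *
    D.γ p q * (D.γ r t')⁻¹ * D.ε h t' *
    (α.toFun (s y) ((s y)⁻¹ * s (y * z)) q)⁻¹ * (α.toFun (s z) p q)⁻¹ *
    (α.toFun (s x) (s y) t)⁻¹ * α.toFun (s x * s y) t h * α.toFun (s z) r t'

end EtaleData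

end

section
open CategoryTheory MonoidalCategory

/-- The étale algebra `A(H,F,γ,ε) = E(k[F,γ,ε])` in `Z(G,α)`. -/
noncomputable def etaleAlg {G k : Type u} [Group G] [Finite G] [Field k] {α : Cocycle3 G k}
    {H : Subgroup G} {F : Subgroup H} [F.Normal] (D : EtaleData (α.restrict H) F) :
    Mon (ZObj α) :=
  D.alg.transfer.toMon

instance {G k : Type u} [Group G] [Finite G] [Field k] {α : Cocycle3 G k}
    {H : Subgroup G} {F : Subgroup H} [F.Normal] (D : EtaleData (α.restrict H) F) :
    IsCommMonObj (etaleAlg D).X :=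
  inferInstanceAs (IsCommMonObj D.alg.transfer.toMon.X)

/-- `θ` is a ribbon structure: it is balanced, every object has a dual, and `θ` is compatible
with duality. -/
structure IsRibbon {C : Type w} [Category.{v} C] [MonoidalCategory C] [BraidedCategory C]
    (θ : 𝟭 C ≅ 𝟭 C) : Prop where
  balanced : ∀ X Y : C, θ.hom.app (X ⊗ Y) =
    (θ.hom.app X ⊗ₘ θ.hom.app Y) ≫ (β_ X Y).hom ≫ (β_ Y X).hom
  dual : ∀ X : C, ∃ (Y : C) (_ : ExactPairing X Y),
    η_ X Y ≫ θ.hom.app X ▷ Y = η_ X Y ≫ X ◁ θ.hom.app Y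

end

open CategoryTheory

/-! The equivalence is built from `Z(H/F,ᾱ)` to local modules, by composing two lax braided
functors, and is inverted at the end.

Cochains. There is a 2-cochain η on all of H, equal to γ on F, with α(u,v,w) η(u,v) η(uv,w) =
ᾱ(x,y,z) η(v,w) η(u,vw) for u, v, w in the cosets x, y, z, and with ε_h(f) = η(h,f)/η(hfh⁻¹,h). It
consists of the structure constants of a product on symbols [u], u ∈ H. The symbols form a free
right module over k[F,γ,ε] with [u] = [s(u)] e_f for f = s(u)⁻¹u. The left action of F is the right
action read through the braiding, that is, through ε. The product by [s(u)] is the right F-linear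
map with [s(u)] [s(u)⁻¹s(z)] = [s(z)]. The defect `om` of associativity is cohomologous to α, and it
vanishes when an argument lies in F, because the product is F-linear on the right, F-balanced in the
middle and F-linear on the left (`om_right`, `om_mid`, `om_left`). A 3-cocycle with this property is
constant on cosets of F. Its value at well chosen representatives is the formula for ᾱ
(`om_section`), so ᾱ is a cocycle.

The functor. By means of η, inflation from `Z(H/F,ᾱ)` to `Z(H,α|_H)`, with V_x repeated in each
degree u of the coset x, is lax braided, and it takes the unit object to k[F,γ,ε]. The transfer is
lax braided as well. The composite L takes the unit object to A. An object in the image of a lax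
braided functor is a local module over the image of the unit object, since the braiding with a unit
object is trivial. Thus L lands in local A-modules, and it is braided monoidal there once the maps L
X ⊗_A L Y → L(X ⊗ Y) are invertible.

The equivalence. Let e ∈ A be the indicator of H, an idempotent of degree 1. Its G-translates add up
to |H| times the unit, so in characteristic 0 a module M is generated by Me under the action of G,
and injectivity and surjectivity of module morphisms can be tested on e-parts (`injective_of_idem`,
`eq_top_of_idem`). Locality forces Me to live in degrees in H (`rmul_idem_eq_zero`). On Me,
multiplication by η(u,f)⁻¹ e_f identifies degree u with degree uf, coherently in f (`star_star`).
Locality also shows that, up to these identifications, F acts trivially (`trans_tri_coe`). Hence the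
components of Me in a system of representatives of H/F form an object of `Z(H/F,ᾱ)` whose image
under L is M (`toK_bijective`). The e-part of L X consists of sums of elements v[u], from which full
faithfulness and the invertibility of the comparison maps follow (`map_preimage`, `tens_bijective`).

Twists. The ribbon axioms of `Z(G,α)` are cocycle identities. Since η(u,u)/η(uuu⁻¹,u) = 1, inflation
preserves twists, and so does the transfer. Therefore the twist is trivial on A, and by balancing
and locality it is a module morphism on each local module. Balancing descends along M ⊗ N → M ⊗_A N,
and duals are pulled back along the equivalence. -/

/-! ### Trivializing the 3-cocycle along F by a 2-cochain on H, in additive notation. -/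

/-- The data of an étale algebra, written additively, with all cochains extended to `H`, and a
section `s` of `H → H/F`, regarded as a function on `H`. -/
structure AddEtaleData (H M : Type*) [Group H] [AddCommGroup M] (F : Subgroup H) where
  a : H → H → H → M
  γ : H → H → M
  ε : H → H → M
  s : H → H
  a_cocycle : ∀ f g h l, a g h l + a f (g * h) l + a f g h = a (f * g) h l + a f g (h * l)
  a_one_left : ∀ g h, a 1 g h = 0
  a_one_mid : ∀ g h, a g 1 h = 0
  a_one_right : ∀ g h, a g h 1 = 0
  γ_one_left : ∀ f, γ 1 f = 0
  γ_one_right : ∀ f, γ f 1 = 0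
  coboundary : ∀ f ∈ F, ∀ g ∈ F, ∀ h ∈ F, γ g h + γ f (g * h) = a f g h + γ f g + γ (f * g) h
  ε_mul : ∀ g h, ∀ f ∈ F, ε (g * h) f = ε g (h * f * h⁻¹) + ε h f +
    (a g (h * f * h⁻¹) h - a g h f - a (g * h * f * (g * h)⁻¹) g h)
  γ_ε : ∀ h, ∀ f ∈ F, ∀ g ∈ F, γ f g + ε h (f * g) =
    (a h f g - a (h * f * h⁻¹) h g + a (h * f * h⁻¹) (h * g * h⁻¹) h) + ε h f + ε h g +
      γ (h * f * h⁻¹) (h * g * h⁻¹)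
  γ_comm : ∀ f ∈ F, ∀ g ∈ F, γ f g = ε f g + γ (f * g * f⁻¹) f
  s_one : s 1 = 1
  s_mul : ∀ u, ∀ f ∈ F, s (u * f) = s u
  s_mem : ∀ u, (s u)⁻¹ * u ∈ F

namespace AddEtaleData
variable {H M : Type*} [Group H] [AddCommGroup M] {F : Subgroup H} [hF : F.Normal]
  (D : AddEtaleData H M F)

/-- `u = s(u) * fr u`. -/
def fr (u : H) : H := (D.s u)⁻¹ * u

theorem s_mul_fr (u : H) : D.s u * D.fr u = u := mul_inv_cancel_left _ _

theorem fr_mem (u : H) : D.fr u ∈ F := D.s_mem u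

theorem fr_mul (u : H) {f : H} (hf : f ∈ F) : D.fr (u * f) = D.fr u * f := by
  rw [fr, fr, D.s_mul u f hf, mul_assoc]

theorem s_s (u : H) : D.s (D.s u) = D.s u := by
  have := D.s_mul (D.s u) _ (D.fr_mem u)
  rw [s_mul_fr] at this
  exact this.symm

theorem fr_s (u : H) : D.fr (D.s u) = 1 := by rw [fr, s_s, inv_mul_cancel]

theorem fr_of_mem {f : H} (hf : f ∈ F) : D.fr f = f := by
  have := D.fr_mul 1 hf
  rwa [one_mul, fr, fr, D.s_one, inv_one, one_mul, one_mul, ← fr] at this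

theorem s_of_mem {f : H} (hf : f ∈ F) : D.s f = 1 := by
  have := D.s_mul 1 f hf
  rwa [one_mul, D.s_one] at this

theorem s_mul_left (u : H) {f : H} (hf : f ∈ F) : D.s (f * u) = D.s u := by
  have := D.s_mul u (u⁻¹ * f * u⁻¹⁻¹) (hF.conj_mem f hf u⁻¹)
  rwa [show u * (u⁻¹ * f * u⁻¹⁻¹) = f * u by group] at this

theorem s_mul_mid (u w : H) {f : H} (hf : f ∈ F) : D.s (u * f * w) = D.s (u * w) := by
  have := D.s_mul_left (u * w) (hF.conj_mem f hf u)
  rwa [show u * f * u⁻¹ * (u * w) = u * f * w by group] at this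

theorem s_s_mul (u w : H) : D.s (D.s u * w) = D.s (u * w) := by
  have := D.s_mul_mid (D.s u) w (D.fr_mem u)
  rw [s_mul_fr] at this
  exact this.symm

/-- The right action of `F`: `[u] e_g = r(u,g) [ug]`. -/
def r (u g : H) : M := D.γ (D.fr u) g - D.a (D.s u) (D.fr u) g

/-- The left action of `F`: `e_f [v] = l(f,v) [fv]`. -/
def l (f v : H) : M := D.r v (v⁻¹ * f * v) - D.ε v (v⁻¹ * f * v)

/-- The form in which the left action is used: `[v] e_f = ε_v(f) e_{vfv⁻¹} [v]`, commutation through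
the braiding. -/
theorem l_conj (v f : H) : D.l (v * f * v⁻¹) v = D.r v f - D.ε v f := by
  rw [l, show v⁻¹ * (v * f * v⁻¹) * v = f by group]

/-- The product `[s(u)] [w]`. -/
def sg (u w : H) : M :=
  D.a (D.s u) ((D.s u)⁻¹ * D.s (u * w)) ((D.s (u * w))⁻¹ * D.s u * w) -
    D.r ((D.s u)⁻¹ * D.s (u * w)) ((D.s (u * w))⁻¹ * D.s u * w)

/-- The product `[u] [v]`. -/
def gauge (u v : H) : M := D.l (D.fr u) v + D.sg u (D.fr u * v) - D.a (D.s u) (D.fr u) v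

/-- Associativity of the right action. As `[u] = [s(u)] e_{fr u}`, it reduces to associativity
inside the algebra, which is `coboundary`, and to one instance of the cocycle condition. -/
theorem r_mul (u : H) {g h : H} (hg : g ∈ F) (hh : h ∈ F) :
    D.a u g h + D.r u g + D.r (u * g) h = D.γ g h + D.r u (g * h) := by
  have h1 := D.coboundary _ (D.fr_mem u) g hg h hh
  have h2 := D.a_cocycle (D.s u) (D.fr u) g h
  rw [s_mul_fr] at h2
  simp only [r, D.fr_mul u hg, D.s_mul u g hg]
  linear_combination (norm := abel1) -h2 - h1

theorem r_one_left {g : H} : D.r 1 g = 0 := by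
  rw [r, D.fr_of_mem F.one_mem, D.s_one, D.γ_one_left, D.a_one_left, sub_zero]

theorem r_one_right (u : H) : D.r u 1 = 0 := by
  rw [r, D.γ_one_right, D.a_one_right, sub_zero]

theorem r_of_mem {f g : H} (hf : f ∈ F) : D.r f g = D.γ f g := by
  rw [r, D.fr_of_mem hf, D.s_of_mem hf, D.a_one_left, sub_zero]

theorem r_s (u g : H) : D.r (D.s u) g = 0 := by
  rw [r, fr_s, D.γ_one_left, D.a_one_mid, sub_zero]

/-- Commutativity of the algebra makes the left and right actions agree with the product on F
itself. -/
theorem l_of_mem {f g : H} (hf : f ∈ F) (hg : g ∈ F) : D.l f g = D.γ f g := by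
  obtain ⟨f, rfl⟩ : ∃ f', f = g * f' * g⁻¹ := ⟨g⁻¹ * f * g, by group⟩
  have hf' : f ∈ F := by
    have := hF.conj_mem _ hf g⁻¹
    rwa [show g⁻¹ * (g * f * g⁻¹) * g⁻¹⁻¹ = f by group] at this
  rw [l_conj, D.r_of_mem hg, D.γ_comm g hg f hf']
  abel

/-- Associativity of the left action. With f and g written as conjugates by v, both sides become
right actions on `[v]`. They are compared by `r_mul`, by the compatibility of ε with both products,
and by the commutation of `e_g` with `e_{g⁻¹fg}`. -/
theorem l_mul {f g : H} (hf : f ∈ F) (hg : g ∈ F) (v : H) :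
    D.a f g v + D.γ f g + D.l (f * g) v = D.l g v + D.l f (g * v) := by
  obtain ⟨f, rfl⟩ : ∃ f', f = v * f' * v⁻¹ := ⟨v⁻¹ * f * v, by group⟩
  obtain ⟨g, rfl⟩ : ∃ g', g = v * g' * v⁻¹ := ⟨v⁻¹ * g * v, by group⟩
  have hf' : f ∈ F := by
    have := hF.conj_mem _ hf v⁻¹
    rwa [show v⁻¹ * (v * f * v⁻¹) * v⁻¹⁻¹ = f by group] at this
  have hg' : g ∈ F := by
    have := hF.conj_mem _ hg v⁻¹
    rwa [show v⁻¹ * (v * g * v⁻¹) * v⁻¹⁻¹ = g by group] at this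
  have hc : g⁻¹ * f * g ∈ F := by simpa using hF.conj_mem _ hf' g⁻¹
  have e1 : D.l (v * f * v⁻¹) (v * g * v⁻¹ * v) =
      D.r (v * g) (g⁻¹ * f * g) - D.ε (v * g) (g⁻¹ * f * g) := by
    rw [← l_conj]
    congr 1 <;> group
  have e2 : D.l (v * f * v⁻¹ * (v * g * v⁻¹)) v = D.r v (f * g) - D.ε v (f * g) := by
    rw [← l_conj]
    congr 1; group
  have h1 := D.ε_mul v g _ hc
  have h2 := D.γ_ε v f hf' g hg'
  have h3 := D.r_mul v hg' hc
  have h4 := D.γ_comm g hg' _ hc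
  have e3 : g * (g⁻¹ * f * g) = f * g := by group
  have e4 : g * (g⁻¹ * f * g) * g⁻¹ = f := by group
  have e5 : v * g * (g⁻¹ * f * g) * (v * g)⁻¹ = v * f * v⁻¹ := by group
  rw [e4, e5] at h1
  rw [e3] at h3
  rw [e4] at h4
  rw [e1, e2, l_conj]
  linear_combination (norm := abel1) h1 - h2 - h3 - h4

/-- The bimodule axiom. After passing to right actions it compares `e_f e_g` with `e_g e_{g⁻¹fg}`,
two products in the algebra that differ by `γ_comm`. -/
theorem l_r {f g : H} (hf : f ∈ F) (hg : g ∈ F) (v : H) :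
    D.a f v g + D.l f v + D.r (f * v) g = D.r v g + D.l f (v * g) := by
  obtain ⟨f, rfl⟩ : ∃ f', f = v * f' * v⁻¹ := ⟨v⁻¹ * f * v, by group⟩
  have hf' : f ∈ F := by
    have := hF.conj_mem _ hf v⁻¹
    rwa [show v⁻¹ * (v * f * v⁻¹) * v⁻¹⁻¹ = f by group] at this
  have hc : g⁻¹ * f * g ∈ F := by simpa using hF.conj_mem _ hf' g⁻¹
  have e1 : D.l (v * f * v⁻¹) (v * g) =
      D.r (v * g) (g⁻¹ * f * g) - D.ε (v * g) (g⁻¹ * f * g) := by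
    rw [← l_conj]
    congr 1; group
  have h1 := D.ε_mul v g _ hc
  have h3 := D.r_mul v hg hc
  have h4 := D.γ_comm g hg _ hc
  have h5 := D.r_mul v hf' hg
  have e3 : g * (g⁻¹ * f * g) = f * g := by group
  have e4 : g * (g⁻¹ * f * g) * g⁻¹ = f := by group
  have e5 : v * g * (g⁻¹ * f * g) * (v * g)⁻¹ = v * f * v⁻¹ := by group
  have e6 : v * f * v⁻¹ * v = v * f := by group
  rw [e4, e5] at h1
  rw [e3] at h3
  rw [e4] at h4
  rw [e1, l_conj, e6]
  linear_combination (norm := abel1) h5 - h3 + h1 - h4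

/-- Right F-linearity of multiplication by `[s(u)]`. It holds because `sg` was defined as the right
linear extension of its values at `s(u)⁻¹ s(uw)`. -/
theorem sg_mul (u w : H) {g : H} (hg : g ∈ F) :
    D.a (D.s u) w g + D.sg u w + D.r (D.s u * w) g = D.r w g + D.sg u (w * g) := by
  have e0 : D.s (u * (w * g)) = D.s (u * w) := by rw [← mul_assoc, D.s_mul _ _ hg]
  have hm : (D.s (u * w))⁻¹ * D.s u * w ∈ F := by
    have := D.fr_mem (D.s u * w)
    rwa [fr, s_s_mul, ← mul_assoc] at this
  simp only [sg, e0]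
  rw [show (D.s (u * w))⁻¹ * D.s u * (w * g) = (D.s (u * w))⁻¹ * D.s u * w * g by group]
  have e1 : D.r (D.s u * w) g = D.γ ((D.s (u * w))⁻¹ * D.s u * w) g -
      D.a (D.s (u * w)) ((D.s (u * w))⁻¹ * D.s u * w) g := by
    rw [r, fr, s_s_mul, mul_assoc _ (D.s u) w]
  have h1 := D.r_mul ((D.s u)⁻¹ * D.s (u * w)) hm hg
  have h2 := D.a_cocycle (D.s u) ((D.s u)⁻¹ * D.s (u * w)) ((D.s (u * w))⁻¹ * D.s u * w) g
  rw [show (D.s u)⁻¹ * D.s (u * w) * ((D.s (u * w))⁻¹ * D.s u * w) = w by group] at h1 h2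
  rw [mul_inv_cancel_left] at h2
  rw [e1]
  linear_combination (norm := abel1) h2 - h1

theorem sg_of_mem (u : H) {g : H} (hg : g ∈ F) : D.sg u g = 0 := by
  rw [sg, D.s_mul u g hg, inv_mul_cancel, one_mul, r_one_left, D.a_one_mid, sub_zero]

theorem sg_one_left (w : H) {f : H} (hf : f ∈ F) (e : D.s (f * w) = D.s w) : D.sg f w = 0 := by
  rw [sg, e, D.s_of_mem hf, D.a_one_left, inv_one, one_mul, r_s, sub_zero]

theorem s_mul_section (u z : H) : D.s (u * ((D.s u)⁻¹ * D.s z)) = D.s z := by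
  have h := hF.conj_mem _ (D.fr_mem u) (D.s u)
  rw [s_mul_fr] at h
  rw [← mul_assoc, D.s_mul_left _ h, s_s]

/-- The normalization behind `sg`: `[s(u)] [s(u)⁻¹ s(z)] = [s(z)]` with coefficient 1. The explicit
formula for the reduced cocycle depends on it. -/
theorem sg_section (u z : H) : D.sg u ((D.s u)⁻¹ * D.s z) = 0 := by
  rw [sg, s_mul_section, mul_assoc, mul_inv_cancel_left, inv_mul_cancel, D.a_one_right,
    r_one_right, sub_zero]

theorem sg_fr (u v f : H) (hf : f ∈ F) : D.sg (u * f) v = D.sg u v := by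
  simp only [sg, D.s_mul u f hf, D.s_mul_mid u v hf]

theorem gauge_of_mem_right (u : H) {g : H} (hg : g ∈ F) : D.gauge u g = D.r u g := by
  rw [gauge, D.l_of_mem (D.fr_mem u) hg, D.sg_of_mem u (F.mul_mem (D.fr_mem u) hg), add_zero, r]

theorem gauge_of_mem_left {f : H} (hf : f ∈ F) (v : H) : D.gauge f v = D.l f v := by
  rw [gauge, D.fr_of_mem hf, D.s_of_mem hf, D.a_one_left,
    D.sg_one_left _ hf (D.s_mul_left _ hf), add_zero, sub_zero]

theorem gauge_s (u w : H) : D.gauge (D.s u) w = D.sg u w := by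
  have h : D.l 1 w = 0 := by
    have h1 := D.l_conj w 1
    have h2 := D.ε_mul w 1 1 F.one_mem
    simp only [mul_one, mul_inv_cancel, inv_one, D.a_one_mid, D.a_one_right, sub_zero,
      add_zero] at h1 h2
    have h3 := D.γ_ε w 1 F.one_mem 1 F.one_mem
    simp only [mul_one, mul_inv_cancel, inv_one, D.a_one_mid, D.a_one_right, D.a_one_left,
      sub_zero, add_zero, D.γ_one_left, zero_add, left_eq_add] at h3
    rw [h1, h3, r_one_right, sub_zero]
  rw [gauge, fr_s, h, one_mul, s_s, D.a_one_mid, zero_add, sub_zero]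
  simp only [sg, s_s, s_s_mul]

/-- The cocycle cohomologous to `a` by means of `gauge`. -/
def om (u v w : H) : M :=
  D.a u v w + D.gauge u v + D.gauge (u * v) w - D.gauge v w - D.gauge u (v * w)

theorem om_cocycle (f g h l : H) :
    D.om g h l + D.om f (g * h) l + D.om f g h = D.om (f * g) h l + D.om f g (h * l) := by
  have h1 := D.a_cocycle f g h l
  simp only [om, mul_assoc]
  linear_combination (norm := abel1) h1

/-- Right F-linearity of the product: `l_r` takes care of the factor `e_{fr u}`, and `sg_mul` of the
factor `[s(u)]`. -/
theorem om_right (u v : H) {g : H} (hg : g ∈ F) : D.om u v g = 0 := by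
  have h1 := D.a_cocycle (D.s u) (D.fr u) v g
  have h2 := D.l_r (D.fr_mem u) hg v
  have h3 := D.sg_mul u (D.fr u * v) hg
  rw [← mul_assoc, s_mul_fr] at h3
  rw [s_mul_fr] at h1
  rw [om, D.gauge_of_mem_right _ hg, D.gauge_of_mem_right _ hg, gauge, gauge]
  rw [← mul_assoc (D.fr u)]
  linear_combination (norm := abel1) -h1 + h2 + h3

/-- The product is balanced over F. The factor `[s(u)]` is common to `([u] e_g)[v]` and `[u](e_g
[v])`, and what is left is associativity of the left action. -/
theorem om_mid (u v : H) {g : H} (hg : g ∈ F) : D.om u g v = 0 := by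
  have h1 := D.a_cocycle (D.s u) (D.fr u) g v
  have h2 := D.l_mul (D.fr_mem u) hg v
  rw [s_mul_fr] at h1
  rw [om, D.gauge_of_mem_right _ hg, D.gauge_of_mem_left hg, gauge, gauge, r, D.fr_mul u hg,
    D.s_mul u g hg, D.sg_fr _ _ _ hg, ← mul_assoc (D.fr u)]
  linear_combination (norm := abel1) -h1 + h2

/-- Left F-linearity for a chosen representative: moving `e_f` past `[s(v)]` conjugates f and costs
a value of ε. The right linearity of `[s(v)]` and the multiplicativity of ε in its first argument
then match the two sides. -/
theorem om_left_s {f : H} (hf : f ∈ F) (v w : H) : D.om f (D.s v) w = 0 := by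
  obtain ⟨f, rfl⟩ : ∃ f', f = D.s v * f' * (D.s v)⁻¹ := ⟨(D.s v)⁻¹ * f * D.s v, by group⟩
  have hf' : f ∈ F := by
    have := hF.conj_mem _ hf (D.s v)⁻¹
    rwa [show (D.s v)⁻¹ * (D.s v * f * (D.s v)⁻¹) * (D.s v)⁻¹⁻¹ = f by group] at this
  have hc : w⁻¹ * f * w ∈ F := by simpa using hF.conj_mem _ hf' w⁻¹
  have h1 := D.ε_mul (D.s v) w _ hc
  have h2 := D.sg_mul v w hc
  have e3 : w * (w⁻¹ * f * w) = f * w := by group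
  have e4 : w * (w⁻¹ * f * w) * w⁻¹ = f := by group
  have e5 : D.s v * w * (w⁻¹ * f * w) * (D.s v * w)⁻¹ = D.s v * f * (D.s v)⁻¹ := by group
  rw [e4, e5] at h1
  rw [e3] at h2
  have e6 : D.l (D.s v * f * (D.s v)⁻¹) (D.s v * w) =
      D.r (D.s v * w) (w⁻¹ * f * w) - D.ε (D.s v * w) (w⁻¹ * f * w) := by
    rw [← l_conj]
    congr 1; group
  have e7 : D.l f w = D.r w (w⁻¹ * f * w) - D.ε w (w⁻¹ * f * w) := by
    rw [← l_conj, e4]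
  have e8 : D.gauge (D.s v * f) w = D.l f w + D.sg v (f * w) - D.a (D.s v) f w := by
    rw [gauge, D.fr_mul _ hf', fr_s, one_mul, D.s_mul _ _ hf', s_s, D.sg_fr _ _ _ hf']
    simp only [sg, s_s, s_s_mul]
  rw [om, D.gauge_of_mem_left hf, D.gauge_of_mem_left hf, inv_mul_cancel_right, e8, gauge_s,
    l_conj, r_s, e6, e7]
  linear_combination (norm := abel1) h1 - h2

/-- For general v, the cocycle identity for f, `s v`, `fr v`, w has only vanishing terms besides
this one. -/
theorem om_left {f : H} (hf : f ∈ F) (v w : H) : D.om f v w = 0 := by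
  have h := D.om_cocycle f (D.s v) (D.fr v) w
  rw [s_mul_fr, D.om_left_s hf, D.om_left_s hf, D.om_mid _ _ (D.fr_mem v),
    D.om_mid _ _ (D.fr_mem v)] at h
  simpa using h

/-- When one entry of the cocycle identity lies in F, most of its terms vanish. What survives says
that `om` is constant on cosets of F, here in the last argument and below in the other two. -/
theorem om_mul_right (u v w : H) {f : H} (hf : f ∈ F) : D.om u v (w * f) = D.om u v w := by
  have h := D.om_cocycle u v w f
  rw [D.om_right _ _ hf, D.om_right _ _ hf, D.om_right _ _ hf] at h
  simpa using h.symm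

theorem om_mul_mid (u v w : H) {f : H} (hf : f ∈ F) : D.om u (v * f) w = D.om u v w := by
  have h := D.om_cocycle u v f w
  rw [D.om_mid _ _ hf, D.om_mid _ _ hf, D.om_right _ _ hf] at h
  have h1 := D.om_mul_right u v w (hF.conj_mem f hf w⁻¹)
  rw [show w * (w⁻¹ * f * w⁻¹⁻¹) = f * w by group] at h1
  rw [h1] at h
  simpa using h

theorem om_mul_left (u v w : H) {f : H} (hf : f ∈ F) : D.om (u * f) v w = D.om u v w := by
  have h := D.om_cocycle u f v w
  rw [D.om_mid _ _ hf, D.om_mid _ _ hf, D.om_left hf] at h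
  have h1 := D.om_mul_mid u v w (hF.conj_mem f hf v⁻¹)
  rw [show v * (v⁻¹ * f * v⁻¹⁻¹) = f * v by group] at h1
  rw [h1] at h
  simpa using h.symm

theorem s_div (x z : H) : D.s ((D.s x)⁻¹ * D.s (x * z)) = D.s z := by
  have h : (D.s x)⁻¹ * D.s (x * z) = D.fr x * (z * (D.fr (x * z))⁻¹) := by
    simp only [fr]; group
  rw [h, D.s_mul_left _ (D.fr_mem x), D.s_mul _ _ (F.inv_mem (D.fr_mem _))]

theorem s_mul_s (u v : H) : D.s (D.s u * D.s v) = D.s (u * v) := by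
  rw [s_s_mul]
  have := D.s_mul (u * D.s v) _ (D.fr_mem v)
  rw [mul_assoc, s_mul_fr] at this
  exact this.symm

theorem tau_mem (u v : H) : (D.s v)⁻¹ * (D.s u)⁻¹ * D.s (u * v) ∈ F := by
  have := F.inv_mem (D.fr_mem (D.s u * D.s v))
  rw [fr, s_mul_s] at this
  simpa [mul_assoc] using this

theorem r_div (x z g : H) : D.r ((D.s x)⁻¹ * D.s (x * z)) g =
    D.γ ((D.s z)⁻¹ * (D.s x)⁻¹ * D.s (x * z)) g -
      D.a (D.s z) ((D.s z)⁻¹ * (D.s x)⁻¹ * D.s (x * z)) g := by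
  rw [r, fr, s_div, mul_assoc (D.s z)⁻¹]

/-- The third representative is chosen so that the product of all three is `s (u * v * w)`; then the
last gauge term vanishes by `sg_section`. The other terms reduce to values of a, γ and ε. -/
theorem om_section (u v w : H) :
    D.om (D.s u) (D.s v) ((D.s v)⁻¹ * (D.s u)⁻¹ * D.s (u * v * w)) =
      D.a (D.s u) (D.s v) ((D.s v)⁻¹ * (D.s u)⁻¹ * D.s (u * v * w)) +
      D.γ ((D.s w)⁻¹ * (D.s v)⁻¹ * D.s (v * w))
        ((D.s (v * w))⁻¹ * (D.s u)⁻¹ * D.s (u * v * w)) -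
      D.γ ((D.s w)⁻¹ * (D.s (u * v))⁻¹ * D.s (u * v * w))
        ((D.s (u * v * w))⁻¹ * D.s (u * v) * ((D.s v)⁻¹ * (D.s u)⁻¹ * D.s (u * v)) *
          (D.s (u * v))⁻¹ * D.s (u * v * w)) +
      D.ε ((D.s (u * v))⁻¹ * D.s (u * v * w))
        ((D.s (u * v * w))⁻¹ * D.s (u * v) * ((D.s v)⁻¹ * (D.s u)⁻¹ * D.s (u * v)) *
          (D.s (u * v))⁻¹ * D.s (u * v * w)) -
      D.a (D.s v) ((D.s v)⁻¹ * D.s (v * w)) ((D.s (v * w))⁻¹ * (D.s u)⁻¹ * D.s (u * v * w)) -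
      D.a (D.s w) ((D.s w)⁻¹ * (D.s v)⁻¹ * D.s (v * w))
        ((D.s (v * w))⁻¹ * (D.s u)⁻¹ * D.s (u * v * w)) -
      D.a (D.s u) (D.s v) ((D.s v)⁻¹ * (D.s u)⁻¹ * D.s (u * v)) +
      D.a (D.s u * D.s v) ((D.s v)⁻¹ * (D.s u)⁻¹ * D.s (u * v))
        ((D.s (u * v))⁻¹ * D.s (u * v * w)) +
      D.a (D.s w) ((D.s w)⁻¹ * (D.s (u * v))⁻¹ * D.s (u * v * w))
        ((D.s (u * v * w))⁻¹ * D.s (u * v) * ((D.s v)⁻¹ * (D.s u)⁻¹ * D.s (u * v)) *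
          (D.s (u * v))⁻¹ * D.s (u * v * w)) := by
  have ht := D.tau_mem u v
  set t := (D.s v)⁻¹ * (D.s u)⁻¹ * D.s (u * v) with t_def
  set h := (D.s (u * v))⁻¹ * D.s (u * v * w) with h_def
  have et : (D.s (u * v * w))⁻¹ * D.s (u * v) * t * (D.s (u * v))⁻¹ * D.s (u * v * w) =
      h⁻¹ * t * h := by rw [h_def]; group
  have e0 : t * h = (D.s v)⁻¹ * (D.s u)⁻¹ * D.s (u * v * w) := by rw [t_def, h_def]; group
  have e1 : D.s u * D.s v * t = D.s (u * v) := by rw [t_def]; group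
  have e2 : D.s v * t = (D.s u)⁻¹ * D.s (u * v) := by rw [t_def]; group
  -- Only the sum of `gauge (s u) (s v)` and `gauge (s u * s v) (t * h)` is needed. These two
  -- vanishing values of `om` determine it, because `gauge (s u * s v) t` cancels between them.
  have h1 := D.om_right (D.s u) (D.s v) ht
  have h2 := D.om_mid (D.s u * D.s v) h ht
  rw [om, e2, D.gauge_of_mem_right _ ht, D.gauge_of_mem_right _ ht, r_s, gauge_s _ u (_ * _),
    sg_section] at h1
  rw [om, e0, e1, D.gauge_of_mem_right _ ht, D.gauge_of_mem_left ht, gauge_s, h_def, sg_section,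
    ← h_def, l, h_def, r_div, ← h_def] at h2
  have e3 : D.s v * ((D.s v)⁻¹ * (D.s u)⁻¹ * D.s (u * v * w)) =
      (D.s u)⁻¹ * D.s (u * (v * w)) := by rw [mul_assoc u]; group
  have e4 : D.s (v * ((D.s v)⁻¹ * (D.s u)⁻¹ * D.s (u * v * w))) = D.s (v * w) := by
    rw [← s_s_mul, e3, s_div]
  have e5 : (D.s (v * w))⁻¹ * D.s v * ((D.s v)⁻¹ * (D.s u)⁻¹ * D.s (u * v * w)) =
      (D.s (v * w))⁻¹ * (D.s u)⁻¹ * D.s (u * v * w) := by group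
  rw [et, om, e3, gauge_s _ u ((D.s u)⁻¹ * _), sg_section, gauge_s _ v, sg, e4, e5, r_div]
  linear_combination (norm := abel1) h1 + (-1 : ℤ) • h2

end AddEtaleData

/-! ### The reduced cocycle and its gauge, in multiplicative notation. -/

namespace EtaleData
variable {H k : Type u} [Group H] [Field k] {α : Cocycle3 H k} {F : Subgroup H} [F.Normal]
open scoped Classical

/-- The étale data, written additively and extended to `H`. -/
noncomputable def toAdd (D : EtaleData α F) (s : H ⧸ F → H) (hs : ∀ x, (s x : H ⧸ F) = x)
    (hs1 : s 1 = 1) : AddEtaleData H (Additive kˣ) F where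
  a f g h := .ofMul (α.toFun f g h)
  -- The value 0 outside F keeps the normalization of γ, which is required for all arguments in H;
  -- the remaining identities only concern arguments in F.
  γ f g := if h : f ∈ F ∧ g ∈ F then .ofMul (D.γ ⟨f, h.1⟩ ⟨g, h.2⟩) else 0
  ε h f := if hf : f ∈ F then .ofMul (D.ε h ⟨f, hf⟩) else 0
  s h := s h
  a_cocycle f g h l := congrArg Additive.ofMul (α.isCocycle.cocycle f g h l)
  a_one_left g h := congrArg Additive.ofMul (α.isCocycle.one_left g h)
  a_one_mid g h := congrArg Additive.ofMul (α.isCocycle.one_mid g h)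
  a_one_right g h := congrArg Additive.ofMul (α.isCocycle.one_right g h)
  γ_one_left f := by
    split_ifs
    · exact congrArg Additive.ofMul (D.γ_one_left _)
    · rfl
  γ_one_right f := by
    split_ifs
    · exact congrArg Additive.ofMul (D.γ_one_right _)
    · rfl
  coboundary f hf g hg h hh := by
    simp only [hf, hg, hh, F.mul_mem hf hg, F.mul_mem hg hh, and_self, dite_true]
    exact congrArg Additive.ofMul (D.coboundary ⟨f, hf⟩ ⟨g, hg⟩ ⟨h, hh⟩)
  ε_mul g h f hf := by
    have hc := Subgroup.Normal.conj_mem ‹F.Normal› f hf h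
    simp only [hf, hc, dite_true]
    refine (congrArg Additive.ofMul (D.ε_mul g h ⟨f, hf⟩)).trans ?_
    simp only [Cocycle3.act, ofMul_mul, ofMul_inv]
    rw [show MulAut.conjNormal h (⟨f, hf⟩ : F) = ⟨h * f * h⁻¹, hc⟩ from
      Subtype.ext (MulAut.conjNormal_apply _ _)]
    abel
  γ_ε h f hf g hg := by
    have hc := Subgroup.Normal.conj_mem ‹F.Normal› f hf h
    have hc' := Subgroup.Normal.conj_mem ‹F.Normal› g hg h
    simp only [hf, hg, hc, hc', F.mul_mem hf hg, and_self, dite_true]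
    refine (congrArg Additive.ofMul (D.γ_ε h ⟨f, hf⟩ ⟨g, hg⟩)).trans ?_
    simp only [Cocycle3.ten, ofMul_mul, ofMul_inv]
    rw [show MulAut.conjNormal h (⟨f, hf⟩ : F) = ⟨h * f * h⁻¹, hc⟩ from
      Subtype.ext (MulAut.conjNormal_apply _ _),
      show MulAut.conjNormal h (⟨g, hg⟩ : F) = ⟨h * g * h⁻¹, hc'⟩ from
      Subtype.ext (MulAut.conjNormal_apply _ _)]
    abel
  γ_comm f hf g hg := by
    have hc := Subgroup.Normal.conj_mem ‹F.Normal› g hg f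
    simp only [hf, hg, hc, and_self, dite_true]
    refine (congrArg Additive.ofMul (D.γ_comm ⟨f, hf⟩ ⟨g, hg⟩)).trans ?_
    rw [show MulAut.conjNormal (f : H) (⟨g, hg⟩ : F) = ⟨f * g * f⁻¹, hc⟩ from
      Subtype.ext (MulAut.conjNormal_apply _ _)]
    rfl
  s_one := hs1
  s_mul u f hf := by
    rw [QuotientGroup.mk_mul_of_mem u hf]
  s_mem u := by
    rw [← QuotientGroup.eq, hs]

variable (D : EtaleData α F) (s : H ⧸ F → H) (hs : ∀ x, (s x : H ⧸ F) = x) (hs1 : s 1 = 1)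

/-- The 2-cochain on `H` by which `α` differs from the inflation of the reduced cocycle. -/
noncomputable def gauge (u v : H) : kˣ := ((D.toAdd s hs hs1).gauge u v).toMul

/-- Since `om` is constant on cosets, any lifts u, v, w may be used. This freedom matters because a
product of chosen representatives is in general not a chosen representative. -/
theorem om_eq (x y z : H ⧸ F) (u v w : H) (hu : (u : H ⧸ F) = x) (hv : (v : H ⧸ F) = y)
    (hw : (w : H ⧸ F) = z) :
    (D.toAdd s hs hs1).om u v w = Additive.ofMul (D.reduced s hs x y z) := by
  set E := D.toAdd s hs hs1
  have hw' : ((((s y)⁻¹ * (s x)⁻¹ * s (x * y * z) : H)) : H ⧸ F) = z := by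
    change ((s y : H ⧸ F))⁻¹ * ((s x : H ⧸ F))⁻¹ * (s (x * y * z) : H ⧸ F) = z
    rw [hs, hs, hs]; group
  have key : E.om u v w = E.om (s x) (s y) ((s y)⁻¹ * (s x)⁻¹ * s (x * y * z)) := by
    have e1 := E.om_mul_left (s x) v w (f := (s x)⁻¹ * u)
      (by rw [← QuotientGroup.eq, hs, hu])
    have e2 := E.om_mul_mid (s x) (s y) w (f := (s y)⁻¹ * v)
      (by rw [← QuotientGroup.eq, hs, hv])
    have e3 := E.om_mul_right (s x) (s y) ((s y)⁻¹ * (s x)⁻¹ * s (x * y * z))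
      (f := ((s y)⁻¹ * (s x)⁻¹ * s (x * y * z))⁻¹ * w)
      (by rw [← QuotientGroup.eq, hw', hw])
    rw [mul_inv_cancel_left] at e1 e2 e3
    rw [e1, e2, e3]
  rw [key]
  subst hu hv hw
  refine (E.om_section u v w).trans ?_
  have hγ (f g : F) : E.γ f g = Additive.ofMul (D.γ f g) := dif_pos ⟨f.2, g.2⟩
  have hε (h : H) (f : F) : E.ε h f = Additive.ofMul (D.ε h f) := dif_pos f.2
  have ht : (E.s (u * v * w))⁻¹ * E.s (u * v) * ((E.s v)⁻¹ * (E.s u)⁻¹ * E.s (u * v)) *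
      (E.s (u * v))⁻¹ * E.s (u * v * w) =
        (MulAut.conjNormal ((E.s (u * v))⁻¹ * E.s (u * v * w))⁻¹ (tau s hs (u : H ⧸ F) v) : F) := by
    rw [MulAut.conjNormal_apply]
    change _ = _ * ((E.s v)⁻¹ * (E.s u)⁻¹ * E.s (u * v)) * _
    group
  have htau (x y : H) : (E.s y)⁻¹ * (E.s x)⁻¹ * E.s (x * y) = (tau s hs (x : H ⧸ F) y : F) := rfl
  have hq : (E.s (v * w))⁻¹ * (E.s u)⁻¹ * E.s (u * v * w) =
      (tau s hs (u : H ⧸ F) ((v : H ⧸ F) * w) : F) := by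
    rw [mul_assoc u]; rfl
  rw [ht, hq, htau (u * v) w, htau v w, hγ, hγ, hε]
  simp only [reduced, ofMul_mul, ofMul_inv, sub_eq_add_neg]
  rfl

theorem gauge_cocycle (u v w : H) : α.toFun u v w * D.gauge s hs hs1 u v *
    D.gauge s hs hs1 (u * v) w =
      D.reduced s hs u v w * D.gauge s hs hs1 v w * D.gauge s hs hs1 u (v * w) := by
  have h := D.om_eq s hs hs1 u v w u v w rfl rfl rfl
  rw [AddEtaleData.om, sub_sub, sub_eq_iff_eq_add, ← add_assoc] at h
  exact congrArg Additive.toMul h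

theorem gauge_one_left (u : H) : D.gauge s hs hs1 1 u = 1 := by
  have h : (D.toAdd s hs hs1).gauge 1 u = 0 := by
    have := (D.toAdd s hs hs1).gauge_s 1 u
    rw [(D.toAdd s hs hs1).s_one] at this
    rw [this, AddEtaleData.sg_one_left _ _ F.one_mem (by rw [one_mul])]
  exact congrArg Additive.toMul h

theorem gauge_one_right (u : H) : D.gauge s hs hs1 u 1 = 1 := by
  have h : (D.toAdd s hs hs1).gauge u 1 = 0 := by
    rw [AddEtaleData.gauge_of_mem_right _ _ F.one_mem, AddEtaleData.r_one_right]
  exact congrArg Additive.toMul h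

theorem gauge_coe (f g : F) : D.gauge s hs hs1 f g = D.γ f g := by
  have h : (D.toAdd s hs hs1).gauge f g = Additive.ofMul (D.γ f g) := by
    rw [AddEtaleData.gauge_of_mem_right _ _ g.2, AddEtaleData.r_of_mem _ f.2]
    exact dif_pos ⟨f.2, g.2⟩
  exact congrArg Additive.toMul h

/-- On arguments in F the gauge is the right action on one side and the left action on the other,
and the two differ by ε. This says that the action on an inflated unit object is given by ε. -/
theorem gauge_conj (h : H) (f : F) :
    D.ε h f * D.gauge s hs hs1 (h * f * h⁻¹) h = D.gauge s hs hs1 h f := by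
  have e : Additive.ofMul (D.ε h f) + (D.toAdd s hs hs1).gauge (h * f * h⁻¹) h =
      (D.toAdd s hs hs1).gauge h f := by
    have hε : (D.toAdd s hs hs1).ε h f = Additive.ofMul (D.ε h f) := dif_pos f.2
    rw [AddEtaleData.gauge_of_mem_right _ _ f.2,
      AddEtaleData.gauge_of_mem_left _ (Subgroup.Normal.conj_mem ‹F.Normal› _ f.2 h),
      AddEtaleData.l_conj, hε]
    abel
  exact congrArg Additive.toMul e

/-- The identity for `om` at the lifts `s f`, `s g`, `s h`, `s l` descends, the products of lifts
being lifts of the products. Normalization is the vanishing of `om` on F. -/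
theorem isCocycle3_reduced (hs1 : s 1 = 1) : IsCocycle3 (D.reduced s hs) where
  cocycle f g h l := by
    have e := (D.toAdd s hs hs1).om_cocycle (s f) (s g) (s h) (s l)
    have hm (x y : H ⧸ F) : ((s x * s y : H) : H ⧸ F) = x * y := by
      rw [QuotientGroup.mk_mul, hs, hs]
    rw [D.om_eq s hs hs1 _ _ _ _ _ _ (hs g) (hs h) (hs l),
      D.om_eq s hs hs1 _ _ _ _ _ _ (hs f) (hm g h) (hs l),
      D.om_eq s hs hs1 _ _ _ _ _ _ (hs f) (hs g) (hs h),
      D.om_eq s hs hs1 _ _ _ _ _ _ (hm f g) (hs h) (hs l),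
      D.om_eq s hs hs1 _ _ _ _ _ _ (hs f) (hs g) (hm h l)] at e
    exact congrArg Additive.toMul e
  one_left g h := by
    have e := D.om_eq s hs hs1 1 g h 1 (s g) (s h) rfl (hs g) (hs h)
    rw [AddEtaleData.om_left _ F.one_mem] at e
    exact (congrArg Additive.toMul e).symm
  one_mid g h := by
    have e := D.om_eq s hs hs1 g 1 h (s g) 1 (s h) (hs g) rfl (hs h)
    rw [AddEtaleData.om_mid _ _ _ F.one_mem] at e
    exact (congrArg Additive.toMul e).symm
  one_right g h := by
    have e := D.om_eq s hs hs1 g h 1 (s g) (s h) 1 (hs g) (hs h) rfl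
    rw [AddEtaleData.om_right _ _ _ F.one_mem] at e
    exact (congrArg Additive.toMul e).symm

end EtaleData

/-! ### Lax braided functors as functors to local modules. -/

section
open CategoryTheory MonoidalCategory Limits MonObj Functor.LaxMonoidal

namespace LocMod

universe v' w'
variable {C : Type w} [Category.{v} C] [MonoidalCategory C] [BraidedCategory C]
  {D : Type w'} [Category.{v'} D] [MonoidalCategory D] [BraidedCategory D]

theorem isIso_of_isIso_hom {A : Mon D} {M N : LocMod A} (f : M ⟶ N) [IsIso f.hom] : IsIso f :=
  ⟨{ hom := inv f.hom
     act_hom := by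
      rw [← cancel_epi (f.hom ▷ A.X), ← comp_whiskerRight_assoc, IsIso.hom_inv_id,
        id_whiskerRight, Category.id_comp, ← Category.assoc, ← f.act_hom, Category.assoc,
        IsIso.hom_inv_id, Category.comp_id] },
    hom_ext _ _ (IsIso.hom_inv_id f.hom), hom_ext _ _ (IsIso.inv_hom_id f.hom)⟩

/-- An algebra morphism from `A` to the image of the unit object under a lax braided functor. -/
structure UnitHom (L : C ⥤ D) [L.LaxBraided] (A : Mon D) where
  hom : A.X ⟶ L.obj (𝟙_ C)
  one_hom : η ≫ hom = ε L
  mul_hom : μ ≫ hom = (hom ⊗ₘ hom) ≫ Functor.LaxMonoidal.μ L _ _ ≫ L.map (λ_ _).hom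

namespace UnitHom
variable {L : C ⥤ D} [L.LaxBraided] {A : Mon D} (U : UnitHom L A)

/-- The image of an object under a lax braided functor is a local module. -/
@[reducible] noncomputable def obj (X : C) : LocMod A where
  X := L.obj X
  act := L.obj X ◁ U.hom ≫ Functor.LaxMonoidal.μ L X (𝟙_ C) ≫ L.map (ρ_ X).hom
  act_one := by
    rw [← MonoidalCategory.whiskerLeft_comp_assoc, U.one_hom, right_unitality]
  act_assoc := by
    rw [← MonoidalCategory.whiskerLeft_comp_assoc, U.mul_hom]
    simp only [MonoidalCategory.whiskerLeft_comp, comp_whiskerRight, Category.assoc,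
      MonoidalCategory.tensorHom_def]
    rw [μ_natural_right_assoc, whiskerLeft_μ_comp_μ_assoc, ← L.map_comp_assoc, triangle,
      ← whisker_exchange_assoc, ← whisker_exchange_assoc, μ_natural_left_assoc]
    simp
  -- Naturality moves the algebra map past both braidings. Lax braidedness then turns these into the
  -- image of the double braiding of X with the unit object, which is the identity.
  isLocal := by
    rw [← BraidedCategory.braiding_naturality_left_assoc,
      ← BraidedCategory.braiding_naturality_right_assoc, ← Functor.LaxBraided.braided_assoc,
      ← Functor.LaxBraided.braided_assoc, ← L.map_comp, ← L.map_comp]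
    simp

/-- A lax braided functor as a functor to local modules. -/
@[reducible] noncomputable def functor : C ⥤ LocMod A where
  obj := U.obj
  map f :=
    { hom := L.map f
      act_hom := by
        simp only [Category.assoc]
        rw [← L.map_comp, ← rightUnitor_naturality, L.map_comp, ← μ_natural_left_assoc,
          whisker_exchange_assoc] }

variable [IsCommMonObj A.X] [HasCoequalizers D]
  [∀ X : D, PreservesColimitsOfSize.{0, 0} (tensorLeft X)]
  [∀ X : D, PreservesColimitsOfSize.{0, 0} (tensorRight X)]

/-- Both sides insert the unit object between X and Y and absorb it, once by the right unitor of X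
and once by the left unitor of Y. The triangle axiom identifies them. -/
theorem μ_balanced (X Y : C) : (U.obj X).act ▷ L.obj Y ≫ Functor.LaxMonoidal.μ L X Y =
    (α_ _ _ _).hom ≫ L.obj X ◁ (β_ A.X (L.obj Y)).hom ≫ L.obj X ◁ (U.obj Y).act ≫
      Functor.LaxMonoidal.μ L X Y := by
  simp only [comp_whiskerRight, MonoidalCategory.whiskerLeft_comp, Category.assoc]
  rw [μ_natural_left, μ_natural_right, ← MonoidalCategory.whiskerLeft_comp_assoc _ (β_ _ _).hom,
    ← BraidedCategory.braiding_naturality_left, MonoidalCategory.whiskerLeft_comp_assoc,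
    ← MonoidalCategory.whiskerLeft_comp_assoc _ (β_ _ _).hom,
    ← Functor.LaxBraided.braided, MonoidalCategory.whiskerLeft_comp_assoc, μ_natural_right_assoc,
    whiskerLeft_μ_comp_μ_assoc, ← associator_naturality_middle_assoc, Iso.hom_inv_id_assoc,
    ← L.map_comp, ← L.map_comp]
  simp

/-- The morphism `L X ⊗_A L Y ⟶ L (X ⊗ Y)`. -/
noncomputable def tensorator (X Y : C) : U.obj X ⊗ U.obj Y ⟶ U.obj (X ⊗ Y) where
  hom := prDesc (Functor.LaxMonoidal.μ L X Y) (U.μ_balanced X Y)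
  act_hom := by
    rw [← cancel_epi (pr _ _ ▷ A.X), ← Category.assoc, pr_act, ← comp_whiskerRight_assoc,
      pr_desc, Category.assoc, Category.assoc, pr_desc]
    simp only [MonoidalCategory.whiskerLeft_comp, Category.assoc]
    rw [← whisker_exchange_assoc, μ_natural_right, whiskerLeft_μ_comp_μ_assoc]
    simp

theorem pr_tensorator (X Y : C) :
    pr (U.obj X) (U.obj Y) ≫ (U.tensorator X Y).hom = Functor.LaxMonoidal.μ L X Y :=
  pr_desc _ (U.μ_balanced X Y)

/-- The unit comparison morphism. -/
noncomputable def unitMor : 𝟙_ (LocMod A) ⟶ U.obj (𝟙_ C) where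
  hom := U.hom
  act_hom := by
    change μ ≫ U.hom = U.hom ▷ A.X ≫ _
    rw [U.mul_hom, MonoidalCategory.tensorHom_def, Category.assoc, unitors_equal]

/-- This identity and the coherence identities below are checked after composition with the
epimorphisms onto the tensor products over A, where they become the axioms of a lax braided functor
for L. -/
theorem tensorator_natural_left {X X' : C} (f : X ⟶ X') (Y : C) :
    U.functor.map f ▷ U.obj Y ≫ U.tensorator X' Y =
      U.tensorator X Y ≫ U.functor.map (f ▷ Y) := by
  ext
  rw [← cancel_epi (pr _ _), comp_hom, comp_hom, ← Category.assoc, pr_whiskerRight,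
    Category.assoc, pr_tensorator, ← Category.assoc, pr_tensorator]
  exact μ_natural_left L f Y

theorem tensorator_natural_right {X X' : C} (Y : C) (f : X ⟶ X') :
    U.obj Y ◁ U.functor.map f ≫ U.tensorator Y X' =
      U.tensorator Y X ≫ U.functor.map (Y ◁ f) := by
  ext
  rw [← cancel_epi (pr _ _), comp_hom, comp_hom, ← Category.assoc, pr_whiskerLeft,
    Category.assoc, pr_tensorator, ← Category.assoc, pr_tensorator]
  exact μ_natural_right L Y f

theorem tensorator_assoc (X Y Z : C) :
    U.tensorator X Y ▷ U.obj Z ≫ U.tensorator (X ⊗ Y) Z ≫ U.functor.map (α_ X Y Z).hom =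
      (α_ _ _ _).hom ≫ U.obj X ◁ U.tensorator Y Z ≫ U.tensorator X (Y ⊗ Z) := by
  ext
  rw [← cancel_epi (pr (U.obj X) (U.obj Y) ▷ (U.obj Z).X ≫ pr (U.obj X ⊗ U.obj Y) (U.obj Z))]
  simp only [comp_hom, Category.assoc]
  rw [← Category.assoc (pr (U.obj X ⊗ U.obj Y) (U.obj Z)), pr_whiskerRight, Category.assoc,
    ← Category.assoc (pr (U.obj (X ⊗ Y)) (U.obj Z)), pr_tensorator,
    ← comp_whiskerRight_assoc, pr_tensorator]
  have h := congrArg (fun t => t ≫ (U.obj X ◁ U.tensorator Y Z).hom ≫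
    (U.tensorator X (Y ⊗ Z)).hom) (pr_assoc (U.obj X) (U.obj Y) (U.obj Z))
  simp only [Category.assoc] at h
  rw [h, ← Category.assoc (pr (U.obj X) (U.obj Y ⊗ U.obj Z)), pr_whiskerLeft, Category.assoc,
    pr_tensorator, ← MonoidalCategory.whiskerLeft_comp_assoc, pr_tensorator]
  exact associativity L X Y Z

/-- The unitor is transported from bimodules, where it is induced by the left action; for a local
module the left action is the right one precomposed with the braiding. -/
theorem _root_.LocMod.pr_leftUnitor (M : LocMod A) :
    pr (𝟙_ (LocMod A)) M ≫ (λ_ M).hom.hom = (β_ A.X M.X).hom ≫ M.act := by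
  have h1 : pr (𝟙_ (LocMod A)) M ≫ (unitIso.inv ▷ M.toBimod).hom =
      bproj (Bimod.regular A) M.toBimod := by
    refine (bproj_whiskerRight unitIso.inv M.toBimod).trans ?_
    refine Eq.trans ?_ (Category.id_comp _)
    congr 1
    exact id_whiskerRight _ _
  have h0 : (λ_ M).hom.hom = (𝟙 _ ≫ (unitIso.inv ⊗ₘ 𝟙 M.toBimod).hom) ≫
      (Bimod.leftUnitorBimod M.toBimod).hom.hom := rfl
  rw [tensorHom_id, Category.id_comp] at h0
  refine (congrArg (fun t => pr (𝟙_ (LocMod A)) M ≫ t) h0).trans ?_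
  refine (Category.assoc _ _ _).symm.trans ?_
  refine (congrArg (fun t => t ≫ _) h1).trans ?_
  exact coequalizer.π_desc _ _

theorem _root_.LocMod.pr_rightUnitor (M : LocMod A) :
    pr M (𝟙_ (LocMod A)) ≫ (ρ_ M).hom.hom = M.act := by
  have h1 : pr M (𝟙_ (LocMod A)) ≫ (M.toBimod ◁ unitIso.inv).hom =
      bproj M.toBimod (Bimod.regular A) := by
    refine (bproj_whiskerLeft M.toBimod unitIso.inv).trans ?_
    refine Eq.trans ?_ (Category.id_comp _)
    congr 1
    exact MonoidalCategory.whiskerLeft_id _ _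
  have h0 : (ρ_ M).hom.hom = (𝟙 _ ≫ (𝟙 M.toBimod ⊗ₘ unitIso.inv).hom) ≫
      (Bimod.rightUnitorBimod M.toBimod).hom.hom := rfl
  rw [id_tensorHom, Category.id_comp] at h0
  refine (congrArg (fun t => pr M (𝟙_ (LocMod A)) ≫ t) h0).trans ?_
  refine (Category.assoc _ _ _).symm.trans ?_
  refine (congrArg (fun t => t ≫ _) h1).trans ?_
  exact coequalizer.π_desc _ _

theorem tensorator_left_unitality (X : C) : (λ_ (U.obj X)).hom =
    U.unitMor ▷ U.obj X ≫ U.tensorator (𝟙_ C) X ≫ U.functor.map (λ_ X).hom := by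
  ext
  rw [← cancel_epi (pr _ _)]
  refine (pr_leftUnitor _).trans ?_
  have h : pr (𝟙_ (LocMod A)) (U.obj X) ≫ (U.unitMor ▷ U.obj X).hom ≫
      (U.tensorator (𝟙_ C) X).hom ≫ L.map (λ_ X).hom =
        U.hom ▷ L.obj X ≫ Functor.LaxMonoidal.μ L _ _ ≫ L.map (λ_ X).hom := by
    rw [← Category.assoc, pr_whiskerRight, Category.assoc, ← Category.assoc (pr _ _),
      pr_tensorator]
    rfl
  refine Eq.trans ?_ h.symm
  rw [← BraidedCategory.braiding_naturality_left_assoc, ← Functor.LaxBraided.braided_assoc,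
    ← L.map_comp, braiding_rightUnitor]

theorem tensorator_right_unitality (X : C) : (ρ_ (U.obj X)).hom =
    U.obj X ◁ U.unitMor ≫ U.tensorator X (𝟙_ C) ≫ U.functor.map (ρ_ X).hom := by
  ext
  rw [← cancel_epi (pr _ _)]
  refine (pr_rightUnitor _).trans ?_
  have h : pr (U.obj X) (𝟙_ (LocMod A)) ≫ (U.obj X ◁ U.unitMor).hom ≫
      (U.tensorator X (𝟙_ C)).hom ≫ L.map (ρ_ X).hom =
        L.obj X ◁ U.hom ≫ Functor.LaxMonoidal.μ L _ _ ≫ L.map (ρ_ X).hom := by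
    rw [← Category.assoc, pr_whiskerLeft, Category.assoc, ← Category.assoc (pr _ _),
      pr_tensorator]
    rfl
  exact h.symm

theorem tensorator_braided (X Y : C) : U.tensorator X Y ≫ U.functor.map (β_ X Y).hom =
    (β_ (U.obj X) (U.obj Y)).hom ≫ U.tensorator Y X := by
  ext
  rw [← cancel_epi (pr _ _), comp_hom, comp_hom, ← Category.assoc, pr_tensorator,
    ← Category.assoc]
  refine Eq.trans ?_ (congrArg (fun t => t ≫ (U.tensorator Y X).hom) (pr_braid _ _).symm)
  rw [Category.assoc, pr_tensorator]
  exact Functor.LaxBraided.braided X Y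

/-- A lax braided functor is a braided functor to local modules if its comparison morphisms induce
isomorphisms on tensor products over `A`. -/
@[reducible] noncomputable def braidedFunctor [IsIso U.hom] [∀ X Y, IsIso (U.tensorator X Y)] :
    U.functor.Braided :=
  haveI : IsIso U.unitMor.hom := inferInstanceAs (IsIso U.hom)
  haveI : IsIso U.unitMor := isIso_of_isIso_hom _
  letI : U.functor.Monoidal := Functor.CoreMonoidal.toMonoidal
    { εIso := asIso U.unitMor
      μIso := fun X Y => asIso (U.tensorator X Y)
      μIso_hom_natural_left := fun f Y => U.tensorator_natural_left f Y
      μIso_hom_natural_right := fun Y f => U.tensorator_natural_right Y f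
      associativity := fun X Y Z => U.tensorator_assoc X Y Z
      left_unitality := fun X => U.tensorator_left_unitality X
      right_unitality := fun X => U.tensorator_right_unitality X }
  { braided := fun X Y => U.tensorator_braided X Y }

end UnitHom
end LocMod
end

/-! ### Inflation along a quotient map, twisted by a 2-cochain. -/

section
attribute [local instance] Fintype.ofFinite
open scoped TensorProduct Classical

/-- A 2-cochain `η` on `H` by which `α` differs from the inflation of `β` along `π : H → Q`. -/
structure Gauge {H Q k : Type u} [Group H] [Group Q] [Field k] (π : H →* Q) (α : Cocycle3 H k)
    (β : Cocycle3 Q k) where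
  η : H → H → kˣ
  one_left : ∀ u, η 1 u = 1
  one_right : ∀ u, η u 1 = 1
  cocycle : ∀ u v w, α.toFun u v w * η u v * η (u * v) w =
    β.toFun (π u) (π v) (π w) * η v w * η u (v * w)

namespace Gauge
variable {H Q k : Type u} [Group H] [Group Q] [Field k] {π : H →* Q} {α : Cocycle3 H k}
  {β : Cocycle3 Q k} (Γ : Gauge π α β)

/-- `λ(h,u) = η(h,u) / η(huh⁻¹,h)`. -/
def lam (h u : H) : kˣ := Γ.η h u * (Γ.η (h * u * h⁻¹) h)⁻¹

theorem lam_one_left (u : H) : Γ.lam 1 u = 1 := by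
  simp [lam, Γ.one_left, Γ.one_right]

theorem lam_one_right (u : H) : Γ.lam u 1 = 1 := by
  simp [lam, Γ.one_left, Γ.one_right]

/-- Conjugation by u fixes u, so numerator and denominator coincide. For this reason inflation
preserves twists. -/
theorem lam_self (u : H) : Γ.lam u u = 1 := by
  simp [lam]

/-- What makes `h.v[u] = λ(h,u) (π(h).v)[huh⁻¹]` an α-projective action when the action on V is
β-projective. Each factor of the act cochain contributes one instance of the cocycle relation of the
gauge. -/
theorem lam_mul (f g h : H) : Γ.lam (f * g) h * β.act (π f) (π g) (π h) =
    α.act f g h * Γ.lam f (g * h * g⁻¹) * Γ.lam g h := by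
  have h1 := Γ.cocycle f g h
  have h2 := Γ.cocycle f (g * h * g⁻¹) g
  have h3 := Γ.cocycle (f * g * h * g⁻¹ * f⁻¹) f g
  simp only [lam, Cocycle3.act]
  simp only [mul_assoc, mul_inv_rev, inv_mul_cancel_left, inv_mul_cancel, mul_one, inv_inv,
    map_mul, map_inv] at *
  apply_fun Additive.ofMul at h1 h2 h3 ⊢
  simp only [ofMul_mul, ofMul_inv] at *
  linear_combination (norm := abel1) h1 - h2 + h3

/-- Equivariance of the comparison morphism `v[u] ⊗ w[u'] ↦ η(u,u') (v ⊗ w)[uu']`, again from three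
instances of the relation between α and β. -/
theorem lam_ten (f u v : H) : α.ten f u v * Γ.lam f u * Γ.lam f v *
    Γ.η (f * u * f⁻¹) (f * v * f⁻¹) =
      Γ.η u v * Γ.lam f (u * v) * β.ten (π f) (π u) (π v) := by
  have h1 := Γ.cocycle f u v
  have h2 := Γ.cocycle (f * u * f⁻¹) f v
  have h3 := Γ.cocycle (f * u * f⁻¹) (f * v * f⁻¹) f
  simp only [lam, Cocycle3.ten]
  simp only [mul_assoc, mul_inv_rev, inv_mul_cancel_left, inv_mul_cancel, mul_one, inv_inv,
    map_mul, map_inv] at *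
  apply_fun Additive.ofMul at h1 h2 h3 ⊢
  simp only [ofMul_mul, ofMul_inv] at *
  linear_combination (norm := abel1) h1 - h2 + h3

variable [Finite H] [Finite Q]
open ZObj CategoryTheory MonoidalCategory

/-- The space of maps `n : H → V` such that `n u` has degree `π u`. -/
def inflSub (π : H →* Q) (V : ZObj β) : Submodule k (H → V.V) where
  carrier := {n | ∀ u, V.p (π u) (n u) = n u}
  add_mem' ha hb u := by simp only [Pi.add_apply, map_add, ha u, hb u]
  zero_mem' u := by simp
  smul_mem' c a ha u := by simp only [Pi.smul_apply, map_smul, ha u]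

/-- The map supported at `u` with value the component of `v` of degree `π u`. -/
noncomputable def sgl (π : H →* Q) (V : ZObj β) (u : H) : V.V →ₗ[k] inflSub π V :=
  LinearMap.codRestrict _ (LinearMap.single k (fun _ => V.V) u ∘ₗ V.p (π u)) fun v w => by
    by_cases h : w = u
    · subst h; simp [V.p_same]
    · simp [h]

theorem sgl_apply (V : ZObj β) (u : H) (v : V.V) (w : H) :
    (sgl π V u v).1 w = if w = u then V.p (π u) v else 0 := by
  change Pi.single (M := fun _ => V.V) u (V.p (π u) v) w = _
  rw [Pi.single_apply]

theorem sum_sgl (V : ZObj β) (n : inflSub π V) : ∑ u, sgl π V u (n.1 u) = n := by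
  refine Subtype.ext (funext fun w => ?_)
  rw [AddSubmonoidClass.coe_finsetSum, Finset.sum_apply, Finset.sum_eq_single w]
  · rw [sgl_apply, if_pos rfl]; exact n.2 w
  · intro b _ hb
    rw [sgl_apply, if_neg hb.symm]
  · simp

theorem sgl_ext {V : ZObj β} {M : Type*} [AddCommMonoid M] [Module k M]
    (φ ψ : inflSub π V →ₗ[k] M)
    (h : ∀ u v, V.Deg (π u) v → φ (sgl π V u v) = ψ (sgl π V u v)) (n : inflSub π V) :
    φ n = ψ n := by
  rw [← sum_sgl V n, map_sum, map_sum]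
  exact Finset.sum_congr rfl fun u _ => h u _ (n.2 u)

/-- The projection onto degree `u`. -/
noncomputable def inflP (π : H →* Q) (V : ZObj β) (u : H) : inflSub π V →ₗ[k] inflSub π V :=
  sgl π V u ∘ₗ LinearMap.proj u ∘ₗ (inflSub π V).subtype

/-- `h.v[u] = λ(h,u) (π(h).v)[huh⁻¹]`. -/
noncomputable def inflρ (V : ZObj β) (h : H) : inflSub π V →ₗ[k] inflSub π V :=
  ∑ u, (Γ.lam h u : k) • sgl π V (h * u * h⁻¹) ∘ₗ V.ρ (π h) ∘ₗ LinearMap.proj u ∘ₗ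
    (inflSub π V).subtype

theorem inflP_sgl {V : ZObj β} (u w : H) {v : V.V} (hv : V.Deg (π u) v) :
    inflP π V w (sgl π V u v) = if w = u then sgl π V u v else 0 := by
  change sgl π V w ((sgl π V u v).1 w) = _
  rw [sgl_apply]
  split_ifs with h
  · subst h; rw [show V.p (π w) v = v from hv]
  · exact map_zero _

theorem inflρ_sgl {V : ZObj β} (h u : H) {v : V.V} (hv : V.Deg (π u) v) :
    Γ.inflρ V h (sgl π V u v) = (Γ.lam h u : k) • sgl π V (h * u * h⁻¹) (V.ρ (π h) v) := by
  simp only [inflρ, LinearMap.sum_apply, LinearMap.smul_apply, LinearMap.comp_apply,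
    LinearMap.proj_apply, Submodule.subtype_apply, sgl_apply]
  rw [Finset.sum_eq_single u]
  · rw [if_pos rfl, show V.p (π u) v = v from hv]
  · intro b _ hb
    rw [if_neg hb]; simp
  · simp

theorem deg_ρ_conj {V : ZObj β} {u : H} {v : V.V} (hv : V.Deg (π u) v) (h : H) :
    V.Deg (π (h * u * h⁻¹)) (V.ρ (π h) v) := by
  rw [map_mul, map_mul, map_inv]; exact hv.ρ _

/-- The inflation of an object of `Z(Q,β)` to an object of `Z(H,α)`. -/
noncomputable def inflObj (V : ZObj β) : ZObj α where
  V := inflSub π V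
  p := inflP π V
  p_same g := sgl_ext (inflP π V g ∘ₗ inflP π V g) _ fun u v hv => by
    rw [LinearMap.comp_apply, inflP_sgl u g hv]
    split_ifs with h
    · rw [inflP_sgl u g hv, if_pos h]
    · exact map_zero _
  p_ne g h n hgh := sgl_ext (inflP π V g ∘ₗ inflP π V h) 0 (fun u v hv => by
    rw [LinearMap.comp_apply, inflP_sgl u h hv]
    split_ifs with h'
    · rw [inflP_sgl u g hv, if_neg (fun e => hgh (e.trans h'.symm))]; rfl
    · exact map_zero _) n
  p_sum n := sum_sgl V n
  ρ := Γ.inflρ V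
  ρ_one := sgl_ext _ LinearMap.id fun u v hv => by
    rw [inflρ_sgl _ _ _ hv, lam_one_left, map_one, V.ρ_one]
    simp
  ρ_p f g := sgl_ext (Γ.inflρ V f ∘ₗ inflP π V g) (inflP π V (f * g * f⁻¹) ∘ₗ Γ.inflρ V f)
    fun u v hv => by
      rw [LinearMap.comp_apply, LinearMap.comp_apply, inflP_sgl u g hv, inflρ_sgl _ _ _ hv,
        map_smul, inflP_sgl _ _ (deg_ρ_conj hv f)]
      have : f * g * f⁻¹ = f * u * f⁻¹ ↔ g = u := by simp
      simp only [this]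
      split_ifs
      · rw [inflρ_sgl _ _ _ hv]
      · simp
  ρ_mul f g h := sgl_ext (Γ.inflρ V (f * g) ∘ₗ inflP π V h)
    ((α.act f g h : k) • (Γ.inflρ V f ∘ₗ Γ.inflρ V g ∘ₗ inflP π V h)) fun u v hv => by
      simp only [LinearMap.comp_apply, LinearMap.smul_apply, inflP_sgl u h hv]
      split_ifs with hu
      · subst hu
        rw [inflρ_sgl _ _ _ hv, inflρ_sgl _ _ _ hv, map_smul, inflρ_sgl _ _ _ (deg_ρ_conj hv g),
          map_mul, hv.ρ_mul, map_smul, smul_smul, smul_smul, smul_smul,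
          show f * g * h * (f * g)⁻¹ = f * (g * h * g⁻¹) * f⁻¹ by group]
        congr 1
        have := congrArg (fun t : kˣ => (t : k)) (Γ.lam_mul f g h)
        push_cast at this
        linear_combination this
      · simp

/-- The element `v[u]` of the inflation of `V`: the map supported at `u` with value the component
of `v` of degree `π u`. -/
noncomputable def sg (V : ZObj β) (u : H) : V.V →ₗ[k] (Γ.inflObj V).V := sgl π V u

/-- The value of an element of the inflation of `V` at `u`. -/
noncomputable def val (V : ZObj β) (u : H) : (Γ.inflObj V).V →ₗ[k] V.V :=
  LinearMap.proj u ∘ₗ (inflSub π V).subtype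

theorem val_sg {V : ZObj β} {u : H} {v : V.V} (hv : V.Deg (π u) v) (w : H) :
    Γ.val V w (Γ.sg V u v) = if w = u then v else 0 := by
  refine (sgl_apply V u v w).trans ?_
  rw [show V.p (π u) v = v from hv]

theorem val_sg_self {V : ZObj β} {u : H} {v : V.V} (hv : V.Deg (π u) v) :
    Γ.val V u (Γ.sg V u v) = v := (Γ.val_sg hv u).trans (if_pos rfl)

theorem sg_ext {V : ZObj β} {M : Type*} [AddCommMonoid M] [Module k M]
    (φ ψ : (Γ.inflObj V).V →ₗ[k] M)
    (h : ∀ u v, V.Deg (π u) v → φ (Γ.sg V u v) = ψ (Γ.sg V u v)) (n : (Γ.inflObj V).V) :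
    φ n = ψ n := sgl_ext φ ψ h n

theorem deg_sg {V : ZObj β} {u : H} {v : V.V} (hv : V.Deg (π u) v) :
    (Γ.inflObj V).Deg u (Γ.sg V u v) :=
  (inflP_sgl u u hv).trans (if_pos rfl)

theorem exists_sg {V : ZObj β} {u : H} {n : (Γ.inflObj V).V} (hn : (Γ.inflObj V).Deg u n) :
    ∃ v, V.Deg (π u) v ∧ n = Γ.sg V u v :=
  ⟨n.1 u, n.2 u, Eq.symm hn⟩

theorem ρ_sg {V : ZObj β} (h u : H) {v : V.V} (hv : V.Deg (π u) v) :
    (Γ.inflObj V).ρ h (Γ.sg V u v) =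
      (Γ.lam h u : k) • Γ.sg V (h * u * h⁻¹) (V.ρ (π h) v) := Γ.inflρ_sgl h u hv

/-- The inflation of a linear map. -/
noncomputable def inflMapLin {V W : ZObj β} (φ : V.V →ₗ[k] W.V) :
    (Γ.inflObj V).V →ₗ[k] (Γ.inflObj W).V := ∑ u, Γ.sg W u ∘ₗ φ ∘ₗ Γ.val V u

theorem inflMapLin_sg {V W : ZObj β} (φ : V.V →ₗ[k] W.V) {u : H} {v : V.V}
    (hv : V.Deg (π u) v) : Γ.inflMapLin φ (Γ.sg V u v) = Γ.sg W u (φ v) := by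
  simp only [inflMapLin, LinearMap.sum_apply, LinearMap.comp_apply, Γ.val_sg hv]
  rw [Finset.sum_eq_single u]
  · rw [if_pos rfl]
  · intro b _ hb
    rw [if_neg hb, map_zero, map_zero]
  · simp

/-- The inflation of a morphism. -/
noncomputable def inflMap {V W : ZObj β} (f : V ⟶ W) : Γ.inflObj V ⟶ Γ.inflObj W where
  lin := Γ.inflMapLin f.lin
  p_comm := p_comm_of_deg (X := Γ.inflObj V) (Γ.inflObj W) _ fun a n hn => by
    obtain ⟨v, hv, rfl⟩ := Γ.exists_sg hn
    rw [Γ.inflMapLin_sg _ hv]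
    exact Γ.deg_sg (f.deg hv)
  ρ_comm h := Γ.sg_ext (Γ.inflMapLin f.lin ∘ₗ (Γ.inflObj V).ρ h)
    ((Γ.inflObj W).ρ h ∘ₗ Γ.inflMapLin f.lin) fun u v hv => by
      rw [LinearMap.comp_apply, LinearMap.comp_apply, ρ_sg _ _ _ hv, map_smul,
        Γ.inflMapLin_sg _ hv, Γ.inflMapLin_sg _ (deg_ρ_conj hv h), ρ_sg _ _ _ (f.deg hv),
        f.ρ_comm]

theorem inflMap_sg {V W : ZObj β} (f : V ⟶ W) {u : H} {v : V.V} (hv : V.Deg (π u) v) :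
    Hom.lin (Γ.inflMap f) (Γ.sg V u v) = Γ.sg W u (f.lin v) := Γ.inflMapLin_sg f.lin hv

/-- The inflation functor. -/
@[reducible] noncomputable def infl : ZObj β ⥤ ZObj α where
  obj V := Γ.inflObj V
  map f := Γ.inflMap f
  map_id V := hom_ext _ _ (LinearMap.ext (Γ.sg_ext _ LinearMap.id fun _ _ hv =>
    Γ.inflMap_sg (𝟙 V) hv))
  map_comp f g := hom_ext _ _ (LinearMap.ext (Γ.sg_ext _ _ fun _ _ hv => by
    rw [ZObj.comp_apply, Γ.inflMap_sg _ hv, Γ.inflMap_sg _ hv, Γ.inflMap_sg _ (f.deg hv),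
      ZObj.comp_apply]))

/-- `v[u] ⊗ w[u'] ↦ η(u,u') (v ⊗ w)[uu']`. -/
noncomputable def inflTenLin (V W : ZObj β) :
    (Γ.inflObj V).V ⊗[k] (Γ.inflObj W).V →ₗ[k] (Γ.inflObj (V ⊗ W)).V :=
  ∑ u, ∑ u', (Γ.η u u' : k) • Γ.sg (V ⊗ W) (u * u') ∘ₗ
    TensorProduct.map (Γ.val V u) (Γ.val W u')

theorem inflTenLin_sg {V W : ZObj β} {u u' : H} {v : V.V} {w : W.V} (hv : V.Deg (π u) v)
    (hw : W.Deg (π u') w) : Γ.inflTenLin V W (Γ.sg V u v ⊗ₜ Γ.sg W u' w) =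
      (Γ.η u u' : k) • Γ.sg (V ⊗ W) (u * u') (tm v w) := by
  have key (a b : H) : ((Γ.η a b : k) • Γ.sg (V ⊗ W) (a * b) ∘ₗ
      TensorProduct.map (Γ.val V a) (Γ.val W b)) (Γ.sg V u v ⊗ₜ Γ.sg W u' w) =
      (Γ.η a b : k) • Γ.sg (V ⊗ W) (a * b) (tm (if a = u then v else 0)
        (if b = u' then w else 0)) := by
    rw [← Γ.val_sg hv, ← Γ.val_sg hw]
    rfl
  simp only [inflTenLin, LinearMap.sum_apply, key]
  rw [Finset.sum_eq_single u, Finset.sum_eq_single u']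
  · rw [if_pos rfl, if_pos rfl]
  · intro b _ hb
    rw [if_neg hb, tm_zero, map_zero, smul_zero]
  · simp
  · intro b _ hb
    refine Finset.sum_eq_zero fun c _ => ?_
    rw [if_neg hb, zero_tm, map_zero, smul_zero]
  · simp

theorem deg_tm_map {V W : ZObj β} {u u' : H} {v : V.V} {w : W.V} (hv : V.Deg (π u) v)
    (hw : W.Deg (π u') w) : (V ⊗ W).Deg (π (u * u')) (tm v w) := by
  rw [map_mul]; exact hv.tm hw

/-- The comparison morphism of the inflation functor. -/
noncomputable def inflTen (V W : ZObj β) :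
    Γ.inflObj V ⊗ Γ.inflObj W ⟶ Γ.inflObj (V ⊗ W) :=
  homMk₂ (Γ.inflTenLin V W)
    (fun a b x y hx hy => by
      obtain ⟨v, hv, rfl⟩ := Γ.exists_sg hx
      obtain ⟨w, hw, rfl⟩ := Γ.exists_sg hy
      rw [Γ.inflTenLin_sg hv hw]
      exact (Γ.deg_sg (deg_tm_map hv hw)).smul _)
    (fun f a b x y hx hy => by
      obtain ⟨v, hv, rfl⟩ := Γ.exists_sg hx
      obtain ⟨w, hw, rfl⟩ := Γ.exists_sg hy
      rw [Γ.inflTenLin_sg hv hw, map_smul, Γ.ρ_sg _ _ hv, Γ.ρ_sg _ _ hw,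
        TensorProduct.smul_tmul_smul, map_smul,
        Γ.inflTenLin_sg (deg_ρ_conj hv f) (deg_ρ_conj hw f),
        Γ.ρ_sg _ _ (deg_tm_map hv hw), ρ_tm hv hw, map_smul, smul_smul, smul_smul, smul_smul,
        smul_smul, show f * a * f⁻¹ * (f * b * f⁻¹) = f * (a * b) * f⁻¹ by group]
      congr 1
      have := congrArg (fun t : kˣ => (t : k)) (Γ.lam_ten f a b)
      push_cast at this
      linear_combination this)

theorem inflTen_sg {V W : ZObj β} {u u' : H} {v : V.V} {w : W.V} (hv : V.Deg (π u) v)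
    (hw : W.Deg (π u') w) :
    Hom.lin (Γ.inflTen V W) (tm (Γ.sg V u v) (Γ.sg W u' w)) =
      (Γ.η u u' : k) • Γ.sg (V ⊗ W) (u * u') (tm v w) := Γ.inflTenLin_sg hv hw

/-- The unit morphism of the inflation functor. -/
noncomputable def inflUnit : 𝟙_ (ZObj α) ⟶ Γ.inflObj (𝟙_ (ZObj β)) where
  lin := Γ.sg (𝟙_ (ZObj β)) 1
  p_comm g c := by
    have h1 : (𝟙_ (ZObj β)).Deg (π 1) (c : k) := by rw [map_one]; exact deg_unit (α := β) c
    have h2 : (𝟙_ (ZObj α)).Deg 1 (c : k) := deg_unit (α := α) c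
    rw [h2.p_eq]
    refine Eq.trans ?_ (inflP_sgl 1 g h1).symm
    split_ifs
    · rfl
    · exact map_zero _
  ρ_comm f c := by
    have h1 : (𝟙_ (ZObj β)).Deg (π 1) (c : k) := by rw [map_one]; exact deg_unit (α := β) c
    refine Eq.symm ((Γ.ρ_sg f 1 h1).trans ?_)
    rw [lam_one_right, mul_one, mul_inv_cancel, Units.val_one, one_smul]
    rfl

/-- Associativity is the relation `Γ.cocycle`. Compatibility with braidings is the definition of
`lam`, namely η(a,b) = λ(a,b) η(aba⁻¹,a). -/
noncomputable instance : Γ.infl.LaxBraided where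
  ε := Γ.inflUnit
  μ := Γ.inflTen
  μ_natural_left f W := hom_ext₂ fun a b x y hx hy => by
    obtain ⟨v, hv, rfl⟩ := Γ.exists_sg hx
    obtain ⟨w, hw, rfl⟩ := Γ.exists_sg hy
    simp only [ZObj.comp_apply, whiskerRight_tm, Γ.inflMap_sg _ hv,
      Γ.inflMap_sg _ (deg_tm_map hv hw), Γ.inflTen_sg (f.deg hv) hw,
      Γ.inflTen_sg hv hw, map_smul]
  μ_natural_right V f := hom_ext₂ fun a b x y hx hy => by
    obtain ⟨v, hv, rfl⟩ := Γ.exists_sg hx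
    obtain ⟨w, hw, rfl⟩ := Γ.exists_sg hy
    simp only [ZObj.comp_apply, whiskerLeft_tm, Γ.inflMap_sg _ hw,
      Γ.inflMap_sg _ (deg_tm_map hv hw), Γ.inflTen_sg hv (f.deg hw),
      Γ.inflTen_sg hv hw, map_smul]
  associativity X Y Z := hom_ext₃ fun a b c x y z hx hy hz => by
    obtain ⟨x, hx', rfl⟩ := Γ.exists_sg hx
    obtain ⟨y, hy', rfl⟩ := Γ.exists_sg hy
    obtain ⟨z, hz', rfl⟩ := Γ.exists_sg hz
    simp only [ZObj.comp_apply, whiskerRight_tm, whiskerLeft_tm, Γ.inflTen_sg hx' hy', smul_tm,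
      tm_smul, map_smul, Γ.inflTen_sg (deg_tm_map hx' hy') hz', associator_hom_tm hx hy hz,
      Γ.inflTen_sg hy' hz', Γ.inflTen_sg hx' (deg_tm_map hy' hz'),
      Γ.inflMap_sg _ (deg_tm_map (deg_tm_map hx' hy') hz'),
      associator_hom_tm hx' hy' hz', smul_smul]
    rw [mul_assoc a b c]
    congr 1
    have := congrArg (fun t : kˣ => (t : k)) (Γ.cocycle a b c)
    push_cast at this ⊢
    field_simp
    linear_combination this
  left_unitality X := hom_ext₂ fun a b c x hc hx => by
    obtain ⟨x, hx', rfl⟩ := Γ.exists_sg hx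
    have h1 : (𝟙_ (ZObj β)).Deg (π 1) (c : k) := by rw [map_one]; exact deg_unit (α := β) c
    simp only [ZObj.comp_apply, whiskerRight_tm]
    refine (leftUnitor_hom_tm _ c _).trans ?_
    refine Eq.symm ((congrArg (Hom.lin (Γ.inflMap (λ_ X).hom))
      (Γ.inflTen_sg h1 hx')).trans ?_)
    rw [map_smul, Γ.inflMap_sg _ (deg_tm_map h1 hx'),
      Γ.one_left, one_mul, Units.val_one, one_smul, ← map_smul]
    exact congrArg _ (leftUnitor_hom_tm _ c x)
  right_unitality X := hom_ext₂ fun a b x c hx hc => by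
    obtain ⟨x, hx', rfl⟩ := Γ.exists_sg hx
    have h1 : (𝟙_ (ZObj β)).Deg (π 1) (c : k) := by rw [map_one]; exact deg_unit (α := β) c
    simp only [ZObj.comp_apply, whiskerLeft_tm]
    refine (rightUnitor_hom_tm _ c _).trans ?_
    refine Eq.symm ((congrArg (Hom.lin (Γ.inflMap (ρ_ X).hom))
      (Γ.inflTen_sg hx' h1)).trans ?_)
    rw [map_smul, Γ.inflMap_sg _ (deg_tm_map hx' h1),
      Γ.one_right, mul_one, Units.val_one, one_smul, ← map_smul]
    exact congrArg _ (rightUnitor_hom_tm _ c x)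
  braided X Y := hom_ext₂ fun a b x y hx hy => by
    obtain ⟨x, hx', rfl⟩ := Γ.exists_sg hx
    obtain ⟨y, hy', rfl⟩ := Γ.exists_sg hy
    simp only [ZObj.comp_apply, Γ.inflTen_sg hx' hy', map_smul,
      Γ.inflMap_sg _ (deg_tm_map hx' hy'), braiding_tm hx',
      braiding_tm hx, Γ.ρ_sg a b hy', smul_tm, Γ.inflTen_sg (deg_ρ_conj hy' a) hx',
      smul_smul, inv_mul_cancel_right]
    congr 1
    simp [lam]

end Gauge
end

/-! ### The transfer from H to G as a lax braided functor. -/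

section
attribute [local instance] Fintype.ofFinite
open scoped TensorProduct Classical

namespace Transfer
variable {G k : Type u} [Group G] [Finite G] [Field k] {α : Cocycle3 G k} {H : Subgroup G}
open ZObj CategoryTheory MonoidalCategory

/-- The transfer of an object of `Z(H,α|_H)` to `Z(G,α)`. -/
noncomputable def obj (V : ZObj (α.restrict H)) : ZObj α := V.transfer

variable {V W : ZObj (α.restrict H)}

/-- The value at `x`. -/
noncomputable def val (V : ZObj (α.restrict H)) (x : G) : (obj V).V →ₗ[k] V.V :=
  LinearMap.proj x ∘ₗ V.transferSub.subtype

theorem obj_ext {a b : (obj V).V} (h : ∀ x, val V x a = val V x b) : a = b :=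
  Subtype.ext (funext h)

/-- A linear map to the transfer from its values. -/
noncomputable def lift {M : Type*} [AddCommGroup M] [Module k M] (φ : G → M →ₗ[k] V.V)
    (h : ∀ m, (fun x => φ x m) ∈ V.transferSub) : M →ₗ[k] (obj V).V :=
  LinearMap.codRestrict V.transferSub (LinearMap.pi φ) h

theorem val_lift {M : Type*} [AddCommGroup M] [Module k M] (φ : G → M →ₗ[k] V.V)
    (h : ∀ m, (fun x => φ x m) ∈ V.transferSub) (x : G) (m : M) :
    val V x (lift φ h m) = φ x m := rfl

theorem deg_iff {f : G} {a : (obj V).V} :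
    (obj V).Deg f a ↔ ∀ x, V.pG (x⁻¹ * f * x) (val V x a) = val V x a :=
  ⟨fun h x => congrFun (V.deg_transfer h) x, fun h => Subtype.ext (funext h)⟩

theorem deg_val {f : G} {a : (obj V).V} (ha : (obj V).Deg f a) (x : G) :
    val V x a = 0 ∨ ∃ h : x⁻¹ * f * x ∈ H, V.Deg ⟨_, h⟩ (val V x a) :=
  V.deg_map_apply (V.deg_transfer ha) x

theorem val_ρ {f : G} {a : (obj V).V} (ha : (obj V).Deg f a) (g x : G) :
    val V x ((obj V).ρ g a) = (((α.act x⁻¹ g f)⁻¹ : kˣ) : k) • val V (g⁻¹ * x) a :=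
  V.mapρ_apply g f a.1 (V.deg_transfer ha) x

theorem val_mul {f : G} {a : (obj V).V} (ha : (obj V).Deg f a) (x : G) (h : H) :
    val V (x * h) a = (α.act (h : G)⁻¹ x⁻¹ f : k) • V.ρ h⁻¹ (val V x a) :=
  (V.mem_transferSub (V.deg_transfer ha)).1 a.2 x h

theorem pG_of_deg {h : H} {v : V.V} (hv : V.Deg h v) {g : G} (hg : (h : G) = g) :
    V.pG g v = v := by
  subst hg
  exact (V.pG_coe h v).trans hv

theorem mem_transferSub {a : G → V.V} {f : G} (hd : ∀ x, V.pG (x⁻¹ * f * x) (a x) = a x)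
    (h : ∀ (x : G) (h : H), a (x * h) = (α.act (h : G)⁻¹ x⁻¹ f : k) • V.ρ h⁻¹ (a x)) :
    a ∈ V.transferSub :=
  (V.mem_transferSub (funext hd)).2 h

theorem lin_pG (φ : V ⟶ W) (g : G) (v : V.V) : φ.lin (V.pG g v) = W.pG g (φ.lin v) := by
  unfold pG
  split_ifs
  · exact φ.p_comm _ _
  · exact map_zero _

/-- Composition with the quotient map by `transferSub` turns membership into the vanishing of a
linear map, which may be tested on homogeneous elements. The equivariance condition carries a scalar
depending on the degree and has a simple form only there. -/
theorem lift_mem {X : ZObj α} (φ : G → X.V →ₗ[k] V.V)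
    (hd : ∀ f m, X.Deg f m → ∀ x, V.pG (x⁻¹ * f * x) (φ x m) = φ x m)
    (h : ∀ f m, X.Deg f m → ∀ (x : G) (h : H),
      φ (x * h) m = (α.act (h : G)⁻¹ x⁻¹ f : k) • V.ρ h⁻¹ (φ x m)) (m : X.V) :
    (fun x => φ x m) ∈ V.transferSub := by
  have : V.transferSub.mkQ ∘ₗ LinearMap.pi φ = 0 := lin_ext fun f m hm =>
    (Submodule.Quotient.mk_eq_zero _).2 (mem_transferSub (hd f m hm) (h f m hm))
  exact (Submodule.Quotient.mk_eq_zero _).1 (LinearMap.congr_fun this m)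

theorem map_mem (φ : V ⟶ W) (a : (obj V).V) :
    (fun x => (φ.lin ∘ₗ val V x) a) ∈ W.transferSub := by
  refine lift_mem (X := obj V) (fun x => φ.lin ∘ₗ val V x) (fun f a ha x => ?_)
    (fun f a ha x h => ?_) a
  · rw [LinearMap.comp_apply, ← lin_pG, deg_iff.1 ha]
  · rw [LinearMap.comp_apply, LinearMap.comp_apply, val_mul ha, map_smul, φ.ρ_comm]

/-- The transfer of a morphism. -/
noncomputable def map (φ : V ⟶ W) : obj V ⟶ obj W where
  lin := lift (fun x => φ.lin ∘ₗ val V x) (map_mem φ)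
  p_comm := p_comm_of_deg _ _ fun f a ha => deg_iff.2 fun x => by
    rw [val_lift, LinearMap.comp_apply, ← lin_pG, deg_iff.1 ha]
  ρ_comm g := lin_ext_apply (lift (fun x => φ.lin ∘ₗ val V x) (map_mem φ) ∘ₗ (obj V).ρ g)
    ((obj W).ρ g ∘ₗ lift (fun x => φ.lin ∘ₗ val V x) (map_mem φ)) fun f a ha =>
      obj_ext fun x => by
        have hd : (obj W).Deg f (lift (fun x => φ.lin ∘ₗ val V x) (map_mem φ) a) :=
          deg_iff.2 fun x => by rw [val_lift, LinearMap.comp_apply, ← lin_pG, deg_iff.1 ha]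
        rw [LinearMap.comp_apply, LinearMap.comp_apply, val_lift, val_ρ hd, val_lift,
          LinearMap.comp_apply, val_ρ ha, map_smul, LinearMap.comp_apply]

theorem val_map (φ : V ⟶ W) (x : G) (a : (obj V).V) :
    val W x (Hom.lin (map φ) a) = φ.lin (val V x a) := rfl

/-- The transfer functor. -/
@[reducible] noncomputable def functor (α : Cocycle3 G k) (H : Subgroup G) :
    ZObj (α.restrict H) ⥤ ZObj α where
  obj := obj
  map := map

/-- The value at `x` of the transferred tensor product: `α(x⁻¹|f,g) a(x) ⊗ b(x)`. -/
noncomputable def tenVal (V W : ZObj (α.restrict H)) (x : G) :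
    (obj V ⊗ obj W).V →ₗ[k] (V ⊗ W).V :=
  TensorProduct.map (val V x) (val W x) ∘ₗ sc (obj V) (obj W) fun f g => α.ten x⁻¹ f g

theorem tenVal_tm {f g : G} {a : (obj V).V} {b : (obj W).V} (ha : (obj V).Deg f a)
    (hb : (obj W).Deg g b) (x : G) :
    tenVal V W x (tm a b) = (α.ten x⁻¹ f g : k) • tm (val V x a) (val W x b) := by
  refine (congrArg (TensorProduct.map (val V x) (val W x)) (sc_tmul _ ha hb)).trans ?_
  rw [map_smul]
  rfl

theorem tenVal_deg {f g : G} {a : (obj V).V} {b : (obj W).V} (ha : (obj V).Deg f a)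
    (hb : (obj W).Deg g b) (x : G) :
    (V ⊗ W).pG (x⁻¹ * (f * g) * x) (tenVal V W x (tm a b)) = tenVal V W x (tm a b) := by
  rw [tenVal_tm ha hb, map_smul]
  congr 1
  obtain h0 | ⟨h, ha'⟩ := deg_val ha x
  · rw [h0, zero_tm, map_zero]
  obtain h0 | ⟨h', hb'⟩ := deg_val hb x
  · rw [h0, tm_zero, map_zero]
  refine pG_of_deg (ha'.tm hb') ?_
  rw [Subgroup.coe_mul]
  group

theorem tenVal_mul {f g : G} {a : (obj V).V} {b : (obj W).V} (ha : (obj V).Deg f a)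
    (hb : (obj W).Deg g b) (x : G) (h : H) :
    tenVal V W (x * h) (tm a b) =
      (α.act (h : G)⁻¹ x⁻¹ (f * g) : k) • (V ⊗ W).ρ h⁻¹ (tenVal V W x (tm a b)) := by
  rw [tenVal_tm ha hb, tenVal_tm ha hb, val_mul ha, val_mul hb]
  obtain h0 | ⟨h1, ha'⟩ := deg_val ha x
  · rw [h0]; simp [zero_tm]
  obtain h0 | ⟨h2, hb'⟩ := deg_val hb x
  · rw [h0]; simp [tm_zero]
  rw [map_smul, ρ_tm ha' hb', smul_tm, tm_smul]
  simp only [smul_smul]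
  congr 1
  have h3 := congrArg (fun t : kˣ => (t : k)) (α.ten_act (h : G)⁻¹ x⁻¹ f g)
  have h4 : ((α.restrict H).ten h⁻¹ ⟨_, h1⟩ ⟨_, h2⟩ : k) =
      α.ten (h : G)⁻¹ (x⁻¹ * f * x⁻¹⁻¹) (x⁻¹ * g * x⁻¹⁻¹) := by
    rw [inv_inv]; rfl
  rw [h4, mul_inv_rev]
  push_cast at h3
  linear_combination h3

theorem tenVal_mem (t : (obj V ⊗ obj W).V) : (fun x => tenVal V W x t) ∈ (V ⊗ W).transferSub := by
  have : (V ⊗ W).transferSub.mkQ ∘ₗ LinearMap.pi (tenVal V W) = 0 :=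
    lin_ext₂ (X := obj V) (Y := obj W) fun f g a b ha hb =>
      (Submodule.Quotient.mk_eq_zero _).2 (mem_transferSub (tenVal_deg ha hb) (tenVal_mul ha hb))
  exact (Submodule.Quotient.mk_eq_zero _).1 (LinearMap.congr_fun this t)

theorem ten_deg {f g : G} {a : (obj V).V} {b : (obj W).V} (ha : (obj V).Deg f a)
    (hb : (obj W).Deg g b) : (obj (V ⊗ W)).Deg (f * g) (lift _ tenVal_mem (tm a b)) :=
  deg_iff.2 fun x => tenVal_deg ha hb x

/-- The comparison morphism of the transfer. -/
noncomputable def ten (V W : ZObj (α.restrict H)) : obj V ⊗ obj W ⟶ obj (V ⊗ W) :=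
  homMk₂ (lift (tenVal V W) tenVal_mem)
    (fun _ _ _ _ ha hb => ten_deg ha hb)
    (fun h f g a b ha hb => obj_ext fun x => by
      have e1 : tenVal V W x (tm ((obj V).ρ h a) ((obj W).ρ h b)) = _ :=
        tenVal_tm (ha.ρ h) (hb.ρ h) x
      have e2 : tenVal V W (h⁻¹ * x) (tm a b) = _ := tenVal_tm ha hb _
      rw [map_smul]
      refine (congrArg _ e1).trans (Eq.trans ?_ (val_ρ (ten_deg ha hb) h x).symm)
      refine Eq.trans ?_ (congrArg _ e2.symm)
      rw [val_ρ ha, val_ρ hb, smul_tm, tm_smul]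
      simp only [smul_smul]
      congr 1
      have h1 := congrArg (fun t : kˣ => (t : k)) (α.ten_act x⁻¹ h f g)
      rw [show (h⁻¹ * x)⁻¹ = x⁻¹ * h by group]
      push_cast at h1 ⊢
      field_simp
      linear_combination -h1)

theorem val_ten {f g : G} {a : (obj V).V} {b : (obj W).V} (ha : (obj V).Deg f a)
    (hb : (obj W).Deg g b) (x : G) :
    val (V ⊗ W) x (Hom.lin (ten V W) (tm a b)) =
      (α.ten x⁻¹ f g : k) • tm (val V x a) (val W x b) := tenVal_tm ha hb x

theorem deg_ten {f g : G} {a : (obj V).V} {b : (obj W).V} (ha : (obj V).Deg f a)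
    (hb : (obj W).Deg g b) : (obj (V ⊗ W)).Deg (f * g) (Hom.lin (ten V W) (tm a b)) :=
  ten_deg ha hb

/-- The unit morphism of the transfer: constant maps. -/
noncomputable def unitHom (α : Cocycle3 G k) (H : Subgroup G) :
    𝟙_ (ZObj α) ⟶ obj (𝟙_ (ZObj (α.restrict H))) :=
  have hd (c : k) (x : G) : (𝟙_ (ZObj (α.restrict H))).pG (x⁻¹ * 1 * x) c = c :=
    pG_of_deg (V := 𝟙_ (ZObj (α.restrict H))) (h := 1) (deg_unit (α := α.restrict H) c)
      (by rw [mul_one, inv_mul_cancel, Subgroup.coe_one])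
  have hm (c : k) : (fun _ => c) ∈ (𝟙_ (ZObj (α.restrict H))).transferSub :=
    mem_transferSub (V := 𝟙_ (ZObj (α.restrict H))) (f := 1) (hd c) fun x h => by
      rw [α.act_one_right, Units.val_one, one_smul]; rfl
  have hdeg (c : k) : (obj (𝟙_ (ZObj (α.restrict H)))).Deg 1 (lift (M := k)
      (V := 𝟙_ (ZObj (α.restrict H))) (fun _ => LinearMap.id) hm c) :=
    deg_iff.2 fun x => hd c x
  { lin := lift (V := 𝟙_ (ZObj (α.restrict H))) (fun _ => LinearMap.id) hm
    p_comm := p_comm_of_deg (X := 𝟙_ (ZObj α)) _ _ fun a c hc => by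
      by_cases h : (show k from c) = 0
      · have h0 : c = 0 := h
        rw [h0, map_zero]; exact map_zero _
      · obtain rfl := Deg.unit_eq (α := α) hc h
        exact hdeg c
    ρ_comm := fun f c => obj_ext fun x => by
      rw [val_ρ (hdeg c), α.act_one_right, inv_one, Units.val_one, one_smul]
      rfl }

noncomputable instance : (functor α H).LaxBraided where
  ε := unitHom α H
  μ := ten
  μ_natural_left φ W := hom_ext₂ fun f g a b ha hb => obj_ext fun x => by
    simp only [ZObj.comp_apply, whiskerRight_tm, val_ten (Hom.deg (map φ) ha) hb, val_map,
      val_ten ha hb, map_smul]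
  μ_natural_right V φ := hom_ext₂ fun f g a b ha hb => obj_ext fun x => by
    simp only [ZObj.comp_apply, whiskerLeft_tm, val_ten ha (Hom.deg (map φ) hb), val_map,
      val_ten ha hb, map_smul]
  associativity X Y Z := hom_ext₃ fun f g h a b c ha hb hc => obj_ext fun x => by
    simp only [ZObj.comp_apply, whiskerRight_tm, whiskerLeft_tm, associator_hom_tm ha hb hc,
      map_smul, val_map, val_ten (deg_ten ha hb) hc, val_ten ha hb, val_ten ha (deg_ten hb hc),
      val_ten hb hc, smul_tm, tm_smul]
    obtain h0 | ⟨h1, ha'⟩ := deg_val ha x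
    · rw [h0]; simp [zero_tm]
    obtain h0 | ⟨h2, hb'⟩ := deg_val hb x
    · rw [h0]; simp [tm_zero, zero_tm]
    obtain h0 | ⟨h3, hc'⟩ := deg_val hc x
    · rw [h0]; simp [tm_zero, zero_tm]
    rw [associator_hom_tm ha' hb' hc']
    simp only [smul_smul]
    congr 1
    have h4 := congrArg (fun t : kˣ => (t : k)) (α.ten_assoc x⁻¹ f g h)
    have h5 : (((α.restrict H).toFun ⟨_, h1⟩ ⟨_, h2⟩ ⟨_, h3⟩) : kˣ) =
        α.toFun (x⁻¹ * f * x⁻¹⁻¹) (x⁻¹ * g * x⁻¹⁻¹) (x⁻¹ * h * x⁻¹⁻¹) := by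
      rw [inv_inv]; rfl
    rw [h5]
    push_cast at h4 ⊢
    field_simp
    linear_combination h4
  left_unitality X := hom_ext₂ fun f g c a hc ha => obj_ext fun x => by
    have hc' : (obj (𝟙_ (ZObj (α.restrict H)))).Deg 1 (Hom.lin (unitHom α H) c) :=
      Hom.deg (unitHom α H) (deg_unit (α := α) c)
    simp only [ZObj.comp_apply, whiskerRight_tm]
    rw [val_map, val_ten hc' ha, map_smul, α.ten_one_mid, Units.val_one, one_smul]
    refine (congrArg (val X x) (leftUnitor_hom_tm _ c a)).trans ?_
    rw [map_smul]
    exact (leftUnitor_hom_tm X c (val X x a)).symm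
  right_unitality X := hom_ext₂ fun f g a c ha hc => obj_ext fun x => by
    have hc' : (obj (𝟙_ (ZObj (α.restrict H)))).Deg 1 (Hom.lin (unitHom α H) c) :=
      Hom.deg (unitHom α H) (deg_unit (α := α) c)
    simp only [ZObj.comp_apply, whiskerLeft_tm]
    rw [val_map, val_ten ha hc', map_smul, α.ten_one_right, Units.val_one, one_smul]
    refine (congrArg (val X x) (rightUnitor_hom_tm _ c a)).trans ?_
    rw [map_smul]
    exact (rightUnitor_hom_tm X c (val X x a)).symm
  braided X Y := hom_ext₂ fun f g a b ha hb => obj_ext fun x => by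
    simp only [ZObj.comp_apply, val_map, val_ten ha hb, map_smul, braiding_tm ha,
      val_ten (hb.ρ f) ha, val_ρ hb, smul_tm]
    obtain h0 | ⟨h1, ha'⟩ := deg_val ha x
    · rw [h0]; simp [tm_zero, zero_tm]
    -- With h = x⁻¹fx one has `x * h⁻¹ = f⁻¹ * x`. Equivariance thus expresses the value of b at
    -- `f⁻¹ * x` by the action of h, which is the degree of a(x); this is the braiding of the values
    -- at x.
    have h2 := val_mul hb x ⟨_, h1⟩⁻¹
    have h3 : x * ((⟨_, h1⟩⁻¹ : H) : G) = f⁻¹ * x := by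
      rw [Subgroup.coe_inv]
      group
    have h4 : (((⟨_, h1⟩⁻¹ : H) : G))⁻¹ = x⁻¹ * f * x⁻¹⁻¹ := by
      rw [Subgroup.coe_inv, inv_inv, inv_inv]
    rw [h3, h4] at h2
    simp only [inv_inv] at h2
    rw [braiding_tm ha', h2, smul_tm]
    simp only [smul_smul]
    congr 1
    have h5 := congrArg (fun t : kˣ => (t : k)) (α.ten_act_swap x⁻¹ f g)
    rw [inv_inv] at h5
    push_cast at h5 ⊢
    field_simp
    linear_combination h5

end Transfer
end

/-! ### The indicator idempotent of H and modules over a transferred algebra. -/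

section
attribute [local instance] Fintype.ofFinite
open scoped TensorProduct Classical

namespace Transfer
variable {G k : Type u} [Group G] [Finite G] [Field k] {α : Cocycle3 G k} {H : Subgroup G}
open ZObj CategoryTheory MonoidalCategory
variable {V W : ZObj (α.restrict H)}

/-- The value at `x` of the map supported on `H` with value `v` at `1`. -/
noncomputable def inclVal (V : ZObj (α.restrict H)) (x : G) : V.V →ₗ[k] V.V :=
  if h : x ∈ H then V.ρ ⟨x, h⟩⁻¹ else 0

theorem inclVal_coe (h : H) (v : V.V) : inclVal V h v = V.ρ h⁻¹ v := by
  rw [inclVal, dif_pos h.2]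

theorem inclVal_of_not_mem {x : G} (hx : x ∉ H) (v : V.V) : inclVal V x v = 0 := by
  rw [inclVal, dif_neg hx]; rfl

theorem inclVal_deg {u : H} {v : V.V} (hv : V.Deg u v) (x : G) :
    V.pG (x⁻¹ * u * x) (inclVal V x v) = inclVal V x v := by
  by_cases hx : x ∈ H
  · have := inclVal_coe ⟨x, hx⟩ v
    change inclVal V x v = _ at this
    rw [this]
    exact pG_of_deg (hv.ρ _) (by simp)
  · rw [inclVal_of_not_mem hx, map_zero]

theorem inclVal_mul {u : H} {v : V.V} (hv : V.Deg u v) (x : G) (h : H) :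
    inclVal V (x * h) v = (α.act (h : G)⁻¹ x⁻¹ u : k) • V.ρ h⁻¹ (inclVal V x v) := by
  by_cases hx : x ∈ H
  · have h1 := inclVal_coe ⟨x, hx⟩ v
    have h2 := inclVal_coe (⟨x, hx⟩ * h) v
    change inclVal V x v = _ at h1
    change inclVal V (x * h) v = _ at h2
    rw [h1, h2, mul_inv_rev, hv.ρ_mul]
    rfl
  · rw [inclVal_of_not_mem hx,
      inclVal_of_not_mem (fun h' => hx ((H.mul_mem_cancel_right h.2).1 h')),
      map_zero, smul_zero]

theorem inclVal_mem (v : V.V) : (fun x => inclVal V x v) ∈ V.transferSub := by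
  have : V.transferSub.mkQ ∘ₗ LinearMap.pi (inclVal V) = 0 := lin_ext fun u v hv =>
    (Submodule.Quotient.mk_eq_zero _).2 (mem_transferSub (inclVal_deg hv) (inclVal_mul hv))
  exact (Submodule.Quotient.mk_eq_zero _).1 (LinearMap.congr_fun this v)

/-- The element of the transfer supported on `H` with value `v` at `1`. -/
noncomputable def incl (V : ZObj (α.restrict H)) : V.V →ₗ[k] (obj V).V :=
  lift (inclVal V) inclVal_mem

theorem val_incl_coe (h : H) (v : V.V) : val V h (incl V v) = V.ρ h⁻¹ v := inclVal_coe h v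

theorem val_incl_of_not_mem {x : G} (hx : x ∉ H) (v : V.V) : val V x (incl V v) = 0 :=
  inclVal_of_not_mem hx v

theorem val_incl_one (v : V.V) : val V 1 (incl V v) = v := by
  have := val_incl_coe 1 v
  rwa [inv_one, V.ρ_one] at this

theorem deg_incl {u : H} {v : V.V} (hv : V.Deg u v) : (obj V).Deg (u : G) (incl V v) :=
  deg_iff.2 (inclVal_deg hv)

/-- By equivariance the value at 1 determines the values on all of H. Products involving the
idempotent are computed through this, by evaluation at 1. -/
theorem eq_incl_of_supp {f : G} {a : (obj V).V} (ha : (obj V).Deg f a)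
    (h : ∀ x ∉ H, val V x a = 0) : a = incl V (val V 1 a) := obj_ext fun x => by
  by_cases hx : x ∈ H
  · have h1 := val_mul ha 1 ⟨x, hx⟩
    rw [one_mul, inv_one, α.act_one_mid, Units.val_one, one_smul] at h1
    exact h1.trans (val_incl_coe ⟨x, hx⟩ _).symm
  · rw [h x hx, val_incl_of_not_mem hx]

theorem ρ_incl (h : H) (v : V.V) : (obj V).ρ h (incl V v) = incl V (V.ρ h v) := by
  refine lin_ext_apply ((obj V).ρ h ∘ₗ incl V) (incl V ∘ₗ V.ρ h) (fun u v hv => ?_) v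
  rw [LinearMap.comp_apply, LinearMap.comp_apply, eq_incl_of_supp ((deg_incl hv).ρ h)]
  · congr 1
    rw [val_ρ (deg_incl hv), inv_one, α.act_one_left, inv_one, Units.val_one, one_smul, mul_one]
    exact (val_incl_coe h⁻¹ v).trans (by rw [inv_inv])
  · intro x hx
    rw [val_ρ (deg_incl hv), val_incl_of_not_mem, smul_zero]
    exact fun h' => hx ((H.mul_mem_cancel_left (H.inv_mem h.2)).1 h')

theorem map_incl (φ : V ⟶ W) (v : V.V) : Hom.lin (map φ) (incl V v) = incl W (φ.lin v) :=
  obj_ext fun x => by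
    by_cases hx : x ∈ H
    · have h1 := val_incl_coe ⟨x, hx⟩ v
      have h2 := val_incl_coe ⟨x, hx⟩ (φ.lin v)
      rw [val_map]
      exact (congrArg _ h1).trans ((φ.ρ_comm _ _).trans h2.symm)
    · rw [val_map, val_incl_of_not_mem hx, val_incl_of_not_mem hx, map_zero]

theorem ten_incl {u u' : H} {v : V.V} {w : W.V} (hv : V.Deg u v) (hw : W.Deg u' w) :
    Hom.lin (ten V W) (tm (incl V v) (incl W w)) = incl (V ⊗ W) (tm v w) := by
  rw [eq_incl_of_supp (deg_ten (deg_incl hv) (deg_incl hw)),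
    val_ten (deg_incl hv) (deg_incl hw), val_incl_one, val_incl_one, inv_one, α.ten_one_left,
    Units.val_one, one_smul]
  intro x hx
  rw [val_ten (deg_incl hv) (deg_incl hw), val_incl_of_not_mem hx, zero_tm, smul_zero]

/-- The morphism to a transfer determined by an `H`-equivariant map. -/
noncomputable def coind {X : ZObj α} (χ : X.V →ₗ[k] V.V)
    (hd : ∀ f m, X.Deg f m → V.pG f (χ m) = χ m)
    (hρ : ∀ (h : H) m, χ (X.ρ h m) = V.ρ h (χ m)) : X ⟶ obj V :=
  have hmem : ∀ m, (fun x => (χ ∘ₗ X.ρ x⁻¹) m) ∈ V.transferSub :=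
    lift_mem (fun x => χ ∘ₗ X.ρ x⁻¹)
      (fun f m hm x => by
        have := hd _ _ (hm.ρ x⁻¹)
        rwa [inv_inv] at this)
      (fun f m hm x h => by
        rw [LinearMap.comp_apply, LinearMap.comp_apply, mul_inv_rev, hm.ρ_mul, map_smul, ← hρ]
        rfl)
  have hdeg : ∀ f m, X.Deg f m → (obj V).Deg f (lift (fun x => χ ∘ₗ X.ρ x⁻¹) hmem m) :=
    fun f m hm => deg_iff.2 fun x => by
      have := hd _ _ (hm.ρ x⁻¹)
      rwa [inv_inv] at this
  { lin := lift (fun x => χ ∘ₗ X.ρ x⁻¹) hmem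
    p_comm := p_comm_of_deg _ _ hdeg
    ρ_comm := fun g => lin_ext_apply (lift (fun x => χ ∘ₗ X.ρ x⁻¹) hmem ∘ₗ X.ρ g)
      ((obj V).ρ g ∘ₗ lift (fun x => χ ∘ₗ X.ρ x⁻¹) hmem) fun f m hm => obj_ext fun x => by
        rw [LinearMap.comp_apply, LinearMap.comp_apply, val_ρ (hdeg f m hm), val_lift, val_lift,
          LinearMap.comp_apply, LinearMap.comp_apply, mul_inv_rev, inv_inv, hm.ρ_mul, map_smul,
          smul_smul]
        simp }

/-! ### Modules over the transfer of an algebra -/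

section modules
variable {B : CommAlg (α.restrict H)}

/-- The product of the transfer. -/
noncomputable def mulA (B : CommAlg (α.restrict H)) :
    (obj B.X).V →ₗ[k] (obj B.X).V →ₗ[k] (obj B.X).V := B.transfer.mul

/-- The unit of the transfer. -/
noncomputable def oneA (B : CommAlg (α.restrict H)) : (obj B.X).V := B.transfer.one

theorem val_oneA (B : CommAlg (α.restrict H)) (x : G) : val B.X x (oneA B) = B.one := rfl

theorem val_mulA {f g : G} {a b : (obj B.X).V} (ha : (obj B.X).Deg f a) (hb : (obj B.X).Deg g b)
    (x : G) : val B.X x (mulA B a b) = (α.ten x⁻¹ f g : k) • B.mul (val B.X x a) (val B.X x b) :=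
  B.mapMul_apply (B.X.deg_transfer ha) (B.X.deg_transfer hb) x

theorem deg_mulA {f g : G} {a b : (obj B.X).V} (ha : (obj B.X).Deg f a) (hb : (obj B.X).Deg g b) :
    (obj B.X).Deg (f * g) (mulA B a b) := B.transfer.deg_mul f g a b ha hb

/-- The action of the algebra on a module. -/
noncomputable def rmul (M : LocMod B.transfer.toMon) :
    M.X.V →ₗ[k] (obj B.X).V →ₗ[k] M.X.V :=
  TensorProduct.curry (M := M.X.V) (N := (obj B.X).V) (Hom.lin M.act)

variable (M : LocMod B.transfer.toMon)

theorem deg_rmul {f g : G} {m : M.X.V} {a : (obj B.X).V} (hm : M.X.Deg f m)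
    (ha : (obj B.X).Deg g a) : M.X.Deg (f * g) (rmul M m a) :=
  Hom.deg M.act (Deg.tm (X := M.X) (Y := obj B.X) hm ha)

theorem ρ_rmul {f g : G} {m : M.X.V} {a : (obj B.X).V} (hm : M.X.Deg f m)
    (ha : (obj B.X).Deg g a) (h : G) : M.X.ρ h (rmul M m a) =
      (α.ten h f g : k) • rmul M (M.X.ρ h m) ((obj B.X).ρ h a) := by
  refine (Hom.ρ_comm M.act h (tm (X := M.X) (Y := obj B.X) m a)).symm.trans ?_
  refine (congrArg (Hom.lin M.act) (ρ_tm (X := M.X) (Y := obj B.X) hm ha h)).trans ?_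
  exact map_smul (Hom.lin M.act) _ _

theorem rmul_one (m : M.X.V) : rmul M m (oneA B) = m := by
  have h := LinearMap.congr_fun (congrArg Hom.lin M.act_one)
    (tm (X := M.X) (Y := 𝟙_ (ZObj α)) m (1 : k))
  have h2 : Hom.lin (ρ_ M.X).hom (tm (X := M.X) (Y := 𝟙_ (ZObj α)) m (1 : k)) = m :=
    (rightUnitor_hom_tm M.X 1 m).trans (one_smul _ _)
  refine Eq.trans ?_ (h.trans h2)
  have h3 : Hom.lin B.transfer.oneHom (1 : k) = B.transfer.one :=
    (B.transfer.oneHom_apply 1).trans (one_smul _ _)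
  exact (congrArg (rmul M m) h3).symm

theorem rmul_mulA {f g h : G} {m : M.X.V} {a b : (obj B.X).V} (hm : M.X.Deg f m)
    (ha : (obj B.X).Deg g a) (hb : (obj B.X).Deg h b) :
    rmul M m (mulA B a b) = (α.toFun f g h : k) • rmul M (rmul M m a) b := by
  have h1 := LinearMap.congr_fun (congrArg Hom.lin M.act_assoc)
    (tm (X := M.X) (Y := obj B.X ⊗ obj B.X) m (tm a b))
  have h2 : Hom.lin B.transfer.mulHom (tm (X := obj B.X) (Y := obj B.X) a b) = mulA B a b :=
    B.transfer.mulHom_tm a b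
  refine (congrArg (rmul M m) h2).symm.trans (h1.trans ?_)
  have h3 := associator_inv_tm (X := M.X) (Y := obj B.X) (Z := obj B.X) hm ha hb
  refine (congrArg (Hom.lin (M.act ▷ _ ≫ M.act)) h3).trans ?_
  exact map_smul (Hom.lin (M.act ▷ _ ≫ M.act)) _ _

theorem rmul_local {f g : G} {m : M.X.V} {a : (obj B.X).V} (hm : M.X.Deg f m)
    (ha : (obj B.X).Deg g a) :
    rmul M m a = rmul M (M.X.ρ (f * g * f⁻¹) m) ((obj B.X).ρ f a) := by
  have h1 := LinearMap.congr_fun (congrArg Hom.lin M.isLocal)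
    (tm (X := M.X) (Y := obj B.X) m a)
  refine h1.symm.trans ?_
  have h2 : Hom.lin (β_ M.X (obj B.X)).hom (tm m a) = tm ((obj B.X).ρ f a) m := braiding_tm hm a
  have h3 : Hom.lin (β_ (obj B.X) M.X).hom (tm ((obj B.X).ρ f a) m) =
    tm (M.X.ρ (f * g * f⁻¹) m) ((obj B.X).ρ f a) := braiding_tm (ha.ρ f) m
  exact (congrArg (fun t => Hom.lin M.act (Hom.lin (β_ (obj B.X) M.X).hom t)) h2).trans
    (congrArg (Hom.lin M.act) h3)

theorem hom_rmul {M N : LocMod B.transfer.toMon} (φ : M ⟶ N) (m : M.X.V) (a : (obj B.X).V) :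
    φ.hom.lin (rmul M m a) = rmul N (φ.hom.lin m) a :=
  LinearMap.congr_fun (congrArg Hom.lin φ.act_hom) (tm (X := M.X) (Y := obj B.X) m a)

/-- A morphism of modules from a morphism compatible with the action on homogeneous elements. -/
def homMk {M N : LocMod B.transfer.toMon} (φ : M.X ⟶ N.X)
    (h : ∀ f g m a, M.X.Deg f m → (obj B.X).Deg g a →
      φ.lin (rmul M m a) = rmul N (φ.lin m) a) : M ⟶ N where
  hom := φ
  act_hom := hom_ext₂ (Y := obj B.X) fun f g m a hm ha => h f g m a hm ha

variable (B) in
/-- The indicator of `H`, an idempotent of the transfer. -/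
noncomputable def idem : (obj B.X).V := incl B.X B.one

theorem deg_idem : (obj B.X).Deg 1 (idem B) := deg_incl (u := 1) B.deg_one

theorem ρ_idem (h : H) : (obj B.X).ρ h (idem B) = idem B := by
  rw [idem, ρ_incl, B.ρ_one]

theorem val_idem (x : G) : val B.X x (idem B) = if x ∈ H then B.one else 0 := by
  split_ifs with hx
  · exact (val_incl_coe ⟨x, hx⟩ _).trans (B.ρ_one _)
  · exact val_incl_of_not_mem hx _

/-- Multiplication by the indicator of H truncates a to H, and a truncated map is known from its
value at 1. -/
theorem mulA_idem (a : (obj B.X).V) : mulA B a (idem B) = incl B.X (val B.X 1 a) := by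
  refine lin_ext_apply ((mulA B).flip (idem B)) (incl B.X ∘ₗ val B.X 1) (fun f a ha => ?_) a
  rw [LinearMap.flip_apply, LinearMap.comp_apply, eq_incl_of_supp (deg_mulA ha deg_idem),
    val_mulA ha deg_idem, val_idem, if_pos H.one_mem, B.mul_one, α.ten_one_right, Units.val_one,
    one_smul]
  intro x hx
  rw [val_mulA ha deg_idem, val_idem, if_neg hx, map_zero, smul_zero]

theorem idem_mulA_incl (b : B.X.V) : mulA B (idem B) (incl B.X b) = incl B.X b := by
  refine lin_ext_apply (mulA B (idem B) ∘ₗ incl B.X) (incl B.X) (fun f b hb => ?_) b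
  rw [LinearMap.comp_apply, eq_incl_of_supp (deg_mulA deg_idem (deg_incl hb)),
    val_mulA deg_idem (deg_incl hb), val_idem, if_pos H.one_mem, B.one_mul, α.ten_one_mid,
    Units.val_one, one_smul, val_incl_one]
  intro x hx
  rw [val_mulA deg_idem (deg_incl hb), val_idem, if_neg hx, map_zero, LinearMap.zero_apply,
    smul_zero]

theorem incl_mulA_incl {u u' : H} {b b' : B.X.V} (hb : B.X.Deg u b) (hb' : B.X.Deg u' b') :
    mulA B (incl B.X b) (incl B.X b') = incl B.X (B.mul b b') := by
  rw [eq_incl_of_supp (deg_mulA (deg_incl hb) (deg_incl hb')),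
    val_mulA (deg_incl hb) (deg_incl hb'), val_incl_one, val_incl_one, inv_one, α.ten_one_left,
    Units.val_one, one_smul]
  intro x hx
  rw [val_mulA (deg_incl hb) (deg_incl hb'), val_incl_of_not_mem hx, map_zero,
    LinearMap.zero_apply, smul_zero]

theorem rmul_rmul_idem (m : M.X.V) (a : (obj B.X).V) :
    rmul M (rmul M m a) (idem B) = rmul M m (incl B.X (val B.X 1 a)) := by
  refine LinearMap.congr_fun (lin_ext (φ := (rmul M).flip (idem B) ∘ₗ rmul M m)
    (ψ := rmul M m ∘ₗ incl B.X ∘ₗ val B.X 1) fun g a ha => ?_) a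
  refine lin_ext_apply ((rmul M).flip (idem B) ∘ₗ (rmul M).flip a)
    ((rmul M).flip (incl B.X (val B.X 1 a))) (fun f m hm => ?_) m
  have := rmul_mulA M hm ha deg_idem
  rw [α.isCocycle.one_right, Units.val_one, one_smul, mulA_idem] at this
  exact this.symm

theorem rmul_idem_rmul_incl (m : M.X.V) (b : B.X.V) :
    rmul M (rmul M m (idem B)) (incl B.X b) = rmul M m (incl B.X b) := by
  refine LinearMap.congr_fun (lin_ext (φ := rmul M (rmul M m (idem B)) ∘ₗ incl B.X)
    (ψ := rmul M m ∘ₗ incl B.X) fun g b hb => ?_) b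
  refine lin_ext_apply ((rmul M).flip (incl B.X b) ∘ₗ (rmul M).flip (idem B))
    ((rmul M).flip (incl B.X b)) (fun f m hm => ?_) m
  have := rmul_mulA M hm deg_idem (deg_incl hb)
  rw [α.isCocycle.one_mid, Units.val_one, one_smul, idem_mulA_incl] at this
  exact this.symm

theorem rmul_incl_idem (m : M.X.V) (b : B.X.V) :
    rmul M (rmul M m (incl B.X b)) (idem B) = rmul M m (incl B.X b) := by
  rw [rmul_rmul_idem, val_incl_one]

theorem rmul_idem_idem (m : M.X.V) :
    rmul M (rmul M m (idem B)) (idem B) = rmul M m (idem B) := rmul_incl_idem M m B.one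

theorem ρ_rmul_idem (g : G) (m : M.X.V) :
    M.X.ρ g (rmul M m (idem B)) = rmul M (M.X.ρ g m) ((obj B.X).ρ g (idem B)) := by
  refine lin_ext_apply (M.X.ρ g ∘ₗ (rmul M).flip (idem B))
    ((rmul M).flip ((obj B.X).ρ g (idem B)) ∘ₗ M.X.ρ g) (fun f m hm => ?_) m
  have := ρ_rmul M hm deg_idem g
  rwa [α.ten_one_right, Units.val_one, one_smul] at this

theorem ρ_rmul_idem_coe (h : H) (m : M.X.V) :
    M.X.ρ h (rmul M m (idem B)) = rmul M (M.X.ρ h m) (idem B) := by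
  rw [ρ_rmul_idem, ρ_idem]

/-- On a local module, `m e = 0` for `m` of degree outside `H`. -/
theorem rmul_idem_eq_zero {f : G} {m : M.X.V} (hm : M.X.Deg f m) (hf : f ∉ H) :
    rmul M m (idem B) = 0 := by
  -- Since e has degree 1, locality gives m e = m (f.e). Multiplying by e once more leaves the value
  -- of f.e at 1, a multiple of the value of e at f⁻¹, which is zero because f⁻¹ is not in H.
  have h1 := rmul_local M hm deg_idem
  rw [mul_one, mul_inv_cancel, M.X.ρ_one] at h1
  rw [← rmul_idem_idem, h1, rmul_rmul_idem, val_ρ deg_idem, val_idem, if_neg, smul_zero, map_zero,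
    map_zero]
  rw [mul_one]
  exact fun h => hf (inv_mem_iff.1 h)

/-- At each point x, the translate by g takes the value 1 exactly when g⁻¹x ∈ H, which happens for
|H| elements g. Thus the translates of e give, up to the factor |H|, a decomposition of the unit. -/
theorem sum_ρ_idem :
    ∑ g, (obj B.X).ρ g (idem B) = (∑ g : G, if g ∈ H then (1 : k) else 0) • oneA B := by
  refine obj_ext fun x => ?_
  rw [map_sum, map_smul, val_oneA, Finset.sum_smul]
  refine Fintype.sum_equiv ((Equiv.inv G).trans (Equiv.mulRight x)) _ _ fun g => ?_
  rw [val_ρ deg_idem, α.act_one_right, inv_one, Units.val_one, one_smul, val_idem, ite_smul,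
    one_smul, zero_smul]
  rfl

/-- The sum is |H|. Characteristic zero enters the whole argument only here. -/
theorem sum_mem_ne_zero [CharZero k] : (∑ g : G, if g ∈ H then (1 : k) else 0) ≠ 0 := by
  rw [Finset.sum_boole, Nat.cast_ne_zero, Finset.card_ne_zero]
  exact ⟨1, Finset.mem_filter.2 ⟨Finset.mem_univ _, H.one_mem⟩⟩

/-- Expand m · 1 with 1 proportional to the sum of the translates g.e, and write m (g.e) as g
applied to (g⁻¹.m) e, up to the scalar of the projective action. So the e-part generates the module
under G. -/
theorem exists_smul_eq_sum [CharZero k] : ∃ c : k, c ≠ 0 ∧ ∀ f m, M.X.Deg f m →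
    c • m = ∑ g, (α.act g g⁻¹ f : k) • M.X.ρ g (rmul M (M.X.ρ g⁻¹ m) (idem B)) := by
  refine ⟨_, sum_mem_ne_zero (H := H), fun f m hm => ?_⟩
  have h1 := congrArg (rmul M m) (sum_ρ_idem (B := B))
  rw [map_sum, map_smul, rmul_one] at h1
  rw [← h1]
  refine Finset.sum_congr rfl fun g _ => ?_
  rw [ρ_rmul_idem, ← LinearMap.smul_apply, ← map_smul, ← hm.ρ_mul, mul_inv_cancel, M.X.ρ_one]

/-- A morphism of modules is injective if it is so on the elements `m = m e`. -/
theorem injective_of_idem [CharZero k] {M N : LocMod B.transfer.toMon} (φ : M ⟶ N)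
    (h : ∀ (u : H) m, M.X.Deg (u : G) m → rmul M m (idem B) = m → φ.hom.lin m = 0 → m = 0) :
    Function.Injective φ.hom.lin := by
  have key : ∀ f m, M.X.Deg f m → rmul M m (idem B) = m → φ.hom.lin m = 0 → m = 0 := by
    intro f m hm he h0
    by_cases hf : f ∈ H
    · exact h ⟨f, hf⟩ m hm he h0
    · rw [← he, rmul_idem_eq_zero M hm hf]
  have key2 : ∀ f m, M.X.Deg f m → φ.hom.lin m = 0 → m = 0 := by
    intro f m hm h0
    obtain ⟨c, hc, h1⟩ := exists_smul_eq_sum M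
    have h2 := h1 f m hm
    rw [Finset.sum_eq_zero, smul_eq_zero] at h2
    · exact h2.resolve_left hc
    · intro g _
      rw [key _ (rmul M (M.X.ρ g⁻¹ m) (idem B)) (deg_rmul M (hm.ρ g⁻¹) deg_idem)
        (rmul_idem_idem M _), map_zero, smul_zero]
      rw [hom_rmul, φ.hom.ρ_comm, h0, map_zero, map_zero, LinearMap.zero_apply]
  rw [← LinearMap.ker_eq_bot, LinearMap.ker_eq_bot']
  intro m h0
  rw [← M.X.p_sum m]
  refine Finset.sum_eq_zero fun f _ => key2 f _ (M.X.deg_p f m) ?_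
  rw [φ.hom.p_comm, h0, map_zero]

/-- A submodule of a module that is invariant under the action and contains the elements `m = m e`
is everything. -/
theorem eq_top_of_idem [CharZero k] (S : Submodule k M.X.V)
    (hρ : ∀ g m, m ∈ S → M.X.ρ g m ∈ S)
    (h : ∀ (u : H) m, M.X.Deg (u : G) m → rmul M m (idem B) = m → m ∈ S) : S = ⊤ := by
  rw [eq_top_iff]
  intro m _
  rw [← M.X.p_sum m]
  refine Submodule.sum_mem _ fun f _ => ?_
  obtain ⟨c, hc, h1⟩ := exists_smul_eq_sum M
  have h2 := h1 f _ (M.X.deg_p f m)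
  rw [← Submodule.smul_mem_iff _ hc, h2]
  refine Submodule.sum_mem _ fun g _ => Submodule.smul_mem _ _ (hρ _ _ ?_)
  have hd := deg_rmul M ((M.X.deg_p f m).ρ g⁻¹) (deg_idem (B := B))
  by_cases hf : g⁻¹ * f * g⁻¹⁻¹ * 1 ∈ H
  · exact h ⟨_, hf⟩ _ hd (rmul_idem_idem M _)
  · rw [← rmul_idem_idem, rmul_idem_eq_zero M hd hf]
    exact zero_mem _

theorem bijective_of_idem [CharZero k] {M N : LocMod B.transfer.toMon} (φ : M ⟶ N)
    (hi : ∀ (u : H) m, M.X.Deg (u : G) m → rmul M m (idem B) = m → φ.hom.lin m = 0 → m = 0)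
    (hs : ∀ (u : H) n, N.X.Deg (u : G) n → rmul N n (idem B) = n → n ∈ LinearMap.range φ.hom.lin) :
    Function.Bijective φ.hom.lin := by
  refine ⟨injective_of_idem φ hi, LinearMap.range_eq_top.1 (eq_top_of_idem N _ ?_ hs)⟩
  rintro g _ ⟨m, rfl⟩
  exact ⟨M.X.ρ g m, φ.hom.ρ_comm g m⟩

theorem _root_.ZObj.isIso_of_bijective {X Y : ZObj α} (f : X ⟶ Y)
    (h : Function.Bijective f.lin) : IsIso f :=
  (isoMk f (LinearEquiv.ofBijective f.lin h).symm.toLinearMap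
    (LinearMap.ext fun v => (LinearEquiv.ofBijective f.lin h).symm_apply_apply v)
    (LinearMap.ext fun v => (LinearEquiv.ofBijective f.lin h).apply_symm_apply v)).isIso_hom

end modules
end Transfer
end

/-! ### The composite functor and the identification of the étale algebra with the image of the unit
object. -/

section
attribute [local instance] Fintype.ofFinite
open scoped TensorProduct Classical
open ZObj CategoryTheory MonoidalCategory

/-- A gauge compatible with the cochains `γ` and `ε`. -/
structure EtaleGauge {H k : Type u} [Group H] [Field k] {a : Cocycle3 H k} {F : Subgroup H}
    [F.Normal] (D : EtaleData a F) (β : Cocycle3 (H ⧸ F) k) extends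
    Gauge (QuotientGroup.mk' F) a β where
  η_coe : ∀ f g : F, η f g = D.γ f g
  lam_coe : ∀ (h : H) (f : F), toGauge.lam h f = D.ε h f

namespace EtaleGauge
section
variable {H k : Type u} [Group H] [Finite H] [Field k] {a : Cocycle3 H k} {F : Subgroup H}
  [F.Normal] {D : EtaleData a F} {β : Cocycle3 (H ⧸ F) k} (Γ : EtaleGauge D β)

theorem deg_unit_coe (β : Cocycle3 (H ⧸ F) k) (f : F) (c : k) :
    (𝟙_ (ZObj β)).Deg (QuotientGroup.mk' F f) c := by
  have : QuotientGroup.mk' F (f : H) = 1 := (QuotientGroup.eq_one_iff _).2 f.2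
  rw [this]
  exact deg_unit c

/-- `e_f ↦ 1[f]`. -/
noncomputable def unitLin : (F →₀ k) →ₗ[k] (Γ.inflObj (𝟙_ (ZObj β))).V :=
  Finsupp.lsum k fun f => Γ.sg (𝟙_ (ZObj β)) (f : H)

theorem unitLin_single (f : F) (c : k) :
    Γ.unitLin (Finsupp.single f c) = Γ.sg (𝟙_ (ZObj β)) (f : H) c := by
  simp [unitLin]

/-- The isomorphism of `k[F,γ,ε]` with the inflation of the unit object. -/
noncomputable def unitHom₀ : D.algObj ⟶ Γ.inflObj (𝟙_ (ZObj β)) where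
  lin := Γ.unitLin
  p_comm := p_comm_of_deg (X := D.algObj) _ _ fun b v hv => by
    obtain rfl | ⟨f, c, rfl, rfl⟩ := D.deg_algObj hv
    · rw [map_zero]; exact map_zero _
    · rw [unitLin_single]; exact Γ.deg_sg (deg_unit_coe β f c)
  ρ_comm h v := by
    refine LinearMap.congr_fun (f := Γ.unitLin ∘ₗ D.eρ h)
      (g := (Γ.inflObj (𝟙_ (ZObj β))).ρ h ∘ₗ Γ.unitLin) ?_ v
    refine Finsupp.lhom_ext fun f c => ?_
    rw [LinearMap.comp_apply, LinearMap.comp_apply, D.eρ_single, map_smul, unitLin_single,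
      unitLin_single, Γ.ρ_sg h f (deg_unit_coe β f c), Γ.lam_coe]
    rfl

theorem unitHom₀_single (f : F) (c : k) :
    Hom.lin Γ.unitHom₀ (Finsupp.single f c) = Γ.sg (𝟙_ (ZObj β)) (f : H) c :=
  Γ.unitLin_single f c

/-- The unit object is concentrated in degree 1, so in its inflation only the degrees u ∈ F survive,
each with a one-dimensional component. -/
theorem unitHom₀_bijective : Function.Bijective Γ.unitHom₀.lin := by
  have hs : ∀ (u : H) (v : (𝟙_ (ZObj β)).V), (𝟙_ (ZObj β)).Deg (QuotientGroup.mk' F u) v →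
      u ∉ F → v = 0 := by
    intro u v hv hu
    by_contra h0
    exact hu ((QuotientGroup.eq_one_iff u).1 (Deg.unit_eq (α := β) hv h0))
  let g : (Γ.inflObj (𝟙_ (ZObj β))).V →ₗ[k] (F →₀ k) :=
    ∑ f : F, Finsupp.lsingle f ∘ₗ Γ.val (𝟙_ (ZObj β)) (f : H)
  have h1 : ∀ v, g (Hom.lin Γ.unitHom₀ v) = v := by
    intro v
    refine LinearMap.congr_fun (f := g ∘ₗ Γ.unitLin) (g := LinearMap.id) ?_ v
    refine Finsupp.lhom_ext fun f c => ?_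
    rw [LinearMap.comp_apply, unitLin_single, LinearMap.sum_apply, Finset.sum_eq_single f]
    · rw [LinearMap.comp_apply, Γ.val_sg_self (deg_unit_coe β f c)]; rfl
    · intro b _ hb
      rw [LinearMap.comp_apply, Γ.val_sg (deg_unit_coe β f c), if_neg (fun e => hb (Subtype.ext e)),
        map_zero]
    · simp
  refine ⟨Function.LeftInverse.injective h1, fun n => ⟨g n, ?_⟩⟩
  refine Γ.sg_ext (Hom.lin Γ.unitHom₀ ∘ₗ g) LinearMap.id (fun u v hv => ?_) n
  by_cases hu : u ∈ F
  · have := h1 (Finsupp.single ⟨u, hu⟩ v)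
    rw [unitHom₀_single] at this
    rw [LinearMap.comp_apply, this, unitHom₀_single]; rfl
  · rw [hs u v hv hu, map_zero, map_zero, map_zero]

/-- The basis element `e_f` of `k[F,γ,ε]`. -/
noncomputable def bs (D : EtaleData a F) (f : F) : D.alg.X.V := Finsupp.single f (1 : k)

theorem deg_bs (D : EtaleData a F) (f : F) : D.alg.X.Deg (f : H) (bs D f) := D.deg_single f 1

theorem ρ_bs (D : EtaleData a F) (h : H) (f : F) :
    D.alg.X.ρ h (bs D f) = (D.ε h f : k) • bs D (MulAut.conjNormal h f) := D.eρ_single h f 1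

theorem mul_bs (D : EtaleData a F) (f g : F) :
    D.alg.mul (bs D f) (bs D g) = (D.γ f g : k) • bs D (f * g) := by
  refine (D.eMul_single f g 1 1).trans ?_
  rw [mul_one]; rfl

theorem deg_alg (D : EtaleData a F) {u : H} {b : D.alg.X.V} (hb : D.alg.X.Deg u b) :
    b = 0 ∨ ∃ (f : F) (c : k), (f : H) = u ∧ b = c • bs D f := by
  obtain h | ⟨f, c, hf, h⟩ := D.deg_algObj hb
  · exact Or.inl h
  · refine Or.inr ⟨f, c, hf, h.trans ?_⟩
    refine Eq.trans ?_ (Finsupp.smul_single c f (1 : k)).symm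
    rw [smul_eq_mul, mul_one]

/-- The action of `k[F,γ,ε]` on the inflation of an object. -/
noncomputable def inflAct (X : ZObj β) :
    (Γ.inflObj X).V →ₗ[k] D.alg.X.V →ₗ[k] (Γ.inflObj X).V :=
  TensorProduct.curry (M := (Γ.inflObj X).V) (N := F →₀ k)
    (Hom.lin (Γ.inflObj X ◁ Γ.unitHom₀ ≫ Γ.inflTen X (𝟙_ _) ≫ Γ.inflMap (ρ_ X).hom))

theorem inflAct_sg {X : ZObj β} {u : H} {v : X.V} (hv : X.Deg (QuotientGroup.mk' F u) v)
    (f : F) : Γ.inflAct X (Γ.sg X u v) (bs D f) = (Γ.η u f : k) • Γ.sg X (u * f) v := by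
  change Hom.lin (Γ.inflMap (ρ_ X).hom) (Hom.lin (Γ.inflTen X (𝟙_ _))
    (tm (Γ.sg X u v) (Γ.unitLin (Finsupp.single f 1)))) = _
  have h := deg_unit_coe β f 1
  rw [unitLin_single, Γ.inflTen_sg hv h, map_smul, Γ.inflMap_sg _ (Gauge.deg_tm_map hv h)]
  refine (congrArg (fun t => (Γ.η u f : k) • Γ.sg X (u * f) t) (rightUnitor_hom_tm X 1 v)).trans ?_
  rw [one_smul]

end

section
open Transfer
variable {G k : Type u} [Group G] [Finite G] [Field k] {α : Cocycle3 G k} {H : Subgroup G}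
  {F : Subgroup H} [F.Normal] {D : EtaleData (α.restrict H) F} {β : Cocycle3 (H ⧸ F) k}
  (Γ : EtaleGauge D β)

/-- The composite of inflation and transfer. -/
@[reducible] noncomputable def lax : ZObj β ⥤ ZObj α := Γ.infl ⋙ Transfer.functor α H

theorem lax_ε_val (x : G) (c : k) :
    val (Γ.inflObj (𝟙_ (ZObj β))) x (Hom.lin (Functor.LaxMonoidal.ε Γ.lax) c) =
      Γ.sg (𝟙_ (ZObj β)) 1 c := rfl

theorem lax_μ_val {X Y : ZObj β} {f g : G} {m : (obj (Γ.inflObj X)).V} {n : (obj (Γ.inflObj Y)).V}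
    (hm : (obj (Γ.inflObj X)).Deg f m) (hn : (obj (Γ.inflObj Y)).Deg g n) (x : G) :
    val (Γ.inflObj (X ⊗ Y)) x (Hom.lin (Functor.LaxMonoidal.μ Γ.lax X Y) (tm m n)) =
      (α.ten x⁻¹ f g : k) • Hom.lin (Γ.inflTen X Y)
        (tm (val (Γ.inflObj X) x m) (val (Γ.inflObj Y) x n)) := by
  refine (congrArg (Hom.lin (Γ.inflTen X Y)) (val_ten hm hn x)).trans ?_
  exact map_smul _ _ _

/-- The product on the inflated unit object has the gauge as structure constants, and on F the gauge
equals γ. -/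
theorem unitHom₀_mul (b b' : F →₀ k) : Hom.lin (Γ.inflMap (λ_ (𝟙_ (ZObj β))).hom)
    (Hom.lin (Γ.inflTen (𝟙_ (ZObj β)) (𝟙_ (ZObj β)))
      (tm (Γ.unitHom₀.lin b) (Γ.unitHom₀.lin b'))) = Γ.unitHom₀.lin (D.eMul b b') := by
  suffices h : Hom.lin ((Γ.unitHom₀ ⊗ₘ Γ.unitHom₀) ≫ Γ.inflTen (𝟙_ (ZObj β)) (𝟙_ (ZObj β)) ≫
      Γ.inflMap (λ_ (𝟙_ (ZObj β))).hom) = Γ.unitHom₀.lin ∘ₗ D.alg.mulHom.lin from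
    LinearMap.congr_fun h (tm (X := D.algObj) (Y := D.algObj) b b')
  refine lin_ext₂ (X := D.algObj) (Y := D.algObj) fun p q x y hx hy => ?_
  obtain rfl | ⟨f, c, rfl, rfl⟩ := D.deg_algObj hx
  · have h0 : tm (X := D.algObj) (Y := D.algObj) 0 y = 0 := zero_tm _
    exact (congrArg _ h0).trans ((map_zero _).trans
      ((congrArg _ h0).trans (map_zero _)).symm)
  obtain rfl | ⟨g, d, rfl, rfl⟩ := D.deg_algObj hy
  · have h0 : tm (X := D.algObj) (Y := D.algObj) (Finsupp.single f c) 0 = 0 := tm_zero _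
    exact (congrArg _ h0).trans ((map_zero _).trans
      ((congrArg _ h0).trans (map_zero _)).symm)
  have h1 : Hom.lin D.alg.mulHom (tm (X := D.algObj) (Y := D.algObj) (Finsupp.single f c)
      (Finsupp.single g d)) = ((D.γ f g : k) * c) • Finsupp.single (f * g) d :=
    (D.alg.mulHom_tm _ _).trans (D.eMul_single f g c d)
  refine Eq.trans ?_ (congrArg Γ.unitHom₀.lin h1.symm)
  have hf := deg_unit_coe β f c
  have hg := deg_unit_coe β g d
  change Hom.lin (Γ.inflMap (λ_ (𝟙_ (ZObj β))).hom) (Hom.lin (Γ.inflTen _ _)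
    (tm (Γ.unitHom₀.lin (Finsupp.single f c)) (Γ.unitHom₀.lin (Finsupp.single g d)))) = _
  rw [unitHom₀_single, unitHom₀_single, Γ.inflTen_sg hf hg, map_smul,
    Γ.inflMap_sg _ (Gauge.deg_tm_map hf hg), Γ.η_coe]
  refine (congrArg (fun t => (D.γ f g : k) • Γ.sg (𝟙_ (ZObj β)) (f * g : H) t)
    (leftUnitor_hom_tm (𝟙_ (ZObj β)) c d)).trans ?_
  refine Eq.trans ?_ (map_smul _ _ _).symm
  rw [map_smul, smul_smul]
  exact congrArg _ (Γ.unitHom₀_single (f * g) d).symm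

/-- The étale algebra maps to the image of the unit object. -/
noncomputable def unitHom : LocMod.UnitHom Γ.lax (etaleAlg D) where
  hom := Transfer.map Γ.unitHom₀
  one_hom := hom_ext _ _ (LinearMap.ext fun c => obj_ext fun x => by
    refine Eq.trans ?_ (Γ.lax_ε_val x c).symm
    change Γ.unitHom₀.lin ((show k from c) • Finsupp.single (1 : F) (1 : k)) = _
    rw [Finsupp.smul_single, smul_eq_mul, mul_one]
    exact Γ.unitHom₀_single 1 c)
  mul_hom := hom_ext₂ (X := obj D.algObj) (Y := obj D.algObj) fun f g a b ha hb =>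
    obj_ext fun x => by
      have h1 : val D.algObj x (Hom.lin D.alg.transfer.mulHom (tm (X := obj D.algObj)
          (Y := obj D.algObj) a b)) =
          (α.ten x⁻¹ f g : k) • D.eMul (val D.algObj x a) (val D.algObj x b) :=
        (congrArg (val D.algObj x) (D.alg.transfer.mulHom_tm a b)).trans
          (val_mulA (B := D.alg) ha hb x)
      refine (congrArg Γ.unitHom₀.lin h1).trans ?_
      rw [map_smul, ← Γ.unitHom₀_mul]
      have h2 := Γ.lax_μ_val (Hom.deg (Transfer.map Γ.unitHom₀) ha)
        (Hom.deg (Transfer.map Γ.unitHom₀) hb) x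
      refine Eq.trans ?_ (congrArg (Hom.lin (Γ.inflMap (λ_ (𝟙_ (ZObj β))).hom)) h2.symm)
      rw [map_smul]
      rfl

/-- The functor from `Z(H/F,β)` to local modules over the étale algebra. -/
@[reducible] noncomputable def functor : ZObj β ⥤ LocMod (etaleAlg D) := Γ.unitHom.functor

instance : IsIso Γ.unitHom.hom :=
  have : IsIso Γ.unitHom₀ := isIso_of_bijective _ Γ.unitHom₀_bijective
  Functor.map_isIso (Transfer.functor α H) Γ.unitHom₀

end
end EtaleGauge
end

/-! ### Full faithfulness. -/

section
attribute [local instance] Fintype.ofFinite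
open scoped TensorProduct Classical
open ZObj CategoryTheory MonoidalCategory

namespace EtaleGauge
section
variable {H k : Type u} [Group H] [Finite H] [Field k] {a : Cocycle3 H k} {F : Subgroup H}
  [F.Normal] {D : EtaleData a F} {β : Cocycle3 (H ⧸ F) k} (Γ : EtaleGauge D β)

theorem _root_.Gauge.sg_eq_zero {H Q k : Type u} [Group H] [Group Q] [Field k] [Finite H]
    [Finite Q] {π : H →* Q} {α : Cocycle3 H k} {β : Cocycle3 Q k} (Γ : Gauge π α β) {V : ZObj β}
    {u : H} {x : Q} {v : V.V} (hv : V.Deg x v) (h : π u ≠ x) : Γ.sg V u v = 0 := by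
  refine Subtype.ext (funext fun w => ?_)
  refine (Gauge.sgl_apply V u v w).trans ?_
  rw [hv.p_eq, if_neg h, ite_self]
  rfl

theorem inflAct_one {X : ZObj β} (n : (Γ.inflObj X).V) :
    Γ.inflAct X n (bs D 1) = n := by
  refine Γ.sg_ext ((Γ.inflAct X).flip (bs D 1)) LinearMap.id (fun u v hv => ?_) n
  rw [LinearMap.flip_apply, Γ.inflAct_sg hv]
  simp [Γ.one_right]

/-- `v[uf] = η(u,f)⁻¹ v[u] e_f`. -/
theorem sg_mul_coe {X : ZObj β} {u : H} {v : X.V} (hv : X.Deg (QuotientGroup.mk' F u) v) (f : F) :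
    Γ.sg X (u * f) v = (((Γ.η u f)⁻¹ : kˣ) : k) •
      Γ.inflAct X (Γ.sg X u v) (bs D f) := by
  rw [Γ.inflAct_sg hv, smul_smul]
  simp
end

open Transfer
variable {G k : Type u} [Group G] [Finite G] [Field k] {α : Cocycle3 G k} {H : Subgroup G}
  {F : Subgroup H} [F.Normal] {D : EtaleData (α.restrict H) F} {β : Cocycle3 (H ⧸ F) k}
  (Γ : EtaleGauge D β)

/-- The local module attached to an object of `Z(H/F,β)`. -/
@[reducible] noncomputable def kobj (X : ZObj β) : LocMod D.alg.transfer.toMon := Γ.unitHom.obj X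

theorem val_rmul {X : ZObj β} {f g : G} {m : (obj (Γ.inflObj X)).V} {a : (obj D.alg.X).V}
    (hm : (obj (Γ.inflObj X)).Deg f m) (ha : (obj D.alg.X).Deg g a) (x : G) :
    val (Γ.inflObj X) x (rmul (B := D.alg) (Γ.kobj X) m a) =
      (α.ten x⁻¹ f g : k) • Γ.inflAct X (val (Γ.inflObj X) x m) (val D.alg.X x a) := by
  have h2 := Γ.lax_μ_val hm (Hom.deg (Transfer.map Γ.unitHom₀) ha) x
  refine (congrArg (Hom.lin (Γ.inflMap (ρ_ X).hom)) h2).trans ?_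
  exact map_smul (Hom.lin (Γ.inflMap (ρ_ X).hom)) _ _

/-- Truncation to H followed by evaluation at 1: the e-part of the transferred module is the
inflation of X. -/
theorem rmul_idem {X : ZObj β} (m : (obj (Γ.inflObj X)).V) :
    rmul (B := D.alg) (Γ.kobj X) m (idem D.alg) =
      incl (Γ.inflObj X) (val (Γ.inflObj X) 1 m) := by
  refine lin_ext_apply (X := obj (Γ.inflObj X)) ((rmul (B := D.alg) (Γ.kobj X)).flip (idem D.alg))
    (incl (Γ.inflObj X) ∘ₗ val (Γ.inflObj X) 1) (fun f m hm => ?_) m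
  have hd : (obj (Γ.inflObj X)).Deg (f * 1) (rmul (B := D.alg) (Γ.kobj X) m (idem D.alg)) :=
    deg_rmul (B := D.alg) (Γ.kobj X) hm deg_idem
  refine (eq_incl_of_supp hd fun x hx => ?_).trans ?_
  · refine (Γ.val_rmul hm deg_idem x).trans ?_
    rw [val_idem, if_neg hx, map_zero, smul_zero]
  · refine congrArg (incl (Γ.inflObj X)) ((Γ.val_rmul hm deg_idem 1).trans ?_)
    rw [val_idem, if_pos H.one_mem, inv_one, α.ten_one_left, Units.val_one, one_smul]
    exact Γ.inflAct_one _

theorem rmul_incl {X : ZObj β} {u : H} {n : (Γ.inflObj X).V} (hn : (Γ.inflObj X).Deg u n)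
    (f : F) : rmul (B := D.alg) (Γ.kobj X) (incl (Γ.inflObj X) n)
      (incl D.alg.X (bs D f)) =
        incl (Γ.inflObj X) (Γ.inflAct X n (bs D f)) := by
  have hf := deg_incl (deg_bs D f)
  have hd : (obj (Γ.inflObj X)).Deg ((u : G) * (f : H)) (rmul (B := D.alg) (Γ.kobj X)
      (incl (Γ.inflObj X) n) (incl D.alg.X (bs D f))) :=
    deg_rmul (B := D.alg) (Γ.kobj X) (deg_incl hn) hf
  refine (eq_incl_of_supp hd fun x hx => ?_).trans ?_
  · refine (Γ.val_rmul (deg_incl hn) hf x).trans ?_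
    rw [val_incl_of_not_mem hx, map_zero, LinearMap.zero_apply, smul_zero]
  · refine congrArg (incl (Γ.inflObj X)) ((Γ.val_rmul (deg_incl hn) hf 1).trans ?_)
    rw [inv_one, α.ten_one_left, Units.val_one, one_smul, val_incl_one, val_incl_one]

theorem deg_val_one {V : ZObj (α.restrict H)} {u : H} {m : (obj V).V}
    (hm : (obj V).Deg (u : G) m) : V.Deg u (val V 1 m) := by
  have := deg_iff.1 hm 1
  rw [inv_one, one_mul, mul_one] at this
  exact (V.pG_coe u _).symm.trans this

theorem exists_incl_sg {X : ZObj β} {u : H} {m : (Γ.kobj X).X.V}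
    (hm : (Γ.kobj X).X.Deg (u : G) m) (he : rmul (B := D.alg) (Γ.kobj X) m (idem D.alg) = m) :
    ∃ v, X.Deg (QuotientGroup.mk' F u) v ∧ m = incl (Γ.inflObj X) (Γ.sg X u v) := by
  obtain ⟨v, hv, h⟩ := Γ.exists_sg (deg_val_one (V := Γ.inflObj X) hm)
  refine ⟨v, hv, ?_⟩
  rw [← h]
  exact he.symm.trans (Γ.rmul_idem m)

theorem incl_idem {X : ZObj β} (n : (Γ.inflObj X).V) :
    rmul (B := D.alg) (Γ.kobj X) (incl (Γ.inflObj X) n) (idem D.alg) = incl (Γ.inflObj X) n := by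
  rw [rmul_idem, val_incl_one]

theorem incl_sg_injective {X : ZObj β} {u : H} {v w : X.V}
    (hv : X.Deg (QuotientGroup.mk' F u) v) (hw : X.Deg (QuotientGroup.mk' F u) w)
    (h : incl (Γ.inflObj X) (Γ.sg X u v) = incl (Γ.inflObj X) (Γ.sg X u w)) : v = w := by
  have h1 := congrArg (fun t => Γ.val X u (val (Γ.inflObj X) 1 t)) h
  simp only [val_incl_one, Γ.val_sg_self hv, Γ.val_sg_self hw] at h1
  exact h1

theorem functor_map_incl_sg {X Y : ZObj β} (φ : X ⟶ Y) {u : H} {v : X.V}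
    (hv : X.Deg (QuotientGroup.mk' F u) v) :
    Hom.lin (Γ.functor.map φ).hom (incl (Γ.inflObj X) (Γ.sg X u v)) =
      incl (Γ.inflObj Y) (Γ.sg Y u (φ.lin v)) := by
  refine (map_incl (Γ.inflMap φ) (Γ.sg X u v)).trans ?_
  rw [Γ.inflMap_sg _ hv]

instance : Γ.functor.Faithful where
  map_injective {X Y φ φ'} h := hom_ext _ _ (lin_ext fun x v hv => by
    obtain ⟨u, rfl⟩ := QuotientGroup.mk'_surjective F x
    refine Γ.incl_sg_injective (φ.deg hv) (φ'.deg hv) ?_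
    rw [← Γ.functor_map_incl_sg φ hv, ← Γ.functor_map_incl_sg φ' hv, h])

section full
variable {X Y : ZObj β} (ψ : Γ.kobj X ⟶ Γ.kobj Y)

theorem exists_incl_sg_hom {u : H} {v : X.V} (hv : X.Deg (QuotientGroup.mk' F u) v) :
    ∃ w, Y.Deg (QuotientGroup.mk' F u) w ∧
      ψ.hom.lin (incl (Γ.inflObj X) (Γ.sg X u v)) = incl (Γ.inflObj Y) (Γ.sg Y u w) := by
  refine Γ.exists_incl_sg (ψ.hom.deg (deg_incl (Γ.deg_sg hv))) ?_
  rw [← hom_rmul]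
  exact congrArg _ (Γ.incl_idem _)

/-- The linear map underlying the preimage of a morphism of modules. -/
noncomputable def preimageLin : X.V →ₗ[k] Y.V :=
  ∑ x : H ⧸ F, Γ.val Y x.out ∘ₗ val (Γ.inflObj Y) 1 ∘ₗ ψ.hom.lin ∘ₗ incl (Γ.inflObj X) ∘ₗ
    Γ.sg X x.out

theorem mk_out (x : H ⧸ F) : QuotientGroup.mk' F x.out = x := QuotientGroup.out_eq' x

/-- For the representative `x.out` this is how `preimageLin` is defined. It passes to any other
representative because `v[uf]` is `v[u] e_f` up to the scalar η(u,f)⁻¹, which is the same for X and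
Y, and ψ commutes with `e_f`. -/
theorem preimageLin_spec {u : H} {v : X.V} (hv : X.Deg (QuotientGroup.mk' F u) v) :
    Y.Deg (QuotientGroup.mk' F u) (Γ.preimageLin ψ v) ∧
      ψ.hom.lin (incl (Γ.inflObj X) (Γ.sg X u v)) =
        incl (Γ.inflObj Y) (Γ.sg Y u (Γ.preimageLin ψ v)) := by
  generalize hx : QuotientGroup.mk' F u = x at hv
  have hv' : X.Deg (QuotientGroup.mk' F x.out) v := by rwa [mk_out]
  obtain ⟨w, hw, h1⟩ := Γ.exists_incl_sg_hom ψ hv'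
  have h2 : Γ.preimageLin ψ v = w := by
    rw [preimageLin, LinearMap.sum_apply, Finset.sum_eq_single x]
    · simp only [LinearMap.comp_apply]
      refine (congrArg (fun t => Γ.val Y x.out (val (Γ.inflObj Y) 1 t)) h1).trans ?_
      rw [val_incl_one, Γ.val_sg_self hw]
    · intro y _ hy
      simp only [LinearMap.comp_apply]
      rw [Γ.sg_eq_zero hv (by rwa [mk_out])]
      simp only [map_zero]
    · simp
  rw [h2]
  refine ⟨by rwa [mk_out] at hw, ?_⟩
  obtain ⟨f, rfl⟩ : ∃ f : F, u = x.out * f := by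
    refine ⟨⟨x.out⁻¹ * u, ?_⟩, by simp⟩
    rw [← QuotientGroup.eq_one_iff]
    change (QuotientGroup.mk' F) (x.out⁻¹ * u) = 1
    rw [map_mul, map_inv, hx, mk_out, inv_mul_cancel]
  rw [Γ.sg_mul_coe hv', Γ.sg_mul_coe hw, map_smul, map_smul,
    map_smul, ← Γ.rmul_incl (Γ.deg_sg hv') f, ← Γ.rmul_incl (Γ.deg_sg hw) f, hom_rmul]
  refine congrArg _ ?_
  exact congrArg (fun t => rmul (B := D.alg) (Γ.kobj Y) t _) h1

/-- The preimage of a morphism of modules. -/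
noncomputable def preimage : X ⟶ Y where
  lin := Γ.preimageLin ψ
  p_comm := p_comm_of_deg _ _ fun x v hv => by
    obtain ⟨u, rfl⟩ := QuotientGroup.mk'_surjective F x
    exact (Γ.preimageLin_spec ψ hv).1
  ρ_comm q := lin_ext_apply (Γ.preimageLin ψ ∘ₗ X.ρ q) (Y.ρ q ∘ₗ Γ.preimageLin ψ)
    fun x v hv => by
      obtain ⟨u, rfl⟩ := QuotientGroup.mk'_surjective F x
      obtain ⟨h, rfl⟩ := QuotientGroup.mk'_surjective F q
      obtain ⟨h1, h2⟩ := Γ.preimageLin_spec ψ hv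
      obtain ⟨h3, h4⟩ := Γ.preimageLin_spec ψ (Gauge.deg_ρ_conj hv h)
      refine Γ.incl_sg_injective h3 (Gauge.deg_ρ_conj h1 h) ?_
      have h5 := ψ.hom.ρ_comm h (incl (Γ.inflObj X) (Γ.sg X u v))
      have h6 : (Γ.kobj X).X.ρ h (incl (Γ.inflObj X) (Γ.sg X u v)) = _ := ρ_incl h (Γ.sg X u v)
      have h7 : (Γ.kobj Y).X.ρ h (incl (Γ.inflObj Y) (Γ.sg Y u (Γ.preimageLin ψ v))) = _ :=
        ρ_incl h _
      rw [h2, h6, h7, Γ.ρ_sg h u hv, Γ.ρ_sg h u h1, map_smul, map_smul, map_smul,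
        h4] at h5
      -- The same scalar λ(h,u) occurs on both sides, as it does not depend on the object, and is
      -- cancelled.
      exact smul_right_injective _ (Units.ne_zero _) h5

/-- The locus where the two morphisms agree is stable under G, so it suffices that it contains the
e-part, where `preimageLin_spec` applies. -/
theorem map_preimage [CharZero k] : Γ.functor.map (Γ.preimage ψ) = ψ := by
  refine LocMod.hom_ext _ _ (hom_ext _ _ ?_)
  rw [← LinearMap.eqLocus_eq_top]
  refine eq_top_of_idem (B := D.alg) (Γ.kobj X) _ (fun g m hm => ?_) (fun u m hm he => ?_)
  · rw [LinearMap.mem_eqLocus] at hm ⊢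
    rw [ψ.hom.ρ_comm, ← hm]
    exact Hom.ρ_comm (Γ.functor.map (Γ.preimage ψ)).hom g m
  · obtain ⟨v, hv, rfl⟩ := Γ.exists_incl_sg hm he
    exact (Γ.functor_map_incl_sg (Γ.preimage ψ) hv).trans (Γ.preimageLin_spec ψ hv).2.symm

end full

instance [CharZero k] : Γ.functor.Full where
  map_surjective ψ := ⟨Γ.preimage ψ, Γ.map_preimage ψ⟩

end EtaleGauge
end

/-! ### Transport between the degrees of a coset in the e-part of a local module. -/

section
attribute [local instance] Fintype.ofFinite
open scoped TensorProduct Classical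
open ZObj CategoryTheory MonoidalCategory

namespace EtaleGauge
open Transfer
variable {G k : Type u} [Group G] [Finite G] [Field k] {α : Cocycle3 G k} {H : Subgroup G}
  {F : Subgroup H} [F.Normal] {D : EtaleData (α.restrict H) F} {β : Cocycle3 (H ⧸ F) k}
  (Γ : EtaleGauge D β) (M : LocMod D.alg.transfer.toMon)

/-- The basis element `e_f` as an element of the étale algebra. -/
noncomputable def be (D : EtaleData (α.restrict H) F) (f : F) : (obj D.alg.X).V :=
  incl D.alg.X (bs D f)

theorem deg_be (f : F) : (obj D.alg.X).Deg ((f : H) : G) (be D f) := deg_incl (deg_bs D f)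

theorem be_one : be D 1 = idem D.alg := rfl

theorem mulA_be (f g : F) : mulA D.alg (be D f) (be D g) = (D.γ f g : k) • be D (f * g) := by
  rw [be, be, incl_mulA_incl (deg_bs D f) (deg_bs D g), mul_bs, map_smul, be]

theorem ρ_be (h : H) (f : F) :
    (obj D.alg.X).ρ (h : G) (be D f) = (D.ε h f : k) • be D (MulAut.conjNormal h f) := by
  rw [be, ρ_incl, ρ_bs, map_smul, be]

/-- `m` is of degree `u` and `m e = m`. -/
def InS (u : H) (m : M.X.V) : Prop := M.X.Deg (u : G) m ∧ rmul M m (idem D.alg) = m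

/-- `m ↦ η(u,f)⁻¹ m e_f`, for `m` of degree `u`. -/
noncomputable def star (u : H) (f : F) : M.X.V →ₗ[k] M.X.V :=
  (((Γ.η u f)⁻¹ : kˣ) : k) • (rmul M).flip (be D f)

/-- `m ↦ λ(h,u)⁻¹ h.m`, for `m` of degree `u`. -/
noncomputable def tri (h u : H) : M.X.V →ₗ[k] M.X.V :=
  (((Γ.lam h u)⁻¹ : kˣ) : k) • M.X.ρ (h : G)

/-- The transport of elements of degree in `wF` to degree `w`. -/
noncomputable def trans (w : H) : M.X.V →ₗ[k] M.X.V :=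
  ∑ f : F, Γ.star M (w * (f : H)⁻¹) f ∘ₗ M.X.p ((w * (f : H)⁻¹ : H) : G)

variable {M}

theorem star_apply (u : H) (f : F) (m : M.X.V) :
    Γ.star M u f m = (((Γ.η u f)⁻¹ : kˣ) : k) • rmul M m (be D f) := rfl

theorem tri_apply (h u : H) (m : M.X.V) :
    Γ.tri M h u m = (((Γ.lam h u)⁻¹ : kˣ) : k) • M.X.ρ (h : G) m := rfl

/-- Among the terms of `trans` only one starts from the degree of m. -/
theorem trans_mul {u : H} {m : M.X.V} (hm : M.X.Deg (u : G) m) (f : F) :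
    Γ.trans M (u * f) m = Γ.star M u f m := by
  rw [trans, LinearMap.sum_apply, Finset.sum_eq_single f]
  · rw [LinearMap.comp_apply, mul_inv_cancel_right, hm]
  · intro g _ hg
    rw [LinearMap.comp_apply, hm.p_eq, if_neg, map_zero]
    intro h
    refine hg (Subtype.ext ?_)
    have h1 : u * f * (g : H)⁻¹ = u := Subtype.ext h
    rw [mul_assoc, mul_eq_left, mul_inv_eq_one] at h1
    exact h1.symm
  · simp

theorem inS_star {u : H} {m : M.X.V} (hm : InS M u m) (f : F) :
    InS M (u * f) (Γ.star M u f m) := by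
  refine ⟨(deg_rmul M hm.1 (deg_be f)).smul _, ?_⟩
  rw [star_apply, map_smul, LinearMap.smul_apply]
  congr 1
  exact rmul_incl_idem M m _

theorem inS_smul {u : H} {m : M.X.V} (hm : InS M u m) (c : k) : InS M u (c • m) :=
  ⟨hm.1.smul c, by rw [map_smul, LinearMap.smul_apply, hm.2]⟩

theorem inS_ρ {u : H} {m : M.X.V} (hm : InS M u m) (h : H) :
    InS M (h * u * h⁻¹) (M.X.ρ (h : G) m) :=
  ⟨hm.1.ρ (h : G), by rw [← ρ_rmul_idem_coe, hm.2]⟩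

theorem inS_tri {u : H} {m : M.X.V} (hm : InS M u m) (h : H) :
    InS M (h * u * h⁻¹) (Γ.tri M h u m) := inS_smul (inS_ρ hm h) _

theorem star_one {u : H} {m : M.X.V} (hm : InS M u m) : Γ.star M u 1 m = m := by
  rw [star_apply, be_one, hm.2, OneMemClass.coe_one, Γ.one_right, inv_one, Units.val_one, one_smul]

theorem mk'_coe (f : F) : QuotientGroup.mk' F (f : H) = 1 := (QuotientGroup.eq_one_iff _).2 f.2

/-- Coherence of the transports. Both sides are multiples of m e_{fg}, and the scalars match by the
cocycle relation of the gauge, in which β disappears because two of its arguments lie in F and η is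
γ on F. -/
theorem star_star {u : H} {m : M.X.V} (hm : InS M u m) (f g : F) :
    Γ.star M (u * f) g (Γ.star M u f m) = Γ.star M u (f * g) m := by
  have h1 := rmul_mulA M hm.1 (deg_be (D := D) f) (deg_be (D := D) g)
  rw [mulA_be, map_smul] at h1
  have h2 := Γ.cocycle u f g
  rw [mk'_coe, mk'_coe, β.isCocycle.one_mid, one_mul, Γ.η_coe] at h2
  have h3 := congrArg (fun t : kˣ => (t : k)) h2
  change _ = (((α.restrict H).toFun u f g : kˣ) : k) • _ at h1
  rw [star_apply, star_apply, star_apply, map_smul, LinearMap.smul_apply, smul_smul]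
  have h4 : rmul M (rmul M m (be D f)) (be D g) =
      ((((α.restrict H).toFun u f g)⁻¹ : kˣ) : k) • (D.γ f g : k) • rmul M m (be D (f * g)) := by
    rw [h1, smul_smul]; simp
  rw [h4, smul_smul, smul_smul]
  congr 1
  push_cast at h3 ⊢
  field_simp
  linear_combination -h3

/-- Dividing the action by λ replaces the scalar α(g,h|u) by its counterpart for β. So the rescaled
action of H is β-projective and has a chance of descending to the quotient. -/
theorem tri_mul {u : H} {m : M.X.V} (hm : InS M u m) (g h : H) :
    Γ.tri M (g * h) u m = (β.act (QuotientGroup.mk' F g) (QuotientGroup.mk' F h)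
      (QuotientGroup.mk' F u) : k) • Γ.tri M g (h * u * h⁻¹) (Γ.tri M h u m) := by
  have h1 := hm.1.ρ_mul (g : G) (h : G)
  have h3 := congrArg (fun t : kˣ => (t : k)) (Γ.lam_mul g h u)
  change _ = (((α.restrict H).act g h u : kˣ) : k) • _ at h1
  rw [tri_apply, tri_apply, tri_apply, map_smul, smul_smul, smul_smul, Subgroup.coe_mul, h1,
    smul_smul]
  congr 1
  push_cast at h3 ⊢
  field_simp
  linear_combination -h3

/-- The rescaled action commutes with transport. By `lam_ten` the scalars agree, since the β-factor
is trivial for an argument in F and λ(h,f) is ε_h(f). -/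
theorem tri_star {u : H} {m : M.X.V} (hm : InS M u m) (h : H) (f : F) :
    Γ.tri M h (u * f) (Γ.star M u f m) =
      Γ.star M (h * u * h⁻¹) (MulAut.conjNormal h f) (Γ.tri M h u m) := by
  have h1 := ρ_rmul M hm.1 (deg_be (D := D) f) (h : G)
  have h3 := congrArg (fun t : kˣ => (t : k)) (Γ.lam_ten h u f)
  change _ = (((α.restrict H).ten h u f : kˣ) : k) • _ at h1
  rw [tri_apply, tri_apply, star_apply, star_apply, map_smul, map_smul, LinearMap.smul_apply, h1,
    ρ_be, map_smul, smul_smul, smul_smul, smul_smul, smul_smul, MulAut.conjNormal_apply]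
  congr 1
  rw [mk'_coe, β.ten_one_right, Γ.lam_coe] at h3
  push_cast at h3 ⊢
  field_simp
  linear_combination h3

/-- Locality for m and `e_{u⁻¹fu}`: the double braiding replaces the pair by f.m and a multiple of
`e_f`. The scalars are absorbed by λ. -/
theorem star_tri_coe {u : H} {m : M.X.V} (hm : InS M u m) (f : F) :
    Γ.star M ((f : H) * u * (f : H)⁻¹) f (Γ.tri M f u m) =
      Γ.star M u (MulAut.conjNormal u⁻¹ f) m := by
  have h1 := rmul_local M hm.1 (deg_be (D := D) (MulAut.conjNormal u⁻¹ f))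
  have h2 : u * (MulAut.conjNormal u⁻¹ f : F) * u⁻¹ = (f : H) := by
    rw [MulAut.conjNormal_apply]; group
  have h3 : (MulAut.conjNormal u (MulAut.conjNormal u⁻¹ f) : F) = f := by
    rw [← MulAut.mul_apply, ← map_mul, mul_inv_cancel, map_one, MulAut.one_apply]
  have h4 : ((u : G) * ((MulAut.conjNormal u⁻¹ f : F) : H) * (u : G)⁻¹) = ((f : H) : G) :=
    congrArg (fun t : H => (t : G)) h2
  have h5 := Γ.lam_coe u (MulAut.conjNormal u⁻¹ f)
  rw [h4, ρ_be, h3, map_smul, ← h5] at h1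
  rw [star_apply, star_apply, tri_apply, map_smul, LinearMap.smul_apply, h1, smul_smul, smul_smul]
  congr 1
  simp only [Gauge.lam, h2]
  push_cast
  field_simp

theorem exists_coe {u w : H} (h : QuotientGroup.mk' F u = QuotientGroup.mk' F w) :
    ∃ f : F, w = u * f := by
  refine ⟨⟨u⁻¹ * w, ?_⟩, by simp⟩
  rw [← QuotientGroup.eq_one_iff]
  change (QuotientGroup.mk' F) (u⁻¹ * w) = 1
  rw [map_mul, map_inv, h, inv_mul_cancel]

theorem inS_trans {u w : H} {m : M.X.V} (hm : InS M u m)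
    (h : QuotientGroup.mk' F u = QuotientGroup.mk' F w) : InS M w (Γ.trans M w m) := by
  obtain ⟨f, rfl⟩ := exists_coe h
  rw [Γ.trans_mul hm.1]
  exact Γ.inS_star hm f

theorem trans_self {u : H} {m : M.X.V} (hm : InS M u m) : Γ.trans M u m = m := by
  have := Γ.trans_mul hm.1 1
  rwa [OneMemClass.coe_one, mul_one, Γ.star_one hm] at this

theorem trans_trans {u w w' : H} {m : M.X.V} (hm : InS M u m)
    (h : QuotientGroup.mk' F u = QuotientGroup.mk' F w)
    (h' : QuotientGroup.mk' F u = QuotientGroup.mk' F w') :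
    Γ.trans M w' (Γ.trans M w m) = Γ.trans M w' m := by
  obtain ⟨f, rfl⟩ := exists_coe h
  obtain ⟨g, rfl⟩ := exists_coe (h.symm.trans h')
  rw [Γ.trans_mul hm.1, Γ.trans_mul (Γ.inS_star hm f).1, Γ.star_star hm, mul_assoc,
    ← Subgroup.coe_mul, Γ.trans_mul hm.1]

theorem tri_trans {u w : H} {m : M.X.V} (hm : InS M u m)
    (h : QuotientGroup.mk' F u = QuotientGroup.mk' F w) (x : H) :
    Γ.tri M x w (Γ.trans M w m) = Γ.trans M (x * w * x⁻¹) (Γ.tri M x u m) := by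
  obtain ⟨f, rfl⟩ := exists_coe h
  rw [Γ.trans_mul hm.1, Γ.tri_star hm, ← Γ.trans_mul (Γ.inS_tri hm x).1, MulAut.conjNormal_apply,
    show x * u * x⁻¹ * (x * (f : H) * x⁻¹) = x * (u * f) * x⁻¹ by group]

theorem trans_tri_coe {u w : H} {m : M.X.V} (hm : InS M u m) (f : F)
    (h : QuotientGroup.mk' F u = QuotientGroup.mk' F w) :
    Γ.trans M w (Γ.tri M f u m) = Γ.trans M w m := by
  have h0 : QuotientGroup.mk' F u = QuotientGroup.mk' F ((f : H) * u) := by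
    rw [map_mul, mk'_coe, one_mul]
  have h1 : QuotientGroup.mk' F u = QuotientGroup.mk' F ((f : H) * u * (f : H)⁻¹) := by
    rw [map_mul, map_mul, map_inv, mk'_coe, inv_one, one_mul, mul_one]
  have h2 := Γ.inS_tri hm f
  rw [← Γ.trans_trans h2 (h1.symm.trans h0) (h1.symm.trans h)]
  have h3 := Γ.trans_mul h2.1 f
  have h4 : (f : H) * u = u * (MulAut.conjNormal u⁻¹ f : F) := by
    rw [MulAut.conjNormal_apply]; group
  rw [inv_mul_cancel_right, Γ.star_tri_coe hm, ← Γ.trans_mul hm.1, ← h4] at h3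
  rw [h3, Γ.trans_trans hm h0 h]

/-- Two lifts of one element of H/F differ by an element of F on the left, which acts trivially up
to transport. Hence the action descends to H/F. -/
theorem trans_tri_congr {u w h h' : H} {m : M.X.V} (hm : InS M u m)
    (e : QuotientGroup.mk' F h = QuotientGroup.mk' F h')
    (hw : QuotientGroup.mk' F (h * u * h⁻¹) = QuotientGroup.mk' F w) :
    Γ.trans M w (Γ.tri M h' u m) = Γ.trans M w (Γ.tri M h u m) := by
  obtain ⟨f, rfl⟩ : ∃ f : F, h' = f * h := by
    refine ⟨⟨h' * h⁻¹, ?_⟩, by simp⟩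
    rw [← QuotientGroup.eq_one_iff]
    change (QuotientGroup.mk' F) (h' * h⁻¹) = 1
    rw [map_mul, map_inv, e, mul_inv_cancel]
  rw [Γ.tri_mul hm, mk'_coe, β.act_one_left, Units.val_one, one_smul,
    Γ.trans_tri_coe (Γ.inS_tri hm h) f hw]

end EtaleGauge
end

/-! ### The fiber of a local module and essential surjectivity. -/

section
attribute [local instance] Fintype.ofFinite
open scoped TensorProduct Classical
open ZObj CategoryTheory MonoidalCategory

namespace EtaleGauge
open Transfer
variable {G k : Type u} [Group G] [Finite G] [Field k] {α : Cocycle3 G k} {H : Subgroup G}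
  {F : Subgroup H} [F.Normal] {D : EtaleData (α.restrict H) F} {β : Cocycle3 (H ⧸ F) k}
  (Γ : EtaleGauge D β) (M : LocMod D.alg.transfer.toMon)

theorem p_rmul_idem (g : G) (m : M.X.V) :
    M.X.p g (rmul M m (idem D.alg)) = rmul M (M.X.p g m) (idem D.alg) := by
  refine lin_ext_apply (M.X.p g ∘ₗ (rmul M).flip (idem D.alg))
    ((rmul M).flip (idem D.alg) ∘ₗ M.X.p g) (fun f m hm => ?_) m
  have h := deg_rmul M hm (deg_idem (B := D.alg))
  rw [mul_one] at h
  simp only [LinearMap.comp_apply, LinearMap.flip_apply]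
  rw [h.p_eq, hm.p_eq]
  split_ifs
  · rfl
  · rw [map_zero, LinearMap.zero_apply]

/-- The representative of `x` in `H`. -/
noncomputable def rep (x : H ⧸ F) : H := x.out

theorem mk'_rep (x : H ⧸ F) : QuotientGroup.mk' F (rep x) = x := QuotientGroup.out_eq' x

theorem rep_injective {x y : H ⧸ F} (h : ((rep x : H) : G) = (rep y : H)) : x = y := by
  rw [← mk'_rep x, ← mk'_rep y, Subtype.ext h]

/-- The elements `m = m e` of degrees in the chosen system of representatives. -/
noncomputable def fibSub : Submodule k M.X.V where
  carrier := {m | rmul M m (idem D.alg) = m ∧ ∑ x : H ⧸ F, M.X.p ((rep x : H) : G) m = m}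
  add_mem' ha hb := ⟨by rw [map_add, LinearMap.add_apply, ha.1, hb.1], by
    simp only [map_add, Finset.sum_add_distrib, ha.2, hb.2]⟩
  zero_mem' := ⟨by simp, by simp⟩
  smul_mem' c m hm := ⟨by rw [map_smul, LinearMap.smul_apply, hm.1], by
    simp only [map_smul, ← Finset.smul_sum, hm.2]⟩

variable {M}

theorem mem_fibSub {x : H ⧸ F} {m : M.X.V} (hm : InS M (rep x) m) : m ∈ fibSub M := by
  refine ⟨hm.2, ?_⟩
  rw [Finset.sum_eq_single x]
  · exact hm.1
  · intro y _ hy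
    rw [hm.1.p_eq, if_neg (fun e => hy (rep_injective e))]
  · simp

theorem inS_p {m : M.X.V} (hm : rmul M m (idem D.alg) = m) (u : H) : InS M u (M.X.p (u : G) m) :=
  ⟨M.X.deg_p _ m, by rw [← p_rmul_idem, hm]⟩

theorem p_mem_fibSub (x : H ⧸ F) {m : M.X.V} (hm : m ∈ fibSub M) :
    M.X.p ((rep x : H) : G) m ∈ fibSub M := mem_fibSub (inS_p hm.1 _)

/-- The action of `q` on elements of degree `rep x`. -/
noncomputable def fibρ₁ (M : LocMod D.alg.transfer.toMon) (q x : H ⧸ F) : M.X.V →ₗ[k] M.X.V :=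
  Γ.trans M (rep (q * x * q⁻¹)) ∘ₗ Γ.tri M (rep q) (rep x)

theorem mk'_conj_rep (q x : H ⧸ F) :
    QuotientGroup.mk' F (rep q * rep x * (rep q)⁻¹) = q * x * q⁻¹ := by
  rw [map_mul, map_mul, map_inv, mk'_rep, mk'_rep]

theorem inS_fibρ₁ (q : H ⧸ F) {x : H ⧸ F} {m : M.X.V} (hm : InS M (rep x) m) :
    InS M (rep (q * x * q⁻¹)) (Γ.fibρ₁ M q x m) :=
  Γ.inS_trans (Γ.inS_tri hm _) ((mk'_conj_rep q x).trans (mk'_rep _).symm)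

/-- The action of `q`. -/
noncomputable def fibρ (M : LocMod D.alg.transfer.toMon) (q : H ⧸ F) : M.X.V →ₗ[k] M.X.V :=
  ∑ x : H ⧸ F, Γ.fibρ₁ M q x ∘ₗ M.X.p ((rep x : H) : G)

theorem fibρ_mem (q : H ⧸ F) {m : M.X.V} (hm : m ∈ fibSub M) : Γ.fibρ M q m ∈ fibSub M := by
  rw [fibρ, LinearMap.sum_apply]
  exact Submodule.sum_mem _ fun x _ => mem_fibSub (Γ.inS_fibρ₁ q (inS_p hm.1 _))

theorem fibρ_apply (q : H ⧸ F) {x : H ⧸ F} {m : M.X.V} (hm : InS M (rep x) m) :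
    Γ.fibρ M q m = Γ.fibρ₁ M q x m := by
  rw [fibρ, LinearMap.sum_apply, Finset.sum_eq_single x]
  · rw [LinearMap.comp_apply, hm.1]
  · intro y _ hy
    rw [LinearMap.comp_apply, hm.1.p_eq, if_neg (fun e => hy (rep_injective e)), map_zero]
  · simp

theorem fibρ_one {m : M.X.V} (hm : m ∈ fibSub M) : Γ.fibρ M 1 m = m := by
  rw [fibρ, LinearMap.sum_apply]
  refine Eq.trans (Finset.sum_congr rfl fun x _ => ?_) hm.2
  have h1 := inS_p hm.1 (rep x)
  -- The representative of the trivial coset is an element of F that need not be 1, so the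
  -- triviality of the action of F is needed even here.
  have h2 : (rep (1 : H ⧸ F) : H) ∈ F := (QuotientGroup.eq_one_iff _).1 (mk'_rep 1)
  have h3 := Γ.trans_tri_coe h1 ⟨_, h2⟩ rfl
  rw [LinearMap.comp_apply, fibρ₁, one_mul, inv_one, mul_one, LinearMap.comp_apply]
  exact h3.trans (Γ.trans_self h1)

/-- The inner transport is moved past the outer action by `tri_trans` and merged with the outer
transport. The two actions then combine by `tri_mul`, which yields the scalar of β, and `rep q * rep
r` may be replaced by `rep (q * r)`. -/
theorem fibρ_mul (q r : H ⧸ F) {x : H ⧸ F} {m : M.X.V} (hm : InS M (rep x) m) :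
    Γ.fibρ M (q * r) m = (β.act q r x : k) • Γ.fibρ M q (Γ.fibρ M r m) := by
  rw [Γ.fibρ_apply (q * r) hm, Γ.fibρ_apply r hm, Γ.fibρ_apply q (Γ.inS_fibρ₁ r hm)]
  simp only [fibρ₁, LinearMap.comp_apply]
  have e1 : QuotientGroup.mk' F (rep r * rep x * (rep r)⁻¹) =
      QuotientGroup.mk' F (rep (r * x * r⁻¹)) := (mk'_conj_rep r x).trans (mk'_rep _).symm
  have e2 : q * (r * x * r⁻¹) * q⁻¹ = q * r * x * (q * r)⁻¹ := by group
  rw [Γ.tri_trans (Γ.inS_tri hm (rep r)) e1, e2]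
  have hm2 := Γ.inS_tri (Γ.inS_tri hm (rep r)) (rep q)
  rw [Γ.trans_trans hm2]
  · have h1 := Γ.tri_mul hm (rep q) (rep r)
    rw [mk'_rep, mk'_rep, mk'_rep] at h1
    rw [← map_smul, ← h1]
    refine Γ.trans_tri_congr hm ?_ ?_
    · rw [map_mul, mk'_rep, mk'_rep, mk'_rep]
    · simp only [map_mul, map_inv, mk'_rep]
  · simp only [map_mul, map_inv, mk'_rep]
  · simp only [map_mul, map_inv, mk'_rep]
    group

/-- The object of `Z(H/F,β)` attached to a local module. -/
@[reducible] noncomputable def fib (M : LocMod D.alg.transfer.toMon) : ZObj β where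
  V := fibSub M
  p x := (M.X.p ((rep x : H) : G)).restrict fun _ hm => p_mem_fibSub x hm
  p_same x m := Subtype.ext (M.X.p_same _ m.1)
  p_ne x y m hxy := Subtype.ext (M.X.p_ne _ _ m.1 fun e => hxy (rep_injective e))
  p_sum m := Subtype.ext (by
    refine Eq.trans ?_ m.2.2
    rw [AddSubmonoidClass.coe_finsetSum]
    exact Finset.sum_congr (by ext; simp) fun _ _ => rfl)
  ρ q := (Γ.fibρ M q).restrict fun _ hm => Γ.fibρ_mem q hm
  ρ_one m := Subtype.ext (Γ.fibρ_one m.2)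
  ρ_p q x m := Subtype.ext (by
    change Γ.fibρ M q (M.X.p ((rep x : H) : G) m.1) =
      M.X.p ((rep (q * x * q⁻¹) : H) : G) (Γ.fibρ M q m.1)
    rw [Γ.fibρ_apply q (inS_p m.2.1 _), fibρ, LinearMap.sum_apply, map_sum,
      Finset.sum_eq_single x]
    · exact (Γ.inS_fibρ₁ q (inS_p m.2.1 (rep x))).1.symm
    · intro y _ hy
      rw [LinearMap.comp_apply, (Γ.inS_fibρ₁ q (inS_p m.2.1 (rep y))).1.p_eq, if_neg]
      exact fun e => hy (by simpa using (rep_injective e).symm)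
    · simp)
  ρ_mul q r x m := Subtype.ext (Γ.fibρ_mul q r (inS_p m.2.1 (rep x)))

theorem fib_deg_iff {x : H ⧸ F} {v : (Γ.fib M).V} : (Γ.fib M).Deg x v ↔ InS M (rep x) v.1 :=
  ⟨fun h => ⟨congrArg Subtype.val h, v.2.1⟩, fun h => Subtype.ext h.1⟩

/-- The component of degree `u` of `m e`, transported to the degree `rep ū`. -/
noncomputable def toFib (M : LocMod D.alg.transfer.toMon) (u : H) : M.X.V →ₗ[k] (Γ.fib M).V :=
  LinearMap.codRestrict (fibSub M)
    (Γ.trans M (rep (QuotientGroup.mk' F u)) ∘ₗ M.X.p (u : G) ∘ₗ (rmul M).flip (idem D.alg))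
    fun m => mem_fibSub (Γ.inS_trans (inS_p (rmul_idem_idem M m) u) (mk'_rep _).symm)

theorem toFib_coe {u : H} {m : M.X.V} (hm : M.X.Deg (u : G) m) :
    (Γ.toFib M u m).1 = Γ.trans M (rep (QuotientGroup.mk' F u)) (rmul M m (idem D.alg)) := by
  change Γ.trans M _ (M.X.p (u : G) (rmul M m (idem D.alg))) = _
  rw [p_rmul_idem, hm]

theorem inS_rmul {u : H} {m : M.X.V} (hm : M.X.Deg (u : G) m) :
    InS M u (rmul M m (idem D.alg)) := by
  have h := deg_rmul M hm (deg_idem (B := D.alg))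
  rw [mul_one] at h
  exact ⟨h, rmul_idem_idem M m⟩

theorem deg_toFib {u : H} {m : M.X.V} (hm : M.X.Deg (u : G) m) :
    (Γ.fib M).Deg (QuotientGroup.mk' F u) (Γ.toFib M u m) := by
  rw [fib_deg_iff, toFib_coe Γ hm]
  exact Γ.inS_trans (inS_rmul hm) (mk'_rep _).symm

/-- The map from a local module to the inflation of its fiber. -/
noncomputable def toInfl (M : LocMod D.alg.transfer.toMon) :
    M.X.V →ₗ[k] (Γ.inflObj (Γ.fib M)).V :=
  ∑ u : H, Γ.sg (Γ.fib M) u ∘ₗ Γ.toFib M u ∘ₗ M.X.p (u : G)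

theorem toInfl_coe {u : H} {m : M.X.V} (hm : M.X.Deg (u : G) m) :
    Γ.toInfl M m = Γ.sg (Γ.fib M) u (Γ.toFib M u m) := by
  rw [toInfl, LinearMap.sum_apply, Finset.sum_eq_single u]
  · rw [LinearMap.comp_apply, LinearMap.comp_apply, hm]
  · intro w _ hw
    rw [LinearMap.comp_apply, LinearMap.comp_apply, hm.p_eq, if_neg (fun e => hw (Subtype.ext e)),
      map_zero, map_zero]
  · simp

theorem toInfl_of_not_mem {g : G} {m : M.X.V} (hm : M.X.Deg g m) (hg : g ∉ H) :
    Γ.toInfl M m = 0 := by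
  rw [toInfl, LinearMap.sum_apply]
  refine Finset.sum_eq_zero fun w _ => ?_
  rw [LinearMap.comp_apply, LinearMap.comp_apply, hm.p_eq,
    if_neg (fun e : (w : G) = g => hg (e ▸ w.2)),
      map_zero, map_zero]

theorem toInfl_idem (m : M.X.V) : Γ.toInfl M (rmul M m (idem D.alg)) = Γ.toInfl M m := by
  refine lin_ext_apply (Γ.toInfl M ∘ₗ (rmul M).flip (idem D.alg)) (Γ.toInfl M)
    (fun g m hm => ?_) m
  rw [LinearMap.comp_apply, LinearMap.flip_apply]
  by_cases hg : g ∈ H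
  · lift g to H using hg
    rw [Γ.toInfl_coe hm, Γ.toInfl_coe (inS_rmul hm).1]
    congr 1
    exact Subtype.ext (by rw [Γ.toFib_coe hm, Γ.toFib_coe (inS_rmul hm).1, rmul_idem_idem])
  · rw [rmul_idem_eq_zero M hm hg, map_zero, Γ.toInfl_of_not_mem hm hg]

/-- The scalar λ(h,u) of the inflated action is the one removed in `tri`. What remains is that the
action of the coset of h on the fiber can be computed with h itself instead of the chosen
representative. -/
theorem toInfl_ρ (h : H) (m : M.X.V) :
    Γ.toInfl M (M.X.ρ (h : G) m) = (Γ.inflObj (Γ.fib M)).ρ h (Γ.toInfl M m) := by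
  refine lin_ext_apply (Γ.toInfl M ∘ₗ M.X.ρ (h : G))
    ((Γ.inflObj (Γ.fib M)).ρ h ∘ₗ Γ.toInfl M) (fun g m hm => ?_) m
  rw [LinearMap.comp_apply, LinearMap.comp_apply]
  by_cases hg : g ∈ H
  · lift g to H using hg
    have hm' : M.X.Deg ((h * g * h⁻¹ : H) : G) (M.X.ρ (h : G) m) := hm.ρ (h : G)
    rw [Γ.toInfl_coe hm', Γ.toInfl_coe hm, Γ.ρ_sg h g (Γ.deg_toFib hm), ← map_smul]
    congr 1
    refine Subtype.ext ?_
    rw [Γ.toFib_coe hm', ← ρ_rmul_idem_coe]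
    have hn := inS_rmul hm
    have h1 : M.X.ρ (h : G) (rmul M m (idem D.alg)) =
        (Γ.lam h g : k) • Γ.tri M h g (rmul M m (idem D.alg)) := by
      rw [tri_apply, smul_smul]; simp
    rw [h1, map_smul]
    refine congrArg (fun t => (Γ.lam h g : k) • t) ?_
    change _ = Γ.fibρ M (QuotientGroup.mk' F h) (Γ.toFib M g m).1
    rw [Γ.fibρ_apply _ (Γ.fib_deg_iff.1 (Γ.deg_toFib hm)), Γ.toFib_coe hm, fibρ₁,
      LinearMap.comp_apply, Γ.tri_trans hn (mk'_rep _).symm, Γ.trans_trans]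
    · rw [map_mul, map_mul, map_inv]
      refine (Γ.trans_tri_congr hn (mk'_rep _) ?_).symm.symm
      simp only [map_mul, map_inv, mk'_rep]
    · exact Γ.inS_tri hn _
    · simp only [map_mul, map_inv, mk'_rep]
    · simp only [map_mul, map_inv, mk'_rep]
  · have hg' : (h : G) * g * (h : G)⁻¹ ∉ H := fun h' => hg (by
      have := H.mul_mem (H.mul_mem (H.inv_mem h.2) h') h.2
      simpa [mul_assoc] using this)
    rw [Γ.toInfl_of_not_mem (hm.ρ (h : G)) hg', Γ.toInfl_of_not_mem hm hg, map_zero]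

/-- On the e-part, `e_f` is η(u,f) times a transport. Transport disappears after moving to the
representative of the coset, and η(u,f) is the scalar by which `e_f` acts on an inflation. -/
theorem toInfl_be (m : M.X.V) (f : F) :
    Γ.toInfl M (rmul M m (be D f)) = Γ.inflAct (Γ.fib M) (Γ.toInfl M m) (bs D f) := by
  refine lin_ext_apply (Γ.toInfl M ∘ₗ (rmul M).flip (be D f))
    ((Γ.inflAct (Γ.fib M)).flip (bs D f) ∘ₗ Γ.toInfl M) (fun g m hm => ?_) m
  rw [LinearMap.comp_apply, LinearMap.comp_apply, LinearMap.flip_apply, LinearMap.flip_apply]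
  have e1 : rmul M m (be D f) = rmul M (rmul M m (idem D.alg)) (be D f) :=
    (rmul_idem_rmul_incl M m _).symm
  by_cases hg : g ∈ H
  · lift g to H using hg
    have hn := inS_rmul hm
    have hm' : M.X.Deg ((g * f : H) : G) (rmul M m (be D f)) := deg_rmul M hm (deg_be f)
    rw [Γ.toInfl_coe hm', Γ.toInfl_coe hm, Γ.inflAct_sg (Γ.deg_toFib hm), ← map_smul]
    congr 1
    refine Subtype.ext ?_
    rw [Γ.toFib_coe hm']
    have e2 : rmul M (rmul M m (be D f)) (idem D.alg) =
        (Γ.η g f : k) • Γ.star M g f (rmul M m (idem D.alg)) := by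
      rw [star_apply, smul_smul, ← e1]
      refine (rmul_incl_idem M m _).trans ?_
      simp [be]
    rw [e2, map_smul]
    refine congrArg (fun t => (Γ.η g f : k) • t) ?_
    rw [Γ.toFib_coe hm, ← Γ.trans_mul hn.1, map_mul, mk'_coe, mul_one, Γ.trans_trans hn]
    · rw [map_mul, mk'_coe, mul_one]
    · exact (mk'_rep _).symm
  · rw [e1, rmul_idem_eq_zero M hm hg, map_zero, LinearMap.zero_apply, map_zero,
      Γ.toInfl_of_not_mem hm hg, map_zero, LinearMap.zero_apply]

/-- The morphism from a local module to the module attached to its fiber. -/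
noncomputable def toK₀ (M : LocMod D.alg.transfer.toMon) :
    M.X ⟶ obj (Γ.inflObj (Γ.fib M)) :=
  coind (Γ.toInfl M)
    (fun g m hm => by
      by_cases hg : g ∈ H
      · lift g to H using hg
        rw [Γ.toInfl_coe hm]
        exact pG_of_deg (Γ.deg_sg (Γ.deg_toFib hm)) rfl
      · rw [Γ.toInfl_of_not_mem hm hg, map_zero])
    Γ.toInfl_ρ

theorem val_toK₀ (x : G) (m : M.X.V) :
    val (Γ.inflObj (Γ.fib M)) x (Hom.lin (Γ.toK₀ M) m) = Γ.toInfl M (M.X.ρ x⁻¹ m) := rfl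

theorem toInfl_incl {u : H} {b : D.alg.X.V} (hb : D.alg.X.Deg u b) (m : M.X.V) :
    Γ.toInfl M (rmul M m (incl D.alg.X b)) = Γ.inflAct (Γ.fib M) (Γ.toInfl M m) b := by
  obtain rfl | ⟨f, c, rfl, rfl⟩ := deg_alg D hb
  · simp
  · rw [map_smul, map_smul, map_smul, map_smul]
    exact congrArg _ (Γ.toInfl_be m f)

/-- The morphism of modules from a local module to the module attached to its fiber. -/
noncomputable def toK (M : LocMod D.alg.transfer.toMon) : M ⟶ Γ.kobj (Γ.fib M) :=
  homMk (B := D.alg) (N := Γ.kobj (Γ.fib M)) (Γ.toK₀ M) fun f g m a hm ha => by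
    refine obj_ext (V := Γ.inflObj (Γ.fib M)) fun x => ?_
    refine Eq.trans ?_ (Γ.val_rmul (Hom.deg (Γ.toK₀ M) hm) ha x).symm
    -- `toInfl` does not change when its argument is multiplied by e, and this replaces x⁻¹.a by the
    -- element supported on H with value a(x) at 1. The action of the whole algebra is thereby
    -- reduced to that of k[F,γ,ε].
    rw [val_toK₀, val_toK₀, ρ_rmul M hm ha, map_smul, ← toInfl_idem, rmul_rmul_idem, val_ρ ha,
      inv_one, α.act_one_left, inv_one, Units.val_one, one_smul, inv_inv, mul_one]
    refine congrArg _ ?_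
    obtain h0 | ⟨h, hd⟩ := deg_val ha x
    · rw [h0, map_zero, map_zero, map_zero, map_zero]
    · exact Γ.toInfl_incl hd _

theorem toK_hom (M : LocMod D.alg.transfer.toMon) : (Γ.toK M).hom = Γ.toK₀ M := rfl

theorem val_one_toK₀ (m : M.X.V) :
    val (Γ.inflObj (Γ.fib M)) 1 (Hom.lin (Γ.toK₀ M) m) = Γ.toInfl M m := by
  rw [val_toK₀, inv_one, M.X.ρ_one]

/-- Tested on the e-part. In degree u the map is transport to the representative of the coset of u,
and transport back is its inverse. -/
theorem toK_bijective [CharZero k] (M : LocMod D.alg.transfer.toMon) :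
    Function.Bijective (Γ.toK M).hom.lin := by
  refine bijective_of_idem (B := D.alg) (Γ.toK M) (fun u m hm he h0 => ?_) (fun u n hn he => ?_)
  · have hS : InS M u m := ⟨hm, he⟩
    have h1 : Γ.toInfl M m = 0 := by
      rw [← Γ.val_one_toK₀, ← toK_hom]
      exact (congrArg _ h0).trans (map_zero _)
    rw [Γ.toInfl_coe hm] at h1
    have h2 := Γ.val_sg_self (Γ.deg_toFib hm)
    rw [h1, map_zero] at h2
    have h3 := congrArg Subtype.val h2
    rw [Γ.toFib_coe hm, he] at h3
    rw [← Γ.trans_self hS, ← Γ.trans_trans hS (mk'_rep _).symm rfl, ← h3]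
    exact map_zero _
  · obtain ⟨v, hv, rfl⟩ := Γ.exists_incl_sg hn he
    have hS := Γ.fib_deg_iff.1 hv
    have hT := Γ.inS_trans (w := u) hS (mk'_rep _)
    refine ⟨Γ.trans M u v.1, ?_⟩
    have h1 : Γ.toInfl M (Γ.trans M u v.1) = Γ.sg (Γ.fib M) u v := by
      rw [Γ.toInfl_coe hT.1]
      congr 1
      refine Subtype.ext ?_
      rw [Γ.toFib_coe hT.1, hT.2, Γ.trans_trans hS (mk'_rep _) rfl, Γ.trans_self hS]
    rw [← h1, ← Γ.val_one_toK₀, ← Γ.rmul_idem]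
    refine Eq.trans ?_ (hom_rmul (B := D.alg) (Γ.toK M) _ _)
    rw [hT.2]

theorem isIso_toK [CharZero k] (M : LocMod D.alg.transfer.toMon) : IsIso (Γ.toK M) :=
  have : IsIso (Γ.toK M).hom := isIso_of_bijective _ (Γ.toK_bijective M)
  LocMod.isIso_of_isIso_hom (Γ.toK M)

instance [CharZero k] : Γ.functor.EssSurj where
  mem_essImage M := ⟨Γ.fib M, ⟨(@asIso _ _ _ _ (Γ.toK M) (Γ.isIso_toK M)).symm⟩⟩

instance [CharZero k] : Γ.functor.IsEquivalence where

end EtaleGauge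
end

/-! ### The comparison maps on tensor products over the étale algebra are invertible. -/

section
attribute [local instance] Fintype.ofFinite
open scoped TensorProduct Classical
open ZObj CategoryTheory MonoidalCategory

/-- The projection onto the cokernel of f and the zero map agree after composition with f, so the
cokernel vanishes. -/
theorem ZObj.surjective_of_epi {G k : Type u} [Group G] [Finite G] [Field k] {α : Cocycle3 G k}
    {X Y : ZObj α} (f : X ⟶ Y) [Epi f] : Function.Surjective f.lin := by
  let z (Z : ZObj α) : X ⟶ Z := ⟨0, fun _ _ => (map_zero _).symm, fun _ _ => (map_zero _).symm⟩
  let z' : Y ⟶ coeqObj f (z Y) :=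
    ⟨0, fun _ _ => (map_zero _).symm, fun _ _ => (map_zero _).symm⟩
  have h1 : f ≫ coeqπ f (z Y) = f ≫ z' := by
    rw [coeq_condition]
    exact hom_ext _ _ (LinearMap.ext fun v => map_zero (Hom.lin (coeqπ f (z Y))))
  have h2 : Submodule.mkQ (LinearMap.range (f.lin - 0)) = 0 :=
    congrArg Hom.lin ((cancel_epi f).1 h1)
  rw [sub_zero] at h2
  rw [← LinearMap.range_eq_top, ← Submodule.ker_mkQ (LinearMap.range f.lin), h2,
    LinearMap.ker_zero]

namespace Transfer
variable {G k : Type u} [Group G] [Finite G] [Field k] {α : Cocycle3 G k} {H : Subgroup G}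
  {B : CommAlg (α.restrict H)} {M N : LocMod B.transfer.toMon}

/-- The class of `m ⊗ n` in the tensor product of modules. -/
noncomputable def prt (M N : LocMod B.transfer.toMon) : M.X.V →ₗ[k] N.X.V →ₗ[k] (M ⊗ N).X.V :=
  TensorProduct.curry (M := M.X.V) (N := N.X.V) (Hom.lin (LocMod.pr M N))

theorem deg_prt {f g : G} {m : M.X.V} {n : N.X.V} (hm : M.X.Deg f m) (hn : N.X.Deg g n) :
    (M ⊗ N).X.Deg (f * g) (prt M N m n) := Hom.deg (LocMod.pr M N) (hm.tm hn)

theorem rmul_prt {f g h : G} {m : M.X.V} {n : N.X.V} {a : (obj B.X).V} (hm : M.X.Deg f m)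
    (hn : N.X.Deg g n) (ha : (obj B.X).Deg h a) : rmul (M ⊗ N) (prt M N m n) a =
      (((α.toFun f g h)⁻¹ : kˣ) : k) • prt M N m (rmul N n a) := by
  have h1 := LinearMap.congr_fun (congrArg Hom.lin (LocMod.pr_act M N))
    (tm (X := M.X ⊗ N.X) (Y := obj B.X) (tm m n) a)
  refine h1.trans ?_
  have h3 := associator_hom_tm (X := M.X) (Y := N.X) (Z := obj B.X) hm hn ha
  refine (congrArg (Hom.lin (M.X ◁ N.act ≫ LocMod.pr M N)) h3).trans ?_
  exact map_smul (Hom.lin (M.X ◁ N.act ≫ LocMod.pr M N)) _ _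

theorem prt_rmul {f g h : G} {m : M.X.V} {n : N.X.V} {a : (obj B.X).V} (hm : M.X.Deg f m)
    (ha : (obj B.X).Deg g a) (hn : N.X.Deg h n) : prt M N (rmul M m a) n =
      (((α.toFun f g h)⁻¹ : kˣ) : k) • prt M N m (rmul N (N.X.ρ g n) a) := by
  have h1 := LinearMap.congr_fun (congrArg Hom.lin (LocMod.pr_condition M N))
    (tm (X := M.X ⊗ obj B.X) (Y := N.X) (tm m a) n)
  refine h1.trans ?_
  have h3 := associator_hom_tm (X := M.X) (Y := obj B.X) (Z := N.X) hm ha hn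
  refine (congrArg (Hom.lin (M.X ◁ (β_ (obj B.X) N.X).hom ≫ M.X ◁ N.act ≫ LocMod.pr M N))
    h3).trans ?_
  refine (map_smul (Hom.lin (M.X ◁ (β_ (obj B.X) N.X).hom ≫ M.X ◁ N.act ≫ LocMod.pr M N))
    _ _).trans ?_
  refine congrArg _ ?_
  have h4 : Hom.lin (β_ (obj B.X) N.X).hom (tm a n) = tm (N.X.ρ g n) a := braiding_tm ha n
  exact congrArg (fun t => Hom.lin (M.X ◁ N.act ≫ LocMod.pr M N)
    (tm (X := M.X) (Y := N.X ⊗ obj B.X) m t)) h4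

/-- Over A one has (m ⊗ n) e = m ⊗ ne = m ⊗ (ne)e = me ⊗ ne. The scalars are trivial because e has
degree 1. -/
theorem rmul_prt_idem {f g : G} {m : M.X.V} {n : N.X.V} (hm : M.X.Deg f m) (hn : N.X.Deg g n) :
    rmul (M ⊗ N) (prt M N m n) (idem B) =
      prt M N (rmul M m (idem B)) (rmul N n (idem B)) := by
  have h2 := deg_rmul N hn (deg_idem (B := B))
  rw [rmul_prt hm hn deg_idem, prt_rmul hm deg_idem h2, α.isCocycle.one_right,
    α.isCocycle.one_mid, N.X.ρ_one, rmul_idem_idem]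

end Transfer

namespace EtaleGauge
open Transfer
variable {G k : Type u} [Group G] [Finite G] [Field k] {α : Cocycle3 G k} {H : Subgroup G}
  {F : Subgroup H} [F.Normal] {D : EtaleData (α.restrict H) F} {β : Cocycle3 (H ⧸ F) k}
  (Γ : EtaleGauge D β) {X Y : ZObj β}

/-- The element `v[u]` of the module attached to `X`. -/
noncomputable def el (X : ZObj β) (u : H) : X.V →ₗ[k] (Γ.kobj X).X.V :=
  incl (Γ.inflObj X) ∘ₗ Γ.sg X u

theorem deg_el {u : H} {v : X.V} (hv : X.Deg (QuotientGroup.mk' F u) v) :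
    (Γ.kobj X).X.Deg (u : G) (Γ.el X u v) := deg_incl (Γ.deg_sg hv)

theorem el_eq_zero {u : H} {x : H ⧸ F} {v : X.V} (hv : X.Deg x v)
    (h : QuotientGroup.mk' F u ≠ x) : Γ.el X u v = 0 :=
  (congrArg (incl (Γ.inflObj X)) (Γ.sg_eq_zero hv h)).trans (map_zero (incl (Γ.inflObj X)))

theorem rmul_el {u : H} {v : X.V} (hv : X.Deg (QuotientGroup.mk' F u) v) (f : F) :
    rmul (B := D.alg) (Γ.kobj X) (Γ.el X u v) (be D f) =
      (Γ.η u f : k) • Γ.el X (u * f) v := by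
  refine (Γ.rmul_incl (Γ.deg_sg hv) f).trans ?_
  rw [Γ.inflAct_sg hv, map_smul]
  rfl

theorem ρ_el_coe {u : H} {v : X.V} (hv : X.Deg (QuotientGroup.mk' F u) v) (f : F) :
    (Γ.kobj X).X.ρ ((f : H) : G) (Γ.el X u v) =
      (Γ.lam f u : k) • Γ.el X (f * u * (f : H)⁻¹) v := by
  refine (ρ_incl (f : H) (Γ.sg X u v)).trans ?_
  rw [Γ.ρ_sg _ _ hv, mk'_coe, X.ρ_one, map_smul]
  rfl

/-- The comparison morphism of the functor to local modules. -/
noncomputable def tens (X Y : ZObj β) : Γ.kobj X ⊗ Γ.kobj Y ⟶ Γ.kobj (X ⊗ Y) :=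
  Γ.unitHom.tensorator X Y

theorem tens_prt_el {u u' : H} {v : X.V} {w : Y.V} (hv : X.Deg (QuotientGroup.mk' F u) v)
    (hw : Y.Deg (QuotientGroup.mk' F u') w) :
    Hom.lin (Γ.tens X Y).hom (prt (Γ.kobj X) (Γ.kobj Y) (Γ.el X u v) (Γ.el Y u' w)) =
      (Γ.η u u' : k) • Γ.el (X ⊗ Y) (u * u') (tm v w) := by
  have h1 := LinearMap.congr_fun (congrArg Hom.lin (Γ.unitHom.pr_tensorator X Y))
    (tm (X := obj (Γ.inflObj X)) (Y := obj (Γ.inflObj Y)) (Γ.el X u v) (Γ.el Y u' w))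
  refine h1.trans ?_
  have h2 := ten_incl (Γ.deg_sg hv) (Γ.deg_sg hw)
  refine (congrArg (Hom.lin (Transfer.map (Γ.inflTen X Y))) h2).trans ?_
  rw [map_incl, Γ.inflTen_sg hv hw, map_smul]
  rfl

theorem exists_el {u : H} {m : (Γ.kobj X).X.V} (hm : (Γ.kobj X).X.Deg (u : G) m) :
    ∃ v, X.Deg (QuotientGroup.mk' F u) v ∧
      rmul (B := D.alg) (Γ.kobj X) m (idem D.alg) = Γ.el X u v :=
  Γ.exists_incl_sg (inS_rmul hm).1 (inS_rmul hm).2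

/-- The factor `e_f` contained in `v[uf]` is moved to the second factor, which is allowed over A;
only the existence of the scalar matters. -/
theorem prt_el_mul {u w : H} (f : F) {v : X.V} {v' : Y.V}
    (hv : X.Deg (QuotientGroup.mk' F u) v) (hv' : Y.Deg (QuotientGroup.mk' F w) v') :
    ∃ c : k, prt (Γ.kobj X) (Γ.kobj Y) (Γ.el X (u * f) v) (Γ.el Y w v') =
      c • prt (Γ.kobj X) (Γ.kobj Y) (Γ.el X u v) (Γ.el Y (f * w) v') := by
  have h1 := Γ.rmul_el hv f
  have h2 := prt_rmul (B := D.alg) (M := Γ.kobj X) (N := Γ.kobj Y) (Γ.deg_el hv) (deg_be f)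
    (Γ.deg_el hv')
  have h3 : Y.Deg (QuotientGroup.mk' F (f * w * (f : H)⁻¹)) v' := by
    rwa [map_mul, map_mul, map_inv, mk'_coe, one_mul, inv_one, mul_one]
  have h4 := Γ.rmul_el h3 f
  rw [inv_mul_cancel_right] at h4
  rw [h1, Γ.ρ_el_coe hv' f, map_smul, map_smul, LinearMap.smul_apply, LinearMap.smul_apply, h4,
    map_smul, map_smul, smul_smul, smul_smul] at h2
  have h5 := congrArg (fun t => (((Γ.η u f)⁻¹ : kˣ) : k) • t) h2
  simp only [smul_smul, Units.inv_mul, one_smul] at h5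
  exact ⟨_, h5⟩

/-- The map `v ⊗ w ↦ η(r,r⁻¹u)⁻¹ v[r] ⊗ w[r⁻¹u]`, where `v` is of degree `x` and `r` represents
`x`. -/
noncomputable def split (X Y : ZObj β) (u : H) :
    (X ⊗ Y).V →ₗ[k] (Γ.kobj X ⊗ Γ.kobj Y).X.V :=
  ∑ x : H ⧸ F, (((Γ.η (rep x) ((rep x)⁻¹ * u))⁻¹ : kˣ) : k) •
    TensorProduct.lift ((prt (Γ.kobj X) (Γ.kobj Y)).compl₁₂ (Γ.el X (rep x))
      (Γ.el Y ((rep x)⁻¹ * u)))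

theorem split_tm {x : H ⧸ F} {v : X.V} (hv : X.Deg x v) (w : Y.V) (u : H) :
    Γ.split X Y u (tm v w) = (((Γ.η (rep x) ((rep x)⁻¹ * u))⁻¹ : kˣ) : k) •
      prt (Γ.kobj X) (Γ.kobj Y) (Γ.el X (rep x) v) (Γ.el Y ((rep x)⁻¹ * u) w) := by
  rw [split, LinearMap.sum_apply, Finset.sum_eq_single x]
  · rfl
  · intro y _ hy
    have h0 : Γ.el X (rep y) v = 0 := Γ.el_eq_zero hv (by rwa [mk'_rep])
    refine (congrArg (fun t => (((Γ.η (rep y) ((rep y)⁻¹ * u))⁻¹ : kˣ) : k) •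
      prt (Γ.kobj X) (Γ.kobj Y) t (Γ.el Y ((rep y)⁻¹ * u) w)) h0).trans ?_
    rw [map_zero, LinearMap.zero_apply, smul_zero]
  · simp

/-- The scalar in `split` is the inverse of the one in `tens_prt_el`. Pairs whose degrees do not fit
u give zero on both sides. -/
theorem tens_split (u : H) (t : (X ⊗ Y).V) :
    Hom.lin (Γ.tens X Y).hom (Γ.split X Y u t) = Γ.el (X ⊗ Y) u t := by
  refine LinearMap.congr_fun (lin_ext₂ (φ := Hom.lin (Γ.tens X Y).hom ∘ₗ Γ.split X Y u)
    (ψ := Γ.el (X ⊗ Y) u) fun x y v w hv hw => ?_) t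
  rw [LinearMap.comp_apply, Γ.split_tm hv, map_smul]
  by_cases h : QuotientGroup.mk' F ((rep x)⁻¹ * u) = y
  · subst h
    have hv' : X.Deg (QuotientGroup.mk' F (rep x)) v := by rwa [mk'_rep]
    rw [Γ.tens_prt_el hv' hw, smul_smul, Units.inv_mul, one_smul, mul_inv_cancel_left]
  · rw [Γ.el_eq_zero hw h, map_zero, map_zero, smul_zero, Γ.el_eq_zero (hv.tm hw)]
    rintro e
    refine h ?_
    rw [map_mul, map_inv, mk'_rep, e, inv_mul_cancel_left]

theorem split_p (u : H) (t : (X ⊗ Y).V) :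
    Γ.split X Y u ((X ⊗ Y).p (QuotientGroup.mk' F u) t) = Γ.split X Y u t := by
  refine LinearMap.congr_fun (lin_ext₂
    (φ := Γ.split X Y u ∘ₗ (X ⊗ Y).p (QuotientGroup.mk' F u))
    (ψ := Γ.split X Y u) fun x y v w hv hw => ?_) t
  rw [LinearMap.comp_apply, (hv.tm hw).p_eq]
  split_ifs with h
  · rfl
  · rw [map_zero, Γ.split_tm hv, Γ.el_eq_zero hw, map_zero, smul_zero]
    rintro rfl
    refine h ?_
    rw [map_mul, map_inv, mk'_rep, mul_inv_cancel_left]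

theorem prt_el_mem {u u' : H} {v : X.V} {w : Y.V} (hv : X.Deg (QuotientGroup.mk' F u) v)
    (hw : Y.Deg (QuotientGroup.mk' F u') w) :
    prt (Γ.kobj X) (Γ.kobj Y) (Γ.el X u v) (Γ.el Y u' w) ∈
      LinearMap.range (Γ.split X Y (u * u')) := by
  generalize hx : QuotientGroup.mk' F u = x at hv
  obtain ⟨f, rfl⟩ : ∃ f : F, u = rep x * f := by
    refine ⟨⟨(rep x)⁻¹ * u, ?_⟩, by simp⟩
    rw [← QuotientGroup.eq_one_iff]
    change (QuotientGroup.mk' F) ((rep x)⁻¹ * u) = 1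
    rw [map_mul, map_inv, mk'_rep, hx, inv_mul_cancel]
  have hv' : X.Deg (QuotientGroup.mk' F (rep x)) v := by rwa [mk'_rep]
  obtain ⟨c, hc⟩ := Γ.prt_el_mul f hv' hw
  rw [hc]
  refine Submodule.smul_mem _ _ ((Submodule.smul_mem_iff _
    (Units.ne_zero (Γ.η (rep x) (f * u'))⁻¹)).1 ⟨tm v w, ?_⟩)
  rw [Γ.split_tm hv, mul_assoc, inv_mul_cancel_left]

/-- The e-part of the tensor product is spanned by products of e-parts, by `rmul_prt_idem`, hence by
classes of `v[u] ⊗ w[u']`. By `prt_el_mem` the first degree can be made a chosen representative. -/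
theorem rmul_idem_mem (u : H) (q : (Γ.kobj X ⊗ Γ.kobj Y).X.V) :
    (Γ.kobj X ⊗ Γ.kobj Y).X.p (u : G) (rmul (B := D.alg) (Γ.kobj X ⊗ Γ.kobj Y) q (idem D.alg)) ∈
      LinearMap.range (Γ.split X Y u) := by
  obtain ⟨t, rfl⟩ := ZObj.surjective_of_epi (LocMod.pr (Γ.kobj X) (Γ.kobj Y)) q
  rw [← Submodule.Quotient.mk_eq_zero, ← Submodule.mkQ_apply]
  refine LinearMap.congr_fun (lin_ext₂ (φ := Submodule.mkQ (LinearMap.range (Γ.split X Y u)) ∘ₗ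
    (Γ.kobj X ⊗ Γ.kobj Y).X.p (u : G) ∘ₗ
      (rmul (B := D.alg) (Γ.kobj X ⊗ Γ.kobj Y)).flip (idem D.alg) ∘ₗ
        Hom.lin (LocMod.pr (Γ.kobj X) (Γ.kobj Y))) (ψ := 0) fun f g m n hm hn => ?_) t
  change Submodule.mkQ (LinearMap.range (Γ.split X Y u)) ((Γ.kobj X ⊗ Γ.kobj Y).X.p (u : G)
    (rmul (B := D.alg) (Γ.kobj X ⊗ Γ.kobj Y) (prt (Γ.kobj X) (Γ.kobj Y) m n) (idem D.alg))) = 0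
  rw [rmul_prt_idem hm hn]
  by_cases hf : f ∈ H
  · by_cases hg : g ∈ H
    · lift f to H using hf
      lift g to H using hg
      obtain ⟨v, hv, h1⟩ := Γ.exists_el hm
      obtain ⟨w, hw, h2⟩ := Γ.exists_el hn
      rw [h1, h2, (deg_prt (Γ.deg_el hv) (Γ.deg_el hw)).p_eq]
      split_ifs with h
      · obtain rfl : u = f * g := Subtype.ext h
        rw [Submodule.mkQ_apply, Submodule.Quotient.mk_eq_zero]
        exact Γ.prt_el_mem hv hw
      · exact map_zero _
    · rw [rmul_idem_eq_zero _ hn hg]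
      simp only [map_zero]
  · rw [rmul_idem_eq_zero _ hm hf]
    simp only [map_zero, LinearMap.zero_apply]

/-- On e-parts in degree u, `split` is onto, and the comparison map composed with it is t ↦ t[u],
which is injective on t of the degree of the coset of u and hits the whole e-part of the target. So
the comparison map is bijective there. -/
theorem tens_bijective [CharZero k] (X Y : ZObj β) :
    Function.Bijective (Γ.tens X Y).hom.lin := by
  refine bijective_of_idem (B := D.alg) (Γ.tens X Y) (fun u q hq he h0 => ?_)
    (fun u n hn he => ?_)
  · obtain ⟨t, ht⟩ := Γ.rmul_idem_mem u q
    rw [he, hq] at ht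
    have h1 := Γ.tens_split u ((X ⊗ Y).p (QuotientGroup.mk' F u) t)
    rw [split_p, ht, h0] at h1
    have h2 := Γ.incl_sg_injective ((X ⊗ Y).deg_p _ t) (map_zero _)
      (h1.symm.trans (map_zero (Γ.el (X ⊗ Y) u)).symm)
    rw [← ht, ← split_p, h2, map_zero]
  · obtain ⟨t, -, rfl⟩ := Γ.exists_incl_sg hn he
    exact ⟨_, Γ.tens_split u t⟩

instance [CharZero k] (X Y : ZObj β) : IsIso (Γ.unitHom.tensorator X Y) :=
  have : IsIso (Γ.unitHom.tensorator X Y).hom := isIso_of_bijective _ (Γ.tens_bijective X Y)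
  LocMod.isIso_of_isIso_hom _

noncomputable instance [CharZero k] : Γ.functor.Braided := Γ.unitHom.braidedFunctor

end EtaleGauge
end

/-! ### Twists on local modules, and transport of braidings, twists and duals along an equivalence.
-/

section
open CategoryTheory MonoidalCategory Limits

namespace LocMod
variable {C : Type w} [Category.{v} C] [MonoidalCategory C] [BraidedCategory C] {A : Mon C}
  (θ : 𝟭 C ≅ 𝟭 C) (hb : ∀ X Y : C, θ.hom.app (X ⊗ Y) =
    (θ.hom.app X ⊗ₘ θ.hom.app Y) ≫ (β_ X Y).hom ≫ (β_ Y X).hom)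
  (hA : θ.hom.app A.X = 𝟙 A.X)

/-- A twist that is trivial on `A` is a morphism of modules. -/
noncomputable def twistHom (M : LocMod A) : M ⟶ M where
  hom := θ.hom.app M.X
  act_hom := by
    -- Naturality passes to the twist of M ⊗ A. Balancing writes it as the twist of M followed by
    -- the double braiding, which the action of a local module absorbs.
    have h1 := θ.hom.naturality M.act
    have h2 := M.isLocal
    simp only [Functor.id_map] at h1
    rw [h1, hb, hA]
    simp only [Category.assoc]
    rw [h2]
    simp

/-- The twist on local modules. -/
noncomputable def twist : 𝟭 (LocMod A) ≅ 𝟭 (LocMod A) :=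
  NatIso.ofComponents
    (fun M => @asIso _ _ _ _ (twistHom θ hb hA M)
      (@isIso_of_isIso_hom _ _ _ _ _ _ _ (twistHom θ hb hA M)
        (inferInstanceAs (IsIso (θ.hom.app M.X)))))
    (fun f => LocMod.hom_ext _ _ (θ.hom.naturality f.hom))

variable [IsCommMonObj A.X] [HasCoequalizers C]
  [∀ X : C, PreservesColimitsOfSize.{0, 0} (tensorLeft X)]
  [∀ X : C, PreservesColimitsOfSize.{0, 0} (tensorRight X)]

/-- The twist and the double braiding over A are induced from those of C along the epimorphism `pr M
N`, so the identity is inherited from C. -/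
theorem twist_balanced (M N : LocMod A) : (twist θ hb hA).hom.app (M ⊗ N) =
    ((twist θ hb hA).hom.app M ⊗ₘ (twist θ hb hA).hom.app N) ≫ (β_ M N).hom ≫ (β_ N M).hom := by
  refine LocMod.hom_ext _ _ ?_
  rw [← cancel_epi (pr M N), MonoidalCategory.tensorHom_def]
  have h1 : pr M N ≫ ((twist θ hb hA).hom.app (M ⊗ N)).hom = θ.hom.app (M.X ⊗ N.X) ≫ pr M N :=
    θ.hom.naturality (pr M N)
  have h2 : pr M N ≫ (β_ M N).hom.hom ≫ (β_ N M).hom.hom =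
      (β_ M.X N.X).hom ≫ (β_ N.X M.X).hom ≫ pr M N := by
    rw [← Category.assoc]
    refine (congrArg (fun t => t ≫ (β_ N M).hom.hom) (pr_braid M N)).trans ?_
    rw [Category.assoc]
    exact congrArg _ (pr_braid N M)
  rw [h1, hb]
  simp only [comp_hom, Category.assoc]
  have h3 := pr_whiskerRight ((twist θ hb hA).hom.app M) N
  have h4 := pr_whiskerLeft M ((twist θ hb hA).hom.app N)
  refine Eq.trans ?_ (Category.assoc _ _ _)
  refine Eq.trans ?_ (congrArg (fun t => t ≫ _) h3.symm)
  refine Eq.trans ?_ (Category.assoc _ _ _).symm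
  refine Eq.trans ?_ (congrArg (fun t => _ ≫ t) (Category.assoc _ _ _))
  refine Eq.trans ?_ (congrArg (fun t => _ ≫ t ≫ _) h4.symm)
  simp only [Category.assoc]
  refine Eq.trans ?_ (congrArg (fun t => _ ≫ _ ≫ t) h2.symm)
  rw [MonoidalCategory.tensorHom_def]
  simp only [Category.assoc]
  rfl

end LocMod

universe v' w'
variable {C : Type w} [Category.{v} C] [MonoidalCategory C] [BraidedCategory C]
  {D : Type w'} [Category.{v'} D] [MonoidalCategory D] [BraidedCategory D]

open Functor.LaxMonoidal Functor.OplaxMonoidal in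
/-- The inverse of a braided equivalence is braided. -/
@[reducible] noncomputable def CategoryTheory.Equivalence.inverseBraided (e : C ≌ D)
    [e.functor.Braided] : e.inverse.Braided :=
  letI := e.inverseMonoidal
  haveI : e.IsMonoidal :=
    letI := e.toAdjunction.rightAdjointLaxMonoidal
    inferInstanceAs e.toAdjunction.IsMonoidal
  { braided := fun X Y => by
      refine e.functor.map_injective ?_
      rw [← cancel_mono (e.counitIso.hom.app (Y ⊗ X))]
      simp only [Functor.map_comp, Category.assoc]
      have h1 := e.functor_map_μ_inverse_comp_counitIso_hom_app_tensor X Y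
      have h2 := e.functor_map_μ_inverse_comp_counitIso_hom_app_tensor Y X
      have h3 := e.counitIso.hom.naturality (β_ X Y).hom
      simp only [Functor.comp_map, Functor.id_map] at h3
      rw [h3, ← Category.assoc, h1, h2, Functor.map_braiding]
      simp only [Category.assoc, Functor.Monoidal.μ_δ_assoc]
      exact congrArg _ (BraidedCategory.braiding_naturality (e.counitIso.hom.app X)
        (e.counitIso.hom.app Y)) }

theorem CategoryTheory.Equivalence.inverse_map_app_of_functor_map_app (e : C ≌ D) {θ : 𝟭 C ≅ 𝟭 C}
    {θ' : 𝟭 D ≅ 𝟭 D} (h : ∀ X, e.functor.map (θ.hom.app X) = θ'.hom.app (e.functor.obj X))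
    (M : D) : e.inverse.map (θ'.hom.app M) = θ.hom.app (e.inverse.obj M) := by
  refine e.functor.map_injective ?_
  have h1 := θ'.hom.naturality (e.counitIso.hom.app M)
  simp only [Functor.id_map, Functor.id_obj, Functor.comp_obj] at h1
  refine (e.fun_inv_map _ _ _).trans (Eq.trans ?_ (h _).symm)
  refine ((Category.assoc _ _ _).symm.trans (congrArg (· ≫ e.counitIso.inv.app M) h1)).trans ?_
  refine (Category.assoc _ _ _).trans ?_
  refine (congrArg (_ ≫ ·) (e.counitIso.hom_inv_id_app M)).trans ?_
  exact Category.comp_id _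

open Functor.LaxMonoidal Functor.OplaxMonoidal in
/-- Duals compatible with twists pull back along an equivalence. -/
theorem exists_dual_of_equivalence (Φ : D ⥤ C) [Φ.Monoidal] [Φ.IsEquivalence] {θ : 𝟭 C ≅ 𝟭 C}
    {θ' : 𝟭 D ≅ 𝟭 D} (h : ∀ M, Φ.map (θ'.hom.app M) = θ.hom.app (Φ.obj M))
    (hd : ∀ X : C, ∃ (Y : C) (_ : ExactPairing X Y),
      η_ X Y ≫ θ.hom.app X ▷ Y = η_ X Y ≫ X ◁ θ.hom.app Y) (M : D) :
    ∃ (N : D) (_ : ExactPairing M N),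
      η_ M N ≫ θ'.hom.app M ▷ N = η_ M N ≫ M ◁ θ'.hom.app N := by
  obtain ⟨Y, P, hY⟩ := hd (Φ.obj M)
  -- The dual of M is a preimage of the dual of its image. Its coevaluation is the given one
  -- followed by `i.inv`, and naturality of the twist at `i.inv` carries the compatibility over.
  let i := Φ.objObjPreimageIso Y
  let P' : ExactPairing (Φ.obj M) (Φ.obj (Φ.objPreimage Y)) := exactPairingCongrRight i
  refine ⟨Φ.objPreimage Y, ExactPairing.ofFullyFaithful Φ _ _, Φ.map_injective ?_⟩
  have h0 : (η_ (Φ.obj M) (Φ.obj (Φ.objPreimage Y))) = η_ (Φ.obj M) Y ≫ Φ.obj M ◁ i.inv := rfl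
  have h1 : Φ.map (@ExactPairing.coevaluation _ _ _ M (Φ.objPreimage Y)
      (ExactPairing.ofFullyFaithful Φ _ _)) =
      η Φ ≫ η_ (Φ.obj M) (Φ.obj (Φ.objPreimage Y)) ≫ μ Φ _ _ := Φ.map_preimage _
  have h2 := θ.hom.naturality i.inv
  simp only [Functor.id_map] at h2
  rw [Φ.map_comp, Φ.map_comp, h1, h0]
  simp only [Category.assoc]
  rw [← μ_natural_left, ← μ_natural_right, h, h, whisker_exchange_assoc, reassoc_of% hY,
    ← MonoidalCategory.whiskerLeft_comp_assoc, h2, MonoidalCategory.whiskerLeft_comp_assoc]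
  rfl

end

/-! ### The ribbon structure of the twisted double, and twists under transfer and inflation. -/

section
attribute [local instance] Fintype.ofFinite
open scoped TensorProduct Classical
open ZObj CategoryTheory MonoidalCategory

namespace ZObj
variable {G k : Type u} [Group G] [Finite G] [Field k] (α : Cocycle3 G k)

/-- The scalar that compares the twist of x ⊗ y with the double braiding of the twisted factors, for
x of degree a and y of degree b. All its factors are accounted for by a single instance of the
cocycle condition. -/
theorem _root_.Cocycle3.ten_twist (a b : G) :
    α.ten (a * b) a b * α.act a b b * α.act (a * b * a⁻¹) a a = 1 := by
  have h := α.isCocycle.cocycle (a * b * a * (a * b)⁻¹) (a * b * a⁻¹) a b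
  simp only [Cocycle3.ten, Cocycle3.act]
  have e1 : a * b * a⁻¹ * a = a * b := by group
  have e2 : a * b * a * (a * b)⁻¹ * (a * b * a⁻¹) = a * b := by group
  have e3 : a * b * b * (a * b)⁻¹ = a * b * a⁻¹ := by group
  have e5 : a * a * a⁻¹ = a := by group
  have e6 : b * b * b⁻¹ = b := by group
  rw [e1, e2] at h
  rw [e1, e3, e5, e6]
  refine Units.ext ?_
  have h' := congrArg (fun t : kˣ => (t : k)) h
  push_cast at h' ⊢
  field_simp
  linear_combination -h'

/-- Both sides reduce to values at a and a⁻¹, which `inv_self` relates. The left side measures the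
failure of the action of a⁻¹ to invert that of a; the right side occurs in the dual action. -/
theorem _root_.Cocycle3.act_inv_self (a : G) : α.act a a⁻¹ a = α.ten a⁻¹ a⁻¹ a := by
  have h := α.inv_self a
  simp only [Cocycle3.ten, Cocycle3.act]
  have e1 : a⁻¹ * a * a⁻¹⁻¹ = a := by group
  have e2 : a * a⁻¹ * a * (a * a⁻¹)⁻¹ = a := by group
  have e3 : a⁻¹ * a⁻¹ * a⁻¹⁻¹ = a⁻¹ := by group
  rw [e1, e2, e3, mul_assoc, mul_inv_cancel, mul_one, mul_inv_cancel, one_mul]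
  exact (eq_inv_of_mul_eq_one_left h).symm

theorem twist_balanced (X Y : ZObj α) : (twist α).hom.app (X ⊗ Y) =
    ((twist α).hom.app X ⊗ₘ (twist α).hom.app Y) ≫ (β_ X Y).hom ≫ (β_ Y X).hom :=
  hom_ext₂ fun a b x y hx hy => by
    have h1 := hx.ρ_mul (a * b * a⁻¹) a
    rw [inv_mul_cancel_right] at h1
    have e1 : Hom.lin ((twist α).hom.app X) x = X.ρ a x := twist_apply hx
    have e2 : Hom.lin ((twist α).hom.app Y) y = Y.ρ b y := twist_apply hy
    rw [comp_apply, comp_apply]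
    refine (twist_apply (hx.tm hy)).trans ?_
    rw [ρ_tm hx hy, h1, hy.ρ_mul]
    have e3 : Hom.lin ((twist α).hom.app X ⊗ₘ (twist α).hom.app Y) (tm x y) =
        tm (X.ρ a x) (Y.ρ b y) := (tensorHom_tm _ _ _ _).trans (congrArg₂ tm e1 e2)
    refine Eq.trans ?_ (congrArg (fun t => Hom.lin (β_ Y X).hom (Hom.lin (β_ X Y).hom t)) e3).symm
    rw [braiding_tm hx.ρ_self, braiding_tm (hy.ρ_self.ρ a), tm_smul, smul_tm, smul_smul, smul_smul]
    have := congrArg (fun t : kˣ => (t : k)) (α.ten_twist a b)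
    push_cast at this
    rw [this, one_smul]

variable {α}

/-- Under the identification of X ⊗ X* with End X this says that the twist of the dual is the
transpose of the twist of X. In degree a it compares the action of a with the inverse of the action
of a⁻¹, and the scalars match by `act_inv_self`. -/
theorem twist_can (X : ZObj α) (a : G) :
    TensorProduct.map (Hom.lin ((twist α).hom.app X)) LinearMap.id (can X a) =
      TensorProduct.map LinearMap.id (Hom.lin ((twist α).hom.app (dual X))) (can X a) := by
  have h1 : Hom.lin ((twist α).hom.app X) ∘ₗ X.p a = X.ρ a ∘ₗ X.p a :=
    LinearMap.ext fun x => twist_apply (X.deg_p a x)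
  have h2 : Hom.lin ((twist α).hom.app (dual X)) ∘ₗ (dual X).p a⁻¹ =
      (((α.ten a⁻¹ a⁻¹ a)⁻¹ : kˣ) : k) • (X.p a ∘ₗ (X.ρE a⁻¹).symm.toLinearMap).dualMap := by
    refine LinearMap.ext fun l => (twist_apply ((dual X).deg_p a⁻¹ l)).trans ?_
    refine LinearMap.ext fun v => ?_
    have := LinearMap.congr_fun (dualρ_p X a⁻¹ a⁻¹ l) v
    rw [inv_inv] at this
    refine Eq.trans ?_ this
    simp only [inv_inv]
  have h3 : (X.p a).dualMap = (dual X).p a⁻¹ := by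
    change _ = (X.p a⁻¹⁻¹).dualMap
    rw [inv_inv]
  refine (endEquiv X).injective ?_
  rw [← can_eq' X a, TensorProduct.map_map, TensorProduct.map_map, h2, h1, LinearMap.id_comp,
    LinearMap.id_comp, ← h3, TensorProduct.map_smul_right, LinearMap.smul_apply, map_smul,
    endEquiv_map, endEquiv_map, endEquiv_can]
  refine LinearMap.ext fun v => ?_
  obtain ⟨w, rfl⟩ : ∃ w, X.ρ a⁻¹ w = v := ⟨(X.ρE a⁻¹).symm v, ρ_ρE_symm _ _ _⟩
  have h4 := X.ρ_p a⁻¹ a w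
  rw [inv_mul_cancel, one_mul, inv_inv] at h4
  have h5 := X.ρ_mul a a⁻¹ a w
  rw [mul_inv_cancel, X.ρ_one, α.act_inv_self] at h5
  simp only [LinearMap.comp_apply, LinearMap.smul_apply, LinearEquiv.coe_coe, ρE_symm_ρ, X.p_same]
  rw [← h4]
  conv_rhs => rw [h5, smul_smul, Units.inv_mul, one_smul]

theorem isRibbon_twist : IsRibbon (twist α) where
  balanced := twist_balanced α
  dual X := ⟨dual X, inferInstance, hom_ext _ _ (LinearMap.ext fun c => by
    have h : TensorProduct.map (Hom.lin ((twist α).hom.app X)) LinearMap.id (coevElt X) =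
        TensorProduct.map LinearMap.id (Hom.lin ((twist α).hom.app (dual X))) (coevElt X) := by
      simp only [coevElt, map_sum, map_smul, twist_can]
    refine (map_smul (TensorProduct.map (Hom.lin ((twist α).hom.app X)) LinearMap.id)
      (show k from c) (coevElt X)).trans ?_
    refine Eq.trans ?_ (map_smul (TensorProduct.map LinearMap.id
      (Hom.lin ((twist α).hom.app (dual X)))) (show k from c) (coevElt X)).symm
    rw [h])⟩

end ZObj

namespace Transfer
variable {G k : Type u} [Group G] [Finite G] [Field k] {α : Cocycle3 G k} {H : Subgroup G}

/-- For a of degree f, the value of f.a at x is a multiple of a(f⁻¹x), which by equivariance is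
x⁻¹fx applied to a(x), and x⁻¹fx is the degree of a(x). The scalars cancel by `act_twist`. -/
theorem twist_obj (V : ZObj (α.restrict H)) :
    (twist α).hom.app (obj V) = Transfer.map ((twist (α.restrict H)).hom.app V) :=
  hom_ext _ _ (lin_ext fun f a ha => obj_ext fun x => by
    have ha : (obj V).Deg f a := ha
    refine (congrArg (val V x) (twist_apply ha)).trans ?_
    refine Eq.trans ?_ (val_map _ x a).symm
    refine (val_ρ ha f x).trans ?_
    by_cases h : x⁻¹ * f * x ∈ H
    · have h1 := val_mul ha x ⟨_, h⟩⁻¹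
      have e1 : x * ((⟨_, h⟩⁻¹ : H) : G) = f⁻¹ * x := by
        rw [Subgroup.coe_inv]
        group
      have e2 : ((⟨_, h⟩⁻¹ : H) : G)⁻¹ = x⁻¹ * f * x := by
        rw [Subgroup.coe_inv, inv_inv]
      have hd : V.Deg ⟨_, h⟩ (val V x a) := by
        obtain h0 | ⟨_, hd⟩ := deg_val ha x
        · rw [h0]
          exact map_zero _
        · exact hd
      rw [e1, e2, inv_inv] at h1
      rw [h1, α.act_twist, inv_inv x, smul_smul, Units.inv_mul, one_smul]
      exact (twist_apply hd).symm
    · have h1 : val V x a = 0 := (deg_val ha x).resolve_right fun ⟨h', _⟩ => h h'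
      have h2 : val V (f⁻¹ * x) a = 0 := (deg_val ha (f⁻¹ * x)).resolve_right fun ⟨h', _⟩ => h (by
        have e : (f⁻¹ * x)⁻¹ * f * (f⁻¹ * x) = x⁻¹ * f * x := by group
        rwa [e] at h')
      rw [h1, h2, smul_zero]
      exact (map_zero _).symm)

end Transfer

namespace Gauge
variable {H Q k : Type u} [Group H] [Group Q] [Field k] [Finite H] [Finite Q] {π : H →* Q}
  {α : Cocycle3 H k} {β : Cocycle3 Q k} (Γ : Gauge π α β)

theorem twist_inflObj (V : ZObj β) :
    (twist α).hom.app (Γ.inflObj V) = Γ.inflMap ((twist β).hom.app V) :=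
  hom_ext _ _ (LinearMap.ext (Γ.sg_ext _ _ fun u v hv => by
    refine (twist_apply (Γ.deg_sg hv)).trans ?_
    rw [Γ.ρ_sg _ _ hv, Γ.inflMap_sg _ hv, lam_self, mul_inv_cancel_right, Units.val_one, one_smul]
    exact congrArg _ (twist_apply hv).symm))

end Gauge
end

/-! ### Assembly: twists, linearity and the inverse equivalence. -/

section
attribute [local instance] Fintype.ofFinite
open scoped TensorProduct Classical
open ZObj CategoryTheory MonoidalCategory

namespace EtaleGauge
open Transfer
variable {G k : Type u} [Group G] [Finite G] [Field k] {α : Cocycle3 G k} {H : Subgroup G}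
  {F : Subgroup H} [F.Normal] {D : EtaleData (α.restrict H) F} {β : Cocycle3 (H ⧸ F) k}
  (Γ : EtaleGauge D β)

theorem lax_twist (X : ZObj β) :
    Γ.lax.map ((ZObj.twist β).hom.app X) = (ZObj.twist α).hom.app (Γ.lax.obj X) := by
  refine Eq.trans ?_ (twist_obj (Γ.inflObj X)).symm
  exact congrArg Transfer.map (Γ.twist_inflObj X).symm

theorem twist_unit : (ZObj.twist β).hom.app (𝟙_ (ZObj β)) = 𝟙 (𝟙_ (ZObj β)) :=
  hom_ext _ _ (LinearMap.ext fun c => twist_apply (deg_unit (α := β) c))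

/-- The twist is trivial on the étale algebra. -/
theorem twist_etaleAlg (Γ : EtaleGauge D β) :
    (ZObj.twist α).hom.app (etaleAlg D).X = 𝟙 (etaleAlg D).X := by
  have h1 : Γ.unitHom.hom ≫ (ZObj.twist α).hom.app (Γ.lax.obj (𝟙_ (ZObj β))) =
      (ZObj.twist α).hom.app (etaleAlg D).X ≫ Γ.unitHom.hom :=
    (ZObj.twist α).hom.naturality Γ.unitHom.hom
  have h2 : (ZObj.twist α).hom.app (Γ.lax.obj (𝟙_ (ZObj β))) = 𝟙 (Γ.lax.obj (𝟙_ (ZObj β))) :=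
    (Γ.lax_twist _).symm.trans ((congrArg Γ.lax.map twist_unit).trans (Γ.lax.map_id _))
  refine (cancel_mono Γ.unitHom.hom).1 (h1.symm.trans ?_)
  exact (congrArg (Γ.unitHom.hom ≫ ·) h2).trans
    ((Category.comp_id _).trans (Category.id_comp _).symm)

/-- The twist on local modules over the étale algebra. -/
noncomputable def locTwist : 𝟭 (LocMod (etaleAlg D)) ≅ 𝟭 (LocMod (etaleAlg D)) :=
  LocMod.twist (ZObj.twist α) (ZObj.twist_balanced α) Γ.twist_etaleAlg

theorem locTwist_hom_app (M : LocMod (etaleAlg D)) :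
    (Γ.locTwist.hom.app M).hom = (ZObj.twist α).hom.app M.X := rfl

theorem functor_map_twist (X : ZObj β) :
    Γ.functor.map ((ZObj.twist β).hom.app X) = Γ.locTwist.hom.app (Γ.functor.obj X) :=
  LocMod.hom_ext _ _ (Γ.lax_twist X)

/-- Linearity is expressed through underlying maps, in one condition for sums and scalars. Both
inflation and transfer apply the given linear map value by value. -/
theorem functor_map_lin {X Y : ZObj β} {f g h : X ⟶ Y} {c : k}
    (e : h.lin = c • f.lin + g.lin) : Hom.lin (Γ.functor.map h).hom =
      c • Hom.lin (Γ.functor.map f).hom + Hom.lin (Γ.functor.map g).hom := by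
  refine LinearMap.ext fun m => obj_ext (V := Γ.inflObj Y) fun x => ?_
  have h1 (φ : X ⟶ Y) : val (Γ.inflObj Y) x (Hom.lin (Γ.functor.map φ).hom m) =
      Γ.inflMapLin φ.lin (val (Γ.inflObj X) x m) := val_map _ x m
  refine (h1 h).trans ?_
  refine Eq.trans ?_ (map_add (val (Γ.inflObj Y) x) _ _).symm
  refine Eq.trans ?_ (congrArg₂ (· + ·) ((map_smul (val (Γ.inflObj Y) x) c _).trans
    (congrArg (c • ·) (h1 f))) (h1 g)).symm
  rw [e]
  simp only [Gauge.inflMapLin, LinearMap.sum_apply, LinearMap.comp_apply, LinearMap.add_apply,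
    LinearMap.smul_apply, map_add, map_smul, Finset.sum_add_distrib, Finset.smul_sum]

variable [CharZero k]

/-- The equivalence between `Z(H/F,β)` and local modules. -/
@[reducible] noncomputable def equiv : ZObj β ≌ LocMod (etaleAlg D) := Γ.functor.asEquivalence

noncomputable instance : Γ.equiv.functor.Braided := inferInstanceAs Γ.functor.Braided

/-- The equivalence from local modules to `Z(H/F,β)`. -/
@[reducible] noncomputable def inverse : LocMod (etaleAlg D) ⥤ ZObj β := Γ.equiv.inverse

noncomputable instance : Γ.inverse.Braided := Γ.equiv.inverseBraided

theorem functor_map_inverse_map {M N : LocMod (etaleAlg D)} (f : M ⟶ N) :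
    Γ.functor.map (Γ.inverse.map f) =
      Γ.equiv.counitIso.hom.app M ≫ f ≫ Γ.equiv.counitIso.inv.app N :=
  Γ.equiv.fun_inv_map M N f

theorem inverse_map_twist (M : LocMod (etaleAlg D)) :
    Γ.inverse.map (Γ.locTwist.hom.app M) = (ZObj.twist β).hom.app (Γ.inverse.obj M) :=
  Γ.equiv.inverse_map_app_of_functor_map_app Γ.functor_map_twist M

theorem inverse_map_lin {M N : LocMod (etaleAlg D)} {f g h : M ⟶ N} {c : k}
    (e : h.hom.lin = c • f.hom.lin + g.hom.lin) :
    (Γ.inverse.map h).lin = c • (Γ.inverse.map f).lin + (Γ.inverse.map g).lin := by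
  -- The wanted combination is itself a morphism. Faithfulness of the functor, whose composite with
  -- its inverse is conjugation by the counit, identifies it with the image of h.
  let φ : Γ.inverse.obj M ⟶ Γ.inverse.obj N :=
    { lin := c • (Γ.inverse.map f).lin + (Γ.inverse.map g).lin
      p_comm := fun a v => by
        simp only [LinearMap.add_apply, LinearMap.smul_apply, Hom.p_comm, map_add, map_smul]
      ρ_comm := fun a v => by
        simp only [LinearMap.add_apply, LinearMap.smul_apply, Hom.ρ_comm, map_add, map_smul] }
  suffices h1 : Γ.inverse.map h = φ from congrArg Hom.lin h1
  refine Γ.functor.map_injective (LocMod.hom_ext _ _ (hom_ext _ _ ?_))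
  rw [Γ.functor_map_lin (f := Γ.inverse.map f) (g := Γ.inverse.map g) (h := φ) (c := c) rfl]
  have h1 (ψ : M ⟶ N) : Hom.lin (Γ.functor.map (Γ.inverse.map ψ)).hom =
      Hom.lin (Γ.equiv.counitIso.inv.app N).hom ∘ₗ Hom.lin ψ.hom ∘ₗ
        Hom.lin (Γ.equiv.counitIso.hom.app M).hom := by
    rw [functor_map_inverse_map]
    rfl
  rw [h1, h1, h1, e]
  simp only [LinearMap.add_comp, LinearMap.comp_add, LinearMap.smul_comp, LinearMap.comp_smul]
  rfl

/-- Balancing is inherited from `Z(G,α)`, while duals are pulled back from `Z(H/F,ᾱ)` along the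
braided equivalence, which matches the twists. -/
theorem isRibbon_locTwist : IsRibbon Γ.locTwist where
  balanced := LocMod.twist_balanced (ZObj.twist α) (ZObj.twist_balanced α) Γ.twist_etaleAlg
  dual := exists_dual_of_equivalence Γ.inverse Γ.inverse_map_twist isRibbon_twist.dual

end EtaleGauge

/-- The gauge of the étale data attached to a section. -/
noncomputable def EtaleData.etaleGauge {H k : Type u} [Group H] [Field k] {α : Cocycle3 H k}
    {F : Subgroup H} [F.Normal] (D : EtaleData α F) (s : H ⧸ F → H)
    (hs : ∀ x, (s x : H ⧸ F) = x) (hs1 : s 1 = 1) :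
    EtaleGauge D ⟨D.reduced s hs, D.isCocycle3_reduced s hs hs1⟩ where
  η := D.gauge s hs hs1
  one_left := D.gauge_one_left s hs hs1
  one_right := D.gauge_one_right s hs hs1
  cocycle := D.gauge_cocycle s hs hs1
  η_coe := D.gauge_coe s hs hs1
  lam_coe h f := mul_inv_eq_of_eq_mul (D.gauge_conj s hs hs1 h f).symm
end

theorem mainTheorem3 {G k : Type u} [Group G] [Finite G] [Field k] [CharZero k]
    (α : Cocycle3 G k) (H : Subgroup G) (F : Subgroup H) [F.Normal]
    (D : EtaleData (α.restrict H) F)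
    (s : H ⧸ F → H) (hs : ∀ x, (s x : H ⧸ F) = x) (hs1 : s 1 = 1) :
    ∃ hc : IsCocycle3 (D.reduced s hs),
      IsRibbon (ZObj.twist ⟨D.reduced s hs, hc⟩) ∧
      ∃ θ : 𝟭 (LocMod (etaleAlg D)) ≅ 𝟭 (LocMod (etaleAlg D)),
        (∀ M, (θ.hom.app M).hom = (ZObj.twist α).hom.app M.X) ∧ IsRibbon θ ∧
        ∃ (Φ : LocMod (etaleAlg D) ⥤ ZObj ⟨D.reduced s hs, hc⟩) (_ : Φ.Braided),
          Φ.IsEquivalence ∧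
          (∀ (M N : LocMod (etaleAlg D)) (f g h : M ⟶ N) (c : k),
            h.hom.lin = c • f.hom.lin + g.hom.lin →
              (Φ.map h).lin = c • (Φ.map f).lin + (Φ.map g).lin) ∧
          ∀ M, Φ.map (θ.hom.app M) = (ZObj.twist ⟨D.reduced s hs, hc⟩).hom.app (Φ.obj M) := by
  let Γ := D.etaleGauge s hs hs1
  exact ⟨D.isCocycle3_reduced s hs hs1, ZObj.isRibbon_twist, Γ.locTwist,
    Γ.locTwist_hom_app, Γ.isRibbon_locTwist, Γ.inverse, inferInstance, inferInstance,
    fun _ _ _ _ _ _ e => Γ.inverse_map_lin e, Γ.inverse_map_twist⟩
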